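/- **Conventions.** Let $\mathbb K$ be a commutative ring. All $\mathbb K$-modules are cochain complexes $V=\bigoplus_{k\in\mathbb Z}V^k$ with a differential $d$ of degree $+1$, and tensor powers and the actions of permutations on them carry the Koszul signs. Let $\mathcal{P}re\mathcal{L}ie(n)$ be the free $\mathbb K$-module on the rooted trees with vertices labelled bijectively by $\{1,\dots,n\}$; with the insertion of trees into vertices (the sum of all ways of attaching the children of the vertex to the vertices of the inserted tree) it is the pre-Lie operad. A *$\Gamma(\mathcal{P}re\mathcal{L}ie,-)$-algebra* is an algebra, with structure map $l:\Gamma(\mathcal{P}re\mathcal{L}ie,L)\to L$, over the monad $$\Gamma(\mathcal{P}re\mathcal{L}ie,V)=\bigoplus_{n}\bigl(\mathcal{P}re\mathcal{L}ie(n)\otimes V^{\otimes n}\bigr)^{\Sigma_n},$$ whose unit sends $x$ to $\bullet\otimes x$ and whose multiplication is induced by the operadic composition, summed over all partitions of $\{1,\dots,n\}$ into blocks. Morphisms are the morphisms of algebras over this monad. $L$ is *positively graded* if $L^k=0$ for $k<0$. For $x,y\in L$ (with $y$ of even degree, or $n\le 1$) the *weighted brace* is $x\{y\}_n=l\bigl(\mathcal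 O(F_n\otimes x\otimes y\otimes\cdots\otimes y)\bigr)$, where $F_n$ is the tree with root $1$ and $n$ leaves attached to it and $\mathcal O$ is the sum over the cosets in $\Sigma_{n+1}$ of the stabilizer $\Sigma_n$ permuting the $n$ leaves. If $A$ is a commutative $\mathbb K$-algebra, flat over $\mathbb K$, then $L\otimes_{\mathbb K} A$ (with $A$ in degree $0$) is a $\Gamma(\mathcal{P}re\mathcal{L}ie,-)$-algebra: $\Gamma(\mathcal{P}re\mathcal{L}ie,L\otimes A)\to\Gamma(\mathcal{P}re\mathcal{L}ie,L)\otimes A\to L\otimes A$, where the first map multiplies the elements of $A$ and the second is $l\otimes A$. Let $A$ be local artinian with maximal ideal $\mathfrak m_A$. The *gauge group* is $G(L,A)=1+(L\otimes\mathfrak m_A)^0$ with the product $$(1+\mu)\circledcirc(1+\nu)=1+\nu+\sum_{n\ge0}\mu\{\nu\}_n ;$$ one also puts $x\circledcirc(1+\nu)=\sum_{n\ge 0}x\{\nu\}_n$. The *Maurer–Cartan elements* are the $\alpha\in(L\otimes\mathfrak m_A)^1$ with $d(\alpha)+\alpha\{\alpha\}_1=0$. The gauge group acts on them by $$(1+\mu)\cdot\alpha=\bigl(\alpha+\mu\{\alpha\}_1-d(\mu)\bigr)\circledcirc(1+\mu)^{\circledcirc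 -1}.$$ The *Deligne groupoid* $\mathrm{Deligne}(L,A)$ has the Maurer–Cartan elements of $L\otimes\mathfrak m_A$ as objects; the morphisms from $\alpha$ to $\beta$ are the $1+\mu\in G(L,A)$ with $(1+\mu)\cdot\alpha=\beta$, composed by $\circledcirc$. **Theorem B.** Let $\mathbb K$ be a noetherian integral domain and $\mathbf K$ its field of fractions. Let $L$ and $\overline L$ be positively graded $\Gamma(\mathcal{P}re\mathcal{L}ie,-)$-algebras over $\mathbb K$, and let $\varphi:L\to\overline L$ be a morphism of $\Gamma(\mathcal{P}re\mathcal{L}ie,-)$-algebras such that $H^0(\varphi)$ and $H^1(\varphi)$ are isomorphisms and $H^2(\varphi)$ is injective. Then for every (commutative) local artinian $\mathbf K$-algebra $A$, the gauge groups of $L\otimes\mathfrak m_A$ and $\overline L\otimes\mathfrak m_A$ are groups acting on the Maurer–Cartan sets as described, $\varphi\otimes A$ induces a functor $\varphi_*:\mathrm{Deligne}(L,A)\to\mathrm{Deligne}(\overline L,A)$ between the Deligne groupoids, and $\varphi_*$ is an equivalence of groupoids. -/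

import Mathlib

noncomputable section

namespace GammaPreLie

open scoped TensorProduct DirectSum

/-- A rooted tree with vertex set `I`, recorded by the map sending each vertex to its parent
(the root is its own parent, and every vertex is joined to the root). -/
def RTree (I : Type*) : Type _ :=
  {p : I → I // ∃ r, p r = r ∧ ∀ i, ∃ k : ℕ, p^[k] i = r}

namespace RTree

variable {I J : Type*}

def parent (T : RTree I) : I → I := T.1

/-- The root. -/
def root (T : RTree I) : I := T.2.choose

theorem parent_root (T : RTree I) : T.parent T.root = T.root := T.2.choose_spec.1

theorem exists_iterate (T : RTree I) (i : I) : ∃ k : ℕ, T.parent^[k] i = T.root :=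
  T.2.choose_spec.2 i

/-- Relabelling of the vertices along a bijection. -/
def map (e : I ≃ J) (T : RTree I) : RTree J :=
  ⟨fun j => e (T.parent (e.symm j)), e T.root, by simp [T.parent_root], fun j => by
    obtain ⟨k, hk⟩ := T.exists_iterate (e.symm j)
    refine ⟨k, ?_⟩
    have h : ∀ (k : ℕ) (i : I), (fun j => e (T.parent (e.symm j)))^[k] (e i)
        = e (T.parent^[k] i) := by
      intro k
      induction k with
      | zero => intro i; rfl
      | succ k ih => intro i; simpa using ih (T.parent i)
    have := h k (e.symm j)
    rw [e.apply_symm_apply] at this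
    rw [this, hk]⟩

theorem exists_iterate_mem (T : RTree I) {R : Finset I} (h : T.root ∈ R) (i : I) :
    ∃ k : ℕ, T.parent^[k] i ∈ R := by
  obtain ⟨k, hk⟩ := T.exists_iterate i
  exact ⟨k, hk ▸ h⟩

open Classical in
/-- For a set `R` of vertices containing the root: the first vertex in `R` that is met on the way
from `i` down to the root (`i` itself if `i ∈ R`). -/
def top (T : RTree I) {R : Finset I} (h : T.root ∈ R) (i : I) : {x // x ∈ R} :=
  ⟨T.parent^[Nat.find (T.exists_iterate_mem h i)] i, Nat.find_spec (T.exists_iterate_mem h i)⟩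

theorem top_of_mem (T : RTree I) {R : Finset I} (h : T.root ∈ R) {i : I} (hi : i ∈ R) :
    T.top h i = ⟨i, hi⟩ := by
  classical
  refine Subtype.ext ?_
  change T.parent^[Nat.find (T.exists_iterate_mem h i)] i = i
  have h0 : Nat.find (T.exists_iterate_mem h i) = 0 := by
    rw [Nat.find_eq_zero]; exact hi
  rw [h0, Function.iterate_zero, id]

theorem top_of_notMem (T : RTree I) {R : Finset I} (h : T.root ∈ R) {i : I} (hi : i ∉ R) :
    T.top h i = T.top h (T.parent i) := by
  classical
  refine Subtype.ext ?_
  change T.parent^[Nat.find (T.exists_iterate_mem h i)] i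
    = T.parent^[Nat.find (T.exists_iterate_mem h (T.parent i))] (T.parent i)
  rw [Nat.find_comp_succ (T.exists_iterate_mem h i)
    (T.exists_iterate_mem h (T.parent i)) hi, Function.iterate_succ_apply]
  congr

/-- Given a set `R` of vertices containing the root, cut every edge joining a vertex of `R` to
its parent. The vertices fall into connected blocks, one for each `ρ ∈ R`, with root `ρ`.
`T.contract h` is the tree of blocks, each block being denoted by its root. -/
def contract (T : RTree I) {R : Finset I} (h : T.root ∈ R) : RTree {x // x ∈ R} :=
  ⟨fun ρ => T.top h (T.parent ρ), ⟨T.root, h⟩, by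
    change T.top h (T.parent T.root) = _
    rw [T.parent_root, T.top_of_mem h h], fun ρ => by
    have key : ∀ (m : ℕ) (i : I), T.parent^[m] i = T.root →
        ∃ k : ℕ, (fun ρ : {x // x ∈ R} => T.top h (T.parent ρ))^[k] (T.top h i)
          = ⟨T.root, h⟩ := by
      intro m
      induction m with
      | zero =>
        intro i hi
        refine ⟨0, ?_⟩
        have hi' : i = T.root := hi
        subst hi'
        exact T.top_of_mem h h
      | succ m ih =>
        intro i hi
        obtain ⟨k, hk⟩ := ih (T.parent i) hi
        by_cases hiR : i ∈ R
        · refine ⟨k + 1, ?_⟩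
          rw [Function.iterate_succ_apply, T.top_of_mem h hiR]
          exact hk
        · exact ⟨k, by rw [T.top_of_notMem h hiR]; exact hk⟩
    obtain ⟨m, hm⟩ := T.exists_iterate ρ
    have := key m ρ hm
    rwa [T.top_of_mem h ρ.2] at this⟩

open Classical in
/-- The block with root `ρ` of the same cutting, with the tree structure induced by `T`. -/
def block (T : RTree I) {R : Finset I} (h : T.root ∈ R) (ρ : {x // x ∈ R}) :
    RTree {i // T.top h i = ρ} :=
  ⟨fun i => if hi : i.1 ∈ R then i else
      ⟨T.parent i, by rw [← T.top_of_notMem h hi]; exact i.2⟩,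
    ⟨ρ, T.top_of_mem h ρ.2⟩, by simp, fun i => by
    have key : ∀ (m : ℕ) (i : {i // T.top h i = ρ}), T.parent^[m] i.1 = T.root →
        ∃ k : ℕ, (fun i : {i // T.top h i = ρ} => if hi : i.1 ∈ R then i else
          (⟨T.parent i, by rw [← T.top_of_notMem h hi]; exact i.2⟩ :
            {i // T.top h i = ρ}))^[k] i = ⟨ρ, T.top_of_mem h ρ.2⟩ := by
      intro m
      induction m with
      | zero =>
        intro i hi
        have hi' : i.1 = T.root := hi
        refine ⟨0, Subtype.ext ?_⟩
        have h1 := i.2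
        have hR : i.1 ∈ R := by rw [hi']; exact h
        rw [T.top_of_mem h hR] at h1
        exact congrArg (fun x : {x // x ∈ R} => x.1) h1
      | succ m ih =>
        intro i hi
        by_cases hiR : i.1 ∈ R
        · refine ⟨0, Subtype.ext ?_⟩
          have h1 := i.2
          rw [T.top_of_mem h hiR] at h1
          exact congrArg (fun x : {x // x ∈ R} => x.1) h1
        · obtain ⟨k, hk⟩ := ih ⟨T.parent i, by rw [← T.top_of_notMem h hiR]; exact i.2⟩ hi
          refine ⟨k + 1, ?_⟩
          rw [Function.iterate_succ_apply]
          simp only [hiR, dite_false]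
          exact hk
    obtain ⟨m, hm⟩ := T.exists_iterate i
    exact key m i hm⟩

end RTree

/-- The grading modulo `2` of a graded module, as a pair of complementary projections
(`proj 0` onto the even part, `proj 1` onto the odd part). Koszul signs only depend on it. -/
class SuperModule (𝕂 : Type*) (V : Type*) [CommRing 𝕂] [AddCommGroup V] [Module 𝕂 V] where
  proj : ZMod 2 → V →ₗ[𝕂] V
  proj_proj : ∀ a b x, proj a (proj b x) = if a = b then proj b x else 0
  sum_proj : ∀ x, ∑ a, proj a x = x

/-- The component of parity `a`. -/
abbrev part (𝕂 : Type*) {V : Type*} [CommRing 𝕂] [AddCommGroup V] [Module 𝕂 V] [SuperModule 𝕂 V]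
    (a : ZMod 2) : V →ₗ[𝕂] V := SuperModule.proj a

set_option linter.unusedSectionVars false

section Signs

variable {I : Type*} [Fintype I]

open Classical in
/-- The Koszul sign produced when homogeneous elements of parities `p i` (`i : I`), written in the
order `a`, are rearranged in the order `b`: each pair of odd elements whose order is reversed
contributes `-1`. -/
def koszulSign (a b : I → I → Prop) (p : I → ZMod 2) : ℤˣ :=
  ∏ i, ∏ j, if (a i j ∧ b j i) ∧ p i = 1 ∧ p j = 1 then -1 else 1

/-- Strict total orders. -/
structure IsOrd {I : Type*} (a : I → I → Prop) : Prop where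
  asymm : ∀ i j, a i j → ¬ a j i
  total : ∀ i j, i ≠ j → a i j ∨ a j i

theorem koszulSign_mul {a b c : I → I → Prop} (ha : IsOrd a) (hb : IsOrd b) (hc : IsOrd c)
    (p : I → ZMod 2) : koszulSign a b p * koszulSign b c p = koszulSign a c p := by
  classical
  have sym : ∀ (r s : I → I → Prop), IsOrd r → koszulSign r s p =
      ∏ i, ∏ j, (if a i j then (if (r i j ∧ s j i) ∧ p i = 1 ∧ p j = 1 then (-1 : ℤˣ) else 1) *
        (if (r j i ∧ s i j) ∧ p j = 1 ∧ p i = 1 then (-1 : ℤˣ) else 1) else 1) := by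
    intro r s hr
    have e1 : ∀ i j, (if a i j then (if (r i j ∧ s j i) ∧ p i = 1 ∧ p j = 1 then (-1 : ℤˣ) else 1) *
        (if (r j i ∧ s i j) ∧ p j = 1 ∧ p i = 1 then (-1 : ℤˣ) else 1) else 1) =
        (if a i j then (if (r i j ∧ s j i) ∧ p i = 1 ∧ p j = 1 then (-1 : ℤˣ) else 1) else 1) *
        (if a i j then (if (r j i ∧ s i j) ∧ p j = 1 ∧ p i = 1 then (-1 : ℤˣ) else 1) else 1) := by
      intro i j; split_ifs <;> simp
    simp_rw [e1, Finset.prod_mul_distrib]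
    rw [Finset.prod_comm (f := fun i j => if a i j then
      (if (r j i ∧ s i j) ∧ p j = 1 ∧ p i = 1 then (-1 : ℤˣ) else 1) else 1)]
    simp_rw [← Finset.prod_mul_distrib]
    unfold koszulSign
    refine Finset.prod_congr rfl fun i _ => Finset.prod_congr rfl fun j _ => ?_
    by_cases hij : i = j
    · subst hij
      have h1 : ¬ r i i := fun h => hr.asymm i i h h
      simp [h1]
    · rcases ha.total i j hij with h | h
      · have h2 := ha.asymm _ _ h
        simp [h, h2]
      · have h2 := ha.asymm _ _ h
        simp [h, h2]
  rw [sym a b ha, sym b c hb, sym a c ha, ← Finset.prod_mul_distrib]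
  refine Finset.prod_congr rfl fun i _ => ?_
  rw [← Finset.prod_mul_distrib]
  refine Finset.prod_congr rfl fun j _ => ?_
  by_cases hij : a i j
  · have hne : i ≠ j := by
      rintro rfl; exact ha.asymm i i hij hij
    have h1 := ha.asymm _ _ hij
    by_cases hp : p i = 1 ∧ p j = 1
    · obtain ⟨hi, hj⟩ := hp
      rcases hb.total i j hne with h2 | h2 <;> rcases hc.total i j hne with h3 | h3 <;>
        have h4 := hb.asymm _ _ h2 <;> have h5 := hc.asymm _ _ h3 <;>
        simp [hij, h1, h2, h3, h4, h5, hi, hj]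
    · have hp' : ¬ (p j = 1 ∧ p i = 1) := fun h => hp h.symm
      simp only [hp, hp', and_false, if_false, hij, if_true, mul_one]
  · simp [hij]

theorem koszulSign_self {a : I → I → Prop} (ha : IsOrd a) (p : I → ZMod 2) :
    koszulSign a a p = 1 := by
  classical
  unfold koszulSign
  refine Finset.prod_eq_one fun i _ => Finset.prod_eq_one fun j _ => ?_
  have h : ¬ (a i j ∧ a j i) := fun h => ha.asymm _ _ h.1 h.2
  simp [h]

theorem koszulSign_comp {J : Type*} [Fintype J] (e : I ≃ J) (a b : J → J → Prop)
    (p : I → ZMod 2) :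
    koszulSign a b (p ∘ e.symm) = koszulSign (fun i j => a (e i) (e j)) (fun i j => b (e i) (e j)) p := by
  classical
  unfold koszulSign
  rw [← Equiv.prod_comp e]
  refine Finset.prod_congr rfl fun i _ => ?_
  rw [← Equiv.prod_comp e]
  simp

/-- Effect on the Koszul sign of a change of the parity of one of the elements. -/
theorem koszulSign_toggle [DecidableEq I] {a b : I → I → Prop} (ha : IsOrd a) (hb : IsOrd b)
    (p : I → ZMod 2) (k : I) [DecidableRel a] [DecidableRel b] :
    koszulSign a b (Function.update p k (p k + 1)) *
        ∏ i, (if a i k ∧ p i = 1 then (-1 : ℤˣ) else 1)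
      = koszulSign a b p * ∏ i, (if b i k ∧ p i = 1 then (-1 : ℤˣ) else 1) := by
  have h2 : ∀ x : ZMod 2, x = 0 ∨ x = 1 := by decide
  have key : ∀ i j, (if (a i j ∧ b j i) ∧ Function.update p k (p k + 1) i = 1 ∧
      Function.update p k (p k + 1) j = 1 then (-1 : ℤˣ) else 1) =
      (if (a i j ∧ b j i) ∧ p i = 1 ∧ p j = 1 then (-1 : ℤˣ) else 1) *
      ((if i = k then (if a k j ∧ b j k ∧ p j = 1 then -1 else 1) else 1) *
       (if j = k then (if a i k ∧ b k i ∧ p i = 1 then -1 else 1) else 1)) := by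
    intro i j
    by_cases hi : i = k <;> by_cases hj : j = k
    · subst hi; subst hj
      have : ¬ a j j := fun h => ha.asymm _ _ h h
      simp [this]
    · subst hi
      rcases h2 (p i) with h | h <;> rcases h2 (p j) with h' | h' <;> simp [hj, h, h'] <;>
        intros <;> simp_all
    · subst hj
      rcases h2 (p i) with h | h <;> rcases h2 (p j) with h' | h' <;> simp [hi, h, h'] <;>
        intros <;> simp_all
    · simp [hi, hj]
  have e : koszulSign a b (Function.update p k (p k + 1)) = koszulSign a b p *
      ((∏ j, (if a k j ∧ b j k ∧ p j = 1 then (-1 : ℤˣ) else 1)) *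
        ∏ i, (if a i k ∧ b k i ∧ p i = 1 then (-1 : ℤˣ) else 1)) := by
    unfold koszulSign
    classical
    have : ∀ i j, (if (a i j ∧ b j i) ∧ Function.update p k (p k + 1) i = 1 ∧
      Function.update p k (p k + 1) j = 1 then (-1 : ℤˣ) else 1) = _ := key
    trans ∏ i, ∏ j, (if (a i j ∧ b j i) ∧ Function.update p k (p k + 1) i = 1 ∧
      Function.update p k (p k + 1) j = 1 then (-1 : ℤˣ) else 1)
    · refine Finset.prod_congr rfl fun i _ => Finset.prod_congr rfl fun j _ => ?_
      congr
    simp_rw [this, Finset.prod_mul_distrib]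
    congr 1
    · refine Finset.prod_congr rfl fun i _ => Finset.prod_congr rfl fun j _ => ?_
      congr
    congr 1
    · rw [Finset.prod_comm]
      simp
    · simp
  rw [e, mul_assoc, mul_assoc, ← Finset.prod_mul_distrib, ← Finset.prod_mul_distrib]
  congr 1
  refine Finset.prod_congr rfl fun i _ => ?_
  by_cases hik : i = k
  · subst hik
    have h1 : ¬ a i i := fun h => ha.asymm _ _ h h
    have h3 : ¬ b i i := fun h => hb.asymm _ _ h h
    simp [h1, h3]
  · rcases ha.total i k hik with h | h <;> rcases hb.total i k hik with h' | h' <;>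
      have h1 := ha.asymm _ _ h <;> have h3 := hb.asymm _ _ h' <;>
      rcases h2 (p i) with h4 | h4 <;> simp [h, h', h1, h3, h4]

theorem isOrd_lt [LinearOrder I] : IsOrd (fun i j : I => i < j) :=
  ⟨fun _ _ h => h.asymm, fun _ _ h => lt_or_gt_of_ne h⟩

theorem isOrd_comap {I J : Type*} [LinearOrder J] (e : I ≃ J) : IsOrd (fun i j : I => e i < e j) :=
  ⟨fun _ _ h => h.asymm, fun _ _ h => lt_or_gt_of_ne (fun h' => h (e.injective h'))⟩

end Signs

section Tensors

variable {𝕂 : Type*} [CommRing 𝕂] {V W : Type*} [AddCommGroup V] [Module 𝕂 V]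
  [AddCommGroup W] [Module 𝕂 W] [SuperModule 𝕂 V] [SuperModule 𝕂 W]
  {I J K : Type*} [Fintype I] [Fintype J] [Fintype K]

open SuperModule

open Classical in
/-- The operator on `V^{⊗ I}` which multiplies homogeneous tensors by `koszulSign a b`. -/
def koszul (a b : I → I → Prop) : (⨂[𝕂] _ : I, V) →ₗ[𝕂] ⨂[𝕂] _ : I, V :=
  ∑ p : I → ZMod 2, ((koszulSign a b p : ℤ) : 𝕂) • PiTensorProduct.map (fun i => proj (p i))

/-- The action of a bijection `e : I ≃ J` of totally ordered finite sets on tensor powers: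
the factor in position `i` is moved to position `e i`, with the Koszul sign. -/
def permute [LinearOrder I] [LinearOrder J] (e : I ≃ J) :
    (⨂[𝕂] _ : I, V) →ₗ[𝕂] ⨂[𝕂] _ : J, V :=
  (PiTensorProduct.reindex 𝕂 (fun _ => V) e).toLinearMap ∘ₗ
    koszul (fun i j => i < j) (fun i j => e i < e j)

open Classical in
/-- The component of given parity of a tensor power. -/
def tensorProj (a : ZMod 2) : (⨂[𝕂] _ : I, V) →ₗ[𝕂] ⨂[𝕂] _ : I, V :=
  ∑ p : I → ZMod 2, if ∑ i, p i = a then PiTensorProduct.map (fun i => proj (p i)) else 0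

/-- `v` is a family of homogeneous elements of parities `p`. -/
def IsHom (𝕂 : Type*) [CommRing 𝕂] {V : Type*} [AddCommGroup V] [Module 𝕂 V] [SuperModule 𝕂 V]
    {I : Type*} (p : I → ZMod 2) (v : I → V) : Prop := ∀ i, proj (𝕂 := 𝕂) (p i) (v i) = v i

theorem proj_of_isHom {p : I → ZMod 2} {v : I → V} (h : IsHom 𝕂 p v) (a : ZMod 2) (i : I) :
    proj (𝕂 := 𝕂) a (v i) = if a = p i then v i else 0 := by
  have := proj_proj (𝕂 := 𝕂) a (p i) (v i)
  rwa [h i] at this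

theorem map_proj_tprod {p q : I → ZMod 2} {v : I → V} (h : IsHom 𝕂 p v) [Decidable (q = p)] :
    PiTensorProduct.map (fun i => proj (𝕂 := 𝕂) (V := V) (q i)) (PiTensorProduct.tprod 𝕂 v)
      = if q = p then PiTensorProduct.tprod 𝕂 v else 0 := by
  rw [PiTensorProduct.map_tprod]
  split_ifs with hq
  · subst hq; congr 1; funext i; exact h i
  · obtain ⟨i, hi⟩ := Function.ne_iff.mp hq
    refine (PiTensorProduct.tprod 𝕂).map_coord_zero i ?_
    rw [proj_of_isHom h, if_neg hi]

theorem koszul_tprod (a b : I → I → Prop) {p : I → ZMod 2} {v : I → V} (h : IsHom 𝕂 p v) :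
    koszul a b (PiTensorProduct.tprod 𝕂 v)
      = ((koszulSign a b p : ℤ) : 𝕂) • PiTensorProduct.tprod 𝕂 v := by
  classical
  simp only [koszul, LinearMap.sum_apply, LinearMap.smul_apply, map_proj_tprod h]
  simp

theorem tensorProj_tprod (a : ZMod 2) {p : I → ZMod 2} {v : I → V} (h : IsHom 𝕂 p v) :
    tensorProj a (PiTensorProduct.tprod 𝕂 v)
      = if ∑ i, p i = a then PiTensorProduct.tprod 𝕂 v else 0 := by
  classical
  simp only [tensorProj, LinearMap.sum_apply]
  rw [Finset.sum_eq_single p]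
  · split_ifs
    · rw [map_proj_tprod h, if_pos rfl]
    · rfl
  · intro q _ hq
    split_ifs
    · rw [map_proj_tprod h, if_neg hq]
    · rfl
  · simp

theorem isHom_comp {p : I → ZMod 2} {v : I → V} (h : IsHom 𝕂 p v) (e : I ≃ J) :
    IsHom 𝕂 (p ∘ e.symm) (fun j => v (e.symm j)) := fun j => h (e.symm j)

theorem permute_tprod [LinearOrder I] [LinearOrder J] (e : I ≃ J) {p : I → ZMod 2} {v : I → V}
    (h : IsHom 𝕂 p v) :
    permute e (PiTensorProduct.tprod 𝕂 v)
      = ((koszulSign (fun i j => i < j) (fun i j => e i < e j) p : ℤ) : 𝕂) •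
        PiTensorProduct.tprod 𝕂 (fun j => v (e.symm j)) := by
  simp only [permute, LinearMap.comp_apply, koszul_tprod _ _ h, map_smul]
  congr 1
  exact PiTensorProduct.reindex_tprod e v

/-- Linear maps on a tensor power are determined by their values on homogeneous tensors. -/
theorem ext_hom {M : Type*} [AddCommGroup M] [Module 𝕂 M] {f g : (⨂[𝕂] _ : I, V) →ₗ[𝕂] M}
    (h : ∀ (p : I → ZMod 2) (v : I → V), IsHom 𝕂 p v →
      f (PiTensorProduct.tprod 𝕂 v) = g (PiTensorProduct.tprod 𝕂 v)) : f = g := by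
  classical
  ext v
  have hv : v = fun i => ∑ a, proj (𝕂 := 𝕂) a (v i) := by funext i; exact (sum_proj (v i)).symm
  simp only [LinearMap.compMultilinearMap_apply]
  rw [hv, MultilinearMap.map_sum, map_sum, map_sum]
  refine Finset.sum_congr rfl fun p _ => h p _ fun i => ?_
  rw [proj_proj, if_pos rfl]

theorem permute_permute [LinearOrder I] [LinearOrder J] [LinearOrder K] (e : I ≃ J) (e' : J ≃ K)
    (x : ⨂[𝕂] _ : I, V) : permute e' (permute e x) = permute (e.trans e') x := by
  suffices h : (permute e' : (⨂[𝕂] _ : J, V) →ₗ[𝕂] _) ∘ₗ permute e = permute (e.trans e') from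
    LinearMap.congr_fun h x
  refine ext_hom fun p v h => ?_
  rw [LinearMap.comp_apply, permute_tprod e h, map_smul, permute_tprod e' (isHom_comp h e),
    permute_tprod _ h, smul_smul, koszulSign_comp, ← koszulSign_mul isOrd_lt (isOrd_comap e)
      (isOrd_comap (e.trans e'))]
  simp

theorem permute_of_strictMono [LinearOrder I] [LinearOrder J] (e : I ≃ J) (he : StrictMono e)
    (x : ⨂[𝕂] _ : I, V) : permute e x = PiTensorProduct.reindex 𝕂 (fun _ => V) e x := by
  suffices h : (permute e : (⨂[𝕂] _ : I, V) →ₗ[𝕂] _) =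
      (PiTensorProduct.reindex 𝕂 (fun _ => V) e).toLinearMap from LinearMap.congr_fun h x
  refine ext_hom fun p v h => ?_
  rw [permute_tprod e h]
  have : (fun i j : I => e i < e j) = fun i j => i < j := by
    funext i j; exact propext he.lt_iff_lt
  rw [this, koszulSign_self isOrd_lt]
  simp

theorem tensorProj_permute [LinearOrder I] [LinearOrder J] (e : I ≃ J) (a : ZMod 2)
    (x : ⨂[𝕂] _ : I, V) : tensorProj a (permute e x) = permute e (tensorProj a x) := by
  suffices h : (tensorProj a : (⨂[𝕂] _ : J, V) →ₗ[𝕂] _) ∘ₗ permute e =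
    permute e ∘ₗ tensorProj a from LinearMap.congr_fun h x
  refine ext_hom fun p v h => ?_
  simp only [LinearMap.comp_apply]
  rw [permute_tprod e h, map_smul, tensorProj_tprod a (isHom_comp h e), tensorProj_tprod a h]
  have : ∑ i, (p ∘ e.symm) i = ∑ i, p i := Equiv.sum_comp e.symm p
  rw [this]
  split_ifs
  · rw [permute_tprod e h]
  · simp

theorem tensorProj_tensorProj (a b : ZMod 2) (x : ⨂[𝕂] _ : I, V) :
    tensorProj a (tensorProj b x) = if a = b then tensorProj b x else 0 := by
  suffices h : (tensorProj a : (⨂[𝕂] _ : I, V) →ₗ[𝕂] _) ∘ₗ tensorProj b =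
    if a = b then tensorProj b else 0 by
    rw [← LinearMap.comp_apply, h]; split_ifs <;> rfl
  refine ext_hom fun p v h => ?_
  rw [LinearMap.comp_apply, tensorProj_tprod b h]
  split_ifs with h1 h2 h2
  · rw [tensorProj_tprod a h, tensorProj_tprod b h, if_pos h1, if_pos (h1.trans h2.symm)]
  · rw [tensorProj_tprod a h, if_neg (fun h3 => h2 (h3.symm.trans h1))]; rfl
  · rw [tensorProj_tprod b h, if_neg h1, map_zero]
  · simp

theorem sum_tensorProj (x : ⨂[𝕂] _ : I, V) : ∑ a, tensorProj a x = x := by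
  suffices h : (∑ a, tensorProj a : (⨂[𝕂] _ : I, V) →ₗ[𝕂] _) = LinearMap.id by
    have := LinearMap.congr_fun h x
    simpa using this
  refine ext_hom fun p v h => ?_
  simp only [LinearMap.sum_apply, tensorProj_tprod _ h]
  simp

/-- An even linear map, i.e. one that preserves parities. -/
def IsEven (g : V →ₗ[𝕂] W) : Prop := ∀ a x, g (proj (𝕂 := 𝕂) a x) = proj (𝕂 := 𝕂) a (g x)

theorem map_permute [LinearOrder I] [LinearOrder J] {g : V →ₗ[𝕂] W} (hg : IsEven g) (e : I ≃ J)
    (x : ⨂[𝕂] _ : I, V) : PiTensorProduct.map (fun _ => g) (permute e x)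
      = permute e (PiTensorProduct.map (fun _ => g) x) := by
  suffices h : PiTensorProduct.map (fun _ => g) ∘ₗ permute e
      = permute e ∘ₗ PiTensorProduct.map (fun _ => g) from LinearMap.congr_fun h x
  refine ext_hom fun p v h => ?_
  have h' : IsHom 𝕂 p (fun i => g (v i)) := fun i => by rw [← hg, h i]
  simp only [LinearMap.comp_apply]
  rw [permute_tprod e h, map_smul, PiTensorProduct.map_tprod, PiTensorProduct.map_tprod,
    permute_tprod e h']

/-- An odd linear map. -/
def IsOdd (d : V →ₗ[𝕂] V) : Prop := ∀ a x, d (proj (𝕂 := 𝕂) a x) = proj (𝕂 := 𝕂) (a + 1) (d x)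

/-- The involution `x ↦ (-1)^{|x|} x`. -/
def signInv (𝕂 V : Type*) [CommRing 𝕂] [AddCommGroup V] [Module 𝕂 V] [SuperModule 𝕂 V] :
    V →ₗ[𝕂] V := proj 0 - proj 1

open Classical in
/-- The differential of a tensor power:
`d(x₁ ⊗ ⋯ ⊗ xₙ) = ∑ₖ (-1)^{|x₁| + ⋯ + |xₖ₋₁|} x₁ ⊗ ⋯ ⊗ d(xₖ) ⊗ ⋯ ⊗ xₙ`. -/
def tensorDiff [LinearOrder I] (d : V →ₗ[𝕂] V) : (⨂[𝕂] _ : I, V) →ₗ[𝕂] ⨂[𝕂] _ : I, V :=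
  ∑ k : I, PiTensorProduct.map
    (fun i => if i < k then signInv 𝕂 V else if i = k then d else LinearMap.id)

theorem signInv_tprod {p : I → ZMod 2} {v : I → V} (h : IsHom 𝕂 p v) (i : I) :
    signInv 𝕂 V (v i) = (if p i = 1 then (-1 : 𝕂) else 1) • v i := by
  have h2 : ∀ x : ZMod 2, x = 0 ∨ x = 1 := by decide
  simp only [signInv, LinearMap.sub_apply, proj_of_isHom h]
  rcases h2 (p i) with h' | h' <;> simp [h']

open Classical in
theorem tensorDiff_tprod [LinearOrder I] (d : V →ₗ[𝕂] V) {p : I → ZMod 2} {v : I → V}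
    (h : IsHom 𝕂 p v) : tensorDiff d (PiTensorProduct.tprod 𝕂 v) =
      ∑ k, (((∏ i, (if i < k ∧ p i = 1 then (-1 : ℤˣ) else 1) : ℤˣ) : ℤ) : 𝕂) •
        PiTensorProduct.tprod 𝕂 (Function.update v k (d (v k))) := by
  simp only [tensorDiff, LinearMap.sum_apply, PiTensorProduct.map_tprod]
  refine Finset.sum_congr rfl fun k _ => ?_
  have e1 : (fun i => (if i < k then signInv 𝕂 V else if i = k then d else LinearMap.id) (v i))
      = fun i => (if i < k ∧ p i = 1 then (-1 : 𝕂) else 1) • Function.update v k (d (v k)) i := by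
    funext i
    rcases lt_trichotomy i k with hi | hi | hi
    · simp only [hi, if_true, true_and, Function.update_of_ne hi.ne]
      exact signInv_tprod h i
    · subst hi; simp
    · simp [hi.not_gt, hi.ne']
  rw [e1, MultilinearMap.map_smul_univ]
  congr 1
  push_cast
  refine Finset.prod_congr rfl fun i _ => ?_
  split_ifs <;> simp

theorem tensorDiff_permute [LinearOrder I] [LinearOrder J] {d : V →ₗ[𝕂] V} (hd : IsOdd d)
    (e : I ≃ J) (x : ⨂[𝕂] _ : I, V) :
    tensorDiff d (permute e x) = permute e (tensorDiff d x) := by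
  classical
  suffices h : tensorDiff d ∘ₗ permute e = permute e ∘ₗ tensorDiff d from LinearMap.congr_fun h x
  refine ext_hom fun p v h => ?_
  simp only [LinearMap.comp_apply]
  rw [permute_tprod e h, map_smul, tensorDiff_tprod d (isHom_comp h e), tensorDiff_tprod d h,
    map_sum, Finset.smul_sum, ← Equiv.sum_comp e]
  refine Finset.sum_congr rfl fun k _ => ?_
  have h' : IsHom 𝕂 (Function.update p k (p k + 1)) (Function.update v k (d (v k))) := by
    intro i
    by_cases hi : i = k
    · subst hi
      simp only [Function.update_self]
      rw [← hd, h i]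
    · simp only [Function.update_of_ne hi]
      exact h i
  rw [map_smul, permute_tprod e h', smul_smul, smul_smul]
  congr 1
  · have := koszulSign_toggle (isOrd_lt (I := I)) (isOrd_comap e) p k
    rw [← Equiv.prod_comp e]
    simp only [Function.comp_apply, Equiv.symm_apply_apply]
    rw [← Int.cast_mul, ← Int.cast_mul, ← Units.val_mul, ← Units.val_mul, ← this, mul_comm]
  · congr 1
    funext j
    by_cases hj : j = e k
    · subst hj; simp
    · have : e.symm j ≠ k := fun hh => hj (by rw [← hh]; simp)
      simp [Function.update_of_ne hj, Function.update_of_ne this]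

end Tensors

section Nested

variable {𝕂 : Type*} [CommRing 𝕂] {V : Type*} [AddCommGroup V] [Module 𝕂 V]
  {I R : Type*} [Fintype I] [Fintype R]

open Classical in
/-- Auxiliary: `V` placed in position `i` of `⨂_I (𝕂 ⊕ V)`, with `1` in the other positions
(`𝕂 ⊕ V` is the square-zero extension of `𝕂`, as a commutative algebra). -/
def slot (𝕂 V : Type*) [CommRing 𝕂] [AddCommGroup V] [Module 𝕂 V] {I : Type*}
    [Module 𝕂ᵐᵒᵖ V] [IsCentralScalar 𝕂 V] (i : I) : V →ₗ[𝕂] ⨂[𝕂] _ : I, TrivSqZeroExt 𝕂 V :=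
  (PiTensorProduct.tprod 𝕂).toLinearMap 1 i ∘ₗ TrivSqZeroExt.inrHom 𝕂 V

theorem prod_slot [Module 𝕂ᵐᵒᵖ V] [IsCentralScalar 𝕂 V] (v : I → V) :
    ∏ i, slot 𝕂 V i (v i) = PiTensorProduct.tprod 𝕂 (fun i => TrivSqZeroExt.inr (v i)) := by
  classical
  simp only [slot, LinearMap.comp_apply, MultilinearMap.toLinearMap_apply]
  rw [← PiTensorProduct.tprod_prod]
  congr 1
  funext j
  rw [Finset.prod_apply, Finset.prod_eq_single j]
  · simp
  · intro i _ hij; rw [Function.update_of_ne (Ne.symm hij)]; rfl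
  · simp

/-- For a finite set `I` partitioned into the fibres of `t : I → R`, the identification
`⨂_{ρ ∈ R} (⨂_{i ∈ t⁻¹(ρ)} V) → ⨂_{i ∈ I} V`, without signs; it is characterized by `nest_tprod`. -/
def nest (t : I → R) [∀ ρ, Fintype {i // t i = ρ}] :
    (⨂[𝕂] ρ, ⨂[𝕂] _ : {i // t i = ρ}, V) →ₗ[𝕂] ⨂[𝕂] _ : I, V :=
  letI : Module 𝕂ᵐᵒᵖ V := Module.compHom _ ((RingHom.id 𝕂).fromOpposite mul_comm)
  haveI : IsCentralScalar 𝕂 V := ⟨fun _ _ => rfl⟩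
  PiTensorProduct.map (fun _ => TrivSqZeroExt.sndHom 𝕂 V) ∘ₗ
    PiTensorProduct.lift ((MultilinearMap.mkPiAlgebra 𝕂 R
      (⨂[𝕂] _ : I, TrivSqZeroExt 𝕂 V)).compLinearMap fun ρ =>
        PiTensorProduct.lift ((MultilinearMap.mkPiAlgebra 𝕂 {i // t i = ρ}
          (⨂[𝕂] _ : I, TrivSqZeroExt 𝕂 V)).compLinearMap fun i => slot 𝕂 V i.1))

theorem nest_tprod (t : I → R) [∀ ρ, Fintype {i // t i = ρ}] (v : I → V) :
    nest t (PiTensorProduct.tprod 𝕂 fun ρ => PiTensorProduct.tprod 𝕂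
      fun i : {i // t i = ρ} => v i) = PiTensorProduct.tprod 𝕂 v := by
  classical
  let _ : Module 𝕂ᵐᵒᵖ V := Module.compHom _ ((RingHom.id 𝕂).fromOpposite mul_comm)
  have _ : IsCentralScalar 𝕂 V := ⟨fun _ _ => rfl⟩
  change PiTensorProduct.map (fun _ => TrivSqZeroExt.sndHom 𝕂 V)
    (PiTensorProduct.lift _ (PiTensorProduct.tprod 𝕂 _)) = _
  simp only [PiTensorProduct.lift.tprod, MultilinearMap.compLinearMap_apply,
    MultilinearMap.mkPiAlgebra_apply]
  have : ∏ ρ, ∏ i : {i // t i = ρ}, slot 𝕂 V i.1 (v i.1) = ∏ i, slot 𝕂 V i (v i) := by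
    rw [← Finset.prod_fiberwise (s := Finset.univ) (g := t)]
    refine Finset.prod_congr rfl fun ρ _ => ?_
    rw [Finset.prod_subtype (p := fun i => t i = ρ) _ (by simp)]
  rw [this, prod_slot, PiTensorProduct.map_tprod]
  simp

/-- For `I` totally ordered and partitioned into the fibres of `t : I → R`, the order on `I` in
which the fibres are listed one after the other. -/
def lexOrd [LinearOrder I] [LinearOrder R] (t : I → R) (i j : I) : Prop :=
  t i < t j ∨ (t i = t j ∧ i < j)

/-- The map `⨂_{ρ ∈ R} (⨂_{i ∈ t⁻¹(ρ)} V) → ⨂_{i ∈ I} V` which moves each factor to its position,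
with the Koszul sign. -/
def assemble [SuperModule 𝕂 V] [LinearOrder I] [LinearOrder R] (t : I → R)
    [∀ ρ, Fintype {i // t i = ρ}] :
    (⨂[𝕂] ρ, ⨂[𝕂] _ : {i // t i = ρ}, V) →ₗ[𝕂] ⨂[𝕂] _ : I, V :=
  koszul (lexOrd t) (fun i j => i < j) ∘ₗ nest t

theorem isOrd_lexOrd [LinearOrder I] [LinearOrder R] (t : I → R) : IsOrd (lexOrd t) := by
  refine ⟨?_, ?_⟩
  · rintro i j (h | ⟨h, h'⟩) (h2 | ⟨h2, h2'⟩)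
    · exact h.asymm h2
    · exact h.ne' h2
    · exact h2.ne' h
    · exact h'.asymm h2'
  · intro i j hij
    rcases lt_trichotomy (t i) (t j) with h | h | h
    · exact Or.inl (Or.inl h)
    · rcases lt_or_gt_of_ne hij with h' | h'
      · exact Or.inl (Or.inr ⟨h, h'⟩)
      · exact Or.inr (Or.inr ⟨h.symm, h'⟩)
    · exact Or.inr (Or.inl h)

/-- Linear maps on a nested tensor product are determined by their values on nested homogeneous
tensors. -/
theorem ext_nest [SuperModule 𝕂 V] (t : I → R) [∀ ρ, Fintype {i // t i = ρ}]
    {M : Type*} [AddCommGroup M] [Module 𝕂 M]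
    {f g : (⨂[𝕂] ρ, ⨂[𝕂] _ : {i // t i = ρ}, V) →ₗ[𝕂] M}
    (h : ∀ (p : I → ZMod 2) (v : I → V), IsHom 𝕂 p v →
      f (PiTensorProduct.tprod 𝕂 fun ρ => PiTensorProduct.tprod 𝕂
        fun i : {i // t i = ρ} => v i) =
      g (PiTensorProduct.tprod 𝕂 fun ρ => PiTensorProduct.tprod 𝕂
        fun i : {i // t i = ρ} => v i)) : f = g := by
  classical
  have span : ∀ ρ, Submodule.span 𝕂 (Set.range fun (x : {x : ({i // t i = ρ} → ZMod 2) ×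
      ({i // t i = ρ} → V) // IsHom 𝕂 x.1 x.2}) => PiTensorProduct.tprod 𝕂 x.1.2) = ⊤ := by
    intro ρ
    rw [← (Submodule.span 𝕂 _).ker_mkQ, LinearMap.ker_eq_top]
    refine ext_hom fun p v hv => ?_
    simp only [Submodule.mkQ_apply, LinearMap.zero_apply, Submodule.Quotient.mk_eq_zero]
    exact Submodule.subset_span ⟨⟨(p, v), hv⟩, rfl⟩
  refine PiTensorProduct.ext_of_span_eq_top (γ := fun ρ => {x : ({i // t i = ρ} → ZMod 2) ×
      ({i // t i = ρ} → V) // IsHom 𝕂 x.1 x.2})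
      (g := fun ρ x => PiTensorProduct.tprod 𝕂 x.1.2) span fun c => ?_
  have := h (fun i => (c (t i)).1.1 ⟨i, rfl⟩) (fun i => (c (t i)).1.2 ⟨i, rfl⟩)
    (fun i => (c (t i)).2 ⟨i, rfl⟩)
  have e : (fun ρ => PiTensorProduct.tprod 𝕂 fun i : {i // t i = ρ} =>
      (c (t i)).1.2 ⟨i, rfl⟩) = fun ρ => PiTensorProduct.tprod 𝕂 (c ρ).1.2 := by
    funext ρ
    congr 1
    funext i
    obtain ⟨i, rfl⟩ := i
    rfl
  rw [e] at this
  exact this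

theorem assemble_tprod [SuperModule 𝕂 V] [LinearOrder I] [LinearOrder R] (t : I → R)
    [∀ ρ, Fintype {i // t i = ρ}] {p : I → ZMod 2} {v : I → V} (h : IsHom 𝕂 p v) :
    assemble t (PiTensorProduct.tprod 𝕂 fun ρ => PiTensorProduct.tprod 𝕂
        fun i : {i // t i = ρ} => v i) =
      ((koszulSign (lexOrd t) (fun i j => i < j) p : ℤ) : 𝕂) • PiTensorProduct.tprod 𝕂 v := by
  rw [assemble, LinearMap.comp_apply, nest_tprod, koszul_tprod _ _ h]

theorem koszulSign_sum (t : I → R) [∀ ρ, Fintype {i // t i = ρ}] (a b : R → R → Prop)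
    (p : I → ZMod 2) :
    koszulSign a b (fun ρ => ∑ i : {i // t i = ρ}, p i)
      = koszulSign (fun i j => a (t i) (t j)) (fun i j => b (t i) (t j)) p := by
  classical
  have hadd : ∀ x y z : ZMod 2, (if x + y = 1 ∧ z = 1 then (-1 : ℤˣ) else 1) =
      (if x = 1 ∧ z = 1 then (-1 : ℤˣ) else 1) * (if y = 1 ∧ z = 1 then (-1 : ℤˣ) else 1) := by
    decide
  have hsum : ∀ (s : Finset I) (z : ZMod 2), (if ∑ i ∈ s, p i = 1 ∧ z = 1 then (-1 : ℤˣ) else 1) =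
      ∏ i ∈ s, (if p i = 1 ∧ z = 1 then (-1 : ℤˣ) else 1) := by
    intro s z
    induction s using Finset.induction_on with
    | empty => simp
    | insert i s hi ih => rw [Finset.sum_insert hi, Finset.prod_insert hi, hadd, ih]
  have hS : ∀ ρ, ∑ i : {i // t i = ρ}, p i = ∑ i ∈ Finset.univ.filter (fun i => t i = ρ), p i :=
    fun ρ => (Finset.sum_subtype (p := fun i => t i = ρ) _ (by simp) _).symm
  simp only [koszulSign, hS]
  rw [← Finset.prod_fiberwise (s := Finset.univ) (g := t)]
  refine Finset.prod_congr rfl fun ρ _ => ?_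
  simp only [← Finset.prod_fiberwise (s := (Finset.univ : Finset I)) (g := t)]
  rw [Finset.prod_comm]
  refine Finset.prod_congr rfl fun ρ' _ => ?_
  have h1 : ∀ i ∈ Finset.univ.filter (fun i => t i = ρ), ∀ j ∈ Finset.univ.filter
      (fun j => t j = ρ'), (if (a (t i) (t j) ∧ b (t j) (t i)) ∧ p i = 1 ∧ p j = 1
      then (-1 : ℤˣ) else 1) = if a ρ ρ' ∧ b ρ' ρ then
        (if p i = 1 ∧ p j = 1 then (-1 : ℤˣ) else 1) else 1 := by
    intro i hi j hj
    simp only [Finset.mem_filter, Finset.mem_univ, true_and] at hi hj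
    rw [hi, hj]
    split_ifs <;> simp_all
  rw [Finset.prod_congr rfl fun i hi => Finset.prod_congr rfl (h1 i hi)]
  by_cases hab : a ρ ρ' ∧ b ρ' ρ
  · simp only [hab, and_self, true_and, if_true]
    rw [hsum]
    refine Finset.prod_congr rfl fun i _ => ?_
    have := hsum (Finset.univ.filter (fun j => t j = ρ')) (p i)
    simp only [and_comm (b := p i = 1)] at this
    exact this
  · simp [hab]

theorem prod_koszulSign (t : I → R) [∀ ρ, Fintype {i // t i = ρ}] (a b : I → I → Prop)
    (p : I → ZMod 2) :
    ∏ ρ, koszulSign (fun i j : {i // t i = ρ} => a i j) (fun i j => b i j) (fun i => p i)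
      = koszulSign (fun i j => t i = t j ∧ a i j) (fun i j => t i = t j ∧ b i j) p := by
  classical
  simp only [koszulSign]
  rw [← Finset.prod_fiberwise (s := (Finset.univ : Finset I)) (g := t)]
  refine Finset.prod_congr rfl fun ρ _ => ?_
  rw [Finset.prod_subtype (p := fun i => t i = ρ) _ (by simp)]
  refine Finset.prod_congr rfl fun i _ => ?_
  rw [← Finset.prod_filter_mul_prod_filter_not Finset.univ (fun j => t j = ρ),
    Finset.prod_subtype (p := fun i => t i = ρ) (Finset.univ.filter (fun j => t j = ρ)) (by simp)]
  rw [Finset.prod_eq_one (s := Finset.univ.filter (fun j => ¬ t j = ρ)), mul_one]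
  · refine Finset.prod_congr rfl fun j _ => ?_
    simp [i.2, j.2]
  · intro j hj
    have : t j ≠ ρ := by simpa using hj
    rw [if_neg]
    rintro ⟨⟨⟨h, -⟩, -⟩, -⟩
    exact this (h ▸ i.2)

end Nested

section Assemble

variable {𝕂 : Type*} [CommRing 𝕂] {V : Type*} [AddCommGroup V] [Module 𝕂 V] [SuperModule 𝕂 V]
  {I J R R' : Type*} [Fintype I] [Fintype J] [Fintype R] [Fintype R']
  [LinearOrder I] [LinearOrder J] [LinearOrder R] [LinearOrder R']

/-- The bijection induced by `e : I ≃ J` between corresponding fibres. -/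
def fibreEquiv {t : I → R} {t' : J → R'} {e : I ≃ J} {r : R ≃ R'}
    (ht : ∀ i, t' (e i) = r (t i)) (ρ : R') : {i // t i = r.symm ρ} ≃ {j // t' j = ρ} :=
  e.subtypeEquiv fun i => by rw [ht, Equiv.eq_symm_apply]

theorem assemble_sign {t : I → R} {t' : J → R'} {e : I ≃ J} {r : R ≃ R'}
    [∀ ρ, Fintype {i // t i = ρ}] [∀ ρ, Fintype {j // t' j = ρ}]
    (ht : ∀ i, t' (e i) = r (t i)) (p : I → ZMod 2) :
    koszulSign (fun i j => i < j) (fun i j => r i < r j) (fun ρ => ∑ i : {i // t i = ρ}, p i) *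
      ((∏ ρ, koszulSign (fun i j : {i // t i = r.symm ρ} => i < j)
        (fun i j => fibreEquiv ht ρ i < fibreEquiv ht ρ j) (fun i => p i)) *
        koszulSign (lexOrd t') (fun i j => i < j) (p ∘ e.symm)) =
    koszulSign (lexOrd t) (fun i j => i < j) p *
      koszulSign (fun i j => i < j) (fun i j => e i < e j) p := by
  classical
  have hB : IsOrd (fun i j : I => lexOrd (fun i => r (t i)) i j) := isOrd_lexOrd _
  have hC : IsOrd (fun i j : I => lexOrd t' (e i) (e j)) :=
    ⟨fun i j h => (isOrd_lexOrd t').asymm _ _ h,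
      fun i j h => (isOrd_lexOrd t').total _ _ (fun h' => h (e.injective h'))⟩
  have e1 : koszulSign (fun i j => i < j) (fun i j => r i < r j)
      (fun ρ => ∑ i : {i // t i = ρ}, p i)
      = koszulSign (lexOrd t) (lexOrd (fun i => r (t i))) p := by
    rw [koszulSign_sum]
    unfold koszulSign
    refine Finset.prod_congr rfl fun i _ => Finset.prod_congr rfl fun j _ => ?_
    congr 2
    apply propext
    simp only [lexOrd]
    constructor
    · rintro ⟨h1, h2⟩; exact ⟨Or.inl h1, Or.inl h2⟩
    · rintro ⟨h1 | ⟨h1, h1'⟩, h2 | ⟨h2, h2'⟩⟩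
      · exact ⟨h1, h2⟩
      · exact absurd (r.injective h2) h1.ne'
      · rw [h1] at h2; exact absurd h2 (lt_irrefl _)
      · exact absurd h1' h2'.asymm
  have e2 : (∏ ρ, koszulSign (fun i j : {i // t i = r.symm ρ} => i < j)
        (fun i j => fibreEquiv ht ρ i < fibreEquiv ht ρ j) (fun i => p i))
      = koszulSign (lexOrd (fun i => r (t i))) (fun i j => lexOrd t' (e i) (e j)) p := by
    rw [← Equiv.prod_comp r]
    have : ∀ ρ, koszulSign (fun i j : {i // t i = r.symm (r ρ)} => i < j)
        (fun i j => fibreEquiv ht (r ρ) i < fibreEquiv ht (r ρ) j) (fun i => p i)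
        = koszulSign (fun i j : {i // t i = ρ} => i.1 < j.1)
          (fun i j : {i // t i = ρ} => e i.1 < e j.1) (fun i => p i) := by
      intro ρ
      have hρ : r.symm (r ρ) = ρ := r.symm_apply_apply ρ
      let E : {i // t i = r.symm (r ρ)} ≃ {i // t i = ρ} :=
        Equiv.subtypeEquivRight fun i => by rw [hρ]
      have := koszulSign_comp E (fun i j : {i // t i = ρ} => i.1 < j.1)
          (fun i j : {i // t i = ρ} => e i.1 < e j.1) (fun i => p i)
      exact this.symm
    rw [Finset.prod_congr rfl fun ρ _ => this ρ]
    rw [prod_koszulSign t (fun i j => i < j) (fun i j => e i < e j)]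
    unfold koszulSign
    refine Finset.prod_congr rfl fun i _ => Finset.prod_congr rfl fun j _ => ?_
    congr 2
    apply propext
    simp only [lexOrd, ht]
    constructor
    · rintro ⟨⟨h1, h2⟩, h3, h4⟩
      exact ⟨Or.inr ⟨by rw [h1], h2⟩, Or.inr ⟨by rw [h1], h4⟩⟩
    · rintro ⟨h1 | ⟨h1, h1'⟩, h2 | ⟨h2, h2'⟩⟩
      · exact absurd h2 h1.asymm
      · rw [h2] at h1; exact absurd h1 (lt_irrefl _)
      · rw [h1] at h2; exact absurd h2 (lt_irrefl _)
      · exact ⟨⟨r.injective h1, h1'⟩, r.injective h2, h2'⟩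
  rw [e1, e2, koszulSign_comp, koszulSign_mul hB hC (isOrd_comap e),
    koszulSign_mul (isOrd_lexOrd t) hB (isOrd_comap e),
    koszulSign_mul (isOrd_lexOrd t) isOrd_lt (isOrd_comap e)]

theorem assemble_permute {G : Type*} [AddCommGroup G] [Module 𝕂 G] [SuperModule 𝕂 G]
    {t : I → R} {t' : J → R'} {e : I ≃ J} {r : R ≃ R'}
    [∀ ρ, Fintype {i // t i = ρ}] [∀ ρ, Fintype {j // t' j = ρ}]
    (ht : ∀ i, t' (e i) = r (t i))
    (ev : ∀ ρ, G →ₗ[𝕂] ⨂[𝕂] _ : {i // t i = ρ}, V)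
    (ev' : ∀ ρ, G →ₗ[𝕂] ⨂[𝕂] _ : {j // t' j = ρ}, V)
    (heven : ∀ ρ a x, ev ρ (SuperModule.proj (𝕂 := 𝕂) a x) = tensorProj a (ev ρ x))
    (hev : ∀ ρ x, ev' ρ x = permute (fibreEquiv ht ρ) (ev (r.symm ρ) x))
    (F : ⨂[𝕂] _ : R, G) :
    assemble t' (PiTensorProduct.map ev' (permute r F))
      = permute e (assemble t (PiTensorProduct.map ev F)) := by
  classical
  let Y : (⨂[𝕂] ρ, ⨂[𝕂] _ : {i // t i = ρ}, V) →ₗ[𝕂] ⨂[𝕂] ρ, ⨂[𝕂] _ : {j // t' j = ρ}, V :=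
    PiTensorProduct.map (fun ρ => permute (fibreEquiv ht ρ)) ∘ₗ
      (PiTensorProduct.reindex 𝕂 (fun ρ => ⨂[𝕂] _ : {i // t i = ρ}, V) r).toLinearMap
  have key : ∀ P : R → ZMod 2,
      (((koszulSign (fun i j => i < j) (fun i j => r i < r j) P : ℤˣ) : ℤ) : 𝕂) •
        (assemble t' ∘ₗ Y ∘ₗ PiTensorProduct.map (fun ρ => tensorProj (𝕂 := 𝕂) (V := V) (P ρ)))
      = permute e ∘ₗ assemble t ∘ₗ
        PiTensorProduct.map (fun ρ => tensorProj (𝕂 := 𝕂) (V := V) (P ρ)) := by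
    intro P
    refine ext_nest t fun p v hv => ?_
    simp only [LinearMap.comp_apply, LinearMap.smul_apply, PiTensorProduct.map_tprod]
    have h1 : ∀ ρ, IsHom 𝕂 (fun i : {i // t i = ρ} => p i) (fun i => v i) := fun ρ i => hv i
    by_cases hP : P = fun ρ => ∑ i : {i // t i = ρ}, p i
    · have h2 : ∀ ρ, tensorProj (P ρ) (PiTensorProduct.tprod 𝕂 fun i : {i // t i = ρ} => v i)
          = PiTensorProduct.tprod 𝕂 fun i : {i // t i = ρ} => v i := by
        intro ρ
        rw [tensorProj_tprod _ (h1 ρ), if_pos (by rw [hP])]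
      simp only [h2]
      rw [assemble_tprod t hv, map_smul, permute_tprod e hv]
      have hY : Y (PiTensorProduct.tprod 𝕂 fun ρ => PiTensorProduct.tprod 𝕂
          fun i : {i // t i = ρ} => v i) =
          (((∏ ρ, koszulSign (fun i j : {i // t i = r.symm ρ} => i < j)
            (fun i j => fibreEquiv ht ρ i < fibreEquiv ht ρ j) (fun i => p i) : ℤˣ) : ℤ) : 𝕂) •
          PiTensorProduct.tprod 𝕂 fun ρ => PiTensorProduct.tprod 𝕂
            fun j : {j // t' j = ρ} => v (e.symm j) := by
        simp only [Y, LinearMap.comp_apply, LinearEquiv.coe_coe]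
        rw [PiTensorProduct.reindex_tprod, PiTensorProduct.map_tprod]
        have h3 : ∀ ρ, permute (fibreEquiv ht ρ) (PiTensorProduct.tprod 𝕂
            fun i : {i // t i = r.symm ρ} => v i) = _ := fun ρ =>
          permute_tprod (fibreEquiv ht ρ) (h1 (r.symm ρ))
        simp only [h3]
        rw [MultilinearMap.map_smul_univ]
        push_cast
        rfl
      rw [hY, map_smul, assemble_tprod t' (isHom_comp hv e), smul_smul, smul_smul, smul_smul]
      congr 1
      have := assemble_sign ht p
      rw [← hP] at this
      rw [← Int.cast_mul, ← Int.cast_mul, ← Int.cast_mul, ← Units.val_mul, ← Units.val_mul,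
        ← Units.val_mul, ← this, mul_assoc]
    · obtain ⟨ρ, hρ⟩ := Function.ne_iff.mp hP
      have h2 : (PiTensorProduct.tprod 𝕂 fun ρ => tensorProj (P ρ)
          (PiTensorProduct.tprod 𝕂 fun i : {i // t i = ρ} => v i)) = 0 := by
        refine (PiTensorProduct.tprod 𝕂).map_coord_zero ρ ?_
        rw [tensorProj_tprod _ (h1 ρ), if_neg (Ne.symm hρ)]
      rw [h2]; simp
  suffices h : assemble t' ∘ₗ PiTensorProduct.map ev' ∘ₗ permute r
      = permute e ∘ₗ assemble t ∘ₗ PiTensorProduct.map ev from LinearMap.congr_fun h F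
  refine ext_hom fun P w hw => ?_
  have h4 : ∀ ρ, tensorProj (P ρ) (ev ρ (w ρ)) = ev ρ (w ρ) := fun ρ => by
    rw [← heven, hw ρ]
  have := LinearMap.congr_fun (key P) (PiTensorProduct.tprod 𝕂 fun ρ => ev ρ (w ρ))
  simp only [LinearMap.comp_apply, LinearMap.smul_apply, PiTensorProduct.map_tprod, h4] at this
  simp only [LinearMap.comp_apply, PiTensorProduct.map_tprod]
  rw [← this, permute_tprod r hw, map_smul, map_smul, PiTensorProduct.map_tprod]
  congr 2
  simp only [Y, LinearMap.comp_apply, LinearEquiv.coe_coe]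
  rw [PiTensorProduct.reindex_tprod, PiTensorProduct.map_tprod]
  congr 1
  funext ρ
  exact hev ρ _

end Assemble

section GammaFunctor

variable (𝕂 : Type*) [CommRing 𝕂] (V : Type*) [AddCommGroup V] [Module 𝕂 V] [SuperModule 𝕂 V]

/-- The invariants `(PreLie(n) ⊗ V^{⊗ n})^{Σ_n}`. Since `PreLie(n)` is free on the set of rooted
trees with vertex set `Fin n`, an element `∑_T T ⊗ v_T` of `PreLie(n) ⊗ V^{⊗ n}` is a function
`T ↦ v_T`; it is invariant when `v_{σT} = σ v_T` for all permutations `σ`, which act on `V^{⊗ n}`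
with the Koszul sign. (For `n = 0` there is no tree.) -/
def GammaPart (n : ℕ) : Submodule 𝕂 (RTree (Fin n) → ⨂[𝕂] _ : Fin n, V) where
  carrier := {f | ∀ (σ : Fin n ≃ Fin n) T, f (T.map σ) = permute σ (f T)}
  add_mem' := fun hf hg σ T => by simp [hf σ T, hg σ T]
  zero_mem' := fun σ T => by simp
  smul_mem' := fun c f hf σ T => by simp [hf σ T]

/-- The functor `Γ(PreLie, -)`: `Γ(PreLie, V) = ⨁_n (PreLie(n) ⊗ V^{⊗ n})^{Σ_n}`. -/
def Gamma : Type _ := ⨁ n, GammaPart 𝕂 V n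

instance : AddCommGroup (Gamma 𝕂 V) := inferInstanceAs (AddCommGroup (⨁ n, GammaPart 𝕂 V n))

instance : Module 𝕂 (Gamma 𝕂 V) := inferInstanceAs (Module 𝕂 (⨁ n, GammaPart 𝕂 V n))

variable {𝕂 V}

namespace Gamma

/-- The coefficient `f_T ∈ V^{⊗ n}` of a tree `T` in `f ∈ Γ(PreLie, V)`. -/
def coeff {n : ℕ} (T : RTree (Fin n)) : Gamma 𝕂 V →ₗ[𝕂] ⨂[𝕂] _ : Fin n, V :=
  LinearMap.proj T ∘ₗ (GammaPart 𝕂 V n).subtype ∘ₗ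
    DirectSum.component 𝕂 ℕ (fun n => GammaPart 𝕂 V n) n

theorem coeff_apply {n : ℕ} (T : RTree (Fin n)) (f : ⨁ n, GammaPart 𝕂 V n) :
    coeff (𝕂 := 𝕂) (V := V) T f = (f n).1 T := rfl

theorem ext {f g : Gamma 𝕂 V} (h : ∀ n (T : RTree (Fin n)), coeff T f = coeff T g) : f = g :=
  DFinsupp.ext fun n => Subtype.ext (funext fun T => h n T)

theorem coeff_map {n : ℕ} (σ : Fin n ≃ Fin n) (T : RTree (Fin n)) (f : Gamma 𝕂 V) :
    coeff (T.map σ) f = permute σ (coeff T f) :=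
  (DirectSum.component 𝕂 ℕ (fun n => GammaPart 𝕂 V n) n f).2 σ T

/-- An equivariant family of coefficients which vanishes in large arities is an element
of `Γ(PreLie, V)`. -/
theorem exists_of_coeff (c : ∀ n, RTree (Fin n) → ⨂[𝕂] _ : Fin n, V)
    (hc : ∀ n, c n ∈ GammaPart 𝕂 V n) (N : ℕ) (hN : ∀ n, N ≤ n → c n = 0) :
    ∃ f : Gamma 𝕂 V, ∀ n (T : RTree (Fin n)), coeff T f = c n T := by
  refine ⟨DirectSum.mk _ (Finset.range N) fun n => ⟨c n, hc n⟩, fun n T => ?_⟩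
  refine (coeff_apply T _).trans ?_
  by_cases hn : n < N
  · rw [DirectSum.mk_apply_of_mem (Finset.mem_range.mpr hn)]
  · rw [DirectSum.mk_apply_of_notMem (by simpa using hn), hN n (by omega)]
    rfl

theorem exists_coeff_eq_zero (f : Gamma 𝕂 V) :
    ∃ N, ∀ n, N ≤ n → ∀ T : RTree (Fin n), coeff T f = 0 := by
  classical
  change ⨁ n, GammaPart 𝕂 V n at f
  refine ⟨(f.support.sup id) + 1, fun n hn T => ?_⟩
  have : n ∉ f.support := fun h => by
    have : n ≤ f.support.sup id := Finset.le_sup (f := id) h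
    omega
  rw [coeff_apply, DFinsupp.notMem_support_iff.mp this]
  rfl

/-- Linear operators on tensor powers that commute with permutations act on `Γ(PreLie, -)`. -/
def lift {W : Type*} [AddCommGroup W] [Module 𝕂 W] [SuperModule 𝕂 W]
    (φ : ∀ n, (⨂[𝕂] _ : Fin n, V) →ₗ[𝕂] ⨂[𝕂] _ : Fin n, W)
    (hφ : ∀ n (σ : Fin n ≃ Fin n) x, φ n (permute σ x) = permute σ (φ n x)) :
    Gamma 𝕂 V →ₗ[𝕂] Gamma 𝕂 W :=
  DirectSum.lmap fun n => ((φ n).compLeft (RTree (Fin n))).restrict fun f hf σ T => by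
    change φ n (f (T.map σ)) = permute σ (φ n (f T))
    rw [hf σ T, hφ]

@[simp] theorem coeff_lift {W : Type*} [AddCommGroup W] [Module 𝕂 W] [SuperModule 𝕂 W]
    (φ : ∀ n, (⨂[𝕂] _ : Fin n, V) →ₗ[𝕂] ⨂[𝕂] _ : Fin n, W)
    (hφ : ∀ n (σ : Fin n ≃ Fin n) x, φ n (permute σ x) = permute σ (φ n x)) {n : ℕ}
    (T : RTree (Fin n)) (f : Gamma 𝕂 V) : coeff T (lift φ hφ f) = φ n (coeff T f) := rfl

/-- Parities on `Γ(PreLie, V)`. -/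
instance : SuperModule 𝕂 (Gamma 𝕂 V) where
  proj a := lift (fun _ => tensorProj a) fun _ σ x => tensorProj_permute σ a x
  proj_proj a b f := by
    refine ext fun n T => ?_
    rw [coeff_lift, coeff_lift, tensorProj_tensorProj]
    split_ifs <;> simp
  sum_proj f := by
    refine ext fun n T => ?_
    rw [map_sum]
    exact sum_tensorProj _

theorem coeff_proj {n : ℕ} (T : RTree (Fin n)) (a : ZMod 2) (f : Gamma 𝕂 V) :
    coeff T (part 𝕂 a f) = tensorProj a (coeff T f) := rfl

/-- Functoriality of `Γ(PreLie, -)` for even linear maps. -/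
def map {W : Type*} [AddCommGroup W] [Module 𝕂 W] [SuperModule 𝕂 W] (g : V →ₗ[𝕂] W)
    (hg : IsEven g) : Gamma 𝕂 V →ₗ[𝕂] Gamma 𝕂 W :=
  lift (fun _ => PiTensorProduct.map fun _ => g) fun _ σ x => map_permute hg σ x

/-- The differential of `Γ(PreLie, V)` induced by a differential of `V`. -/
def diff (d : V →ₗ[𝕂] V) (hd : IsOdd d) : Gamma 𝕂 V →ₗ[𝕂] Gamma 𝕂 V :=
  lift (fun _ => tensorDiff d) fun _ σ x => tensorDiff_permute hd σ x

/-- The unit of the monad, `x ↦ • ⊗ x` where `•` is the tree with one vertex. -/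
def unit (x : V) : Gamma 𝕂 V :=
  DirectSum.of (fun n => GammaPart 𝕂 V n) 1 ⟨fun _ => PiTensorProduct.tprod 𝕂 fun _ => x,
    fun σ T => by
      rw [Subsingleton.elim σ (Equiv.refl _), permute_of_strictMono _ (fun _ _ h => h)]
      simp⟩

/-- The value of `f ∈ Γ(PreLie, V)` at a tree whose vertices form any finite totally ordered
set `I`, by means of the increasing bijection between `I` and `Fin n`. -/
def evalOn {I : Type*} [Fintype I] [LinearOrder I] (T : RTree I) :
    Gamma 𝕂 V →ₗ[𝕂] ⨂[𝕂] _ : I, V :=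
  (PiTensorProduct.reindex 𝕂 (fun _ => V)
      (Fintype.orderIsoFinOfCardEq I rfl).toEquiv).toLinearMap ∘ₗ
    coeff (T.map (Fintype.orderIsoFinOfCardEq I rfl).symm.toEquiv)

open Classical in
/-- The coefficient at the tree `S` of the image of `F` under the multiplication
`Γ(PreLie, Γ(PreLie, V)) → Γ(PreLie, V)`. The tree `S` occurs, exactly once, in a composite
`γ(T; T₁, …, Tₙ)` for every way of cutting it into connected blocks: `T` is the tree of blocks
and the `Tᵢ` are the blocks. A cutting is given by the set `R` of the roots of the blocks. -/
def mulCoeff {I : Type*} [Fintype I] [LinearOrder I] (S : RTree I) :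
    Gamma 𝕂 (Gamma 𝕂 V) →ₗ[𝕂] ⨂[𝕂] _ : I, V :=
  ∑ R : {R : Finset I // S.root ∈ R},
    assemble (S.top R.2) ∘ₗ PiTensorProduct.map (fun ρ => evalOn (S.block R.2 ρ)) ∘ₗ
      evalOn (S.contract R.2)

end Gamma

end GammaFunctor

namespace RTree

variable {I J K : Type*}

theorem eq_root (T : RTree I) {i : I} (h : T.parent i = i) : i = T.root := by
  obtain ⟨k, hk⟩ := T.exists_iterate i
  rw [← hk, Function.iterate_fixed h]

theorem root_map (T : RTree I) (e : I ≃ J) : (T.map e).root = e T.root := by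
  symm
  apply eq_root
  change e (T.parent (e.symm (e T.root))) = _
  rw [e.symm_apply_apply, T.parent_root]

theorem root_map_mem (T : RTree I) (e : I ≃ J) {R : Finset I} (h : T.root ∈ R) :
    (T.map e).root ∈ R.map e.toEmbedding := by
  rw [root_map]; exact Finset.mem_map_of_mem _ h

/-- The bijection between a set of vertices and its image. -/
def imageEquiv (e : I ≃ J) (R : Finset I) : {x // x ∈ R} ≃ {y // y ∈ R.map e.toEmbedding} :=
  e.subtypeEquiv fun i => by simp

theorem top_map (T : RTree I) (e : I ≃ J) {R : Finset I} (h : T.root ∈ R) (i : I) :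
    (T.map e).top (T.root_map_mem e h) (e i) = imageEquiv e R (T.top h i) := by
  obtain ⟨k, hk⟩ := T.exists_iterate i
  induction k generalizing i with
  | zero =>
    have hi : i ∈ R := by
      have hk' : i = T.root := hk
      rw [hk']; exact h
    rw [top_of_mem _ _ hi, top_of_mem (i := e i) _ _ (Finset.mem_map_of_mem e.toEmbedding hi)]
    rfl
  | succ k ih =>
    by_cases hi : i ∈ R
    · rw [top_of_mem _ _ hi, top_of_mem (i := e i) _ _ (Finset.mem_map_of_mem e.toEmbedding hi)]
      rfl
    · rw [top_of_notMem _ _ hi, top_of_notMem _ _ (by simpa using hi), ← ih _ hk]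
      congr 1
      change e (T.parent (e.symm (e i))) = _
      rw [e.symm_apply_apply]

theorem contract_map (T : RTree I) (e : I ≃ J) {R : Finset I} (h : T.root ∈ R) :
    (T.map e).contract (T.root_map_mem e h) = (T.contract h).map (imageEquiv e R) := by
  refine Subtype.ext (funext fun ρ => ?_)
  obtain ⟨ρ, rfl⟩ := (imageEquiv e R).surjective ρ
  change (T.map e).top (T.root_map_mem e h) (e (T.parent (e.symm (e ρ)))) =
    imageEquiv e R (T.top h (T.parent ((imageEquiv e R).symm (imageEquiv e R ρ))))
  rw [e.symm_apply_apply, Equiv.symm_apply_apply, top_map]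

open Classical in
theorem block_map (T : RTree I) (e : I ≃ J) {R : Finset I} (h : T.root ∈ R)
    (ρ : {y // y ∈ R.map e.toEmbedding}) :
    (T.map e).block (T.root_map_mem e h) ρ =
      (T.block h ((imageEquiv e R).symm ρ)).map (fibreEquiv (T.top_map e h) ρ) := by
  refine Subtype.ext (funext fun i => ?_)
  obtain ⟨i, rfl⟩ := (fibreEquiv (T.top_map e h) ρ).surjective i
  refine Subtype.ext ?_
  change Subtype.val (dite _ _ _) = e (Subtype.val ((T.block h ((imageEquiv e R).symm ρ)).parent
    ((fibreEquiv (T.top_map e h) ρ).symm (fibreEquiv (T.top_map e h) ρ i))))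
  rw [Equiv.symm_apply_apply]
  change _ = e (Subtype.val (dite _ _ _))
  have hi : (fibreEquiv (T.top_map e h) ρ i).1 = e i.1 := rfl
  by_cases hR : i.1 ∈ R
  · rw [dif_pos hR, dif_pos (by rw [hi]; exact Finset.mem_map_of_mem e.toEmbedding hR), hi]
  · rw [dif_neg hR, dif_neg (by rw [hi]; simpa using hR)]
    change e (T.parent (e.symm (e i.1))) = _
    rw [e.symm_apply_apply]

instance [Finite I] : Finite (RTree I) := Subtype.finite

end RTree

namespace Gamma

variable {𝕂 : Type*} [CommRing 𝕂] {V : Type*} [AddCommGroup V] [Module 𝕂 V] [SuperModule 𝕂 V]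
  {I J : Type*} [Fintype I] [Fintype J] [LinearOrder I] [LinearOrder J]

theorem evalOn_eq {n : ℕ} (o : Fin n ≃o I) (T : RTree I) (f : Gamma 𝕂 V) :
    evalOn T f = PiTensorProduct.reindex 𝕂 (fun _ => V) o.toEquiv
      (coeff (T.map o.symm.toEquiv) f) := by
  have hn : n = Fintype.card I := by simpa using Fintype.card_congr o.toEquiv
  subst hn
  rw [Subsingleton.elim o (Fintype.orderIsoFinOfCardEq I rfl)]
  rfl

theorem evalOn_map (e : I ≃ J) (T : RTree I) (f : Gamma 𝕂 V) :
    evalOn (T.map e) f = permute e (evalOn T f) := by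
  let oI := Fintype.orderIsoFinOfCardEq I rfl
  let oJ := Fintype.orderIsoFinOfCardEq J (Fintype.card_congr e).symm
  have hT : (T.map e).map oJ.symm.toEquiv
      = (T.map oI.symm.toEquiv).map ((oI.toEquiv.trans e).trans oJ.symm.toEquiv) := by
    refine Subtype.ext (funext fun j => ?_)
    change oJ.symm (e (T.parent (e.symm (oJ j)))) = oJ.symm (e (oI (oI.symm (T.parent
      (oI (oI.symm (e.symm (oJ j))))))))
    rw [oI.apply_symm_apply, oI.apply_symm_apply]
  rw [evalOn_eq oI, evalOn_eq oJ, hT, coeff_map, ← permute_of_strictMono _ oJ.strictMono,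
    ← permute_of_strictMono _ oI.strictMono, permute_permute, permute_permute]
  congr 2
  refine Equiv.ext fun i => ?_
  simp

theorem evalOn_part (T : RTree I) (a : ZMod 2) (f : Gamma 𝕂 V) :
    evalOn T (part 𝕂 a f) = tensorProj a (evalOn T f) := by
  let oI := Fintype.orderIsoFinOfCardEq I rfl
  rw [evalOn_eq oI, evalOn_eq oI, coeff_proj, ← permute_of_strictMono _ oI.strictMono,
    ← permute_of_strictMono _ oI.strictMono, tensorProj_permute]

theorem mulCoeff_map (e : I ≃ J) (S : RTree I) (F : Gamma 𝕂 (Gamma 𝕂 V)) :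
    mulCoeff (S.map e) F = permute e (mulCoeff S F) := by
  classical
  simp only [mulCoeff, LinearMap.sum_apply, map_sum]
  symm
  refine Fintype.sum_equiv (e.finsetCongr.subtypeEquiv fun R => ?_) _ _ fun R => ?_
  · rw [RTree.root_map]; simp
  · simp only [LinearMap.comp_apply]
    have h1 : evalOn ((S.map e).contract (S.root_map_mem e R.2)) F
        = permute (RTree.imageEquiv e R.1) (evalOn (S.contract R.2) F) := by
      rw [RTree.contract_map, evalOn_map]
    have h2 : ∀ (ρ : {x // x ∈ R.1}) (a : ZMod 2) (x : Gamma 𝕂 V),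
        evalOn (S.block R.2 ρ) (part 𝕂 a x) = tensorProj a (evalOn (S.block R.2 ρ) x) :=
      fun ρ a x => evalOn_part _ a x
    have h3 : ∀ (ρ : {y // y ∈ R.1.map e.toEmbedding}) (x : Gamma 𝕂 V),
        evalOn ((S.map e).block (S.root_map_mem e R.2) ρ) x =
          permute (fibreEquiv (S.top_map e R.2) ρ)
            (evalOn (S.block R.2 ((RTree.imageEquiv e R.1).symm ρ)) x) :=
      fun ρ x => by rw [RTree.block_map, evalOn_map]
    have h4 := assemble_permute (S.top_map e R.2) _ _ h2 h3 (evalOn (S.contract R.2) F)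
    rw [← h1] at h4
    exact h4.symm

/-- Forget the components of arity at least `M`. -/
def trunc (M : ℕ) : Gamma 𝕂 V →ₗ[𝕂] Gamma 𝕂 V :=
  lift (fun n => if n < M then LinearMap.id else 0) fun n σ x => by split_ifs <;> simp

theorem evalOn_trunc {M : ℕ} (T : RTree I) (hM : M ≤ Fintype.card I) (f : Gamma 𝕂 V) :
    evalOn T (trunc M f) = 0 := by
  rw [evalOn_eq (Fintype.orderIsoFinOfCardEq I rfl), trunc, coeff_lift,
    if_neg (by simpa using hM)]
  simp

open Filter in
theorem eventually_trunc (f : Gamma 𝕂 V) : ∀ᶠ M in atTop, trunc M f = f := by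
  obtain ⟨N, hN⟩ := exists_coeff_eq_zero f
  filter_upwards [eventually_ge_atTop N] with M hM
  refine ext fun n T => ?_
  rw [trunc, coeff_lift]
  split_ifs with h
  · rfl
  · rw [hN n (by omega)]; rfl

open Filter in
theorem eventually_map_trunc {n : ℕ} (x : ⨂[𝕂] _ : Fin n, Gamma 𝕂 V) :
    ∀ᶠ M in atTop, PiTensorProduct.map (fun _ => trunc M) x = x := by
  induction x using PiTensorProduct.induction_on with
  | smul_tprod c v =>
    have : ∀ᶠ M in atTop, ∀ i, trunc M (v i) = v i :=
      eventually_all.mpr fun i => eventually_trunc (v i)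
    filter_upwards [this] with M hM
    rw [map_smul, PiTensorProduct.map_tprod]
    simp only [hM]
  | add x y hx hy =>
    filter_upwards [hx, hy] with M h1 h2
    rw [map_add, h1, h2]

theorem map_evalOn_trunc {M : ℕ} {t : I → J} [∀ ρ, Fintype {i // t i = ρ}]
    (B : ∀ ρ, RTree {i // t i = ρ}) (hM : Fintype.card J * M < Fintype.card I)
    (x : ⨂[𝕂] _ : J, Gamma 𝕂 V) :
    PiTensorProduct.map (fun ρ => evalOn (B ρ)) (PiTensorProduct.map (fun _ => trunc M) x) = 0 := by
  have hbig : ∃ ρ, M ≤ Fintype.card {i // t i = ρ} := by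
    by_contra! hlt
    have h1 : Fintype.card I = ∑ ρ, Fintype.card {i // t i = ρ} := by
      rw [← Fintype.card_sigma]
      exact Fintype.card_congr (Equiv.sigmaFiberEquiv _).symm
    have h2 : ∑ ρ, Fintype.card {i // t i = ρ} ≤ ∑ ρ : J, M :=
      Finset.sum_le_sum fun ρ _ => (hlt ρ).le
    rw [← h1, Finset.sum_const, Finset.card_univ, smul_eq_mul] at h2
    omega
  obtain ⟨ρ, hρ⟩ := hbig
  induction x using PiTensorProduct.induction_on with
  | smul_tprod c v =>
    rw [map_smul, map_smul, PiTensorProduct.map_tprod, PiTensorProduct.map_tprod]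
    rw [(PiTensorProduct.tprod 𝕂).map_coord_zero ρ (evalOn_trunc _ hρ _), smul_zero]
  | add x y hx hy => rw [map_add, map_add, hx, hy, add_zero]

theorem map_trunc_reindex (M : ℕ) (e : I ≃ J) (x : ⨂[𝕂] _ : I, Gamma 𝕂 V) :
    PiTensorProduct.map (fun _ => trunc M) (PiTensorProduct.reindex 𝕂 (fun _ => Gamma 𝕂 V) e x)
      = PiTensorProduct.reindex 𝕂 (fun _ => Gamma 𝕂 V) e
        (PiTensorProduct.map (fun _ => trunc M) x) := by
  induction x using PiTensorProduct.induction_on with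
  | smul_tprod c v =>
    rw [map_smul, map_smul, map_smul, map_smul, PiTensorProduct.map_tprod]
    have h1 := PiTensorProduct.reindex_tprod (R := 𝕂) (s := fun _ => Gamma 𝕂 V) e
      (fun i => trunc M (v i))
    have h2 := PiTensorProduct.reindex_tprod (R := 𝕂) (s := fun _ => Gamma 𝕂 V) e v
    rw [h1, h2, PiTensorProduct.map_tprod]
  | add x y hx hy => rw [map_add, map_add, map_add, map_add, hx, hy]

open Filter in
theorem exists_map_trunc (F : Gamma 𝕂 (Gamma 𝕂 V)) : ∃ N M : ℕ,
    ∀ (J : Type) [Fintype J] [LinearOrder J] (T : RTree J),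
      PiTensorProduct.map (fun _ => trunc M) (evalOn T F) = evalOn T F ∧
        (N ≤ Fintype.card J → evalOn T F = 0) := by
  obtain ⟨N, hN⟩ := exists_coeff_eq_zero F
  have hM : ∀ᶠ M in atTop, ∀ n ∈ Set.Iio N, ∀ T : RTree (Fin n),
      PiTensorProduct.map (fun _ => trunc M) (coeff T F) = coeff T F :=
    (eventually_all_finite (Set.finite_Iio N)).mpr fun n _ =>
      eventually_all.mpr fun T => eventually_map_trunc _
  obtain ⟨M, hM⟩ := hM.exists
  refine ⟨N, M, fun J _ _ T => ?_⟩
  rw [evalOn_eq (Fintype.orderIsoFinOfCardEq J rfl), map_trunc_reindex]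
  by_cases hJ : N ≤ Fintype.card J
  · rw [hN _ hJ]; simp
  · refine ⟨?_, fun h => absurd h hJ⟩
    rw [hM _ (not_le.mp hJ)]

theorem exists_mulCoeff_eq_zero (F : Gamma 𝕂 (Gamma 𝕂 V)) :
    ∃ N, ∀ n, N ≤ n → ∀ S : RTree (Fin n), mulCoeff S F = 0 := by
  obtain ⟨N, M, h⟩ := exists_map_trunc F
  refine ⟨N * M + 1, fun n hn S => ?_⟩
  simp only [mulCoeff, LinearMap.sum_apply, LinearMap.comp_apply]
  refine Finset.sum_eq_zero fun R _ => ?_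
  have hR := h {x // x ∈ R.1} (S.contract R.2)
  by_cases hc : N ≤ Fintype.card {x // x ∈ R.1}
  · rw [hR.2 hc]; simp
  · have := Nat.mul_le_mul_right M (not_le.mp hc).le
    rw [← hR.1, map_evalOn_trunc _ (by rw [Fintype.card_fin]; omega), map_zero]

theorem exists_mul (F : Gamma 𝕂 (Gamma 𝕂 V)) :
    ∃ g : Gamma 𝕂 V, ∀ n (S : RTree (Fin n)), coeff S g = mulCoeff S F := by
  obtain ⟨N, hN⟩ := exists_mulCoeff_eq_zero F
  exact exists_of_coeff (fun n S => mulCoeff S F) (fun n σ S => mulCoeff_map σ S F) N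
    fun n hn => funext fun S => hN n hn S

/-- The multiplication `Γ(PreLie, Γ(PreLie, V)) → Γ(PreLie, V)` of the monad. -/
def mul (F : Gamma 𝕂 (Gamma 𝕂 V)) : Gamma 𝕂 V := (exists_mul F).choose

theorem coeff_mul (F : Gamma 𝕂 (Gamma 𝕂 V)) {n : ℕ} (S : RTree (Fin n)) :
    coeff S (mul F) = mulCoeff S F := (exists_mul F).choose_spec n S

end Gamma

section Algebras

universe u v v₁ v₂

/-- Cochain complexes of `𝕂`-modules, graded by `ℤ`. -/
structure DGMod (𝕂 : Type u) [CommRing 𝕂] where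
  /-- The direct sum of all the components. -/
  carrier : Type v
  [addCommGroup : AddCommGroup carrier]
  [module : Module 𝕂 carrier]
  /-- The component of degree `k`. -/
  gr : ℤ → Submodule 𝕂 carrier
  internal : DirectSum.IsInternal gr
  d : carrier →ₗ[𝕂] carrier
  d_mem : ∀ k x, x ∈ gr k → d x ∈ gr (k + 1)
  d_d : ∀ x, d (d x) = 0

attribute [instance] DGMod.addCommGroup DGMod.module

variable {𝕂 : Type u} [CommRing 𝕂]

namespace DGMod

variable (M : DGMod.{u, v} 𝕂)

/-- `M` is the direct sum of its components. -/
def equiv : (⨁ k, M.gr k) ≃ₗ[𝕂] M.carrier :=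
  LinearEquiv.ofBijective (DirectSum.coeLinearMap M.gr) M.internal

open Classical in
/-- The sum of the components of the degrees of parity `a`. -/
def parity (a : ZMod 2) : M.carrier →ₗ[𝕂] M.carrier :=
  M.equiv.toLinearMap ∘ₗ
    DirectSum.lmap (fun k => if (k : ZMod 2) = a then LinearMap.id else 0) ∘ₗ
    M.equiv.symm.toLinearMap

open Classical in
theorem parity_of_mem (a : ZMod 2) {k : ℤ} {x : M.carrier} (hx : x ∈ M.gr k) :
    M.parity a x = if (k : ZMod 2) = a then x else 0 := by
  have h : M.equiv (DirectSum.lof 𝕂 ℤ (fun k => M.gr k) k ⟨x, hx⟩) = x :=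
    DirectSum.coeLinearMap_lof _ _ _
  conv_lhs => rw [← h]
  simp only [parity, LinearMap.comp_apply, LinearEquiv.coe_coe, LinearEquiv.symm_apply_apply]
  rw [DirectSum.lmap_lof]
  split_ifs with hk
  · exact h
  · simp

theorem induction {p : M.carrier → Prop} (x : M.carrier) (h0 : p 0)
    (hadd : ∀ x y, p x → p y → p (x + y)) (hgr : ∀ k x, x ∈ M.gr k → p x) : p x := by
  classical
  obtain ⟨x, rfl⟩ := M.equiv.surjective x
  induction x using DirectSum.induction_on with
  | zero => rwa [map_zero]
  | of k x =>
    have h : M.equiv (DirectSum.of (fun k => M.gr k) k x) = x :=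
      DirectSum.coeLinearMap_lof M.gr k x
    rw [h]; exact hgr k _ x.2
  | add x y hx hy => rw [map_add]; exact hadd _ _ hx hy

instance : SuperModule 𝕂 M.carrier where
  proj := M.parity
  proj_proj a b x := by
    induction x using M.induction with
    | h0 => simp
    | hadd x y hx hy => rw [map_add, map_add, hx, hy]; split_ifs <;> simp
    | hgr k x hx =>
      rw [M.parity_of_mem b hx]
      by_cases h : (k : ZMod 2) = b
      · subst h
        rw [if_pos rfl, M.parity_of_mem a hx]
        simp only [eq_comm]
      · simp [h]
  sum_proj x := by
    induction x using M.induction with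
    | h0 => simp
    | hadd x y hx hy => simp only [map_add, Finset.sum_add_distrib, hx, hy]
    | hgr k x hx =>
      simp only [M.parity_of_mem _ hx]
      simp

theorem isOdd_d : IsOdd M.d := by
  intro a x
  change M.d (M.parity a x) = M.parity (a + 1) (M.d x)
  induction x using M.induction with
  | h0 => simp
  | hadd x y hx hy => simp only [map_add, hx, hy]
  | hgr k x hx =>
    rw [M.parity_of_mem _ hx, M.parity_of_mem _ (M.d_mem k x hx)]
    push_cast
    simp only [add_left_inj]
    split_ifs <;> simp

/-- The component of degree `k` of a tensor power. -/
def tensorGr {I : Type*} [Fintype I] (k : ℤ) : Submodule 𝕂 (⨂[𝕂] _ : I, M.carrier) :=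
  Submodule.span 𝕂 {x | ∃ (κ : I → ℤ) (v : I → M.carrier), (∀ i, v i ∈ M.gr (κ i)) ∧
    ∑ i, κ i = k ∧ x = PiTensorProduct.tprod 𝕂 v}

/-- Cocycles. -/
def Z (k : ℤ) : Submodule 𝕂 M.carrier := M.gr k ⊓ LinearMap.ker M.d

/-- Coboundaries. -/
def B (k : ℤ) : Submodule 𝕂 M.carrier := (M.gr (k - 1)).map M.d

/-- Cohomology. -/
abbrev H (k : ℤ) : Type _ := M.Z k ⧸ (M.B k).submoduleOf (M.Z k)

/-- `M` is concentrated in degrees `≥ 0`. -/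
def IsPositivelyGraded : Prop := ∀ k < 0, M.gr k = ⊥

end DGMod

/-- Morphisms of cochain complexes. -/
structure DGHom (M : DGMod.{u, v₁} 𝕂) (N : DGMod.{u, v₂} 𝕂) where
  f : M.carrier →ₗ[𝕂] N.carrier
  map_mem : ∀ k x, x ∈ M.gr k → f x ∈ N.gr k
  map_d : ∀ x, f (M.d x) = N.d (f x)

namespace DGHom

variable {M : DGMod.{u, v₁} 𝕂} {N : DGMod.{u, v₂} 𝕂} (φ : DGHom M N)

theorem isEven : IsEven φ.f := by
  intro a x
  change φ.f (M.parity a x) = N.parity a (φ.f x)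
  induction x using M.induction with
  | h0 => simp
  | hadd x y hx hy => simp only [map_add, hx, hy]
  | hgr k x hx =>
    rw [M.parity_of_mem _ hx, N.parity_of_mem _ (φ.map_mem k x hx)]
    split_ifs <;> simp

theorem map_Z {k : ℤ} {x : M.carrier} (hx : x ∈ M.Z k) : φ.f x ∈ N.Z k := by
  refine ⟨φ.map_mem k x hx.1, ?_⟩
  change N.d (φ.f x) = 0
  rw [← φ.map_d, LinearMap.mem_ker.mp hx.2, map_zero]

theorem map_B {k : ℤ} {x : M.carrier} (hx : x ∈ M.B k) : φ.f x ∈ N.B k := by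
  obtain ⟨y, hy, rfl⟩ := hx
  exact ⟨φ.f y, φ.map_mem _ y hy, (φ.map_d y).symm⟩

/-- The map induced in cohomology. -/
def H (k : ℤ) : M.H k →ₗ[𝕂] N.H k :=
  Submodule.mapQ _ _ (φ.f.restrict fun _ hx => φ.map_Z hx) fun _ hx => φ.map_B hx

end DGHom

/-- An algebra over the monad `Γ(PreLie, -)` on cochain complexes of `𝕂`-modules. -/
structure GammaAlg (𝕂 : Type u) [CommRing 𝕂] where
  /-- The underlying cochain complex. -/
  M : DGMod.{u, v} 𝕂
  /-- The structure map. -/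
  l : Gamma 𝕂 M.carrier →ₗ[𝕂] M.carrier
  /-- `l` preserves degrees. -/
  l_mem : ∀ k f, (∀ n (T : RTree (Fin n)), Gamma.coeff T f ∈ M.tensorGr k) → l f ∈ M.gr k
  /-- `l` preserves parities (this is a consequence of `l_mem`). -/
  l_even : IsEven l
  /-- `l` commutes with the differentials. -/
  l_diff : ∀ f, l (Gamma.diff M.d M.isOdd_d f) = M.d (l f)
  /-- The unit law. -/
  l_unit : ∀ x, l (Gamma.unit x) = x
  /-- The associativity law. -/
  l_mul : ∀ F, l (Gamma.map l l_even F) = l (Gamma.mul F)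

/-- Morphisms of `Γ(PreLie, -)`-algebras. -/
structure GammaHom (L : GammaAlg.{u, v₁} 𝕂) (L' : GammaAlg.{u, v₂} 𝕂) where
  /-- The underlying morphism of cochain complexes. -/
  g : DGHom L.M L'.M
  map_l : ∀ x, g.f (L.l x) = L'.l (Gamma.map g.f g.isEven x)

end Algebras

section Scalars

variable {𝕂 : Type*} [CommRing 𝕂] (A : Type*) [CommRing A] [Algebra 𝕂 A]
  {V : Type*} [AddCommGroup V] [Module 𝕂 V]

/-- `A ⊗ V`, with `A` in degree `0`. -/
instance [SuperModule 𝕂 V] : SuperModule 𝕂 (A ⊗[𝕂] V) where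
  proj a := (part 𝕂 a).lTensor A
  proj_proj a b x := by
    rw [← LinearMap.comp_apply, ← LinearMap.lTensor_comp]
    have : (part 𝕂 a : V →ₗ[𝕂] V) ∘ₗ part 𝕂 b = if a = b then part 𝕂 b else 0 := by
      refine LinearMap.ext fun v => ?_
      rw [LinearMap.comp_apply, SuperModule.proj_proj]
      split_ifs <;> rfl
    rw [this]
    split_ifs <;> simp
  sum_proj x := by
    have : (∑ a, part 𝕂 a : V →ₗ[𝕂] V) = LinearMap.id := by
      refine LinearMap.ext fun v => ?_
      rw [LinearMap.sum_apply]
      exact SuperModule.sum_proj v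
    have h := congrArg (fun g => LinearMap.lTensorHom (R := 𝕂) (M := A) g x) this
    simpa using h

variable {A} {I : Type*} [Fintype I]

/-- The map `⨂_I (A ⊗ V) → A ⊗ ⨂_I V`, `⨂ᵢ (aᵢ ⊗ vᵢ) ↦ (∏ aᵢ) ⊗ ⨂ᵢ vᵢ`. -/
def collapse : (⨂[𝕂] _ : I, A ⊗[𝕂] V) →ₗ[𝕂] A ⊗[𝕂] (⨂[𝕂] _ : I, V) :=
  letI : Module 𝕂ᵐᵒᵖ V := Module.compHom _ ((RingHom.id 𝕂).fromOpposite mul_comm)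
  haveI : IsCentralScalar 𝕂 V := ⟨fun _ _ => rfl⟩
  (PiTensorProduct.map fun _ => TrivSqZeroExt.sndHom 𝕂 V).lTensor A ∘ₗ
    PiTensorProduct.lift ((MultilinearMap.mkPiAlgebra 𝕂 I
      (A ⊗[𝕂] (⨂[𝕂] _ : I, TrivSqZeroExt 𝕂 V))).compLinearMap fun i =>
        (slot 𝕂 V i).lTensor A)

theorem prod_tmul {C : Type*} [CommRing C] [Algebra 𝕂 C] (a : I → A) (c : I → C) :
    ∏ i, (a i ⊗ₜ[𝕂] c i) = (∏ i, a i) ⊗ₜ[𝕂] ∏ i, c i := by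
  classical
  have h : ∀ s : Finset I, ∏ i ∈ s, (a i ⊗ₜ[𝕂] c i) = (∏ i ∈ s, a i) ⊗ₜ[𝕂] ∏ i ∈ s, c i := by
    intro s
    induction s using Finset.induction_on with
    | empty => simp [Algebra.TensorProduct.one_def]
    | insert i s hi ih => rw [Finset.prod_insert hi, Finset.prod_insert hi,
        Finset.prod_insert hi, ih, Algebra.TensorProduct.tmul_mul_tmul]
  exact h _

theorem collapse_tprod (a : I → A) (v : I → V) :
    collapse (PiTensorProduct.tprod 𝕂 fun i => a i ⊗ₜ[𝕂] v i)
      = (∏ i, a i) ⊗ₜ[𝕂] PiTensorProduct.tprod 𝕂 v := by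
  classical
  let _ : Module 𝕂ᵐᵒᵖ V := Module.compHom _ ((RingHom.id 𝕂).fromOpposite mul_comm)
  have _ : IsCentralScalar 𝕂 V := ⟨fun _ _ => rfl⟩
  change (PiTensorProduct.map fun _ => TrivSqZeroExt.sndHom 𝕂 V).lTensor A
    (PiTensorProduct.lift _ (PiTensorProduct.tprod 𝕂 _)) = _
  simp only [PiTensorProduct.lift.tprod, MultilinearMap.compLinearMap_apply,
    MultilinearMap.mkPiAlgebra_apply, LinearMap.lTensor_tmul]
  rw [prod_tmul (C := ⨂[𝕂] _ : I, TrivSqZeroExt 𝕂 V)]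
  rw [LinearMap.lTensor_tmul, prod_slot, PiTensorProduct.map_tprod]
  simp

variable [SuperModule 𝕂 V]

theorem collapse_permute {I J : Type*} [Fintype I] [Fintype J] [LinearOrder I] [LinearOrder J]
    (e : I ≃ J) (x : ⨂[𝕂] _ : I, A ⊗[𝕂] V) :
    collapse (permute e x) = (permute e).lTensor A (collapse x) := by
  classical
  suffices h : collapse ∘ₗ permute e = (permute e).lTensor A ∘ₗ collapse (𝕂 := 𝕂) (A := A) (V := V)
    from LinearMap.congr_fun h x
  have span : Submodule.span 𝕂 (Set.range fun (x : {x : ZMod 2 × A × V // part 𝕂 x.1 x.2.2 = x.2.2})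
      => x.1.2.1 ⊗ₜ[𝕂] x.1.2.2) = ⊤ := by
    rw [eq_top_iff, ← TensorProduct.span_tmul_eq_top, Submodule.span_le]
    rintro _ ⟨a, v, rfl⟩
    have hv : v = ∑ p, part 𝕂 p v := (SuperModule.sum_proj v).symm
    rw [hv, TensorProduct.tmul_sum]
    refine sum_mem fun p _ => Submodule.subset_span ⟨⟨(p, a, part 𝕂 p v), ?_⟩, rfl⟩
    change SuperModule.proj p (SuperModule.proj p v) = _
    rw [SuperModule.proj_proj, if_pos rfl]
  refine PiTensorProduct.ext_of_span_eq_top (fun _ => span) fun c => ?_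
  simp only [LinearMap.comp_apply]
  have hh : IsHom 𝕂 (fun i => (c i).1.1) (fun i => (c i).1.2.2) := fun i => (c i).2
  have hh' : IsHom 𝕂 (fun i => (c i).1.1) (fun i => (c i).1.2.1 ⊗ₜ[𝕂] (c i).1.2.2) := fun i => by
    change (part 𝕂 (c i).1.1).lTensor A _ = _
    rw [LinearMap.lTensor_tmul, (c i).2]
  rw [permute_tprod e hh', map_smul, collapse_tprod (fun i => (c i).1.2.1) (fun i => (c i).1.2.2),
    LinearMap.lTensor_tmul, permute_tprod e hh, TensorProduct.tmul_smul,
    collapse_tprod (fun j => (c (e.symm j)).1.2.1) (fun j => (c (e.symm j)).1.2.2),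
    Equiv.prod_comp e.symm (fun i => (c i).1.2.1)]

theorem lTensor_proj_inj {ι M X : Type*} [Finite ι] [AddCommGroup M] [Module 𝕂 M] [AddCommGroup X]
    [Module 𝕂 X] (u : A ⊗[𝕂] (ι → X)) (h : ∀ i, (LinearMap.proj i).lTensor A u = 0) : u = 0 := by
  classical
  cases nonempty_fintype ι
  have : (∑ i : ι, LinearMap.single 𝕂 (fun _ => X) i ∘ₗ LinearMap.proj i) = (LinearMap.id : (ι → X) →ₗ[𝕂] _) := by
    ext; simp
  have h2 := congrArg (fun g => LinearMap.lTensorHom (R := 𝕂) (M := A) g u) this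
  simp only [map_sum, LinearMap.sum_apply, LinearMap.coe_lTensorHom, LinearMap.lTensor_comp,
    LinearMap.comp_apply, h, map_zero, Finset.sum_const_zero, LinearMap.lTensor_id,
    LinearMap.id_apply] at h2
  exact h2.symm

/-- The coefficient of a tree. -/
def pr {n : ℕ} (T : RTree (Fin n)) : (RTree (Fin n) → ⨂[𝕂] _ : Fin n, V) →ₗ[𝕂] ⨂[𝕂] _ : Fin n, V :=
  LinearMap.proj T

variable (𝕂 V) in
/-- The map whose kernel consists of the invariants. -/
def invDefect (n : ℕ) : (RTree (Fin n) → ⨂[𝕂] _ : Fin n, V) →ₗ[𝕂]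
    ((Fin n ≃ Fin n) × RTree (Fin n) → ⨂[𝕂] _ : Fin n, V) :=
  LinearMap.pi fun x => (pr (x.2.map x.1)) - permute x.1 ∘ₗ pr x.2

theorem exact_invDefect (n : ℕ) : Function.Exact (GammaPart 𝕂 V n).subtype (invDefect 𝕂 V n) := by
  intro f
  change _ ↔ f ∈ LinearMap.range _
  rw [Submodule.range_subtype]
  constructor
  · intro h σ T
    have := congrFun h (σ, T)
    simpa [invDefect, pr, sub_eq_zero] using this
  · intro h
    funext x
    simpa [invDefect, pr, sub_eq_zero] using h x.1 x.2

theorem Gamma.exists_scalars [Module.Flat 𝕂 A] (f : Gamma 𝕂 (A ⊗[𝕂] V)) :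
    ∃ w : A ⊗[𝕂] Gamma 𝕂 V, ∀ n (T : RTree (Fin n)),
    (Gamma.coeff T).lTensor A w = collapse (Gamma.coeff T f) := by
  classical
  have h1 : ∀ n, ∃ w : A ⊗[𝕂] GammaPart 𝕂 V n, ∀ T : RTree (Fin n),
      (LinearMap.proj T ∘ₗ (GammaPart 𝕂 V n).subtype).lTensor A w = collapse (Gamma.coeff T f) := by
    intro n
    cases nonempty_fintype (RTree (Fin n))
    let u : A ⊗[𝕂] (RTree (Fin n) → ⨂[𝕂] _ : Fin n, V) :=
      ∑ T, (LinearMap.single 𝕂 (fun _ => ⨂[𝕂] _ : Fin n, V) T).lTensor A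
        (collapse (Gamma.coeff T f))
    have hu : ∀ T, (pr T).lTensor A u = collapse (Gamma.coeff T f) := by
      intro T
      simp only [u, map_sum]
      rw [Finset.sum_eq_single T]
      · rw [← LinearMap.comp_apply, ← LinearMap.lTensor_comp, pr, LinearMap.proj_comp_single_same,
          LinearMap.lTensor_id]; rfl
      · intro T' _ hT
        rw [← LinearMap.comp_apply, ← LinearMap.lTensor_comp, pr, LinearMap.proj_comp_single_ne _ _ _ _ hT.symm]
        simp
      · simp
    have h0 : (invDefect 𝕂 V n).lTensor A u = 0 := by
      refine lTensor_proj_inj (M := V) _ fun x => ?_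
      rw [← LinearMap.comp_apply, ← LinearMap.lTensor_comp]
      have : LinearMap.proj x ∘ₗ invDefect 𝕂 V n =
        pr (x.2.map x.1) - permute x.1 ∘ₗ pr x.2 := rfl
      rw [this, LinearMap.lTensor_sub, LinearMap.sub_apply, hu, LinearMap.lTensor_comp,
        LinearMap.comp_apply, hu, Gamma.coeff_map, collapse_permute, sub_self]
    obtain ⟨w, hw⟩ := (Module.Flat.lTensor_exact A (exact_invDefect (𝕂 := 𝕂) (V := V) n) u).mp h0
    refine ⟨w, fun T => ?_⟩
    rw [LinearMap.lTensor_comp, LinearMap.comp_apply, hw]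
    exact hu T
  choose w hw using h1
  obtain ⟨N, hN⟩ := Gamma.exists_coeff_eq_zero f
  let inc (n : ℕ) : GammaPart 𝕂 V n →ₗ[𝕂] Gamma 𝕂 V :=
    DirectSum.lof 𝕂 ℕ (fun n => GammaPart 𝕂 V n) n
  have hinc : ∀ n m (T : RTree (Fin n)), Gamma.coeff (V := V) T ∘ₗ inc m =
      if h : n = m then (LinearMap.proj (h ▸ T) ∘ₗ (GammaPart 𝕂 V n).subtype) ∘ₗ
        (h ▸ LinearMap.id) else 0 := by
    intro n m T
    split_ifs with h
    · subst h
      refine LinearMap.ext fun x => ?_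
      change (GammaPart 𝕂 V n).subtype (DirectSum.component 𝕂 ℕ (fun n => GammaPart 𝕂 V n) n (DirectSum.lof 𝕂 ℕ (fun n => GammaPart 𝕂 V n) n x)) T = _
      rw [DirectSum.component.lof_self]; rfl
    · refine LinearMap.ext fun x => ?_
      change (GammaPart 𝕂 V n).subtype (DirectSum.component 𝕂 ℕ (fun n => GammaPart 𝕂 V n) n (DirectSum.lof 𝕂 ℕ (fun n => GammaPart 𝕂 V n) m x)) T = _
      rw [DirectSum.component.of, dif_neg (Ne.symm h)]; rfl
  refine ⟨∑ n ∈ Finset.range N, (inc n).lTensor A (w n), fun n T => ?_⟩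
  rw [map_sum]
  have key : ∀ m, (Gamma.coeff T).lTensor A ((inc m).lTensor A (w m)) =
      if m = n then collapse (Gamma.coeff T f) else 0 := by
    intro m
    rw [← LinearMap.comp_apply, ← LinearMap.lTensor_comp, hinc]
    by_cases h : n = m
    · subst h
      rw [dif_pos rfl, if_pos rfl]
      exact hw _ _
    · rw [dif_neg h, if_neg (Ne.symm h)]; simp
  rw [Finset.sum_congr rfl fun m _ => key m, Finset.sum_ite_eq']
  split_ifs with h
  · rfl
  · rw [hN n (by simpa using h), map_zero]

theorem lTensor_component_inj (w : A ⊗[𝕂] ⨁ n, GammaPart 𝕂 V n)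
    (h : ∀ n, (DirectSum.component 𝕂 ℕ (fun n => GammaPart 𝕂 V n) n).lTensor A w = 0) :
    w = 0 := by
  classical
  have hE : ∀ n (w : A ⊗[𝕂] ⨁ n, GammaPart 𝕂 V n),
      (TensorProduct.directSumRight 𝕂 𝕂 A (fun n => GammaPart 𝕂 V n) w) n =
      (DirectSum.component 𝕂 ℕ (fun n => GammaPart 𝕂 V n) n).lTensor A w := by
    intro n w
    induction w using TensorProduct.induction_on with
    | zero => simp
    | add x y hx hy => rw [map_add, map_add, ← hx, ← hy]; rfl
    | tmul a g => apply TensorProduct.directSumRight_tmul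
  apply (TensorProduct.directSumRight 𝕂 𝕂 A (fun n => GammaPart 𝕂 V n)).injective
  rw [map_zero]
  refine DFinsupp.ext fun n => ?_
  exact (hE n w).trans (h n)

theorem Gamma.scalars_inj [Module.Flat 𝕂 A] (w : A ⊗[𝕂] Gamma 𝕂 V)
    (h : ∀ n (T : RTree (Fin n)), (Gamma.coeff T).lTensor A w = 0) : w = 0 := by
  refine lTensor_component_inj w fun n => ?_
  let c : Gamma 𝕂 V →ₗ[𝕂] GammaPart 𝕂 V n :=
    DirectSum.component 𝕂 ℕ (fun n => GammaPart 𝕂 V n) n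
  change c.lTensor A w = 0
  apply Module.Flat.lTensor_preserves_injective_linearMap (M := A) (GammaPart 𝕂 V n).subtype
    Subtype.val_injective
  rw [map_zero]
  refine lTensor_proj_inj (M := V) _ fun T => ?_
  rw [← LinearMap.comp_apply, ← LinearMap.comp_apply, ← LinearMap.lTensor_comp,
    ← LinearMap.lTensor_comp]
  exact h n T

open Classical in
/-- The canonical map `Γ(PreLie, A ⊗ V) → A ⊗ Γ(PreLie, V)`, given on coefficients by `collapse`.
It is well defined for every flat `𝕂`-algebra `A`, by `exists_scalars` and `scalars_inj`;
the value `0` is not used in that case. -/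
def Gamma.scalars (f : Gamma 𝕂 (A ⊗[𝕂] V)) : A ⊗[𝕂] Gamma 𝕂 V :=
  if h : ∃ w : A ⊗[𝕂] Gamma 𝕂 V, ∀ n (T : RTree (Fin n)),
    (Gamma.coeff T).lTensor A w = collapse (Gamma.coeff T f) then h.choose else 0

end Scalars

section Corollas

variable {𝕂 : Type*} [CommRing 𝕂] {V : Type*} [AddCommGroup V] [Module 𝕂 V] [SuperModule 𝕂 V]

/-- The total order on the vertices of a tree obtained from the given one by moving the root
to the first place. -/
def rootFirst {I : Type*} [LinearOrder I] (r i j : I) : Prop :=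
  (i = r ∧ j ≠ r) ∨ (i ≠ r ∧ j ≠ r ∧ i < j)

theorem isOrd_rootFirst {I : Type*} [LinearOrder I] (r : I) : IsOrd (rootFirst r) := by
  refine ⟨?_, ?_⟩
  · rintro i j (⟨rfl, h⟩ | ⟨h1, h2, h3⟩) (⟨h4, h5⟩ | ⟨h4, h5, h6⟩)
    · exact h h4
    · exact h5 rfl
    · exact h2 h4
    · exact h3.asymm h6
  · intro i j hij
    unfold rootFirst
    by_cases hi : i = r
    · subst hi; exact Or.inl (Or.inl ⟨rfl, Ne.symm hij⟩)
    · by_cases hj : j = r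
      · exact Or.inr (Or.inl ⟨hj, hi⟩)
      · rcases lt_or_gt_of_ne hij with h | h
        · exact Or.inl (Or.inr ⟨hi, hj, h⟩)
        · exact Or.inr (Or.inr ⟨hj, hi, h⟩)

open Classical in
/-- The coefficients of the sum of the orbit of `Fₙ ⊗ x ⊗ y ⊗ ⋯ ⊗ y` under permutations modulo
the stabilizer, `Fₙ` being the corolla with a root and `n` leaves: every labelling of the corolla
occurs once, with `x` at the root, `y` at all leaves, and the Koszul sign for moving `x` from the
first place to the place of the root. -/
def corollaCoeff (n : ℕ) (x y : V) (T : RTree (Fin (n + 1))) : ⨂[𝕂] _ : Fin (n + 1), V :=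
  if ∀ i, T.parent i = T.root then
    koszul (rootFirst T.root) (fun i j => i < j)
      (PiTensorProduct.tprod 𝕂 fun i => if i = T.root then x else y)
  else 0

variable {I J : Type*} [Fintype I] [Fintype J]

theorem koszul_koszul {a b c : I → I → Prop} (ha : IsOrd a) (hb : IsOrd b) (hc : IsOrd c)
    (t : ⨂[𝕂] _ : I, V) : koszul b c (koszul a b t) = koszul a c t := by
  suffices h : (koszul b c : (⨂[𝕂] _ : I, V) →ₗ[𝕂] _) ∘ₗ koszul a b = koszul a c from
    LinearMap.congr_fun h t
  refine ext_hom fun p v h => ?_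
  rw [LinearMap.comp_apply, koszul_tprod _ _ h, map_smul, koszul_tprod _ _ h, smul_smul,
    koszul_tprod _ _ h, ← koszulSign_mul ha hb hc]
  simp

theorem koszul_self {a : I → I → Prop} (ha : IsOrd a) (t : ⨂[𝕂] _ : I, V) :
    koszul a a t = t := by
  suffices h : (koszul a a : (⨂[𝕂] _ : I, V) →ₗ[𝕂] _) = LinearMap.id from
    LinearMap.congr_fun h t
  refine ext_hom fun p v h => ?_
  rw [koszul_tprod _ _ h, koszulSign_self ha]
  simp

theorem koszul_reindex (a b : J → J → Prop) (e : I ≃ J) (t : ⨂[𝕂] _ : I, V) :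
    koszul a b (PiTensorProduct.reindex 𝕂 (fun _ => V) e t) =
      PiTensorProduct.reindex 𝕂 (fun _ => V) e
        (koszul (fun i j => a (e i) (e j)) (fun i j => b (e i) (e j)) t) := by
  suffices h : (koszul a b : (⨂[𝕂] _ : J, V) →ₗ[𝕂] _) ∘ₗ
      (PiTensorProduct.reindex 𝕂 (fun _ => V) e).toLinearMap =
      (PiTensorProduct.reindex 𝕂 (fun _ => V) e).toLinearMap ∘ₗ
        koszul (fun i j => a (e i) (e j)) (fun i j => b (e i) (e j)) from LinearMap.congr_fun h t
  refine ext_hom fun p v h => ?_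
  simp only [LinearMap.comp_apply, LinearEquiv.coe_coe]
  rw [koszul_tprod _ _ h, map_smul]
  have := PiTensorProduct.reindex_tprod (R := 𝕂) (s := fun _ => V) e v
  rw [this, koszul_tprod _ _ (isHom_comp h e), koszulSign_comp]

theorem corollaCoeff_mem {n : ℕ} (x : V) {y : V} (h : part 𝕂 1 y = 0 ∨ n ≤ 1) :
    corollaCoeff n x y ∈ GammaPart 𝕂 V (n + 1) := by
  classical
  intro σ T
  have hroot : (T.map σ).root = σ T.root := T.root_map σ
  have hcond : (∀ i, (T.map σ).parent i = (T.map σ).root) ↔ ∀ i, T.parent i = T.root := by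
    rw [hroot, ← σ.forall_congr_right]
    refine forall_congr' fun i => ?_
    change σ (T.parent (σ.symm (σ i))) = σ T.root ↔ _
    rw [σ.symm_apply_apply, σ.apply_eq_iff_eq]
  unfold corollaCoeff
  by_cases hT : ∀ i, T.parent i = T.root
  swap
  · rw [if_neg hT, if_neg (fun h => hT (hcond.mp h)), map_zero]
  rw [if_pos hT, if_pos (hcond.mpr hT), hroot]
  set r := T.root
  set t : ⨂[𝕂] _ : Fin (n + 1), V := PiTensorProduct.tprod 𝕂 fun i => if i = r then x else y
    with ht
  have h1 : (PiTensorProduct.tprod 𝕂 fun j => if j = σ r then x else y)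
      = PiTensorProduct.reindex 𝕂 (fun _ => V) σ t := by
    rw [ht]
    have := PiTensorProduct.reindex_tprod (R := 𝕂) (s := fun _ => V) σ
      (fun i => if i = r then x else y)
    rw [this]
    simp only [Equiv.symm_apply_eq]
  have hrf : IsOrd (fun i j : Fin (n + 1) => rootFirst (σ r) (σ i) (σ j)) :=
    ⟨fun i j h => (isOrd_rootFirst (σ r)).asymm _ _ h,
      fun i j h => (isOrd_rootFirst (σ r)).total _ _ (fun h' => h (σ.injective h'))⟩
  rw [h1, koszul_reindex, permute, LinearMap.comp_apply,
    koszul_koszul (isOrd_rootFirst r) isOrd_lt (isOrd_comap σ),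
    ← koszul_koszul (isOrd_rootFirst r) hrf (isOrd_comap σ)]
  have h2 : koszul (rootFirst r) (fun i j => rootFirst (σ r) (σ i) (σ j)) t = t := by
    conv_rhs => rw [← koszul_self (isOrd_rootFirst r) t]
    simp only [koszul, LinearMap.sum_apply, LinearMap.smul_apply]
    refine Finset.sum_congr rfl fun p _ => ?_
    rw [koszulSign_self (isOrd_rootFirst r)]
    by_cases hs : ∃ i j, (rootFirst r i j ∧ rootFirst (σ r) (σ j) (σ i)) ∧ p i = 1 ∧ p j = 1
    · obtain ⟨i, j, ⟨h3, h4⟩, hi, hj⟩ := hs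
      have hj' : j ≠ r := by
        rcases h3 with h3 | h3
        · exact h3.2
        · exact h3.2.1
      have hi' : i ≠ r := by
        rcases h4 with h4 | h4
        · exact fun h => h4.2 (congrArg σ h)
        · exact fun h => h4.2.1 (congrArg σ h)
      rcases h with h | h
      · have : PiTensorProduct.map (fun i => (SuperModule.proj (p i) : V →ₗ[𝕂] V)) t = 0 := by
          rw [ht, PiTensorProduct.map_tprod]
          refine (PiTensorProduct.tprod 𝕂).map_coord_zero i ?_
          rw [if_neg hi', hi]
          exact h
        rw [this, smul_zero, smul_zero]
      · exfalso
        have hij : i ≠ j := by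
          rintro rfl
          exact (isOrd_rootFirst r).asymm _ _ h3 h3
        have e1 : i.1 ≠ j.1 := fun h => hij (Fin.ext h)
        have e2 : i.1 ≠ r.1 := fun h => hi' (Fin.ext h)
        have e3 : j.1 ≠ r.1 := fun h => hj' (Fin.ext h)
        omega
    · have : koszulSign (rootFirst r) (fun i j => rootFirst (σ r) (σ i) (σ j)) p = 1 := by
        unfold koszulSign
        refine Finset.prod_eq_one fun i _ => Finset.prod_eq_one fun j _ => ?_
        rw [if_neg]
        exact fun h => hs ⟨i, j, h⟩
      rw [this]
  rw [h2]
  rfl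

open Classical in
/-- The sum of the orbit of `Fₙ ⊗ x ⊗ y ⊗ ⋯ ⊗ y` as an element of `Γ(PreLie, V)`. It is used only
for `y` even or `n ≤ 1`, when the coefficients are equivariant. -/
def corolla (n : ℕ) (x y : V) : Gamma 𝕂 V :=
  if h : corollaCoeff n x y ∈ GammaPart 𝕂 V (n + 1) then
    DirectSum.of (fun n => GammaPart 𝕂 V n) (n + 1) ⟨corollaCoeff n x y, h⟩ else 0

end Corollas

section Deligne

universe u v v₁ v₂ w

variable {𝕂 : Type u} [CommRing 𝕂] (L : GammaAlg.{u, v} 𝕂) (A : Type w) [CommRing A] [Algebra 𝕂 A]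

namespace GammaAlg

/-- The underlying module of the algebra `L ⊗ A`. -/
abbrev Ext : Type _ := A ⊗[𝕂] L.M.carrier

variable {A}

/-- The structure map of the algebra `L ⊗ A`:
`l(𝒪(t)(x₁ ⊗ a₁, …, xₙ ⊗ aₙ)) = l(𝒪(t)(x₁, …, xₙ)) ⊗ a₁ ⋯ aₙ`. -/
def extL (f : Gamma 𝕂 (L.Ext A)) : L.Ext A := L.l.lTensor A (Gamma.scalars f)

/-- The differential of `L ⊗ A`. -/
def extD : L.Ext A →ₗ[𝕂] L.Ext A := L.M.d.lTensor A

/-- The weighted brace `x{y}ₙ = l(𝒪(Fₙ)(x, y, …, y))` of `L ⊗ A`. -/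
def brace (n : ℕ) (x y : L.Ext A) : L.Ext A := L.extL (corolla n x y)

/-- The operation `x ⊚ (1 + y) = ∑ₙ x{y}ₙ`. -/
def circ (x y : L.Ext A) : L.Ext A := ∑ᶠ n, L.brace n x y

/-- The product `(1 + μ) ⊚ (1 + ν) = 1 + ν + ∑ₙ μ{ν}ₙ`, the summand `1` being omitted. -/
def gaugeMul (μ ν : L.Ext A) : L.Ext A := ν + L.circ μ ν

variable (A) [IsLocalRing A]

/-- The component `(L ⊗ m)ᵏ = Lᵏ ⊗ m`, where `m` is the maximal ideal of `A`. The gauge group is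
`1 + (L ⊗ m)⁰`; its elements `1 + μ` are represented by `μ`. -/
def extGr (k : ℤ) : Submodule 𝕂 (L.Ext A) :=
  LinearMap.range (TensorProduct.map
    ((IsLocalRing.maximalIdeal A).restrictScalars 𝕂).subtype (L.M.gr k).subtype)

/-- The Maurer–Cartan elements `α ∈ (L ⊗ m)¹`, `d(α) + α{α}₁ = 0`. -/
def MC : Type _ := {α : L.Ext A // α ∈ L.extGr A 1 ∧ L.extD α + L.brace 1 α α = 0}

variable {A}

open Classical in
/-- The inverse in the gauge group. -/
def gaugeInv (μ : L.Ext A) : L.Ext A :=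
  if h : ∃ ν ∈ L.extGr A 0, L.gaugeMul μ ν = 0 ∧ L.gaugeMul ν μ = 0 then h.choose else 0

/-- The action `(1 + μ) · α = (α + μ{α}₁ - d(μ)) ⊚ (1 + μ)⁻¹`. -/
def gaugeAct (μ α : L.Ext A) : L.Ext A :=
  L.circ (α + L.brace 1 μ α - L.extD μ) (L.gaugeInv μ)

variable (A)

/-- The gauge group is a group with unit `1` and acts on the set of Maurer–Cartan elements. -/
structure DeligneLaws : Prop where
  mul_mem : ∀ μ ν : L.Ext A, μ ∈ L.extGr A 0 → ν ∈ L.extGr A 0 → L.gaugeMul μ ν ∈ L.extGr A 0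
  mul_assoc : ∀ μ ν ξ : L.Ext A, μ ∈ L.extGr A 0 → ν ∈ L.extGr A 0 → ξ ∈ L.extGr A 0 →
    L.gaugeMul (L.gaugeMul μ ν) ξ = L.gaugeMul μ (L.gaugeMul ν ξ)
  one_mul : ∀ μ : L.Ext A, μ ∈ L.extGr A 0 → L.gaugeMul 0 μ = μ
  mul_one : ∀ μ : L.Ext A, μ ∈ L.extGr A 0 → L.gaugeMul μ 0 = μ
  exists_inv : ∀ μ : L.Ext A, μ ∈ L.extGr A 0 →
    ∃ ν ∈ L.extGr A 0, L.gaugeMul μ ν = 0 ∧ L.gaugeMul ν μ = 0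
  act_mem : ∀ (μ : L.Ext A) (α : L.MC A), μ ∈ L.extGr A 0 → L.gaugeAct μ α.1 ∈ L.extGr A 1 ∧
    L.extD (L.gaugeAct μ α.1) + L.brace 1 (L.gaugeAct μ α.1) (L.gaugeAct μ α.1) = 0
  one_act : ∀ α : L.MC A, L.gaugeAct 0 α.1 = α.1
  mul_act : ∀ (μ ν : L.Ext A) (α : L.MC A), μ ∈ L.extGr A 0 → ν ∈ L.extGr A 0 →
    L.gaugeAct (L.gaugeMul μ ν) α.1 = L.gaugeAct μ (L.gaugeAct ν α.1)

end GammaAlg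

namespace DeligneGroupoid

open CategoryTheory

variable {L A} [IsLocalRing A]

theorem gaugeInv_spec (h : L.DeligneLaws A) {μ : L.Ext A} (hμ : μ ∈ L.extGr A 0) :
    L.gaugeInv μ ∈ L.extGr A 0 ∧
      L.gaugeMul μ (L.gaugeInv μ) = 0 ∧ L.gaugeMul (L.gaugeInv μ) μ = 0 := by
  have h' := h.exists_inv μ hμ
  unfold GammaAlg.gaugeInv
  rw [dif_pos h']
  exact h'.choose_spec

/-- The Deligne groupoid: its objects are the Maurer–Cartan elements of `L ⊗ m`. -/
def Deligne (_ : L.DeligneLaws A) : Type _ := L.MC A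

/-- A morphism from `α` to `β` is an element `1 + μ` of the gauge group with `(1 + μ) · α = β`. -/
@[ext]
structure Hom {h : L.DeligneLaws A} (α β : Deligne h) where
  μ : L.Ext A
  mem : μ ∈ L.extGr A 0
  act : L.gaugeAct μ (Subtype.val α) = Subtype.val β

/-- Composition is the product of the gauge group. -/
instance (h : L.DeligneLaws A) : Groupoid (Deligne h) where
  Hom α β := Hom α β
  id α := ⟨0, zero_mem _, h.one_act α⟩
  comp {α β γ} f g := ⟨L.gaugeMul g.μ f.μ, h.mul_mem _ _ g.mem f.mem, by
    rw [h.mul_act g.μ f.μ α g.mem f.mem, f.act, g.act]⟩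
  inv {α β} f := ⟨L.gaugeInv f.μ, (gaugeInv_spec h f.mem).1, by
    rw [← f.act, ← h.mul_act _ _ α (gaugeInv_spec h f.mem).1 f.mem,
      (gaugeInv_spec h f.mem).2.2]
    exact h.one_act α⟩
  id_comp f := Hom.ext (h.mul_one _ f.mem)
  comp_id f := Hom.ext (h.one_mul _ f.mem)
  assoc f g k := Hom.ext (h.mul_assoc _ _ _ k.mem g.mem f.mem).symm
  inv_comp f := Hom.ext (gaugeInv_spec h f.mem).2.1
  comp_inv f := Hom.ext (gaugeInv_spec h f.mem).2.2

variable {L₁ : GammaAlg.{u, v₁} 𝕂} {L₂ : GammaAlg.{u, v₂} 𝕂}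

variable (A) in
/-- The map `φ ⊗ A : L₁ ⊗ A → L₂ ⊗ A`. -/
def extMap (φ : GammaHom L₁ L₂) : L₁.Ext A →ₗ[𝕂] L₂.Ext A := φ.g.f.lTensor A

theorem extMap_mem (φ : GammaHom L₁ L₂) {k : ℤ} {x : L₁.Ext A} (hx : x ∈ L₁.extGr A k) :
    extMap A φ x ∈ L₂.extGr A k := by
  obtain ⟨y, rfl⟩ := hx
  induction y using TensorProduct.induction_on with
  | zero => simp
  | tmul a x =>
    refine ⟨a ⊗ₜ ⟨φ.g.f x, φ.g.map_mem k x x.2⟩, ?_⟩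
    rfl
  | add x y hx hy => rw [map_add, map_add]; exact add_mem hx hy

variable (A) in
/-- `φ ⊗ A` is compatible with the structures that define the Deligne groupoids. -/
structure FunctorLaws (φ : GammaHom L₁ L₂) : Prop where
  map_mc : ∀ α : L₁.MC A,
    L₂.extD (extMap A φ α.1) + L₂.brace 1 (extMap A φ α.1) (extMap A φ α.1) = 0
  map_mul : ∀ μ ν : L₁.Ext A, μ ∈ L₁.extGr A 0 → ν ∈ L₁.extGr A 0 →
    extMap A φ (L₁.gaugeMul μ ν) = L₂.gaugeMul (extMap A φ μ) (extMap A φ ν)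
  map_act : ∀ (μ : L₁.Ext A) (α : L₁.MC A), μ ∈ L₁.extGr A 0 →
    extMap A φ (L₁.gaugeAct μ α.1) = L₂.gaugeAct (extMap A φ μ) (extMap A φ α.1)

/-- The functor induced by `φ`: it applies `φ ⊗ A` to objects and to morphisms. -/
def functor (h : L₁.DeligneLaws A) (h' : L₂.DeligneLaws A) {φ : GammaHom L₁ L₂}
    (hφ : FunctorLaws A φ) : Deligne h ⥤ Deligne h' where
  obj α := ⟨extMap A φ (Subtype.val α), extMap_mem φ (Subtype.property α).1, hφ.map_mc α⟩
  map {α β} f := (⟨extMap A φ f.μ, extMap_mem φ f.mem, by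
    rw [← hφ.map_act f.μ α f.mem, f.act]⟩ : Hom (h := h') _ _)
  map_id α := Hom.ext (map_zero _)
  map_comp f g := Hom.ext (hφ.map_mul _ _ g.mem f.mem)

end DeligneGroupoid

end Deligne

end GammaPreLie

end

noncomputable section

namespace GammaPreLie

open scoped TensorProduct DirectSum

open IsLocalRing (maximalIdeal)

universe u v v₁ v₂ w

/-! ### Multiplying out the scalars in tensor powers of `A ⊗ V` -/

section CollapseLemmas

variable {𝕂 : Type*} [CommRing 𝕂] {A : Type*} [CommRing A] [Algebra 𝕂 A]
  {V W : Type*} [AddCommGroup V] [Module 𝕂 V] [AddCommGroup W] [Module 𝕂 W]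
  {I J R : Type*} [Fintype I] [Fintype J] [Fintype R]

/-! The proof has an algebraic half, which produces the Deligne groupoids, and a
deformation-theoretic half, which compares them.

Algebraic half. The laws of the gauge action follow from a few identities between weighted braces,
such as `(x ⊚ (1+μ)) ⊚ (1+ν) = x ⊚ ((1+μ) ⊚ (1+ν))`. Over a general ring nothing may be divided by
factorials, so the identities are proved inside the monad. The coefficient of a tree in a composite
is a sum over the ways of cutting the tree into blocks. All elements that occur are sums over
labelled trees satisfying a predicate (`IsRep`): the labels stand for the arguments, and the sign is
that of sorting the odd labels. For the predicates that are needed, a labelled tree has at most one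
admissible cutting (`card_cut`). Hence a composite is again a sum over labelled trees
(`coeff_mul_eq`), and two iterated operations agree as soon as the same trees with two levels of
vertices above the root describe them. This yields `circ_circ`, `brace_circ`, `circ_brace` and
`brace_brace`; `diff_isStar` yields `extD_circ` and `extD_brace`. The identities are carried to `L ⊗
A` by its associativity law `extL_mul`, which rests on the flatness of `A`. The maximal ideal `𝔪` is
nilpotent, so `⊚ (1+μ)` is bijective on `Lᵏ ⊗ 𝔪`. Therefore `β = (1+μ) · α` is characterized by `β ⊚
(1+μ) = α + μ{α}₁ - d(μ)`, and the group and action laws become short calculations (`deligneLaws`).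

Deformation-theoretic half. Filter by powers of `𝔪`. From one power to the next every operation is
linear: the product of the gauge group is addition, `1+σ` acts by subtracting `d(σ)`, and a change
of `α` by `ξ` changes the curvature `d(α) + α{α}₁` by `d(ξ)`. Faithfulness, fullness and essential
surjectivity thus become exactness of the mapping cone of `φ` at three consecutive places, and the
hypotheses on `H⁰`, `H¹` and `H²` say precisely what is needed there. Exactness survives the passage
to `A` and to quotients of ideals, because `A` is flat over `𝕂` and its ideals are direct summands,
`A` being a vector space over the field of fractions (`DGHom.ConeExact.exists_approx`). Successive
approximation, which ends after finitely many steps, gives `eq_zero_of_stabilizer`,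
`exists_gauge_lift` and `exists_mc_lift`. -/

theorem span_homogeneous_tmul [SuperModule 𝕂 V] : Submodule.span 𝕂 (Set.range
    fun (x : {x : ZMod 2 × A × V // part 𝕂 x.1 x.2.2 = x.2.2}) => x.1.2.1 ⊗ₜ[𝕂] x.1.2.2) = ⊤ := by
  rw [eq_top_iff, ← TensorProduct.span_tmul_eq_top, Submodule.span_le]
  rintro _ ⟨a, v, rfl⟩
  have hv : v = ∑ p, part 𝕂 p v := (SuperModule.sum_proj v).symm
  rw [hv, TensorProduct.tmul_sum]
  refine sum_mem fun p _ => Submodule.subset_span ⟨⟨(p, a, part 𝕂 p v), ?_⟩, rfl⟩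
  change SuperModule.proj p (SuperModule.proj p v) = _
  rw [SuperModule.proj_proj, if_pos rfl]

omit [Fintype I] in
theorem isHom_tmul [SuperModule 𝕂 V] {p : I → ZMod 2} (a : I → A) {v : I → V} (h : IsHom 𝕂 p v) :
    IsHom 𝕂 p (fun i => a i ⊗ₜ[𝕂] v i) := fun i => by
  change (part 𝕂 (p i)).lTensor A _ = _
  rw [LinearMap.lTensor_tmul, h i]

/-- Linear maps on a tensor power of `A ⊗ V` are determined by their values on the tensors
`⨂ᵢ (aᵢ ⊗ vᵢ)` with homogeneous `vᵢ`. -/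
theorem ext_tmul [SuperModule 𝕂 V] {M : Type*} [AddCommGroup M] [Module 𝕂 M]
    {f g : (⨂[𝕂] _ : I, A ⊗[𝕂] V) →ₗ[𝕂] M}
    (h : ∀ (p : I → ZMod 2) (a : I → A) (v : I → V), IsHom 𝕂 p v →
      f (PiTensorProduct.tprod 𝕂 fun i => a i ⊗ₜ[𝕂] v i) =
        g (PiTensorProduct.tprod 𝕂 fun i => a i ⊗ₜ[𝕂] v i)) : f = g := by
  classical
  refine PiTensorProduct.ext_of_span_eq_top (fun _ => span_homogeneous_tmul) fun c => ?_
  exact h (fun i => (c i).1.1) (fun i => (c i).1.2.1) (fun i => (c i).1.2.2) fun i => (c i).2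

/-- The elements of `A` have degree `0`, so extracting them from a tensor creates no Koszul sign.
The same reason underlies `collapse_tensorDiff` and `collapse_assemble`. -/
theorem collapse_tensorProj [SuperModule 𝕂 V] (b : ZMod 2) (x : ⨂[𝕂] _ : I, A ⊗[𝕂] V) :
    collapse (tensorProj b x) = (tensorProj b).lTensor A (collapse x) := by
  suffices h : collapse ∘ₗ tensorProj b = (tensorProj b).lTensor A ∘ₗ
    collapse (𝕂 := 𝕂) (A := A) (V := V) (I := I) from LinearMap.congr_fun h x
  refine ext_tmul fun p a v h => ?_
  simp only [LinearMap.comp_apply]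
  rw [tensorProj_tprod b (isHom_tmul a h), collapse_tprod, LinearMap.lTensor_tmul,
    tensorProj_tprod b h]
  split_ifs
  · rw [collapse_tprod]
  · simp

theorem collapse_map [SuperModule 𝕂 V] (g : V →ₗ[𝕂] W) (x : ⨂[𝕂] _ : I, A ⊗[𝕂] V) :
    collapse (PiTensorProduct.map (fun _ => g.lTensor A) x) =
      (PiTensorProduct.map fun _ => g).lTensor A (collapse x) := by
  suffices h : collapse ∘ₗ PiTensorProduct.map (fun _ => g.lTensor A) =
    (PiTensorProduct.map fun _ => g).lTensor A ∘ₗ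
    collapse (𝕂 := 𝕂) (A := A) (V := V) (I := I) from LinearMap.congr_fun h x
  refine ext_tmul fun p a v h => ?_
  simp only [LinearMap.comp_apply]
  rw [collapse_tprod, PiTensorProduct.map_tprod, LinearMap.lTensor_tmul,
    PiTensorProduct.map_tprod]
  exact collapse_tprod _ _

theorem collapse_reindex [SuperModule 𝕂 V] (e : I ≃ J) (x : ⨂[𝕂] _ : I, A ⊗[𝕂] V) :
    collapse (PiTensorProduct.reindex 𝕂 (fun _ => A ⊗[𝕂] V) e x) =
      (PiTensorProduct.reindex 𝕂 (fun _ => V) e).toLinearMap.lTensor A (collapse x) := by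
  suffices h : collapse ∘ₗ (PiTensorProduct.reindex 𝕂 (fun _ => A ⊗[𝕂] V) e).toLinearMap =
    (PiTensorProduct.reindex 𝕂 (fun _ => V) e).toLinearMap.lTensor A ∘ₗ
    collapse (𝕂 := 𝕂) (A := A) (V := V) (I := I) from LinearMap.congr_fun h x
  refine ext_tmul fun p a v h => ?_
  simp only [LinearMap.comp_apply, LinearEquiv.coe_coe]
  have h1 := PiTensorProduct.reindex_tprod (R := 𝕂) (s := fun _ => A ⊗[𝕂] V) e
    (fun i => a i ⊗ₜ[𝕂] v i)
  rw [h1, collapse_tprod, collapse_tprod, LinearMap.lTensor_tmul, Equiv.prod_comp e.symm a]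
  congr 1
  exact (PiTensorProduct.reindex_tprod (R := 𝕂) (s := fun _ => V) e v).symm

theorem isOdd_lTensor [SuperModule 𝕂 V] {d : V →ₗ[𝕂] V} (hd : IsOdd d) :
    IsOdd (𝕂 := 𝕂) (d.lTensor A) := by
  intro a x
  change d.lTensor A ((part 𝕂 a).lTensor A x) = (part 𝕂 (a + 1)).lTensor A (d.lTensor A x)
  rw [← LinearMap.comp_apply, ← LinearMap.comp_apply, ← LinearMap.lTensor_comp,
    ← LinearMap.lTensor_comp]
  congr 2
  exact LinearMap.ext fun v => hd a v

theorem isEven_lTensor [SuperModule 𝕂 V] [SuperModule 𝕂 W] {g : V →ₗ[𝕂] W} (hg : IsEven g) :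
    IsEven (𝕂 := 𝕂) (g.lTensor A) := by
  intro a x
  change g.lTensor A ((part 𝕂 a).lTensor A x) = (part 𝕂 a).lTensor A (g.lTensor A x)
  rw [← LinearMap.comp_apply, ← LinearMap.comp_apply, ← LinearMap.lTensor_comp,
    ← LinearMap.lTensor_comp]
  congr 2
  exact LinearMap.ext fun v => hg a v

theorem collapse_tensorDiff [SuperModule 𝕂 V] [LinearOrder I] (d : V →ₗ[𝕂] V)
    (x : ⨂[𝕂] _ : I, A ⊗[𝕂] V) :
    collapse (tensorDiff (d.lTensor A) x) = (tensorDiff d).lTensor A (collapse x) := by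
  classical
  suffices h : collapse ∘ₗ tensorDiff (d.lTensor A) = (tensorDiff d).lTensor A ∘ₗ
    collapse (𝕂 := 𝕂) (A := A) (V := V) (I := I) from LinearMap.congr_fun h x
  refine ext_tmul fun p a v h => ?_
  simp only [LinearMap.comp_apply]
  rw [tensorDiff_tprod _ (isHom_tmul a h), collapse_tprod, LinearMap.lTensor_tmul,
    tensorDiff_tprod d h, map_sum, TensorProduct.tmul_sum]
  refine Finset.sum_congr rfl fun k _ => ?_
  rw [map_smul, TensorProduct.tmul_smul]
  congr 1
  have : Function.update (fun i => a i ⊗ₜ[𝕂] v i) k (d.lTensor A (a k ⊗ₜ[𝕂] v k)) =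
      fun i => a i ⊗ₜ[𝕂] Function.update v k (d (v k)) i := by
    funext i
    by_cases hi : i = k
    · subst hi; simp
    · simp [Function.update_of_ne hi]
  rw [this, collapse_tprod]

end CollapseLemmas

/-! ### Multiplying out the scalars for a family of modules -/

section CollapseFamily

variable {𝕂 : Type*} [CommRing 𝕂] {A : Type*} [CommRing A] [Algebra 𝕂 A]
  {R : Type*} [Fintype R] {W X : R → Type*} [∀ ρ, AddCommGroup (W ρ)] [∀ ρ, Module 𝕂 (W ρ)]
  [∀ ρ, AddCommGroup (X ρ)] [∀ ρ, Module 𝕂 (X ρ)]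

open Classical in
/-- The map `⨂_ρ (A ⊗ W_ρ) → A ⊗ ⨂_ρ W_ρ` multiplying the elements of `A`, for a family of
modules. -/
def collapseFamily : (⨂[𝕂] ρ, A ⊗[𝕂] W ρ) →ₗ[𝕂] A ⊗[𝕂] (⨂[𝕂] ρ, W ρ) :=
  letI : ∀ ρ, Module 𝕂ᵐᵒᵖ (W ρ) :=
    fun _ => Module.compHom _ ((RingHom.id 𝕂).fromOpposite mul_comm)
  haveI : ∀ ρ, IsCentralScalar 𝕂 (W ρ) := fun _ => ⟨fun _ _ => rfl⟩
  -- Products in a commutative algebra do the bookkeeping: each `W ρ` is put into position `ρ` of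
  -- the tensor product of the square-zero extensions `𝕂 ⊕ W ρ`, with `1` elsewhere, and the product
  -- of these elements is the pure tensor.
  (PiTensorProduct.map fun ρ => TrivSqZeroExt.sndHom 𝕂 (W ρ)).lTensor A ∘ₗ
    PiTensorProduct.lift ((MultilinearMap.mkPiAlgebra 𝕂 R
      (A ⊗[𝕂] (⨂[𝕂] ρ, TrivSqZeroExt 𝕂 (W ρ)))).compLinearMap fun ρ =>
        ((PiTensorProduct.tprod 𝕂).toLinearMap 1 ρ ∘ₗ TrivSqZeroExt.inrHom 𝕂 (W ρ)).lTensor A)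

theorem collapseFamily_tprod (a : R → A) (w : ∀ ρ, W ρ) :
    collapseFamily (PiTensorProduct.tprod 𝕂 fun ρ => a ρ ⊗ₜ[𝕂] w ρ)
      = (∏ ρ, a ρ) ⊗ₜ[𝕂] PiTensorProduct.tprod 𝕂 w := by
  classical
  let _ : ∀ ρ, Module 𝕂ᵐᵒᵖ (W ρ) :=
    fun _ => Module.compHom _ ((RingHom.id 𝕂).fromOpposite mul_comm)
  have _ : ∀ ρ, IsCentralScalar 𝕂 (W ρ) := fun _ => ⟨fun _ _ => rfl⟩
  change (PiTensorProduct.map fun ρ => TrivSqZeroExt.sndHom 𝕂 (W ρ)).lTensor A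
    (PiTensorProduct.lift _ (PiTensorProduct.tprod 𝕂 _)) = _
  simp only [PiTensorProduct.lift.tprod, MultilinearMap.compLinearMap_apply,
    MultilinearMap.mkPiAlgebra_apply, LinearMap.lTensor_tmul]
  rw [prod_tmul (C := ⨂[𝕂] ρ, TrivSqZeroExt 𝕂 (W ρ)), LinearMap.lTensor_tmul]
  simp only [LinearMap.comp_apply, MultilinearMap.toLinearMap_apply]
  rw [← PiTensorProduct.tprod_prod, PiTensorProduct.map_tprod]
  congr 2
  funext ρ
  rw [Finset.prod_apply, Finset.prod_eq_single ρ]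
  · simp
  · intro i _ hij; rw [Function.update_of_ne (Ne.symm hij)]; rfl
  · simp

theorem collapseFamily_map (g : ∀ ρ, W ρ →ₗ[𝕂] X ρ) (t : ⨂[𝕂] ρ, A ⊗[𝕂] W ρ) :
    collapseFamily (PiTensorProduct.map (fun ρ => (g ρ).lTensor A) t) =
      (PiTensorProduct.map g).lTensor A (collapseFamily t) := by
  classical
  suffices h : collapseFamily ∘ₗ PiTensorProduct.map (fun ρ => (g ρ).lTensor A) =
    (PiTensorProduct.map g).lTensor A ∘ₗ collapseFamily (𝕂 := 𝕂) (A := A) (W := W) from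
    LinearMap.congr_fun h t
  have span : ∀ ρ, Submodule.span 𝕂 (Set.range fun x : A × W ρ => x.1 ⊗ₜ[𝕂] x.2) = ⊤ := by
    intro ρ
    rw [← TensorProduct.span_tmul_eq_top]
    congr 1
    ext y
    simp
  refine PiTensorProduct.ext_of_span_eq_top span fun c => ?_
  simp only [LinearMap.comp_apply]
  rw [PiTensorProduct.map_tprod, collapseFamily_tprod (fun ρ => (c ρ).1) (fun ρ => (c ρ).2),
    LinearMap.lTensor_tmul, PiTensorProduct.map_tprod]
  simp only [LinearMap.lTensor_tmul]
  exact collapseFamily_tprod _ _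

theorem collapse_eq_collapseFamily {V : Type*} [AddCommGroup V] [Module 𝕂 V]
    (t : ⨂[𝕂] _ : R, A ⊗[𝕂] V) : collapse t = collapseFamily (W := fun _ => V) t := by
  classical
  suffices h : collapse (𝕂 := 𝕂) (A := A) (V := V) (I := R) = collapseFamily (W := fun _ => V) from
    LinearMap.congr_fun h t
  have span : Submodule.span 𝕂 (Set.range fun x : A × V => x.1 ⊗ₜ[𝕂] x.2) = ⊤ := by
    rw [← TensorProduct.span_tmul_eq_top]
    congr 1
    ext y
    simp
  refine PiTensorProduct.ext_of_span_eq_top (fun _ => span) fun c => ?_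
  rw [collapse_tprod (fun ρ => (c ρ).1) (fun ρ => (c ρ).2),
    collapseFamily_tprod (fun ρ => (c ρ).1) (fun ρ => (c ρ).2)]

end CollapseFamily

/-! ### Nested tensor products with scalars in `A` -/

section CollapseAssemble

variable {𝕂 : Type*} [CommRing 𝕂]

/-- Linear maps on a nested tensor product are determined by their values on tensors of elements
of a spanning family. -/
theorem ext_nest_of_span {I R : Type*} [Finite R] (t : I → R) [∀ ρ, Finite {i // t i = ρ}]
    {W : Type*} [AddCommGroup W] [Module 𝕂 W] {ι : Type*} {s : ι → W}
    (hs : Submodule.span 𝕂 (Set.range s) = ⊤) {M : Type*} [AddCommGroup M] [Module 𝕂 M]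
    {f g : (⨂[𝕂] ρ, ⨂[𝕂] _ : {i // t i = ρ}, W) →ₗ[𝕂] M}
    (h : ∀ c : I → ι,
      f (PiTensorProduct.tprod 𝕂 fun ρ => PiTensorProduct.tprod 𝕂
        fun i : {i // t i = ρ} => s (c i)) =
      g (PiTensorProduct.tprod 𝕂 fun ρ => PiTensorProduct.tprod 𝕂
        fun i : {i // t i = ρ} => s (c i))) : f = g := by
  classical
  have span : ∀ ρ, Submodule.span 𝕂 (Set.range fun c : {i // t i = ρ} → ι =>
      PiTensorProduct.tprod 𝕂 fun i => s (c i)) = ⊤ := by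
    intro ρ
    rw [← (Submodule.span 𝕂 _).ker_mkQ, LinearMap.ker_eq_top]
    refine PiTensorProduct.ext_of_span_eq_top (fun _ => hs) fun c => ?_
    simp only [Submodule.mkQ_apply, LinearMap.zero_apply, Submodule.Quotient.mk_eq_zero]
    exact Submodule.subset_span ⟨c, rfl⟩
  refine PiTensorProduct.ext_of_span_eq_top span fun c => ?_
  have e : (fun ρ => PiTensorProduct.tprod 𝕂 fun i => s (c ρ i)) =
      fun ρ => PiTensorProduct.tprod 𝕂 fun i : {i // t i = ρ} => s (c (t i) ⟨i, rfl⟩) := by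
    funext ρ
    congr 1
    funext i
    obtain ⟨i, rfl⟩ := i
    rfl
  rw [e]
  exact h fun i => c (t i) ⟨i, rfl⟩

variable {A : Type*} [CommRing A] [Algebra 𝕂 A]

theorem lTensor_collapseFamily_tprod {R : Type*} [Fintype R] {W : R → Type*} [∀ ρ, AddCommGroup (W ρ)]
    [∀ ρ, Module 𝕂 (W ρ)] {U : Type*} [AddCommGroup U] [Module 𝕂 U] (N : (⨂[𝕂] ρ, W ρ) →ₗ[𝕂] U)
    {τ : ∀ ρ, A ⊗[𝕂] W ρ} {a : R → A} {w : ∀ ρ, W ρ} (h : ∀ ρ, τ ρ = a ρ ⊗ₜ[𝕂] w ρ) :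
    N.lTensor A (collapseFamily (PiTensorProduct.tprod 𝕂 τ)) =
      (∏ ρ, a ρ) ⊗ₜ[𝕂] N (PiTensorProduct.tprod 𝕂 w) := by
  rw [funext h, collapseFamily_tprod, LinearMap.lTensor_tmul]

variable {V : Type*} [AddCommGroup V] [Module 𝕂 V] [SuperModule 𝕂 V]
  {I R : Type*} [Fintype I] [Fintype R] [LinearOrder I] [LinearOrder R]

/-- Scalars may be multiplied inside the blocks first and between the blocks afterwards. The sign of
`assemble` is the same on both sides, since it only depends on the parities of the elements of `V`.
-/
theorem collapse_assemble (t : I → R) [∀ ρ, Fintype {i // t i = ρ}]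
    (x : ⨂[𝕂] ρ, ⨂[𝕂] _ : {i // t i = ρ}, A ⊗[𝕂] V) :
    collapse (assemble t x) = (assemble t).lTensor A
      (collapseFamily (PiTensorProduct.map (fun _ => collapse) x)) := by
  classical
  suffices h : collapse ∘ₗ assemble t = (assemble t).lTensor A ∘ₗ
    (collapseFamily ∘ₗ PiTensorProduct.map (fun _ => collapse (𝕂 := 𝕂) (A := A) (V := V))) from
    LinearMap.congr_fun h x
  refine ext_nest_of_span t span_homogeneous_tmul fun c => ?_
  have hv : IsHom 𝕂 (fun i => (c i).1.1) (fun i => (c i).1.2.2) := fun i => (c i).2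
  simp only [LinearMap.comp_apply]
  rw [assemble_tprod t (isHom_tmul (fun i => (c i).1.2.1) hv), map_smul,
    collapse_tprod (fun i => (c i).1.2.1) (fun i => (c i).1.2.2), PiTensorProduct.map_tprod]
  have h2 : ∀ ρ, collapse (PiTensorProduct.tprod 𝕂
        fun i : {i // t i = ρ} => (c i).1.2.1 ⊗ₜ[𝕂] (c i).1.2.2) =
      (∏ i : {i // t i = ρ}, (c i).1.2.1) ⊗ₜ[𝕂]
        PiTensorProduct.tprod 𝕂 fun i : {i // t i = ρ} => (c i).1.2.2 :=
    fun ρ => collapse_tprod _ _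
  refine Eq.trans ?_ (lTensor_collapseFamily_tprod (assemble t) h2).symm
  rw [assemble_tprod t hv, TensorProduct.tmul_smul]
  congr 2
  rw [← Finset.prod_fiberwise (s := Finset.univ) (g := t)]
  refine Finset.prod_congr rfl fun ρ _ => ?_
  rw [Finset.prod_subtype (p := fun i => t i = ρ) _ (by simp)]

end CollapseAssemble

/-! ### Change of scalars and the multiplication of the monad -/

namespace Gamma

section Mul

variable {𝕂 : Type*} [CommRing 𝕂] {V : Type*} [AddCommGroup V] [Module 𝕂 V] [SuperModule 𝕂 V]

variable (𝕂 V) in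
/-- The multiplication of the monad as a linear map. -/
def mulₗ : Gamma 𝕂 (Gamma 𝕂 V) →ₗ[𝕂] Gamma 𝕂 V where
  toFun := mul
  map_add' F G := ext fun n T => by simp only [coeff_mul, map_add]
  map_smul' c F := ext fun n T => by simp only [coeff_mul, map_smul, RingHom.id_apply]

theorem coeff_comp_mulₗ {n : ℕ} (S : RTree (Fin n)) :
    coeff S ∘ₗ mulₗ 𝕂 V = mulCoeff S := LinearMap.ext fun F => coeff_mul F S

end Mul

section Scalars

variable {𝕂 : Type*} [CommRing 𝕂] {A : Type*} [CommRing A] [Algebra 𝕂 A] [Module.Flat 𝕂 A]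
  {V W : Type*} [AddCommGroup V] [Module 𝕂 V] [SuperModule 𝕂 V]
  [AddCommGroup W] [Module 𝕂 W] [SuperModule 𝕂 W]

theorem lTensor_coeff_scalars (f : Gamma 𝕂 (A ⊗[𝕂] V)) {n : ℕ} (T : RTree (Fin n)) :
    (coeff T).lTensor A (scalars f) = collapse (coeff T f) := by
  have h := exists_scalars f
  rw [scalars, dif_pos h]
  exact h.choose_spec n T

/-- Flatness keeps the coefficients jointly injective after tensoring with `A`. Identities in `A ⊗
Γ(PreLie, V)` can therefore be checked one tree at a time. -/
theorem scalars_ext {w w' : A ⊗[𝕂] Gamma 𝕂 V}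
    (h : ∀ n (T : RTree (Fin n)), (coeff T).lTensor A w = (coeff T).lTensor A w') : w = w' := by
  rw [← sub_eq_zero]
  refine scalars_inj _ fun n T => ?_
  rw [map_sub, h, sub_self]

variable (𝕂 A V) in
/-- The map `Γ(PreLie, A ⊗ V) → A ⊗ Γ(PreLie, V)` as a linear map. -/
def scalarsₗ : Gamma 𝕂 (A ⊗[𝕂] V) →ₗ[𝕂] A ⊗[𝕂] Gamma 𝕂 V where
  toFun := scalars
  map_add' f g := scalars_ext fun n T => by simp only [map_add, lTensor_coeff_scalars]
  map_smul' c f := scalars_ext fun n T => by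
    simp only [map_smul, lTensor_coeff_scalars, RingHom.id_apply]

theorem scalarsₗ_apply (f : Gamma 𝕂 (A ⊗[𝕂] V)) : scalarsₗ 𝕂 A V f = scalars f := rfl

/-- Operators on tensor powers which are compatible with `collapse` are compatible with
`scalars`. -/
theorem scalars_lift (φ : ∀ n, (⨂[𝕂] _ : Fin n, A ⊗[𝕂] V) →ₗ[𝕂] ⨂[𝕂] _ : Fin n, A ⊗[𝕂] W)
    (hφ : ∀ n (σ : Fin n ≃ Fin n) x, φ n (permute σ x) = permute σ (φ n x))
    (ψ : ∀ n, (⨂[𝕂] _ : Fin n, V) →ₗ[𝕂] ⨂[𝕂] _ : Fin n, W)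
    (hψ : ∀ n (σ : Fin n ≃ Fin n) x, ψ n (permute σ x) = permute σ (ψ n x))
    (h : ∀ n x, collapse (φ n x) = (ψ n).lTensor A (collapse x)) (f : Gamma 𝕂 (A ⊗[𝕂] V)) :
    scalars (lift φ hφ f) = (lift ψ hψ).lTensor A (scalars f) := by
  refine scalars_ext fun n T => ?_
  have : coeff T ∘ₗ lift ψ hψ = ψ n ∘ₗ coeff T := rfl
  rw [lTensor_coeff_scalars, coeff_lift, h, ← LinearMap.lTensor_comp_apply, this,
    LinearMap.lTensor_comp_apply, lTensor_coeff_scalars]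

theorem scalars_map {g : V →ₗ[𝕂] W} (hg : IsEven g) (f : Gamma 𝕂 (A ⊗[𝕂] V)) :
    scalars (map (g.lTensor A) (isEven_lTensor hg) f) = (map g hg).lTensor A (scalars f) :=
  scalars_lift _ _ _ _ (fun _ x => collapse_map g x) f

theorem scalars_diff {d : V →ₗ[𝕂] V} (hd : IsOdd d) (f : Gamma 𝕂 (A ⊗[𝕂] V)) :
    scalars (diff (d.lTensor A) (isOdd_lTensor hd) f) = (diff d hd).lTensor A (scalars f) :=
  scalars_lift _ _ _ _ (fun _ x => collapse_tensorDiff d x) f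

theorem isEven_scalarsₗ : IsEven (scalarsₗ 𝕂 A V) := by
  intro a f
  refine scalars_ext fun n T => ?_
  have : coeff T ∘ₗ part 𝕂 a = tensorProj a ∘ₗ coeff (𝕂 := 𝕂) (V := V) T := rfl
  rw [scalarsₗ_apply, lTensor_coeff_scalars, scalarsₗ_apply]
  change collapse (tensorProj a (coeff T f)) =
    (coeff T).lTensor A ((part 𝕂 a).lTensor A (scalars f))
  rw [← LinearMap.lTensor_comp_apply, this, LinearMap.lTensor_comp_apply, lTensor_coeff_scalars,
    collapse_tensorProj]

theorem lTensor_evalOn_scalars {I : Type*} [Fintype I] [LinearOrder I] (T : RTree I)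
    (f : Gamma 𝕂 (A ⊗[𝕂] V)) :
    (evalOn T).lTensor A (scalars f) = collapse (evalOn T f) := by
  rw [evalOn, LinearMap.lTensor_comp, LinearMap.comp_apply, lTensor_coeff_scalars,
    ← collapse_reindex]
  rfl

theorem evalOn_Gamma_map {I : Type*} [Fintype I] [LinearOrder I] (T : RTree I) {g : V →ₗ[𝕂] W}
    (hg : IsEven g) (f : Gamma 𝕂 V) :
    evalOn T (map g hg f) = PiTensorProduct.map (fun _ => g) (evalOn T f) := by
  have h : ∀ (e : Fin (Fintype.card I) ≃ I) (x : ⨂[𝕂] _ : Fin (Fintype.card I), V),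
      PiTensorProduct.map (fun _ => g) (PiTensorProduct.reindex 𝕂 (fun _ => V) e x) =
      PiTensorProduct.reindex 𝕂 (fun _ => W) e (PiTensorProduct.map (fun _ => g) x) := by
    intro e x
    induction x using PiTensorProduct.induction_on with
    | smul_tprod c v =>
      simp only [map_smul, PiTensorProduct.map_tprod]
      have h1 := PiTensorProduct.reindex_tprod (R := 𝕂) (s := fun _ => W) e (fun i => g (v i))
      have h2 := PiTensorProduct.reindex_tprod (R := 𝕂) (s := fun _ => V) e v
      rw [h1, h2, PiTensorProduct.map_tprod]
    | add x y hx hy => simp only [map_add, hx, hy]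
  exact (h _ _).symm

/-- The contribution of a single cutting to `scalars_mul`. -/
theorem collapse_assemble_evalOn {I R : Type*} [Fintype I] [Fintype R] [LinearOrder I]
    [LinearOrder R] (t : I → R) [∀ ρ, Fintype {i // t i = ρ}] (B : ∀ ρ, RTree {i // t i = ρ})
    (x : ⨂[𝕂] _ : R, Gamma 𝕂 (A ⊗[𝕂] V)) :
    collapse (assemble t (PiTensorProduct.map (fun ρ => evalOn (B ρ)) x)) =
      (assemble t ∘ₗ PiTensorProduct.map (fun ρ => evalOn (B ρ))).lTensor A
        (collapse (PiTensorProduct.map (fun _ => scalarsₗ 𝕂 A V) x)) := by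
  rw [LinearMap.lTensor_comp, LinearMap.comp_apply, collapse_assemble,
    collapse_eq_collapseFamily, ← collapseFamily_map]
  congr 2
  induction x using PiTensorProduct.induction_on with
  | smul_tprod c v =>
    simp only [map_smul, PiTensorProduct.map_tprod]
    congr 2
    funext ρ
    exact (lTensor_evalOn_scalars _ _).symm
  | add x y hx hy => simp only [map_add, hx, hy]

/-- Both sides are sums over the same cuttings of a tree, and the terms agree by
`collapse_assemble_evalOn`. This is the main ingredient of the associativity law of `L ⊗ A`. -/
theorem scalars_mul (F : Gamma 𝕂 (Gamma 𝕂 (A ⊗[𝕂] V))) :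
    scalars (mul F) =
      (mulₗ 𝕂 V).lTensor A (scalars (map (scalarsₗ 𝕂 A V) isEven_scalarsₗ F)) := by
  classical
  refine scalars_ext fun n S => ?_
  rw [lTensor_coeff_scalars, coeff_mul, ← LinearMap.lTensor_comp_apply, coeff_comp_mulₗ]
  simp only [mulCoeff, LinearMap.sum_apply, map_sum]
  rw [← LinearMap.coe_lTensorHom, map_sum, LinearMap.sum_apply]
  refine Finset.sum_congr rfl fun R _ => ?_
  refine (collapse_assemble_evalOn _ _ _).trans ?_
  rw [← evalOn_Gamma_map _ isEven_scalarsₗ, ← lTensor_evalOn_scalars,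
    ← LinearMap.lTensor_comp_apply, LinearMap.coe_lTensorHom, LinearMap.comp_assoc]

end Scalars

end Gamma

/-! ### `L ⊗ A` as an algebra over the monad -/

namespace GammaAlg

variable {𝕂 : Type u} [CommRing 𝕂] (L : GammaAlg.{u, v} 𝕂) {A : Type w} [CommRing A] [Algebra 𝕂 A]
  [Module.Flat 𝕂 A]

variable (A) in
/-- The structure map of `L ⊗ A` as a linear map. -/
def extLₗ : Gamma 𝕂 (L.Ext A) →ₗ[𝕂] L.Ext A := L.l.lTensor A ∘ₗ Gamma.scalarsₗ 𝕂 A L.M.carrier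

theorem isEven_extLₗ : IsEven (L.extLₗ A) := fun a f => by
  have h1 := Gamma.isEven_scalarsₗ a f
  have h2 := isEven_lTensor (A := A) L.l_even a (Gamma.scalars f)
  rw [extLₗ, LinearMap.comp_apply, h1]
  exact h2

omit [Module.Flat 𝕂 A] in
theorem isOdd_extD : IsOdd (L.extD (A := A)) := isOdd_lTensor L.M.isOdd_d

theorem extL_diff (f : Gamma 𝕂 (L.Ext A)) :
    L.extL (Gamma.diff L.extD L.isOdd_extD f) = L.extD (L.extL f) := by
  have h := Gamma.scalars_diff (A := A) L.M.isOdd_d f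
  change L.l.lTensor A (Gamma.scalars (Gamma.diff (L.M.d.lTensor A) _ f)) = _
  rw [h]
  change _ = L.M.d.lTensor A (L.l.lTensor A (Gamma.scalars f))
  rw [← LinearMap.comp_apply, ← LinearMap.comp_apply, ← LinearMap.lTensor_comp,
    ← LinearMap.lTensor_comp]
  congr 2
  exact LinearMap.ext fun g => L.l_diff g

/-- The associativity law of the algebra `L ⊗ A`. -/
theorem extL_mul (F : Gamma 𝕂 (Gamma 𝕂 (L.Ext A))) :
    L.extL (Gamma.map (L.extLₗ A) L.isEven_extLₗ F) = L.extL (Gamma.mul F) := by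
  -- The structure map of `L ⊗ A` is a composite, and so is the map that it induces on `Γ(PreLie,
  -- -)`. Naturality of `scalars` handles one factor and `scalars_mul` the other, which leaves the
  -- associativity law of `L`.
  have h1 : Gamma.map (L.extLₗ A) L.isEven_extLₗ F = Gamma.map (L.l.lTensor A)
      (isEven_lTensor L.l_even) (Gamma.map (Gamma.scalarsₗ 𝕂 A L.M.carrier)
        Gamma.isEven_scalarsₗ F) := by
    refine Gamma.ext fun n T => ?_
    have h : ∀ x : ⨂[𝕂] _ : Fin n, Gamma 𝕂 (L.Ext A), PiTensorProduct.map (fun _ => L.extLₗ A) x =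
        PiTensorProduct.map (fun _ => L.l.lTensor A)
          (PiTensorProduct.map (fun _ => Gamma.scalarsₗ 𝕂 A L.M.carrier) x) := by
      intro x
      rw [← LinearMap.comp_apply, ← PiTensorProduct.map_comp]
      rfl
    exact h _
  unfold extL
  rw [h1, Gamma.scalars_map L.l_even, Gamma.scalars_mul, ← LinearMap.comp_apply,
    ← LinearMap.comp_apply, ← LinearMap.lTensor_comp, ← LinearMap.lTensor_comp]
  congr 2
  exact LinearMap.ext fun g => L.l_mul g

end GammaAlg

/-! ### Koszul signs of labellings -/

section LabelSigns

/-- Only pairs of odd elements contribute, so the order of all other pairs is irrelevant. -/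
theorem koszulSign_congr_odd {I : Type*} [Fintype I] {a a' b : I → I → Prop} {p : I → ZMod 2}
    (h : ∀ i j, p i = 1 → p j = 1 → (a i j ↔ a' i j)) :
    koszulSign a b p = koszulSign a' b p := by
  classical
  unfold koszulSign
  refine Finset.prod_congr rfl fun i _ => Finset.prod_congr rfl fun j _ => ?_
  by_cases hp : p i = 1 ∧ p j = 1
  · simp only [h i j hp.1 hp.2]
  · simp only [hp, and_false]

theorem isOrd_refine {I R : Type*} {c : R → R → Prop} {b : I → I → Prop} (hc : IsOrd c)
    (hb : IsOrd b) (t : I → R) : IsOrd (fun i j => c (t i) (t j) ∨ (t i = t j ∧ b i j)) := by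
  refine ⟨?_, ?_⟩
  · rintro i j (h | ⟨h, h'⟩) (h2 | ⟨h2, h2'⟩)
    · exact hc.asymm _ _ h h2
    · rw [h2] at h; exact hc.asymm _ _ h h
    · rw [h] at h2; exact hc.asymm _ _ h2 h2
    · exact hb.asymm _ _ h' h2'
  · intro i j hij
    by_cases h : t i = t j
    · rcases hb.total i j hij with h' | h'
      · exact Or.inl (Or.inr ⟨h, h'⟩)
      · exact Or.inr (Or.inr ⟨h.symm, h'⟩)
    · exact (hc.total _ _ h).imp Or.inl Or.inl

variable {I R Λ Λ' : Type*} [LinearOrder I] [LinearOrder R] [LinearOrder Λ] [LinearOrder Λ']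

/-- The sign for moving elements labelled by `ℓ`, of parities given by `p`, from the order of their
labels to the order of their positions. -/
def labelSign [Fintype I] (p : Λ → ZMod 2) (ℓ : I → Λ) : ℤˣ :=
  koszulSign (lexOrd ℓ) (fun i j => i < j) (fun i => p (ℓ i))

/-- No odd label occurs more than once. -/
def OddInjective (p : Λ → ZMod 2) (ℓ : I → Λ) : Prop := ∀ i j, p (ℓ i) = 1 → ℓ i = ℓ j → i = j

theorem OddInjective.lexOrd_iff {p : Λ → ZMod 2} {ℓ : I → Λ} (h : OddInjective p ℓ) {i : I}
    (j : I) (hi : p (ℓ i) = 1) : lexOrd ℓ i j ↔ ℓ i < ℓ j := by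
  refine ⟨?_, Or.inl⟩
  rintro (h' | ⟨h', h''⟩)
  · exact h'
  · rw [h i j hi h'] at h''
    exact absurd h'' (lt_irrefl _)

/-- Ties between equal labels are broken by position, which a bijection need not respect. By
`OddInjective` ties only involve even elements, for which the order does not matter. -/
theorem labelSign_comp_symm {J : Type*} [LinearOrder J] [Fintype Λ] [Fintype I] [Fintype J] (e : I ≃ J)
    {p : Λ → ZMod 2} {ℓ : I → Λ} (h : OddInjective p ℓ) :
    labelSign p ℓ * koszulSign (fun i j => i < j) (fun i j => e i < e j) (fun i => p (ℓ i)) =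
      labelSign p (ℓ ∘ e.symm) := by
  rw [labelSign, koszulSign_mul (isOrd_lexOrd ℓ) isOrd_lt (isOrd_comap e), labelSign]
  have := koszulSign_comp e (lexOrd (ℓ ∘ e.symm)) (fun i j => i < j) (fun i => p (ℓ i))
  refine Eq.trans ?_ this.symm
  refine koszulSign_congr_odd fun i j hi _ => ?_
  rw [h.lexOrd_iff j hi]
  simp only [lexOrd, Function.comp_apply, Equiv.symm_apply_apply]
  refine ⟨Or.inl, ?_⟩
  rintro (h' | ⟨h', h''⟩)
  · exact h'
  · rw [h i j hi h'] at h''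
    exact absurd h'' (lt_irrefl _)

variable [Fintype Λ] [Fintype Λ'] [Fintype R]

/-- Compatibility of the signs of labels with nested tensor products. -/
theorem labelSign_nest [Fintype I] {t : I → R} [∀ ρ, Fintype {i // t i = ρ}] {p : Λ → ZMod 2}
    {P : Λ' → ZMod 2} {ℓ : I → Λ} {m : R → Λ'} (hodd : OddInjective p ℓ)
    (hP : ∀ ρ, ∑ i : {i // t i = ρ}, p (ℓ i) = P (m ρ))
    (hord : ∀ i j, p (ℓ i) = 1 → p (ℓ j) = 1 → ℓ i < ℓ j → m (t i) < m (t j) ∨ t i = t j) :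
    labelSign P m * ((∏ ρ, labelSign p fun i : {i // t i = ρ} => ℓ i) *
      koszulSign (lexOrd t) (fun i j => i < j) (fun i => p (ℓ i))) = labelSign p ℓ := by
  -- Pass from the order of the labels to the order of the positions through three orders that list
  -- the blocks one after the other: blocks by their labels and labels inside, then blocks by
  -- position and labels inside, then blocks by position and positions inside. Each factor on the
  -- left is the sign of one of the transitions.
  have hA := isOrd_refine (isOrd_lexOrd m) (isOrd_lexOrd ℓ) t
  have hB := isOrd_refine (isOrd_lt (I := R)) (isOrd_lexOrd ℓ) t
  have hC := isOrd_refine (isOrd_lt (I := R)) (isOrd_lt (I := I)) t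
  have e1 : labelSign P m = koszulSign
      (fun i j => lexOrd m (t i) (t j) ∨ (t i = t j ∧ lexOrd ℓ i j))
      (fun i j => t i < t j ∨ (t i = t j ∧ lexOrd ℓ i j)) (fun i => p (ℓ i)) := by
    unfold labelSign
    simp only [← hP]
    rw [koszulSign_sum t (lexOrd m) (fun i j => i < j) (fun i => p (ℓ i))]
    unfold koszulSign
    refine Finset.prod_congr rfl fun i _ => Finset.prod_congr rfl fun j _ => ?_
    congr 2
    apply propext
    constructor
    · rintro ⟨h1, h2⟩; exact ⟨Or.inl h1, Or.inl h2⟩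
    · rintro ⟨h1 | ⟨h1, h1'⟩, h2 | ⟨h2, h2'⟩⟩
      · exact ⟨h1, h2⟩
      · rw [h2] at h1; exact absurd h1 ((isOrd_lexOrd m).asymm _ _ h1)
      · rw [h1] at h2; exact absurd h2 (lt_irrefl _)
      · exact absurd h1' ((isOrd_lexOrd ℓ).asymm _ _ h2')
  have e2 : (∏ ρ, labelSign p fun i : {i // t i = ρ} => ℓ i) = koszulSign
      (fun i j => t i < t j ∨ (t i = t j ∧ lexOrd ℓ i j))
      (fun i j => t i < t j ∨ (t i = t j ∧ i < j)) (fun i => p (ℓ i)) := by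
    refine (prod_koszulSign t (lexOrd ℓ) (fun i j => i < j) (fun i => p (ℓ i))).trans ?_
    unfold koszulSign
    refine Finset.prod_congr rfl fun i _ => Finset.prod_congr rfl fun j _ => ?_
    congr 2
    apply propext
    constructor
    · rintro ⟨h1, h2⟩; exact ⟨Or.inr h1, Or.inr h2⟩
    · rintro ⟨h1 | h1, h2 | h2⟩
      · exact absurd h1 h2.asymm
      · rw [h2.1] at h1; exact absurd h1 (lt_irrefl _)
      · rw [h1.1] at h2; exact absurd h2 (lt_irrefl _)
      · exact ⟨h1, h2⟩
  rw [e1, e2]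
  change _ * (_ * koszulSign (fun i j => t i < t j ∨ (t i = t j ∧ i < j)) (fun i j => i < j) _) = _
  rw [koszulSign_mul hB hC isOrd_lt, koszulSign_mul hA hB isOrd_lt]
  -- On pairs of odd elements, listing the blocks by their labels does not disturb the order of the
  -- labels: this is the content of `hord`.
  refine koszulSign_congr_odd fun i j hi hj => ?_
  rw [hodd.lexOrd_iff j hi]
  constructor
  · rintro (h | h)
    · by_contra hlt
      rcases (not_lt.mp hlt).lt_or_eq with h1 | h1
      · rcases hord j i hj hi h1 with h2 | h2
        · rcases h with h | ⟨h, -⟩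
          · exact h.asymm h2
          · exact h2.ne' h
        · rw [h2] at h
          exact (isOrd_lexOrd m).asymm _ _ h h
      · rw [hodd j i hj h1] at h
        exact (isOrd_lexOrd m).asymm _ _ h h
    · exact h.2
  · intro h
    rcases hord i j hi hj h with h1 | h1
    · exact Or.inl (Or.inl h1)
    · exact Or.inr ⟨h1, h⟩

end LabelSigns

/-! ### Sums of tensors over labellings -/

section LabelSums

variable {𝕂 : Type*} [CommRing 𝕂] {V : Type*} [AddCommGroup V] [Module 𝕂 V]
  {I J R Λ Λ' : Type*} [Fintype I] [Fintype J] [Fintype R] [LinearOrder I] [LinearOrder J]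
  [LinearOrder R] [LinearOrder Λ] [LinearOrder Λ'] [Fintype Λ] [Fintype Λ']

open Classical in
variable (𝕂) in
/-- The sum of the tensors obtained by placing the elements `v (ℓ i)` at the positions `i`, with the
sign of `ℓ`, over all labellings `ℓ` in a given set. -/
def labelSum (v : Λ → V) (p : Λ → ZMod 2) (S : (I → Λ) → Prop) : ⨂[𝕂] _ : I, V :=
  ∑ ℓ : I → Λ, (if S ℓ then ((labelSign p ℓ : ℤ) : 𝕂) else 0) •
    PiTensorProduct.tprod 𝕂 fun i => v (ℓ i)

theorem labelSum_congr (v : Λ → V) (p : Λ → ZMod 2) {S S' : (I → Λ) → Prop}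
    (h : ∀ ℓ, S ℓ ↔ S' ℓ) : labelSum 𝕂 v p S = labelSum 𝕂 v p S' := by
  rw [funext fun ℓ => propext (h ℓ)]

theorem labelSum_or (v : Λ → V) (p : Λ → ZMod 2) {S S' : (I → Λ) → Prop}
    (h : ∀ ℓ, S ℓ → ¬ S' ℓ) :
    labelSum 𝕂 v p (fun ℓ => S ℓ ∨ S' ℓ) = labelSum 𝕂 v p S + labelSum 𝕂 v p S' := by
  classical
  simp only [labelSum, ← Finset.sum_add_distrib, ← add_smul]
  refine Finset.sum_congr rfl fun ℓ _ => ?_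
  congr 1
  by_cases h1 : S ℓ
  · simp [h1, h ℓ h1]
  · simp [h1]

theorem labelSum_eq_zero (v : Λ → V) (p : Λ → ZMod 2) {S : (I → Λ) → Prop} (h : ∀ ℓ, ¬ S ℓ) :
    labelSum 𝕂 v p S = 0 := by
  classical
  simp [labelSum, h]

theorem labelSum_eq_single (v : Λ → V) (p : Λ → ZMod 2) {S : (I → Λ) → Prop} {ℓ : I → Λ}
    (h : ∀ ℓ', S ℓ' ↔ ℓ' = ℓ) : labelSum 𝕂 v p S =
      ((labelSign p ℓ : ℤ) : 𝕂) • PiTensorProduct.tprod 𝕂 fun i => v (ℓ i) := by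
  classical
  rw [labelSum, Finset.sum_eq_single ℓ]
  · rw [if_pos ((h ℓ).mpr rfl)]
  · intro ℓ' _ hne
    rw [if_neg (fun hS => hne ((h ℓ').mp hS)), zero_smul]
  · simp

theorem map_labelSum {W : Type*} [AddCommGroup W] [Module 𝕂 W] (g : V →ₗ[𝕂] W)
    (v : Λ → V) (p : Λ → ZMod 2) (S : (I → Λ) → Prop) :
    PiTensorProduct.map (fun _ => g) (labelSum 𝕂 v p S) = labelSum 𝕂 (fun i => g (v i)) p S := by
  classical
  simp only [labelSum, map_sum, map_smul, PiTensorProduct.map_tprod]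

omit [LinearOrder R] in
theorem tprod_sum_smul {W : R → Type*} [∀ ρ, AddCommGroup (W ρ)] [∀ ρ, Module 𝕂 (W ρ)]
    [DecidableEq R] {C : R → Type*} [∀ ρ, Fintype (C ρ)] (r : ∀ ρ, C ρ → 𝕂) (w : ∀ ρ, C ρ → W ρ) :
    PiTensorProduct.tprod 𝕂 (fun ρ => ∑ c, r ρ c • w ρ c) =
      ∑ c : ∀ ρ, C ρ, (∏ ρ, r ρ (c ρ)) • PiTensorProduct.tprod 𝕂 (fun ρ => w ρ (c ρ)) := by
  rw [MultilinearMap.map_sum]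
  exact Finset.sum_congr rfl fun c _ => MultilinearMap.map_smul_univ _ _ _

variable [SuperModule 𝕂 V]

/-- The sign of the permutation is absorbed into `labelSign`. This makes the coefficients given by a
natural predicate equivariant. -/
theorem permute_labelSum (e : I ≃ J) {v : Λ → V} {p : Λ → ZMod 2} (hv : IsHom 𝕂 p v)
    {S : (I → Λ) → Prop} (hodd : ∀ ℓ, S ℓ → OddInjective p ℓ) :
    permute e (labelSum 𝕂 v p S) = labelSum 𝕂 v p (fun ℓ : J → Λ => S (ℓ ∘ e)) := by
  classical
  rw [labelSum, map_sum, labelSum]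
  refine Fintype.sum_equiv (e.arrowCongr (Equiv.refl Λ)) _ _ fun ℓ => ?_
  have h1 : (e.arrowCongr (Equiv.refl Λ)) ℓ = ℓ ∘ e.symm := rfl
  have h2 : (ℓ ∘ e.symm) ∘ e = ℓ := by funext i; simp
  have h3 : IsHom 𝕂 (fun i => p (ℓ i)) (fun i => v (ℓ i)) := fun i => hv (ℓ i)
  rw [h1, h2, map_smul, permute_tprod e h3, smul_smul]
  congr 1
  split_ifs with h
  · rw [← labelSign_comp_symm e (hodd ℓ h)]
    push_cast
    rfl
  · simp

theorem tensorProj_labelSum {v : Λ → V} {p : Λ → ZMod 2} (hv : IsHom 𝕂 p v)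
    {S : (I → Λ) → Prop} {a : ZMod 2} (h : ∀ ℓ, S ℓ → ∑ i, p (ℓ i) = a) :
    tensorProj a (labelSum 𝕂 v p S) = labelSum 𝕂 v p S := by
  classical
  rw [labelSum, map_sum]
  refine Finset.sum_congr rfl fun ℓ _ => ?_
  have h3 : IsHom 𝕂 (fun i => p (ℓ i)) (fun i => v (ℓ i)) := fun i => hv (ℓ i)
  rw [map_smul, tensorProj_tprod a h3]
  by_cases hS : S ℓ
  · rw [if_pos (h ℓ hS)]
  · simp [hS]

/-- Labellings of `I` are families of labellings of the fibres of `t`. -/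
def fibreLabels (t : I → R) : (∀ ρ, {i // t i = ρ} → Λ) ≃ (I → Λ) where
  toFun L i := L (t i) ⟨i, rfl⟩
  invFun ℓ ρ i := ℓ i
  left_inv L := by
    funext ρ i
    obtain ⟨i, rfl⟩ := i
    rfl
  right_inv ℓ := rfl

open Classical in
-- Expanding the tensor product of the block sums selects one labelling of each block, which amounts
-- to one labelling of `I`. The signs are left as they come; `labelSign_nest` combines them later.
theorem assemble_labelSum (t : I → R) [∀ ρ, Fintype {i // t i = ρ}] {v : Λ → V}
    {p : Λ → ZMod 2} (hv : IsHom 𝕂 p v) (S : ∀ ρ, ({i // t i = ρ} → Λ) → Prop) :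
    assemble t (PiTensorProduct.tprod 𝕂 fun ρ => labelSum 𝕂 v p (S ρ)) =
      ∑ ℓ : I → Λ, (if ∀ ρ, S ρ (fun i => ℓ i) then
        ((((∏ ρ, labelSign p fun i : {i // t i = ρ} => ℓ i) *
          koszulSign (lexOrd t) (fun i j => i < j) (fun i => p (ℓ i)) : ℤˣ) : ℤ) : 𝕂) else 0) •
        PiTensorProduct.tprod 𝕂 fun i => v (ℓ i) := by
  simp only [labelSum]
  refine (congrArg (assemble t) (tprod_sum_smul _ _)).trans ?_
  rw [map_sum]
  refine Fintype.sum_equiv (fibreLabels t) _ _ fun L => ?_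
  obtain ⟨ℓ, rfl⟩ := (fibreLabels t).symm.surjective L
  rw [Equiv.apply_symm_apply, map_smul]
  have h3 : IsHom 𝕂 (fun i => p (ℓ i)) (fun i => v (ℓ i)) := fun i => hv (ℓ i)
  have := assemble_tprod t h3
  change _ • assemble t (PiTensorProduct.tprod 𝕂 fun ρ => PiTensorProduct.tprod 𝕂
    fun i : {i // t i = ρ} => v (ℓ i)) = _
  rw [this, smul_smul]
  congr 1
  change (∏ ρ, if S ρ (fun i => ℓ i) then
    ((labelSign p (fun i : {i // t i = ρ} => ℓ i) : ℤ) : 𝕂) else 0) * _ = _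
  split_ifs with h
  · rw [Finset.prod_congr rfl fun ρ _ => if_pos (h ρ)]
    push_cast
    rfl
  · push Not at h
    obtain ⟨ρ, hρ⟩ := h
    rw [Finset.prod_eq_zero (Finset.mem_univ ρ) (if_neg hρ), zero_mul]

end LabelSums

/-- Predicates on trees with labelled vertices. -/
abbrev LabelPred (Λ : Type*) : Type _ := ∀ I : Type, RTree I → (I → Λ) → Prop

/-- `(R, m)` is a way of cutting the tree `S` labelled by `ℓ` into blocks such that the tree of blocks
with labels `m` satisfies `W`, and each block satisfies the predicate `Q` given by its label. -/
def IsCut {Λ Λ' : Type*} (W : LabelPred Λ') (Q : Λ' → LabelPred Λ) {I : Type} (S : RTree I)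
    (ℓ : I → Λ) (R : {R : Finset I // S.root ∈ R}) (m : {x // x ∈ R.1} → Λ') : Prop :=
  W _ (S.contract R.2) m ∧ ∀ ρ, Q (m ρ) _ (S.block R.2 ρ) fun i => ℓ i

/-- The set of all such cuttings. -/
def Cut {Λ Λ' : Type*} (W : LabelPred Λ') (Q : Λ' → LabelPred Λ) {I : Type} (S : RTree I)
    (ℓ : I → Λ) : Type _ :=
  {x : Σ R : {R : Finset I // S.root ∈ R}, {x // x ∈ R.1} → Λ' // IsCut W Q S ℓ x.1 x.2}

/-! ### Elements of `Γ(PreLie, V)` given by predicates on labelled trees -/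

section Rep

variable {𝕂 : Type*} [CommRing 𝕂] {V : Type*} [AddCommGroup V] [Module 𝕂 V] [SuperModule 𝕂 V]
  {Λ Λ' : Type*} [LinearOrder Λ] [LinearOrder Λ'] [Fintype Λ] [Fintype Λ']

/-- The coefficient of `g` at any tree `T` is the sum over all labellings of `T` which satisfy `Q`. -/
def IsRep (v : Λ → V) (p : Λ → ZMod 2) (Q : LabelPred Λ) (g : Gamma 𝕂 V) : Prop :=
  ∀ (I : Type) [Fintype I] [LinearOrder I] (T : RTree I),
    Gamma.evalOn T g = labelSum 𝕂 v p (Q I T)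

theorem evalOn_fin {n : ℕ} (T : RTree (Fin n)) (f : Gamma 𝕂 V) :
    Gamma.evalOn T f = Gamma.coeff T f := by
  rw [Gamma.evalOn_eq (OrderIso.refl (Fin n))]
  have h : T.map (OrderIso.refl (Fin n)).symm.toEquiv = T := rfl
  rw [h]
  exact LinearEquiv.congr_fun (PiTensorProduct.reindex_refl (R := 𝕂) (s := fun _ => V)) _

namespace IsRep

variable {v : Λ → V} {p : Λ → ZMod 2} {Q : LabelPred Λ} {g g' : Gamma 𝕂 V}

theorem coeff_eq (h : IsRep v p Q g) {n : ℕ} (T : RTree (Fin n)) :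
    Gamma.coeff T g = labelSum 𝕂 v p (Q (Fin n) T) := by rw [← evalOn_fin]; exact h _ T

theorem unique (h : IsRep v p Q g) (h' : IsRep v p Q g') : g = g' :=
  Gamma.ext fun n T => by rw [h.coeff_eq, h'.coeff_eq]

theorem congr (h : IsRep v p Q g) {Q' : LabelPred Λ}
    (hQ : ∀ (I : Type) [Finite I] T ℓ, Q I T ℓ ↔ Q' I T ℓ) : IsRep v p Q' g := fun I _ _ T => by rw [h I T]; exact labelSum_congr _ _ (hQ I T)

theorem add (h : IsRep v p Q g) {Q' : LabelPred Λ} (h' : IsRep v p Q' g')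
    (hQ : ∀ I T ℓ, Q I T ℓ → ¬ Q' I T ℓ) :
    IsRep v p (fun I T ℓ => Q I T ℓ ∨ Q' I T ℓ) (g + g') := fun I _ _ T => by
  rw [map_add, h I T, h' I T]
  exact (labelSum_or v p (hQ I T)).symm

theorem map {W : Type*} [AddCommGroup W] [Module 𝕂 W] [SuperModule 𝕂 W] {φ : V →ₗ[𝕂] W}
    (hφ : IsEven φ) (h : IsRep v p Q g) : IsRep (fun i => φ (v i)) p Q (Gamma.map φ hφ g) :=
  fun I _ _ T => by
    rw [Gamma.evalOn_Gamma_map, h I T, map_labelSum]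

theorem part_eq (hv : IsHom 𝕂 p v) (h : IsRep v p Q g) {a : ZMod 2}
    (ha : ∀ (I : Type) [Fintype I] (T : RTree I) ℓ, Q I T ℓ → ∑ i, p (ℓ i) = a) :
    part 𝕂 a g = g :=
  Gamma.ext fun n T => by
    rw [Gamma.coeff_proj, h.coeff_eq, tensorProj_labelSum hv (ha _ T)]

end IsRep

/-- The predicate is compatible with bijections. -/
def LabelPred.IsNatural (Q : LabelPred Λ) : Prop :=
  ∀ (I J : Type) (e : I ≃ J) (T : RTree I) (ℓ : J → Λ), Q J (T.map e) ℓ ↔ Q I T (ℓ ∘ e)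

/-- An arbitrary ordered vertex set is reduced to `Fin n` along the increasing bijection, which
carries no sign. -/
theorem isRep_of_coeff {v : Λ → V} {p : Λ → ZMod 2} (hv : IsHom 𝕂 p v) {Q : LabelPred Λ}
    (hQ : Q.IsNatural)
    (hodd : ∀ (I : Type) [LinearOrder I] (T : RTree I) ℓ, Q I T ℓ → OddInjective p ℓ)
    {g : Gamma 𝕂 V} (hg : ∀ n (T : RTree (Fin n)), Gamma.coeff T g = labelSum 𝕂 v p (Q (Fin n) T)) :
    IsRep v p Q g := by
  intro I _ _ T
  let o := Fintype.orderIsoFinOfCardEq I rfl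
  rw [Gamma.evalOn_eq o, hg, ← permute_of_strictMono _ o.strictMono,
    permute_labelSum o.toEquiv hv (hodd _ _)]
  refine labelSum_congr _ _ fun ℓ => ?_
  rw [hQ]
  have : (ℓ ∘ o.toEquiv) ∘ o.symm.toEquiv = ℓ := funext fun i => by
    change ℓ (o (o.symm i)) = ℓ i
    rw [o.apply_symm_apply]
  rw [this]

/-- Naturality gives equivariant coefficients, and `hN` makes them vanish in large arities, so they
assemble to an element of the direct sum. -/
theorem exists_isRep {v : Λ → V} {p : Λ → ZMod 2} (hv : IsHom 𝕂 p v) {Q : LabelPred Λ}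
    (hQ : Q.IsNatural)
    (hodd : ∀ (I : Type) [LinearOrder I] (T : RTree I) ℓ, Q I T ℓ → OddInjective p ℓ) (N : ℕ)
    (hN : ∀ (n : ℕ) (T : RTree (Fin n)) ℓ, Q _ T ℓ → n < N) :
    ∃ g : Gamma 𝕂 V, IsRep v p Q g := by
  obtain ⟨g, hg⟩ := Gamma.exists_of_coeff (fun n T => labelSum 𝕂 v p (Q (Fin n) T))
    (fun n σ T => by
      rw [permute_labelSum σ hv (hodd _ T)]
      exact labelSum_congr _ _ fun ℓ => hQ _ _ σ T ℓ) N
    (fun n hn => funext fun T => labelSum_eq_zero _ _ fun ℓ h => (hN n T ℓ h).not_ge hn)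
  exact ⟨g, isRep_of_coeff hv hQ hodd hg⟩

open Classical in
/-- The coefficients of a composite, without the determination of the numerical factors. -/
theorem mulCoeff_mem_span {v : Λ → V} {p : Λ → ZMod 2} (hv : IsHom 𝕂 p v) {G : Λ' → Gamma 𝕂 V}
    {P : Λ' → ZMod 2} {Q : Λ' → LabelPred Λ} {W : LabelPred Λ'} {F : Gamma 𝕂 (Gamma 𝕂 V)}
    (hF : IsRep G P W F) (hG : ∀ a, IsRep v p (Q a) (G a))
    {I : Type} [Fintype I] [LinearOrder I] (S : RTree I) :
    Gamma.mulCoeff S F ∈ Submodule.span 𝕂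
      (Set.range fun ℓ : I → Λ => PiTensorProduct.tprod 𝕂 fun i => v (ℓ i)) := by
  simp only [Gamma.mulCoeff, LinearMap.sum_apply, LinearMap.comp_apply]
  refine Submodule.sum_mem _ fun R _ => ?_
  rw [hF, labelSum, map_sum, map_sum]
  refine Submodule.sum_mem _ fun m _ => ?_
  rw [map_smul, map_smul, PiTensorProduct.map_tprod]
  have h2 : (fun ρ => Gamma.evalOn (S.block R.2 ρ) (G (m ρ))) =
      fun ρ => labelSum 𝕂 v p (Q (m ρ) _ (S.block R.2 ρ)) := funext fun ρ => hG _ _ _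
  rw [h2, assemble_labelSum _ hv]
  exact Submodule.smul_mem _ _ (Submodule.sum_mem _ fun ℓ _ =>
    Submodule.smul_mem _ _ (Submodule.subset_span ⟨ℓ, rfl⟩))

open Classical in
/-- The coefficients of a composite: the sum over all labellings, weighted by the number of
cuttings. -/
theorem mulCoeff_eq {v : Λ → V} {p : Λ → ZMod 2} (hv : IsHom 𝕂 p v) {G : Λ' → Gamma 𝕂 V}
    {P : Λ' → ZMod 2} {Q : Λ' → LabelPred Λ} {W : LabelPred Λ'} {F : Gamma 𝕂 (Gamma 𝕂 V)}
    (hF : IsRep G P W F) (hG : ∀ a, IsRep v p (Q a) (G a))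
    (hP : ∀ (a : Λ') (J : Type) [Fintype J] (B : RTree J) ℓ, Q a J B ℓ → ∑ i, p (ℓ i) = P a)
    {I : Type} [Fintype I] [LinearOrder I] (S : RTree I)
    (hodd : ∀ ℓ R m, IsCut W Q S ℓ R m → OddInjective p ℓ)
    (hord : ∀ ℓ R m, IsCut W Q S ℓ R m → ∀ i j, p (ℓ i) = 1 → p (ℓ j) = 1 → ℓ i < ℓ j →
      m (S.top R.2 i) < m (S.top R.2 j) ∨ S.top R.2 i = S.top R.2 j) :
    Gamma.mulCoeff S F = ∑ ℓ : I → Λ, ((Nat.card (Cut W Q S ℓ) : 𝕂) *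
      ((labelSign p ℓ : ℤ) : 𝕂)) • PiTensorProduct.tprod 𝕂 fun i => v (ℓ i) := by
  -- Written as a sum of indicators over the block roots `R` and the block labels `m`, the number of
  -- cuttings can be compared with the double sum that unfolds from `mulCoeff`.
  have h1 : ∀ ℓ : I → Λ, (Nat.card (Cut W Q S ℓ) : 𝕂) =
      ∑ R : {R : Finset I // S.root ∈ R}, ∑ m : {x // x ∈ R.1} → Λ',
        if IsCut W Q S ℓ R m then 1 else 0 := by
    intro ℓ
    rw [← Fintype.sum_sigma' (f := fun (R : {R : Finset I // S.root ∈ R})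
      (m : {x // x ∈ R.1} → Λ') => if IsCut W Q S ℓ R m then (1 : 𝕂) else 0)]
    unfold Cut
    rw [Finset.sum_boole, Nat.card_eq_fintype_card, Fintype.card_subtype]
  simp only [h1, Finset.sum_mul, Finset.sum_smul]
  rw [Finset.sum_comm]
  simp only [Gamma.mulCoeff, LinearMap.sum_apply, LinearMap.comp_apply]
  refine Finset.sum_congr rfl fun R _ => ?_
  rw [hF, labelSum, map_sum, map_sum, Finset.sum_comm]
  refine Finset.sum_congr rfl fun m _ => ?_
  rw [map_smul, map_smul, PiTensorProduct.map_tprod]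
  have h2 : (fun ρ => Gamma.evalOn (S.block R.2 ρ) (G (m ρ))) =
      fun ρ => labelSum 𝕂 v p (Q (m ρ) _ (S.block R.2 ρ)) := funext fun ρ => hG _ _ _
  rw [h2, assemble_labelSum _ hv, Finset.smul_sum]
  refine Finset.sum_congr rfl fun ℓ _ => ?_
  rw [smul_smul]
  congr 1
  by_cases hc : IsCut W Q S ℓ R m
  · rw [if_pos hc, if_pos hc.1, if_pos hc.2, one_mul, ← Int.cast_mul, ← Units.val_mul]
    congr 2
    exact labelSign_nest (hodd ℓ R m hc) (fun ρ => hP _ _ _ _ (hc.2 ρ)) (hord ℓ R m hc)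
  · rw [if_neg hc, zero_mul]
    by_cases h3 : W _ (S.contract R.2) m
    · rw [if_neg (fun h4 => hc ⟨h3, h4⟩), mul_zero]
    · rw [if_neg h3, zero_mul]

end Rep

/-! ### Roots and parents in contracted trees and in blocks -/

namespace RTree

variable {I : Type*} (T : RTree I) {R : Finset I} (h : T.root ∈ R)

theorem contract_root : (T.contract h).root = ⟨T.root, h⟩ :=
  (eq_root _ (by
    change T.top h (T.parent T.root) = _
    rw [T.parent_root, T.top_of_mem h h])).symm

theorem contract_parent (ρ : {x // x ∈ R}) :
    (T.contract h).parent ρ = T.top h (T.parent ρ) := rfl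

theorem block_root (ρ : {x // x ∈ R}) :
    (T.block h ρ).root = ⟨ρ, T.top_of_mem h ρ.2⟩ :=
  (eq_root (T.block h ρ) (i := ⟨ρ, T.top_of_mem h ρ.2⟩) (by
    classical
    exact dif_pos ρ.2)).symm

open Classical in
theorem block_parent (ρ : {x // x ∈ R}) (i : {i // T.top h i = ρ}) :
    (T.block h ρ).parent i = if hi : i.1 ∈ R then i else
      ⟨T.parent i, by rw [← T.top_of_notMem h hi]; exact i.2⟩ := rfl

theorem block_parent_of_notMem (ρ : {x // x ∈ R}) (i : {i // T.top h i = ρ}) (hi : i.1 ∉ R) :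
    ((T.block h ρ).parent i).1 = T.parent i := by
  rw [block_parent, dif_neg hi]

theorem block_parent_of_mem (ρ : {x // x ∈ R}) (i : {i // T.top h i = ρ}) (hi : i.1 ∈ R) :
    (T.block h ρ).parent i = i := by
  rw [block_parent, dif_pos hi]

theorem parent_ne {i : I} (hi : i ≠ T.root) : T.parent i ≠ i := fun h => hi (T.eq_root h)

end RTree

/-! ### Points, corollas and marked corollas -/

section Predicates

variable {Λ : Type*}

/-- There is exactly one element different from the base point. -/
def IsPair (I : Type) (r : I) : Prop := ∃ j, j ≠ r ∧ ∀ i, i = r ∨ i = j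

/-- The size is at most `N`. -/
def IsSmall (N : ℕ) (I : Type) (_ : I) : Prop := Nat.card I ≤ N

/-- The tree with one vertex, labelled by `a`. -/
def isPoint (a : Λ) : LabelPred Λ := fun _ T ℓ => ∀ i, i = T.root ∧ ℓ i = a

/-- Corollas with root labelled by `a` and leaves labelled by `b`, whose pointed set of vertices
satisfies `c`. -/
def isStar (c : ∀ I : Type, I → Prop) (a b : Λ) : LabelPred Λ := fun I T ℓ =>
  (∀ i, T.parent i = T.root) ∧ ℓ T.root = a ∧ (∀ i, i ≠ T.root → ℓ i = b) ∧ c I T.root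

/-- Corollas with root labelled by `a`, one leaf labelled by `b'`, and the other leaves labelled by
`b`, whose pointed set of vertices satisfies `c`. -/
def isMarkedStar (c : ∀ I : Type, I → Prop) (a b b' : Λ) : LabelPred Λ := fun I T ℓ =>
  (∀ i, T.parent i = T.root) ∧ ℓ T.root = a ∧
    (∃ j, j ≠ T.root ∧ ℓ j = b' ∧ ∀ i, i ≠ T.root → i ≠ j → ℓ i = b) ∧ c I T.root

variable {I : Type} (S : RTree I) {R : Finset I} (h : S.root ∈ R) (ℓ : I → Λ)

theorem isPoint_block_iff (ρ : {x // x ∈ R}) (a : Λ) :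
    isPoint a _ (S.block h ρ) (fun i => ℓ i) ↔ ℓ ρ = a ∧ ∀ i, S.top h i = ρ → i = ρ := by
  constructor
  · intro H
    refine ⟨(H ⟨ρ, S.top_of_mem h ρ.2⟩).2, fun i hi => ?_⟩
    have := (H ⟨i, hi⟩).1
    rw [RTree.block_root] at this
    exact congrArg Subtype.val this
  · rintro ⟨h1, h2⟩ ⟨i, hi⟩
    rw [RTree.block_root]
    have := h2 i hi
    subst this
    exact ⟨rfl, h1⟩

theorem isStar_block_iff (ρ : {x // x ∈ R}) (c : ∀ I : Type, I → Prop) (a b : Λ) :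
    isStar c a b _ (S.block h ρ) (fun i => ℓ i) ↔
      (∀ i, i ∉ R → S.top h i = ρ → S.parent i = ρ ∧ ℓ i = b) ∧ ℓ ρ = a ∧
        c {i // S.top h i = ρ} ⟨ρ, S.top_of_mem h ρ.2⟩ := by
  unfold isStar
  rw [RTree.block_root]
  constructor
  · rintro ⟨h1, h2, h3, h4⟩
    refine ⟨fun i hi hρ => ⟨?_, ?_⟩, h2, h4⟩
    · rw [← S.block_parent_of_notMem h ρ ⟨i, hρ⟩ hi, h1 ⟨i, hρ⟩]
    · refine h3 ⟨i, hρ⟩ fun he => hi ?_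
      have : i = ρ := congrArg Subtype.val he
      rw [this]
      exact ρ.2
  · rintro ⟨h1, h2, h3⟩
    refine ⟨fun i => ?_, h2, fun i hi => ?_, h3⟩
    · by_cases hR : i.1 ∈ R
      · rw [S.block_parent_of_mem h ρ i hR]
        exact Subtype.ext (congrArg Subtype.val ((S.top_of_mem h hR).symm.trans i.2) : i.1 = ρ)
      · refine Subtype.ext ?_
        rw [S.block_parent_of_notMem h ρ i hR]
        exact (h1 i hR i.2).1
    · refine (h1 i (fun hR => hi (Subtype.ext ?_)) i.2).2
      exact (congrArg Subtype.val ((S.top_of_mem h hR).symm.trans i.2) : i.1 = ρ)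

theorem isStar_contract_iff (m : {x // x ∈ R} → Λ) (c : ∀ I : Type, I → Prop) (a b : Λ) :
    isStar c a b _ (S.contract h) m ↔
      (∀ ρ ∈ R, S.top h (S.parent ρ) = ⟨S.root, h⟩) ∧ m ⟨S.root, h⟩ = a ∧
        (∀ ρ : {x // x ∈ R}, ρ.1 ≠ S.root → m ρ = b) ∧ c {x // x ∈ R} ⟨S.root, h⟩ := by
  unfold isStar
  rw [RTree.contract_root]
  simp only [RTree.contract_parent, Subtype.forall, ne_eq, Subtype.mk.injEq]

theorem isMarkedStar_contract_iff (m : {x // x ∈ R} → Λ) (c : ∀ I : Type, I → Prop)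
    (a b b' : Λ) : isMarkedStar c a b b' _ (S.contract h) m ↔
      (∀ ρ ∈ R, S.top h (S.parent ρ) = ⟨S.root, h⟩) ∧ m ⟨S.root, h⟩ = a ∧
        (∃ j : {x // x ∈ R}, j.1 ≠ S.root ∧ m j = b' ∧
          ∀ ρ : {x // x ∈ R}, ρ.1 ≠ S.root → ρ ≠ j → m ρ = b) ∧
        c {x // x ∈ R} ⟨S.root, h⟩ := by
  unfold isMarkedStar
  rw [RTree.contract_root]
  simp only [RTree.contract_parent, Subtype.forall, ne_eq, Subtype.mk.injEq, Subtype.exists]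

end Predicates

/-! ### Uniqueness of cuttings of two-level trees -/

section Cuts

variable {I : Type} (S : RTree I) (ℓ : I → Fin 3)

/-- The root is labelled by `0`, all vertices labelled by `1` are children of the root, and all
others are labelled by `2` and are children of the root or of a vertex labelled by `1`. -/
structure TwoLevel : Prop where
  root : ℓ S.root = 0
  step : ∀ i, i ≠ S.root → (ℓ i = 1 ∧ S.parent i = S.root) ∨
    (ℓ i = 2 ∧ (S.parent i = S.root ∨ ℓ (S.parent i) = 1))

variable {S ℓ}

theorem TwoLevel.ne_one_of_two (H : TwoLevel S ℓ) {i : I} (hi : S.parent i ≠ S.root)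
    (hi' : i ≠ S.root) : ℓ i = 2 ∧ ℓ (S.parent i) = 1 ∧ S.parent (S.parent i) = S.root := by
  rcases H.step i hi' with h | ⟨h, h' | h'⟩
  · exact absurd h.2 hi
  · exact absurd h' hi
  · refine ⟨h, h', ?_⟩
    rcases H.step _ hi with h2 | h2
    · exact h2.2
    · rw [h2.1] at h'; exact absurd h' (by decide)

theorem subtype_congr_pred (c : ∀ I : Type, I → Prop) {P P' : I → Prop} (h : ∀ i, P i ↔ P' i) {r : I}
    (hr : P r) : c {i // P i} ⟨r, hr⟩ ↔ c {i // P' i} ⟨r, (h r).mp hr⟩ := by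
  obtain rfl : P = P' := funext fun i => propext (h i)
  rfl

/-- The outer corolla has leaves labelled by `1`, which stand for vertices labelled by `2`; its root
stands for a corolla. -/
def nestedRoot (c₁ : ∀ I : Type, I → Prop) : Fin 2 → LabelPred (Fin 3) :=
  ![isStar c₁ 0 1, isPoint 2]

open Classical in
-- The block of the root is a corolla with leaves `1` and every other block is a single vertex `2`,
-- so the cut has to detach exactly the vertices labelled `2`. The root block then consists of the
-- vertices not labelled `2`, and the contracted tree of those not labelled `1`; this is where `c₁`
-- and `c₂` are tested.
theorem isCut_nestedRoot_iff {c₁ c₂ : ∀ I : Type, I → Prop} {R : {R : Finset I // S.root ∈ R}}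
    {m : {x // x ∈ R.1} → Fin 2} : IsCut (isStar c₂ 0 1) (nestedRoot c₁) S ℓ R m ↔
      (TwoLevel S ℓ ∧ (∃ h : ℓ S.root ≠ 2, c₁ {i // ℓ i ≠ 2} ⟨S.root, h⟩) ∧
        (∃ h : ℓ S.root ≠ 1, c₂ {i // ℓ i ≠ 1} ⟨S.root, h⟩)) ∧
      (∀ i, i ∈ R.1 ↔ ℓ i ≠ 1) ∧ (∀ i, m i = if i.1 = S.root then 0 else 1) := by
  obtain ⟨R, hR⟩ := R
  have e1 : (∀ i, i ∈ R ↔ ℓ i ≠ 1) → TwoLevel S ℓ →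
      (∀ i, i ∉ R → S.top hR i = ⟨S.root, hR⟩) ∧
      (∀ i, S.top hR i = ⟨S.root, hR⟩ ↔ ℓ i ≠ 2) := by
    intro h1 h2
    have h3 : ∀ i, i ∉ R → S.top hR i = ⟨S.root, hR⟩ := by
      intro i hi
      have h4 : ℓ i = 1 := by simpa [h1] using hi
      have h5 : i ≠ S.root := fun h => by rw [h, h2.root] at h4; exact absurd h4 (by decide)
      rcases h2.step i h5 with h | h
      · rw [S.top_of_notMem hR hi, h.2, S.top_of_mem hR hR]
      · rw [h.1] at h4; exact absurd h4 (by decide)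
    refine ⟨h3, fun i => ?_⟩
    by_cases hi : i ∈ R
    · rw [S.top_of_mem hR hi, Subtype.mk.injEq]
      constructor
      · rintro rfl; rw [h2.root]; decide
      · intro h4
        by_contra h5
        rcases h2.step i h5 with h | h
        · exact (h1 i).mp hi h.1
        · exact h4 h.1
    · have h4 : ℓ i = 1 := by simpa [h1] using hi
      simp [h3 i hi, h4]
  constructor
  · rintro ⟨hW, hQ⟩
    rw [isStar_contract_iff] at hW
    obtain ⟨w1, w2, w3, w4⟩ := hW
    have hm : ∀ i, m i = if i.1 = S.root then 0 else 1 := by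
      intro i
      split_ifs with h
      · rw [← w2]; exact congrArg m (Subtype.ext h)
      · exact w3 i h
    have q0 := hQ ⟨S.root, hR⟩
    rw [w2] at q0
    replace q0 := (isStar_block_iff S hR ℓ _ _ _ _).mp q0
    obtain ⟨q1, q2, q3⟩ := q0
    have q4 : ∀ ρ : {x // x ∈ R}, ρ.1 ≠ S.root → ℓ ρ = 2 ∧ ∀ i, S.top hR i = ρ → i = ρ := by
      intro ρ hρ
      have := hQ ρ
      rw [w3 ρ hρ] at this
      exact (isPoint_block_iff S hR ℓ _ _).mp this
    have q5 : ∀ i, i ∉ R → S.top hR i = ⟨S.root, hR⟩ := by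
      intro i hi
      by_contra h
      have h' := (q4 (S.top hR i) (fun h' => h (Subtype.ext h'))).2 i rfl
      exact hi (h' ▸ (S.top hR i).2)
    have hR' : ∀ i, i ∈ R ↔ ℓ i ≠ 1 := by
      intro i
      constructor
      · intro hi
        by_cases h : i = S.root
        · rw [h]
          exact fun h' => absurd (q2.symm.trans h') (by decide)
        · rw [(q4 ⟨i, hi⟩ h).1]; decide
      · intro hi
        by_contra h
        exact hi (q1 i h (q5 i h)).2
    have hT : TwoLevel S ℓ := by
      refine ⟨q2, fun i hi => ?_⟩
      by_cases h : i ∈ R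
      · refine Or.inr ⟨(q4 ⟨i, h⟩ hi).1, ?_⟩
        by_cases h' : S.parent i ∈ R
        · left
          have := w1 i h
          rw [S.top_of_mem hR h'] at this
          exact congrArg Subtype.val this
        · right
          simpa [hR'] using h'
      · exact Or.inl ⟨(q1 i h (q5 i h)).2, (q1 i h (q5 i h)).1⟩
    refine ⟨⟨hT, ⟨by rw [hT.root]; decide, ?_⟩, ⟨by rw [hT.root]; decide, ?_⟩⟩, hR', hm⟩
    · exact (subtype_congr_pred c₁ (e1 hR' hT).2 _).mp q3
    · exact (subtype_congr_pred c₂ hR' hR).mp w4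
  · rintro ⟨⟨hT, ⟨h1, hc1⟩, ⟨h2, hc2⟩⟩, hR', hm⟩
    refine ⟨(isStar_contract_iff _ _ _ _ _ _).mpr ⟨?_, ?_, ?_, ?_⟩, fun ρ => ?_⟩
    · intro ρ hρ
      by_cases h : ρ = S.root
      · rw [h, S.parent_root, S.top_of_mem hR hR]
      rcases hT.step ρ h with h3 | ⟨h3, h4 | h4⟩
      · rw [h3.2, S.top_of_mem hR hR]
      · rw [h4, S.top_of_mem hR hR]
      · exact (e1 hR' hT).1 _ (by simp [hR', h4])
    · rw [hm, if_pos rfl]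
    · intro ρ h
      rw [hm, if_neg h]
    · exact (subtype_congr_pred c₂ hR' hR).mpr hc2
    · rw [hm]
      split_ifs with h
      · obtain rfl : ρ = ⟨S.root, hR⟩ := Subtype.ext h
        refine (isStar_block_iff S hR ℓ _ _ _ _).mpr ⟨fun i hi _ => ?_, hT.root, ?_⟩
        · have h4 : ℓ i = 1 := by simpa [hR'] using hi
          have h5 : i ≠ S.root := fun h => by rw [h, hT.root] at h4; exact absurd h4 (by decide)
          rcases hT.step i h5 with h | h
          · exact ⟨h.2, h4⟩
          · rw [h.1] at h4; exact absurd h4 (by decide)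
        · exact (subtype_congr_pred c₁ (e1 hR' hT).2 _).mpr hc1
      · refine (isPoint_block_iff S hR ℓ _ _).mpr ⟨?_, fun i hi => ?_⟩
        · rcases hT.step ρ h with h3 | h3
          · exact absurd h3.1 ((hR' ρ).mp ρ.2)
          · exact h3.1
        · by_cases h3 : i ∈ R
          · rw [S.top_of_mem hR h3] at hi
            exact congrArg Subtype.val hi
          · rw [(e1 hR' hT).1 i h3] at hi
            exact absurd (congrArg Subtype.val hi).symm h

theorem top_nestedRoot {c₁ c₂ : ∀ I : Type, I → Prop} {R : {R : Finset I // S.root ∈ R}}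
    {m : {x // x ∈ R.1} → Fin 2} (hc : IsCut (isStar c₂ 0 1) (nestedRoot c₁) S ℓ R m) (i : I)
    (hi : ℓ i ≠ 2) : (S.top R.2 i).1 = S.root := by
  obtain ⟨⟨hT, -⟩, hR, -⟩ := isCut_nestedRoot_iff.mp hc
  by_cases h : i = S.root
  · rw [h, S.top_of_mem R.2 R.2]
  · rcases hT.step i h with h' | h'
    · rw [S.top_of_notMem R.2 (by rw [hR, h'.1]; simp), h'.2, S.top_of_mem R.2 R.2]
    · exact absurd h'.1 hi

/-- The root is alone in its block. So a child of the root must start a block of its own, and the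
root of any other block, whose parent lies in the root block, is a child of the root. -/
theorem mem_iff_of_point_root {R : Finset I} (hR : S.root ∈ R)
    (hs : ∀ ρ ∈ R, S.top hR (S.parent ρ) = ⟨S.root, hR⟩)
    (hp : ∀ i, S.top hR i = ⟨S.root, hR⟩ → i = S.root) (i : I) :
    i ∈ R ↔ i = S.root ∨ S.parent i = S.root := by
  constructor
  · intro hi
    exact Or.inr (hp _ (hs i hi))
  · rintro (rfl | h)
    · exact hR
    · by_contra hi
      have := hp i (by rw [S.top_of_notMem hR hi, h, S.top_of_mem hR hR])
      exact hi (this ▸ hR)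

theorem top_parent_of_mem_iff {R : Finset I} (hR : S.root ∈ R)
    (h : ∀ i, i ∈ R ↔ i = S.root ∨ S.parent i = S.root) (i : I) (hi : i ∈ R) :
    S.top hR (S.parent i) = ⟨S.root, hR⟩ := by
  rcases (h i).mp hi with rfl | h'
  · rw [S.parent_root, S.top_of_mem hR hR]
  · rw [h', S.top_of_mem hR hR]

theorem TwoLevel.of_notMem (H : TwoLevel S ℓ) {R : Finset I} (hR : S.root ∈ R)
    (h : ∀ i, i ∈ R ↔ i = S.root ∨ S.parent i = S.root) {i : I} (hi : i ∉ R) :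
    (S.top hR i).1 = S.parent i ∧ ℓ i = 2 ∧ ℓ (S.parent i) = 1 ∧ S.parent i ≠ S.root := by
  have h1 : i ≠ S.root := fun h' => hi ((h i).mpr (Or.inl h'))
  have h2 : S.parent i ≠ S.root := fun h' => hi ((h i).mpr (Or.inr h'))
  obtain ⟨h3, h4, h5⟩ := H.ne_one_of_two h2 h1
  refine ⟨?_, h3, h4, h2⟩
  rw [S.top_of_notMem hR hi, S.top_of_mem hR ((h _).mpr (Or.inr h5))]

theorem TwoLevel.isPoint_block_root (H : TwoLevel S ℓ) {R : Finset I} (hR : S.root ∈ R)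
    (h : ∀ i, i ∈ R ↔ i = S.root ∨ S.parent i = S.root) :
    isPoint 0 _ (S.block hR ⟨S.root, hR⟩) (fun i => ℓ i) := by
  refine (isPoint_block_iff S hR ℓ _ _).mpr ⟨H.root, fun i hi => ?_⟩
  by_cases h3 : i ∈ R
  · rw [S.top_of_mem hR h3] at hi
    exact congrArg Subtype.val hi
  · obtain ⟨h4, -, -, h5⟩ := H.of_notMem hR h h3
    rw [hi] at h4
    exact absurd h4.symm h5

/-- In a tree satisfying `TwoLevel`, the block of a child `ρ` of the root, when the children of the
root are cut off. -/
theorem TwoLevel.isStar_block (H : TwoLevel S ℓ) {R : Finset I} (hR : S.root ∈ R)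
    (h : ∀ i, i ∈ R ↔ i = S.root ∨ S.parent i = S.root) (ρ : {x // x ∈ R}) (hρ : ℓ ρ = 1)
    (c : ∀ I : Type, I → Prop) (hc : c {i // S.top hR i = ρ} ⟨ρ, S.top_of_mem hR ρ.2⟩) :
    isStar c 1 2 _ (S.block hR ρ) (fun i => ℓ i) := by
  refine (isStar_block_iff S hR ℓ _ _ _ _).mpr ⟨fun i hi h2 => ?_, hρ, hc⟩
  obtain ⟨h4, h5, -, -⟩ := H.of_notMem hR h hi
  rw [h2] at h4
  exact ⟨h4.symm, h5⟩

theorem TwoLevel.isPoint_block (H : TwoLevel S ℓ) {R : Finset I} (hR : S.root ∈ R)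
    (h : ∀ i, i ∈ R ↔ i = S.root ∨ S.parent i = S.root) (ρ : {x // x ∈ R}) {a : Fin 3}
    (hρ : ℓ ρ = a) (h1 : ∀ i, S.parent i = ρ → ρ.1 ≠ S.root → ℓ ρ = 1 → ℓ i ≠ 2) :
    isPoint a _ (S.block hR ρ) (fun i => ℓ i) := by
  refine (isPoint_block_iff S hR ℓ _ _).mpr ⟨hρ, fun i hi => ?_⟩
  by_cases h3 : i ∈ R
  · rw [S.top_of_mem hR h3] at hi
    exact congrArg Subtype.val hi
  · obtain ⟨h4, h5, h6, h7⟩ := H.of_notMem hR h h3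
    rw [hi] at h4
    exact absurd h5 (h1 i h4.symm (h4 ▸ h7) (h4 ▸ h6))

/-- The outer corolla has a root labelled by `0`, and leaves which stand for a vertex labelled by `2`
or a corolla with root `1` and leaves `2`. -/
def nestedLeaves (c : ∀ I : Type, I → Prop) : Fin 2 → LabelPred (Fin 3) :=
  ![isPoint 0, fun I T ℓ => isPoint 2 I T ℓ ∨ isStar c 1 2 I T ℓ]

theorem isSmall_subtype [Finite I] {N : ℕ} (hN : Nat.card I ≤ N) (P : I → Prop) (r : {i // P i}) :
    IsSmall N {i // P i} r := (Finite.card_subtype_le P).trans hN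

open Classical in
-- By `mem_iff_of_point_root` the cut separates the root from its children, and the blocks are the
-- subtrees at the children. They are points `2` or corollas with root `1` and leaves `2` exactly
-- when the tree has two levels. The bounds on sizes hold automatically by `hN`.
theorem isCut_nestedLeaves_iff [Finite I] {N : ℕ} (hN : Nat.card I ≤ N)
    {R : {R : Finset I // S.root ∈ R}} {m : {x // x ∈ R.1} → Fin 2} :
    IsCut (isStar (IsSmall N) 0 1) (nestedLeaves (IsSmall N)) S ℓ R m ↔ TwoLevel S ℓ ∧
      (∀ i, i ∈ R.1 ↔ i = S.root ∨ S.parent i = S.root) ∧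
      (∀ i, m i = if i.1 = S.root then 0 else 1) := by
  obtain ⟨R, hR⟩ := R
  constructor
  · rintro ⟨hW, hQ⟩
    obtain ⟨w1, w2, w3, w4⟩ := (isStar_contract_iff _ _ _ _ _ _).mp hW
    have hm : ∀ i, m i = if i.1 = S.root then 0 else 1 := by
      intro i
      split_ifs with h
      · rw [← w2]; exact congrArg m (Subtype.ext h)
      · exact w3 i h
    have q0 := hQ ⟨S.root, hR⟩
    rw [w2] at q0
    obtain ⟨q1, q2⟩ := (isPoint_block_iff S hR ℓ _ _).mp q0
    have hR' := mem_iff_of_point_root hR w1 q2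
    have q3 : ∀ ρ : {x // x ∈ R}, ρ.1 ≠ S.root → (ℓ ρ = 2 ∧ ∀ i, S.top hR i = ρ → i = ρ) ∨
        ((∀ i, i ∉ R → S.top hR i = ρ → S.parent i = ρ ∧ ℓ i = 2) ∧ ℓ ρ = 1) := by
      intro ρ hρ
      have := hQ ρ
      rw [w3 ρ hρ] at this
      rcases this with h | h
      · exact Or.inl ((isPoint_block_iff S hR ℓ _ _).mp h)
      · obtain ⟨h1, h2, -⟩ := (isStar_block_iff S hR ℓ _ _ _ _).mp h
        exact Or.inr ⟨h1, h2⟩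
    refine ⟨⟨q1, fun i hi => ?_⟩, hR', hm⟩
    by_cases h : i ∈ R
    · have h1 : S.parent i = S.root := ((hR' i).mp h).resolve_left hi
      rcases q3 ⟨i, h⟩ hi with h2 | h2
      · exact Or.inr ⟨h2.1, Or.inl h1⟩
      · exact Or.inl ⟨h2.2, h1⟩
    · have h1 : (S.top hR i).1 ≠ S.root := fun h1 => hi (q2 i (Subtype.ext h1))
      rcases q3 _ h1 with h2 | h2
      · have h3 := h2.2 i rfl
        exact absurd (h3 ▸ (S.top hR i).2) h
      · obtain ⟨h3, h4⟩ := h2.1 i h rfl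
        exact Or.inr ⟨h4, Or.inr (h3 ▸ h2.2)⟩
  · rintro ⟨hT, hR', hm⟩
    refine ⟨(isStar_contract_iff _ _ _ _ _ _).mpr ⟨top_parent_of_mem_iff hR hR', ?_, ?_,
      isSmall_subtype hN _ _⟩, fun ρ => ?_⟩
    · rw [hm, if_pos rfl]
    · intro ρ h
      rw [hm, if_neg h]
    · rw [hm]
      split_ifs with h
      · obtain rfl : ρ = ⟨S.root, hR⟩ := Subtype.ext h
        exact hT.isPoint_block_root hR hR'
      · rcases hT.step ρ h with h1 | h1
        · exact Or.inr (hT.isStar_block hR hR' ρ h1.1 _ (isSmall_subtype hN _ _))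
        · refine Or.inl (hT.isPoint_block hR hR' ρ h1.1 fun i _ _ h2 => ?_)
          rw [h1.1] at h2
          exact absurd h2 (by decide)

/-- The outer corolla has a root labelled by `0`, a marked leaf, labelled by `2`, which stands for a
vertex labelled by `2` or a tree with root `1` and one other vertex `2`, and all other leaves are
labelled by `1`. -/
def nestedMarkedLeaf : Fin 3 → LabelPred (Fin 3) :=
  ![isPoint 0, isPoint 1, fun I T ℓ => isPoint 2 I T ℓ ∨ isStar IsPair 1 2 I T ℓ]

open Classical in
-- The cut is the one at the children of the root. The marked block is the one containing the vertex
-- labelled `2`; the `IsPair` condition says that this vertex is unique, and so is the mark.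
theorem isCut_nestedMarkedLeaf_iff [Finite I] {N : ℕ} (hN : Nat.card I ≤ N)
    {R : {R : Finset I // S.root ∈ R}} {m : {x // x ∈ R.1} → Fin 3} :
    IsCut (isMarkedStar (IsSmall N) 0 1 2) nestedMarkedLeaf S ℓ R m ↔
      (TwoLevel S ℓ ∧ (∃ h : ℓ S.root ≠ 1, IsPair {i // ℓ i ≠ 1} ⟨S.root, h⟩)) ∧
      (∀ i, i ∈ R.1 ↔ i = S.root ∨ S.parent i = S.root) ∧
      (∀ i, m i = if i.1 = S.root then 0 else
        if ∃ k, ℓ k = 2 ∧ (k = i ∨ S.parent k = i) then 2 else 1) := by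
  obtain ⟨R, hR⟩ := R
  constructor
  · rintro ⟨hW, hQ⟩
    obtain ⟨w1, w2, ⟨j, hj, w3, w4⟩, -⟩ := (isMarkedStar_contract_iff _ _ _ _ _ _ _).mp hW
    have q0 := hQ ⟨S.root, hR⟩
    rw [w2] at q0
    obtain ⟨q1, q2⟩ := (isPoint_block_iff S hR ℓ _ _).mp q0
    have hR' := mem_iff_of_point_root hR w1 q2
    have q3 : ∀ ρ : {x // x ∈ R}, ρ.1 ≠ S.root → ρ ≠ j → ℓ ρ = 1 ∧ ∀ i, S.top hR i = ρ → i = ρ := by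
      intro ρ hρ hρ'
      have := hQ ρ
      rw [w4 ρ hρ hρ'] at this
      exact (isPoint_block_iff S hR ℓ _ _).mp this
    have hnot : ∀ i, i ∉ R → S.top hR i = j := by
      intro i hi
      by_contra h
      have h1 : (S.top hR i).1 ≠ S.root := fun h1 => hi ((q2 i (Subtype.ext h1)) ▸ hR)
      exact hi ((q3 _ h1 h).2 i rfl ▸ (S.top hR i).2)
    -- The vertex labelled `2` is the marked leaf or is attached to it, and no other vertex can lie
    -- outside `R`.
    have q4 : ∃ k, ℓ k = 2 ∧ (k = j ∨ S.parent k = j ∧ ℓ j = 1) ∧ ∀ i, i ∉ R → i = k := by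
      have := hQ j
      rw [w3] at this
      rcases this with h | h
      · obtain ⟨h1, h2⟩ := (isPoint_block_iff S hR ℓ _ _).mp h
        refine ⟨j, h1, Or.inl rfl, fun i hi => ?_⟩
        exact h2 i (hnot i hi)
      · obtain ⟨h1, h2, ⟨k, hk⟩, hk1, hk2⟩ := (isStar_block_iff S hR ℓ _ _ _ _).mp h
        have hk3 : k ∉ R := by
          intro h
          rw [S.top_of_mem hR h] at hk
          exact hk1 (Subtype.ext (congrArg Subtype.val hk :))
        obtain ⟨h3, h4⟩ := h1 k hk3 hk
        refine ⟨k, h4, Or.inr ⟨h3, h2⟩, fun i hi => ?_⟩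
        rcases hk2 ⟨i, hnot i hi⟩ with h5 | h5
        · have h6 : i = j := congrArg Subtype.val h5
          exact absurd (h6 ▸ j.2) hi
        · exact congrArg Subtype.val h5
    obtain ⟨k, k1, k2, k3⟩ := q4
    have hjR : S.parent j.1 = S.root := ((hR' j).mp j.2).resolve_left hj
    have h2k : ∀ i, ℓ i = 2 → i = k := by
      intro i hi
      by_cases h : i ∈ R
      · have h1 : i ≠ S.root := fun h => by rw [h, q1] at hi; exact absurd hi (by decide)
        have h2 : (⟨i, h⟩ : {x // x ∈ R}) = j := by
          by_contra h2
          rw [(q3 ⟨i, h⟩ h1 h2).1] at hi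
          exact absurd hi (by decide)
        have h2' : i = j := congrArg Subtype.val h2
        rcases k2 with h3 | h3
        · rw [h3, h2']
        · rw [h2', h3.2] at hi
          exact absurd hi (by decide)
      · exact k3 i h
    have hT : TwoLevel S ℓ := by
      refine ⟨q1, fun i hi => ?_⟩
      by_cases h : i ∈ R
      · have h1 : S.parent i = S.root := ((hR' i).mp h).resolve_left hi
        by_cases h2 : (⟨i, h⟩ : {x // x ∈ R}) = j
        · have h2' : i = j := congrArg Subtype.val h2
          rcases k2 with h3 | h3
          · rw [h2', ← h3]
            exact Or.inr ⟨k1, Or.inl (by rw [h3, ← h2', h1])⟩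
          · exact Or.inl ⟨h2' ▸ h3.2, h1⟩
        · exact Or.inl ⟨(q3 ⟨i, h⟩ hi h2).1, h1⟩
      · obtain rfl := k3 i h
        rcases k2 with h3 | h3
        · exact absurd (h3 ▸ j.2) h
        · exact Or.inr ⟨k1, Or.inr (by rw [h3.1, h3.2])⟩
    have hkr : k ≠ S.root := fun h => by rw [h, q1] at k1; exact absurd k1 (by decide)
    refine ⟨⟨hT, by rw [q1]; decide, ⟨k, by rw [k1]; decide⟩, fun h => hkr (congrArg Subtype.val h),
      fun i => ?_⟩, hR', fun i => ?_⟩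
    · by_cases h : i.1 = S.root
      · exact Or.inl (Subtype.ext h)
      · rcases hT.step i h with h1 | h1
        · exact absurd h1.1 i.2
        · exact Or.inr (Subtype.ext (h2k i h1.1))
    · split_ifs with h h1
      · rw [← w2]; exact congrArg m (Subtype.ext h)
      · obtain ⟨k', h2, h3⟩ := h1
        obtain rfl := h2k k' h2
        have h4 : i = j := by
          refine Subtype.ext ?_
          rcases h3 with h3 | h3 <;> rcases k2 with h5 | h5
          · rw [← h3, h5]
          · refine absurd ?_ (show ¬ (1 : Fin 3) = 2 by decide)
            have h6 : k' ∈ R := h3 ▸ i.2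
            have h7 := ((hR' k').mp h6).resolve_left hkr
            exact absurd (h5.1.symm.trans h7) hj
          · rw [h5, hjR] at h3
            exact absurd h3.symm h
          · rw [← h3, h5.1]
        rw [h4, w3]
      · refine w4 i h fun h2 => h1 ⟨k, k1, ?_⟩
        rw [h2]
        exact k2.imp_right And.left
  · rintro ⟨⟨hT, hr, ⟨k, hk⟩, hk1, hk2⟩, hR', hm⟩
    have hkr : k ≠ S.root := fun h => hk1 (Subtype.ext h)
    have hk3 : ∀ i, ℓ i = 2 → i = k := by
      intro i hi
      rcases hk2 ⟨i, by rw [hi]; decide⟩ with h | h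
      · have : i = S.root := congrArg Subtype.val h
        rw [this, hT.root] at hi
        exact absurd hi (by decide)
      · exact congrArg Subtype.val h
    have hk4 : ℓ k = 2 := by
      rcases hT.step k hkr with h | h
      · exact absurd h.1 hk
      · exact h.1
    have hj : ∃ j : {x // x ∈ R}, j.1 ≠ S.root ∧ (k = j ∨ S.parent k = j) := by
      by_cases h : k ∈ R
      · exact ⟨⟨k, h⟩, hkr, Or.inl rfl⟩
      · obtain ⟨h1, -, -, h2⟩ := hT.of_notMem hR hR' h
        exact ⟨S.top hR k, h1 ▸ h2, Or.inr h1.symm⟩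
    obtain ⟨j, hj1, hj2⟩ := hj
    refine ⟨(isMarkedStar_contract_iff _ _ _ _ _ _ _).mpr ⟨top_parent_of_mem_iff hR hR', ?_,
      ⟨j, hj1, ?_, ?_⟩, isSmall_subtype hN _ _⟩, fun ρ => ?_⟩
    · rw [hm, if_pos rfl]
    · rw [hm, if_neg hj1, if_pos ⟨k, hk4, hj2⟩]
    · intro ρ h h1
      rw [hm, if_neg h, if_neg]
      rintro ⟨k', h2, h3⟩
      obtain rfl := hk3 k' h2
      refine h1 (Subtype.ext ?_)
      rcases h3 with h3 | h3 <;> rcases hj2 with h5 | h5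
      · rw [← h3, h5]
      · have h6 : k' ∈ R := h3 ▸ ρ.2
        have h7 := ((hR' k').mp h6).resolve_left hkr
        exact absurd (h5.symm.trans h7) hj1
      · have h6 : k' ∈ R := h5 ▸ j.2
        have h7 := ((hR' k').mp h6).resolve_left hkr
        exact absurd (h3.symm.trans h7) h
      · rw [← h3, h5]
    · rw [hm]
      split_ifs with h h1
      · obtain rfl : ρ = ⟨S.root, hR⟩ := Subtype.ext h
        exact hT.isPoint_block_root hR hR'
      · obtain ⟨k', h2, h3⟩ := h1
        obtain rfl := hk3 k' h2
        rcases h3 with h3 | h3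
        · refine Or.inl (hT.isPoint_block hR hR' ρ (h3 ▸ h2) fun i _ _ h4 => ?_)
          rw [← h3, h2] at h4
          exact absurd h4 (by decide)
        · have h4 : k' ∉ R := fun h4 =>
            h (h3.symm.trans (((hR' k').mp h4).resolve_left hkr))
          obtain ⟨h5, -, h6, -⟩ := hT.of_notMem hR hR' h4
          refine Or.inr (hT.isStar_block hR hR' ρ (h3 ▸ h6) _
            ⟨⟨k', Subtype.ext (h5.trans h3)⟩, fun h7 => h4 ?_, fun i => ?_⟩)
          · have h8 : k' = ρ := congrArg Subtype.val h7
            exact h8 ▸ ρ.2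
          · by_cases h7 : i.1 ∈ R
            · refine Or.inl (Subtype.ext ?_)
              exact (congrArg Subtype.val ((S.top_of_mem hR h7).symm.trans i.2) : i.1 = ρ)
            · exact Or.inr (Subtype.ext (hk3 i (hT.of_notMem hR hR' h7).2.1))
      · have h2 : ℓ ρ = 1 := by
          rcases hT.step ρ h with h2 | h2
          · exact h2.1
          · exact absurd ⟨ρ.1, h2.1, Or.inl rfl⟩ h1
        exact hT.isPoint_block hR hR' ρ h2 fun i h3 _ _ h4 => h1 ⟨i, h4, Or.inr h3⟩

/-- The outer corolla has a root labelled by `0`, a marked leaf, labelled by `2`, which stands for a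
corolla with root `1` and leaves `2`, and all other leaves are labelled by `1` and stand for a vertex
labelled by `2`. -/
def nestedMarkedStar (c : ∀ I : Type, I → Prop) : Fin 3 → LabelPred (Fin 3) :=
  ![isPoint 0, isPoint 2, isStar c 1 2]

/-- There is exactly one vertex with label `1`; it satisfies `c`, together with the vertices attached
to it, and the root satisfies `c'`, together with the vertices attached to it. -/
def UniqueOne (S : RTree I) (ℓ : I → Fin 3) (c c' : ∀ I : Type, I → Prop) : Prop :=
  ∃ b, b ≠ S.root ∧ (∀ i, ℓ i ≠ 2 ↔ i = S.root ∨ i = b) ∧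
    c {i // i = b ∨ S.parent i = b} ⟨b, Or.inl rfl⟩ ∧
    c' {i // i = S.root ∨ S.parent i = S.root} ⟨S.root, Or.inl rfl⟩

open Classical in
-- Again the cut is the one at the children of the root. The marked block is the subtree at the
-- unique vertex labelled `1`; all other children of the root are points labelled `2`.
theorem isCut_nestedMarkedStar_iff {c c' : ∀ I : Type, I → Prop}
    {R : {R : Finset I // S.root ∈ R}} {m : {x // x ∈ R.1} → Fin 3} :
    IsCut (isMarkedStar c' 0 1 2) (nestedMarkedStar c) S ℓ R m ↔
      (TwoLevel S ℓ ∧ UniqueOne S ℓ c c') ∧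
      (∀ i, i ∈ R.1 ↔ i = S.root ∨ S.parent i = S.root) ∧
      (∀ i, m i = if i.1 = S.root then 0 else if ℓ i = 1 then 2 else 1) := by
  obtain ⟨R, hR⟩ := R
  constructor
  · rintro ⟨hW, hQ⟩
    obtain ⟨w1, w2, ⟨j, hj, w3, w4⟩, w5⟩ := (isMarkedStar_contract_iff _ _ _ _ _ _ _).mp hW
    have q0 := hQ ⟨S.root, hR⟩
    rw [w2] at q0
    obtain ⟨q1, q2⟩ := (isPoint_block_iff S hR ℓ _ _).mp q0
    have hR' := mem_iff_of_point_root hR w1 q2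
    have q3 : ∀ ρ : {x // x ∈ R}, ρ.1 ≠ S.root → ρ ≠ j → ℓ ρ = 2 ∧ ∀ i, S.top hR i = ρ → i = ρ := by
      intro ρ hρ hρ'
      have := hQ ρ
      rw [w4 ρ hρ hρ'] at this
      exact (isPoint_block_iff S hR ℓ _ _).mp this
    have q4 := hQ j
    rw [w3] at q4
    obtain ⟨q4, q5, q6⟩ := (isStar_block_iff S hR ℓ _ _ _ _).mp q4
    have hnot : ∀ i, i ∉ R → S.top hR i = j := by
      intro i hi
      by_contra h
      have h1 : (S.top hR i).1 ≠ S.root := fun h1 => hi ((q2 i (Subtype.ext h1)) ▸ hR)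
      exact hi ((q3 _ h1 h).2 i rfl ▸ (S.top hR i).2)
    have hjR : S.parent j.1 = S.root := ((hR' j).mp j.2).resolve_left hj
    have hT : TwoLevel S ℓ := by
      refine ⟨q1, fun i hi => ?_⟩
      by_cases h : i ∈ R
      · have h1 : S.parent i = S.root := ((hR' i).mp h).resolve_left hi
        by_cases h2 : (⟨i, h⟩ : {x // x ∈ R}) = j
        · have h2' : i = j := congrArg Subtype.val h2
          exact Or.inl ⟨h2' ▸ q5, h1⟩
        · exact Or.inr ⟨(q3 ⟨i, h⟩ hi h2).1, Or.inl h1⟩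
      · obtain ⟨h1, h2⟩ := q4 i h (hnot i h)
        exact Or.inr ⟨h2, Or.inr (by rw [h1, q5])⟩
    have h1 : ∀ i, ℓ i = 1 → i = j := by
      intro i hi
      by_cases h : i ∈ R
      · have h1 : i ≠ S.root := fun h => by rw [h, q1] at hi; exact absurd hi (by decide)
        by_contra h2
        rw [(q3 ⟨i, h⟩ h1 (fun h3 => h2 (congrArg Subtype.val h3))).1] at hi
        exact absurd hi (by decide)
      · rw [(q4 i h (hnot i h)).2] at hi
        exact absurd hi (by decide)
    have hblock : ∀ i, S.top hR i = j ↔ i = j ∨ S.parent i = j := by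
      intro i
      by_cases h : i ∈ R
      · rw [S.top_of_mem hR h]
        constructor
        · intro h2; exact Or.inl (congrArg Subtype.val h2)
        · rintro (h2 | h2)
          · exact Subtype.ext h2
          · rcases (hR' i).mp h with h3 | h3
            · rw [h3, S.parent_root] at h2
              exact absurd h2.symm hj
            · exact absurd (h2.symm.trans h3) hj
      · simp [hnot i h, (q4 i h (hnot i h)).1]
    refine ⟨⟨hT, j, hj, fun i => ⟨fun hi => ?_, ?_⟩, ?_, ?_⟩, hR', fun i => ?_⟩
    · by_cases h : i = S.root
      · exact Or.inl h
      · rcases hT.step i h with h2 | h2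
        · exact Or.inr (h1 i h2.1)
        · exact absurd h2.1 hi
    · rintro (rfl | rfl)
      · rw [q1]; decide
      · rw [q5]; decide
    · exact (subtype_congr_pred c hblock _).mp q6
    · exact (subtype_congr_pred c' hR' _).mp w5
    · split_ifs with h h2
      · rw [← w2]; exact congrArg m (Subtype.ext h)
      · rw [← w3]; exact congrArg m (Subtype.ext (h1 i h2))
      · refine w4 i h fun h3 => h2 ?_
        rw [h3, q5]
  · rintro ⟨⟨hT, b, hb, hb1, hb2, hb3⟩, hR', hm⟩
    have hb4 : ℓ b = 1 ∧ S.parent b = S.root := by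
      rcases hT.step b hb with h | h
      · exact h
      · exact absurd h.1 ((hb1 b).mpr (Or.inr rfl))
    have hbR : b ∈ R := (hR' b).mpr (Or.inr hb4.2)
    have h1 : ∀ i, ℓ i = 1 → i = b := by
      intro i hi
      rcases (hb1 i).mp (by rw [hi]; decide) with h | h
      · rw [h, hT.root] at hi
        exact absurd hi (by decide)
      · exact h
    have hblock : ∀ i, S.top hR i = ⟨b, hbR⟩ ↔ i = b ∨ S.parent i = b := by
      intro i
      by_cases h : i ∈ R
      · rw [S.top_of_mem hR h, Subtype.mk.injEq]
        constructor
        · exact Or.inl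
        · rintro (h2 | h2)
          · exact h2
          · rcases (hR' i).mp h with h3 | h3
            · rw [h3, S.parent_root] at h2
              exact absurd h2.symm hb
            · exact absurd (h2.symm.trans h3) hb
      · obtain ⟨h2, h3, h4, h5⟩ := hT.of_notMem hR hR' h
        have h6 := h1 _ h4
        exact ⟨fun _ => Or.inr h6, fun _ => Subtype.ext (h2.trans h6)⟩
    refine ⟨(isMarkedStar_contract_iff _ _ _ _ _ _ _).mpr ⟨top_parent_of_mem_iff hR hR', ?_,
      ⟨⟨b, hbR⟩, hb, ?_, ?_⟩, (subtype_congr_pred c' hR' _).mpr hb3⟩, fun ρ => ?_⟩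
    · rw [hm, if_pos rfl]
    · rw [hm, if_neg hb, if_pos hb4.1]
    · intro ρ h h2
      rw [hm, if_neg h, if_neg]
      exact fun h3 => h2 (Subtype.ext (h1 _ h3))
    · rw [hm]
      split_ifs with h h2
      · obtain rfl : ρ = ⟨S.root, hR⟩ := Subtype.ext h
        exact hT.isPoint_block_root hR hR'
      · obtain rfl : ρ = ⟨b, hbR⟩ := Subtype.ext (h1 _ h2)
        exact hT.isStar_block hR hR' _ h2 _ ((subtype_congr_pred c hblock _).mpr hb2)
      · have h3 : ℓ ρ = 2 := by
          rcases hT.step ρ h with h3 | h3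
          · exact absurd h3.1 h2
          · exact h3.1
        refine hT.isPoint_block hR hR' ρ h3 fun i _ _ h4 => absurd h4 h2

/-- The block roots and the block labels are prescribed by `P` and `m₀`, so two cuttings coincide.
This is why no multiplicities, and no factorials, appear in the composites. -/
theorem card_cut {Λ Λ' : Type*} [Finite I] {W : LabelPred Λ'} {Q : Λ' → LabelPred Λ} {ℓ : I → Λ}
    {K : Prop} {P : I → Prop} (hr : K → P S.root) (m₀ : I → Λ')
    (h : ∀ R m, IsCut W Q S ℓ R m ↔ K ∧ (∀ i, i ∈ R.1 ↔ P i) ∧ ∀ i, m i = m₀ i.1) [Decidable K] :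
    Nat.card (Cut W Q S ℓ) = if K then 1 else 0 := by
  classical
  cases nonempty_fintype I
  split_ifs with hK
  · rw [Nat.card_eq_one_iff_unique]
    constructor
    · constructor
      rintro ⟨⟨R, m⟩, hx⟩ ⟨⟨R', m'⟩, hx'⟩
      obtain ⟨-, h1, h2⟩ := (h R m).mp hx
      obtain ⟨-, h1', h2'⟩ := (h R' m').mp hx'
      obtain rfl : R = R' := Subtype.ext (Finset.ext fun i => by rw [h1, h1'])
      obtain rfl : m = m' := funext fun i => by rw [h2, h2']
      rfl
    · refine ⟨⟨⟨⟨Finset.univ.filter P, by simp [hr hK]⟩, fun i => m₀ i.1⟩, ?_⟩⟩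
      exact (h _ _).mpr ⟨hK, fun i => by simp, fun i => rfl⟩
  · have : IsEmpty (Cut W Q S ℓ) := ⟨fun x => hK ((h _ _).mp x.2).1⟩
    exact Nat.card_of_isEmpty

end Cuts

/-! ### The submodules `Lᵏ ⊗ I` and the splitting of ideals -/

section Projections

/-- Every ideal of `A` is a direct summand of `A` as a `𝕂`-module. -/
class IdealsSplit (𝕂 : Type*) (A : Type*) [CommRing 𝕂] [CommRing A] [Algebra 𝕂 A] : Prop where
  exists_proj : ∀ I : Ideal A, ∃ π : A →ₗ[𝕂] A, (∀ a, π a ∈ I) ∧ ∀ a ∈ I, π a = a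

variable {𝕂 : Type u} [CommRing 𝕂]

namespace DGMod

variable (M : DGMod.{u, v} 𝕂)

open Classical in
/-- The projection onto the component of degree `k`. -/
def projGr (k : ℤ) : M.carrier →ₗ[𝕂] M.carrier :=
  (M.gr k).subtype ∘ₗ DirectSum.component 𝕂 ℤ (fun k => M.gr k) k ∘ₗ M.equiv.symm.toLinearMap

theorem projGr_mem (k : ℤ) (x : M.carrier) : M.projGr k x ∈ M.gr k := Subtype.mem _

theorem projGr_of_mem {k : ℤ} {x : M.carrier} (hx : x ∈ M.gr k) : M.projGr k x = x := by
  classical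
  have h : M.equiv (DirectSum.lof 𝕂 ℤ (fun k => M.gr k) k ⟨x, hx⟩) = x :=
    DirectSum.coeLinearMap_lof _ _ _
  conv_lhs => rw [← h]
  simp only [projGr, LinearMap.comp_apply, LinearEquiv.coe_coe, LinearEquiv.symm_apply_apply]
  rw [DirectSum.component.lof_self]
  rfl

end DGMod

variable {A : Type w} [CommRing A] [Algebra 𝕂 A]

/-- The submodule `N ⊗ I` of `V ⊗ A`. -/
def extSub {V : Type*} [AddCommGroup V] [Module 𝕂 V] (I : Ideal A) (N : Submodule 𝕂 V) :
    Submodule 𝕂 (A ⊗[𝕂] V) :=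
  LinearMap.range (TensorProduct.map (I.restrictScalars 𝕂).subtype N.subtype)

section ExtSub

variable {V : Type*} [AddCommGroup V] [Module 𝕂 V] {W : Type*} [AddCommGroup W] [Module 𝕂 W]

theorem tmul_mem_extSub {I : Ideal A} {N : Submodule 𝕂 V} {a : A} {x : V} (ha : a ∈ I)
    (hx : x ∈ N) : a ⊗ₜ[𝕂] x ∈ extSub I N := ⟨⟨a, ha⟩ ⊗ₜ ⟨x, hx⟩, rfl⟩

theorem extSub_induction {I : Ideal A} {N : Submodule 𝕂 V} {P : A ⊗[𝕂] V → Prop}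
    (h0 : P 0) (hadd : ∀ x y, P x → P y → P (x + y))
    (ht : ∀ a ∈ I, ∀ x ∈ N, P (a ⊗ₜ x)) {x : A ⊗[𝕂] V} (hx : x ∈ extSub I N) : P x := by
  obtain ⟨y, rfl⟩ := hx
  induction y using TensorProduct.induction_on with
  | zero => rwa [map_zero]
  | tmul a x => exact ht a a.2 x x.2
  | add x y hx hy => rw [map_add]; exact hadd _ _ hx hy

theorem extSub_mono {I J : Ideal A} {N N' : Submodule 𝕂 V} (h : I ≤ J) (h' : N ≤ N') :
    extSub I N ≤ extSub J N' := fun _ hx =>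
  extSub_induction (zero_mem _) (fun _ _ => add_mem)
    (fun _ ha _ hy => tmul_mem_extSub (h ha) (h' hy)) hx

theorem extSub_bot (N : Submodule 𝕂 V) : extSub (⊥ : Ideal A) N = ⊥ := by
  rw [eq_bot_iff]
  intro x hx
  refine extSub_induction (zero_mem _) (fun _ _ => add_mem) (fun a ha y _ => ?_) hx
  rw [Ideal.mem_bot.mp ha, TensorProduct.zero_tmul]
  exact zero_mem _

theorem map_mem_extSub {I J : Ideal A} {N : Submodule 𝕂 V} {N' : Submodule 𝕂 W} {π : A →ₗ[𝕂] A}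
    {g : V →ₗ[𝕂] W} (hπ : ∀ a ∈ I, π a ∈ J) (hg : ∀ x ∈ N, g x ∈ N') {x : A ⊗[𝕂] V}
    (hx : x ∈ extSub I N) : TensorProduct.map π g x ∈ extSub J N' := by
  refine extSub_induction (P := fun x => TensorProduct.map π g x ∈ extSub J N') ?_ ?_ ?_ hx
  · rw [map_zero]; exact zero_mem _
  · intro x y hx hy; rw [map_add]; exact add_mem hx hy
  · intro a ha x hx
    rw [TensorProduct.map_tmul]
    exact tmul_mem_extSub (hπ a ha) (hg x hx)

theorem lTensor_mem_extSub {I : Ideal A} {N : Submodule 𝕂 V} {N' : Submodule 𝕂 W}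
    {g : V →ₗ[𝕂] W} (hg : ∀ x ∈ N, g x ∈ N') {x : A ⊗[𝕂] V}
    (hx : x ∈ extSub I N) : g.lTensor A x ∈ extSub I N' :=
  map_mem_extSub (π := LinearMap.id) (fun _ h => h) hg hx

theorem map_eq_self_of_mem_extSub {I : Ideal A} {N : Submodule 𝕂 V} {π : A →ₗ[𝕂] A}
    {g : V →ₗ[𝕂] V} (hπ : ∀ a ∈ I, π a = a) (hg : ∀ x ∈ N, g x = x) {x : A ⊗[𝕂] V}
    (hx : x ∈ extSub I N) : TensorProduct.map π g x = x := by
  refine extSub_induction (P := fun x => TensorProduct.map π g x = x) (map_zero _) ?_ ?_ hx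
  · intro x y hx hy; rw [map_add, hx, hy]
  · intro a ha x hx; rw [TensorProduct.map_tmul, hπ a ha, hg x hx]

theorem mem_extSub_top (x : A ⊗[𝕂] V) : x ∈ extSub (⊤ : Ideal A) (⊤ : Submodule 𝕂 V) := by
  induction x using TensorProduct.induction_on with
  | zero => exact zero_mem _
  | tmul a x => exact tmul_mem_extSub trivial trivial
  | add x y hx hy => exact add_mem hx hy

/-- Turns membership in `N ⊗ I` into a fixed-point equation. Projections onto the ideals of `A` are
required for this purpose. -/
theorem mem_extSub_of_map_eq {I : Ideal A} {N : Submodule 𝕂 V} {π : A →ₗ[𝕂] A}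
    {g : V →ₗ[𝕂] V} (hπ : ∀ a, π a ∈ I) (hg : ∀ x, g x ∈ N) {x : A ⊗[𝕂] V}
    (hx : TensorProduct.map π g x = x) : x ∈ extSub I N := by
  rw [← hx]
  exact map_mem_extSub (fun a _ => hπ a) (fun x _ => hg x) (mem_extSub_top x)

end ExtSub

/-- Choose preimages in the modules `I j ⊗ N j`. On the tensor product of these, the composite with
the quotient map modulo `extSub (∏ j, I j) N'` is linear and vanishes on pure tensors. -/
theorem collapse_tprod_mem {V : Type*} [AddCommGroup V] [Module 𝕂 V] {J : Type*} [Fintype J]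
    {I : J → Ideal A} {N : J → Submodule 𝕂 V} {N' : Submodule 𝕂 (⨂[𝕂] _ : J, V)}
    (hN : ∀ v : J → V, (∀ j, v j ∈ N j) → PiTensorProduct.tprod 𝕂 v ∈ N')
    {x : J → A ⊗[𝕂] V} (hx : ∀ j, x j ∈ extSub (I j) (N j)) :
    collapse (PiTensorProduct.tprod 𝕂 x) ∈ extSub (∏ j, I j) N' := by
  classical
  choose y hy using hx
  let f : (⨂[𝕂] j, ((I j).restrictScalars 𝕂 ⊗[𝕂] N j)) →ₗ[𝕂] A ⊗[𝕂] (⨂[𝕂] _ : J, V) :=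
    collapse ∘ₗ PiTensorProduct.map fun j =>
      TensorProduct.map ((I j).restrictScalars 𝕂).subtype (N j).subtype
  have hf : (extSub (∏ j, I j) N').mkQ ∘ₗ f = 0 := by
    refine PiTensorProduct.ext_of_span_eq_top (γ := fun j => (I j).restrictScalars 𝕂 × N j)
      (g := fun j x => x.1 ⊗ₜ[𝕂] x.2) (fun j => ?_) fun c => ?_
    · rw [← TensorProduct.span_tmul_eq_top]
      congr 1
      ext z
      simp only [Set.mem_range, Prod.exists, Set.mem_ofPred_eq]
    · simp only [f, LinearMap.comp_apply, PiTensorProduct.map_tprod, TensorProduct.map_tmul,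
        LinearMap.zero_apply, Submodule.mkQ_apply, Submodule.Quotient.mk_eq_zero]
      rw [collapse_tprod]
      exact tmul_mem_extSub (Ideal.prod_mem_prod fun j _ => (c j).1.2) (hN _ fun j => (c j).2.2)
  have h1 := LinearMap.congr_fun hf (PiTensorProduct.tprod 𝕂 y)
  simp only [f, LinearMap.comp_apply, PiTensorProduct.map_tprod,
        LinearMap.zero_apply, Submodule.mkQ_apply, Submodule.Quotient.mk_eq_zero] at h1
  rw [funext hy] at h1
  exact h1

theorem exists_lTensor_ker [Module.Flat 𝕂 A] {V W : Type*} [AddCommGroup V] [Module 𝕂 V]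
    [AddCommGroup W] [Module 𝕂 W] (c : V →ₗ[𝕂] W) {x : A ⊗[𝕂] V} (hx : c.lTensor A x = 0) :
    ∃ y, (LinearMap.ker c).subtype.lTensor A y = x :=
  (Module.Flat.lTensor_exact A (LinearMap.exact_subtype_ker_map c) x).mp hx

namespace GammaAlg

variable (L : GammaAlg.{u, v} 𝕂)

/-- The component `Lᵏ ⊗ I` of `L ⊗ A`. -/
def extE (I : Ideal A) (k : ℤ) : Submodule 𝕂 (L.Ext A) := extSub I (L.M.gr k)

theorem tprod_mem_tensorGr {M : DGMod.{u, v} 𝕂} {J : Type*} [Fintype J] {κ : J → ℤ}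
    {x : J → M.carrier} (hx : ∀ j, x j ∈ M.gr (κ j)) :
    PiTensorProduct.tprod 𝕂 x ∈ M.tensorGr (I := J) (∑ j, κ j) :=
  Submodule.subset_span ⟨κ, x, hx, rfl, rfl⟩

variable [Module.Flat 𝕂 A]

/-- The structure map of `L ⊗ A` preserves degrees. -/
theorem lTensor_projGr_extL {k : ℤ} {f : Gamma 𝕂 (L.Ext A)}
    (hf : ∀ n (T : RTree (Fin n)), collapse (Gamma.coeff T f) ∈
      extSub (⊤ : Ideal A) (L.M.tensorGr (I := Fin n) k)) :
    (L.M.projGr k).lTensor A (L.extL f) = L.extL f := by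
  classical
  -- The part of `l` outside degree `k`. In each arity it vanishes on the kernel of the map `c n`
  -- below, which reads the coefficients modulo degree `k`; by flatness the kernel of `c n` tensored
  -- with `A` comes from that kernel.
  let q : Gamma 𝕂 L.M.carrier →ₗ[𝕂] L.M.carrier := L.l - L.M.projGr k ∘ₗ L.l
  suffices hq : q.lTensor A (Gamma.scalars f) = 0 by
    have h1 : q.lTensor A = L.l.lTensor A - (L.M.projGr k).lTensor A ∘ₗ L.l.lTensor A := by
      rw [← LinearMap.lTensor_comp, ← LinearMap.lTensor_sub]
    rw [h1, LinearMap.sub_apply, sub_eq_zero] at hq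
    exact hq.symm
  let inc (n : ℕ) : GammaPart 𝕂 L.M.carrier n →ₗ[𝕂] Gamma 𝕂 L.M.carrier :=
    DirectSum.lof 𝕂 ℕ (fun n => GammaPart 𝕂 L.M.carrier n) n
  let cmp (n : ℕ) : Gamma 𝕂 L.M.carrier →ₗ[𝕂] GammaPart 𝕂 L.M.carrier n :=
    DirectSum.component 𝕂 ℕ (fun n => GammaPart 𝕂 L.M.carrier n) n
  have hcoeff : ∀ n m (T : RTree (Fin n)) (g : GammaPart 𝕂 L.M.carrier m),
      Gamma.coeff T (inc m g) = if h : m = n then (h ▸ g).1 T else 0 := by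
    intro n m T g
    change ((DirectSum.lof 𝕂 ℕ (fun n => GammaPart 𝕂 L.M.carrier n) m g) n).1 T = _
    split_ifs with h
    · subst h
      rw [DirectSum.lof_eq_of, DirectSum.of_eq_same]
    · rw [DirectSum.lof_eq_of, DirectSum.of_eq_of_ne _ _ _ (Ne.symm h)]
      rfl
  let c (n : ℕ) : GammaPart 𝕂 L.M.carrier n →ₗ[𝕂]
      (RTree (Fin n) → (⨂[𝕂] _ : Fin n, L.M.carrier) ⧸ L.M.tensorGr (I := Fin n) k) :=
    LinearMap.pi fun T => (L.M.tensorGr (I := Fin n) k).mkQ ∘ₗ LinearMap.proj T ∘ₗ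
      (GammaPart 𝕂 L.M.carrier n).subtype
  have hz : ∀ n, (q ∘ₗ inc n) ∘ₗ (LinearMap.ker (c n)).subtype = 0 := by
    intro n
    refine LinearMap.ext fun g => ?_
    have hg : ∀ T, g.1.1 T ∈ L.M.tensorGr (I := Fin n) k := fun T => by
      have := congrFun (LinearMap.mem_ker.mp g.2) T
      exact (Submodule.Quotient.mk_eq_zero _).mp this
    have : L.l (inc n g.1) ∈ L.M.gr k := by
      refine L.l_mem k _ fun m T => ?_
      rw [hcoeff]
      split_ifs with h
      · subst h
        exact hg T
      · exact zero_mem _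
    change L.l (inc n g.1) - L.M.projGr k (L.l (inc n g.1)) = 0
    rw [L.M.projGr_of_mem this, sub_self]
  have hn : ∀ n, (q ∘ₗ inc n ∘ₗ cmp n).lTensor A (Gamma.scalars f) = 0 := by
    intro n
    have h1 : (c n).lTensor A ((cmp n).lTensor A (Gamma.scalars f)) = 0 := by
      refine lTensor_proj_inj (M := L.M.carrier) _ fun T => ?_
      rw [← LinearMap.lTensor_comp_apply, ← LinearMap.lTensor_comp_apply]
      have h2 : (LinearMap.proj T ∘ₗ c n) ∘ₗ cmp n =
        (L.M.tensorGr (I := Fin n) k).mkQ ∘ₗ Gamma.coeff T := rfl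
      rw [h2, LinearMap.lTensor_comp_apply, Gamma.lTensor_coeff_scalars]
      have h3 := lTensor_mem_extSub (N' := ⊥) (g := (L.M.tensorGr (I := Fin n) k).mkQ)
        (fun x hx => (Submodule.Quotient.mk_eq_zero _).mpr hx) (hf n T)
      refine extSub_induction (P := fun z => z = 0) rfl ?_ ?_ h3
      · rintro x y rfl rfl; exact add_zero 0
      · intro a _ x hx
        rw [(Submodule.mem_bot _).mp hx, TensorProduct.tmul_zero]
    obtain ⟨y, hy⟩ := exists_lTensor_ker (c n) h1
    rw [← LinearMap.comp_assoc, LinearMap.lTensor_comp_apply, ← hy, ← LinearMap.lTensor_comp_apply,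
      hz, LinearMap.lTensor_zero, LinearMap.zero_apply]
  -- An element of `A ⊗ Γ(PreLie, L)` involves finitely many arities, which can then be treated
  -- separately.
  have hsum : ∀ x : A ⊗[𝕂] Gamma 𝕂 L.M.carrier, ∃ N, x =
      ∑ n ∈ Finset.range N, (inc n ∘ₗ cmp n).lTensor A x := by
    have h1 : ∀ g : Gamma 𝕂 L.M.carrier, ∃ N, ∀ M, N ≤ M → g =
        ∑ n ∈ Finset.range M, inc n (cmp n g) := by
      intro g
      obtain ⟨N, hN⟩ := Gamma.exists_coeff_eq_zero g
      refine ⟨N, fun M hM => Gamma.ext fun n T => ?_⟩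
      rw [map_sum]
      simp only [hcoeff]
      rw [Finset.sum_eq_single n]
      · rw [dif_pos rfl]; rfl
      · intro b _ hb
        rw [dif_neg hb]
      · intro hn
        rw [dif_pos rfl]
        refine hN n ?_ T
        rw [Finset.mem_range] at hn
        omega
    intro x
    have h2 : ∃ N, ∀ M, N ≤ M → x = ∑ n ∈ Finset.range M, (inc n ∘ₗ cmp n).lTensor A x := by
      induction x using TensorProduct.induction_on with
      | zero => exact ⟨0, fun M _ => by simp⟩
      | tmul a g =>
        obtain ⟨N, hN⟩ := h1 g
        refine ⟨N, fun M hM => ?_⟩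
        simp only [LinearMap.lTensor_tmul, ← TensorProduct.tmul_sum]
        congr 1
        exact hN M hM
      | add x y hx hy =>
        obtain ⟨N, hN⟩ := hx
        obtain ⟨N', hN'⟩ := hy
        refine ⟨max N N', fun M hM => ?_⟩
        simp only [map_add, Finset.sum_add_distrib]
        rw [← hN M (le_of_max_le_left hM), ← hN' M (le_of_max_le_right hM)]
    obtain ⟨N, hN⟩ := h2
    exact ⟨N, hN N le_rfl⟩
  obtain ⟨N, hN⟩ := hsum (Gamma.scalars f)
  rw [hN, map_sum]
  refine Finset.sum_eq_zero fun n _ => ?_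
  rw [← LinearMap.lTensor_comp_apply]
  exact hn n

/-- The value is fixed by a projection of `A` onto `I`, which commutes with every map coming from
`L`, and by the projection of `L` onto degree `k`. Together these detect `Lᵏ ⊗ I`. -/
theorem extL_mem [IdealsSplit 𝕂 A] {I : Ideal A} {k : ℤ} {f : Gamma 𝕂 (L.Ext A)}
    (hf : ∀ n (T : RTree (Fin n)), collapse (Gamma.coeff T f) ∈
      extSub I (L.M.tensorGr (I := Fin n) k)) : L.extL f ∈ L.extE I k := by
  obtain ⟨π, h1, h2⟩ := IdealsSplit.exists_proj (𝕂 := 𝕂) I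
  have h3 : π.rTensor (Gamma 𝕂 L.M.carrier) (Gamma.scalars f) = Gamma.scalars f := by
    refine Gamma.scalars_ext fun n T => ?_
    rw [← LinearMap.comp_apply, LinearMap.lTensor_comp_rTensor, ← LinearMap.rTensor_comp_lTensor,
      LinearMap.comp_apply, Gamma.lTensor_coeff_scalars]
    exact map_eq_self_of_mem_extSub h2 (fun _ _ => rfl) (hf n T)
  have h4 : π.rTensor L.M.carrier (L.extL f) = L.extL f := by
    unfold extL
    conv_rhs => rw [← h3]
    rw [← LinearMap.comp_apply, ← LinearMap.comp_apply, LinearMap.lTensor_comp_rTensor,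
      LinearMap.rTensor_comp_lTensor]
  have h5 := L.lTensor_projGr_extL (k := k) (f := f) fun n T => extSub_mono le_top le_rfl (hf n T)
  refine mem_extSub_of_map_eq (g := L.M.projGr k) h1 (L.M.projGr_mem k) ?_
  rw [← LinearMap.rTensor_comp_lTensor, LinearMap.comp_apply, h5, h4]

/-- Coefficients enter the structure map only after the elements of `A` in them have been
multiplied. Hence those whose products of scalars fall into a vanishing power of `𝔪` may be ignored.
-/
theorem extL_eq_of_coeff {f g : Gamma 𝕂 (L.Ext A)}
    (h : ∀ n (T : RTree (Fin n)), collapse (Gamma.coeff T f) = collapse (Gamma.coeff T g)) :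
    L.extL f = L.extL g := by
  unfold extL
  have h1 : Gamma.scalars f = Gamma.scalars g := Gamma.scalars_ext fun n T => by
    rw [Gamma.lTensor_coeff_scalars, Gamma.lTensor_coeff_scalars, h n T]
  rw [h1]

end GammaAlg

end Projections

/-! ### Invariance, odd labels and parities of the predicates -/

section StarPredicates

variable {Λ : Type*}

theorem RTree.map_parent {I J : Type*} (T : RTree I) (e : I ≃ J) (i : I) :
    (T.map e).parent (e i) = e (T.parent i) := by
  change e (T.parent (e.symm (e i))) = _
  rw [e.symm_apply_apply]

/-- The predicate on pointed sets is compatible with bijections. -/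
def IsInvariant (c : ∀ I : Type, I → Prop) : Prop :=
  ∀ (I J : Type) (e : I ≃ J) (r : I), c J (e r) ↔ c I r

theorem isInvariant_isSmall (N : ℕ) : IsInvariant (IsSmall N) := fun I J e r => by
  unfold IsSmall
  rw [Nat.card_congr e]

theorem isInvariant_card (n : ℕ) : IsInvariant (fun I _ => Nat.card I = n) := fun I J e r => by
  dsimp only
  rw [Nat.card_congr e]

theorem isInvariant_isPair : IsInvariant IsPair := fun I J e r => by
  unfold IsPair
  rw [← e.exists_congr_right]
  refine exists_congr fun j => ?_
  rw [← e.forall_congr_right]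
  simp only [ne_eq, e.apply_eq_iff_eq]

theorem card_of_isPair {I : Type} {r : I} (h : IsPair I r) : Nat.card I = 2 := by
  obtain ⟨j, hj, h⟩ := h
  rw [Nat.card_eq_two_iff]
  exact ⟨r, j, hj.symm, Set.eq_univ_of_forall fun i => h i⟩

theorem isPair_of_card {I : Type} (r : I) (h : Nat.card I = 2) : IsPair I r := by
  obtain ⟨x, y, hxy, h⟩ := Nat.card_eq_two_iff.mp h
  have h1 : ∀ i, i = x ∨ i = y := fun i => by
    have : i ∈ ({x, y} : Set I) := h ▸ Set.mem_univ i
    exact this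
  rcases h1 r with rfl | rfl
  · exact ⟨y, hxy.symm, h1⟩
  · exact ⟨x, hxy, fun i => (h1 i).symm⟩

theorem isNatural_isPoint (a : Λ) : (isPoint a).IsNatural := fun I J e T ℓ => by
  unfold isPoint
  rw [T.root_map e, ← e.forall_congr_right]
  simp only [e.apply_eq_iff_eq, Function.comp_apply]

theorem isNatural_isStar {c : ∀ I : Type, I → Prop} (hc : IsInvariant c) (a b : Λ) :
    (isStar c a b).IsNatural := fun I J e T ℓ => by
  unfold isStar
  rw [T.root_map e, ← e.forall_congr_right, ← e.forall_congr_right (q := fun i => i ≠ e T.root → _)]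
  simp only [T.map_parent e, ne_eq, e.apply_eq_iff_eq, Function.comp_apply, hc I J e T.root]

theorem isNatural_isMarkedStar {c : ∀ I : Type, I → Prop} (hc : IsInvariant c) (a b b' : Λ) :
    (isMarkedStar c a b b').IsNatural := fun I J e T ℓ => by
  unfold isMarkedStar
  rw [T.root_map e, ← e.forall_congr_right, ← e.exists_congr_right]
  simp only [T.map_parent e, ne_eq, e.apply_eq_iff_eq, Function.comp_apply, hc I J e T.root,
    ← e.forall_congr_right (q := fun i => ¬ i = e T.root → _)]

/-- The label `b` is even, or the sets satisfying `c` have at most one element different from the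
base point. -/
def LeafCond (c : ∀ I : Type, I → Prop) (q : ZMod 2) : Prop :=
  q = 0 ∨ ∀ I r, c I r → ∀ i j : I, i ≠ r → j ≠ r → i = j

theorem leafCond_isPair (q : ZMod 2) : LeafCond IsPair q := by
  refine Or.inr fun I r h i j hi hj => ?_
  obtain ⟨k, hk, h⟩ := h
  rw [(h i).resolve_left hi, (h j).resolve_left hj]

variable {p : Λ → ZMod 2} {I : Type} {T : RTree I} {ℓ : I → Λ} {c : ∀ I : Type, I → Prop} {a b b' : Λ}

theorem oddInjective_isPoint (h : isPoint a I T ℓ) : OddInjective p ℓ := fun i j _ _ => by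
  rw [(h i).1, (h j).1]

theorem oddInjective_isStar (hab : a ≠ b) (hc : LeafCond c (p b)) (h : isStar c a b I T ℓ) :
    OddInjective p ℓ := by
  obtain ⟨-, h1, h2, h3⟩ := h
  intro i j hi hij
  by_cases hir : i = T.root <;> by_cases hjr : j = T.root
  · rw [hir, hjr]
  · rw [hir, h1, h2 j hjr] at hij; exact absurd hij hab
  · rw [hjr, h1, h2 i hir] at hij; exact absurd hij.symm hab
  · rcases hc with hc | hc
    · rw [h2 i hir, hc] at hi; exact absurd hi (by decide)
    · exact hc _ _ h3 i j hir hjr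

theorem oddInjective_isMarkedStar (hab : a ≠ b) (hab' : a ≠ b')
    (hc : LeafCond c (p b)) (h : isMarkedStar c a b b' I T ℓ) : OddInjective p ℓ := by
  obtain ⟨-, h1, ⟨k, hk, h4, h2⟩, h3⟩ := h
  have hne : ∀ i, i ≠ T.root → ℓ i ≠ a := by
    intro i hi
    by_cases hik : i = k
    · rw [hik, h4]; exact hab'.symm
    · rw [h2 i hi hik]; exact hab.symm
  intro i j hi hij
  by_cases hir : i = T.root <;> by_cases hjr : j = T.root
  · rw [hir, hjr]
  · rw [hir, h1] at hij; exact absurd hij.symm (hne j hjr)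
  · rw [hjr, h1] at hij; exact absurd hij (hne i hir)
  · rcases hc with hc | hc
    · have : ∀ i, i ≠ T.root → p (ℓ i) = 1 → i = k := by
        intro i h5 h6
        by_contra h7
        rw [h2 i h5 h7, hc] at h6
        exact absurd h6 (by decide)
      rw [this i hir hi, this j hjr (hij ▸ hi)]
    · exact hc _ _ h3 i j hir hjr

variable [Fintype I]

theorem sum_isPoint (h : isPoint a I T ℓ) : ∑ i, p (ℓ i) = p a := by
  rw [Finset.sum_eq_single T.root (fun i _ hi => absurd (h i).1 hi) (by simp), (h _).2]

theorem sum_isStar_of_even (hb : p b = 0) (h : isStar c a b I T ℓ) : ∑ i, p (ℓ i) = p a := by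
  rw [Finset.sum_eq_single T.root (fun i _ hi => by rw [h.2.2.1 i hi, hb]) (by simp), h.2.1]

theorem sum_isStar_isPair {M : Type*} [AddCommMonoid M] {p : Λ → M} (h : isStar IsPair a b I T ℓ) :
    ∑ i, p (ℓ i) = p a + p b := by
  classical
  obtain ⟨-, h1, h2, j, hj, h3⟩ := h
  have : (Finset.univ : Finset I) = {T.root, j} := by
    ext i
    simpa using h3 i
  rw [this, Finset.sum_pair hj.symm, h1, h2 j hj]

end StarPredicates

/-! ### Existence of the elements, and the corollas among them -/

section Existence

variable {𝕂 : Type*} [CommRing 𝕂] {V : Type*} [AddCommGroup V] [Module 𝕂 V] [SuperModule 𝕂 V]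
  {Λ : Type*} [LinearOrder Λ] [Fintype Λ] {v : Λ → V} {p : Λ → ZMod 2}
  {c : ∀ I : Type, I → Prop} {a b b' : Λ}

theorem exists_isRep_isStar (hv : IsHom 𝕂 p v) (hi : IsInvariant c) (hab : a ≠ b)
    (hc : LeafCond c (p b)) (N : ℕ) (hN : ∀ I r, c I r → Nat.card I ≤ N) :
    ∃ g : Gamma 𝕂 V, IsRep v p (isStar c a b) g :=
  exists_isRep hv (isNatural_isStar hi a b) (fun _ _ _ _ h => oddInjective_isStar hab hc h) (N + 1)
    fun n T ℓ h => by
      have := hN _ _ h.2.2.2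
      rw [Nat.card_fin] at this
      omega

theorem exists_isRep_isMarkedStar (hv : IsHom 𝕂 p v) (hi : IsInvariant c) (hab : a ≠ b)
    (hab' : a ≠ b') (hc : LeafCond c (p b)) (N : ℕ)
    (hN : ∀ I r, c I r → Nat.card I ≤ N) :
    ∃ g : Gamma 𝕂 V, IsRep v p (isMarkedStar c a b b') g :=
  exists_isRep hv (isNatural_isMarkedStar hi a b b')
    (fun _ _ _ _ h => oddInjective_isMarkedStar hab hab' hc h) (N + 1)
    fun n T ℓ h => by
      have := hN _ _ h.2.2.2
      rw [Nat.card_fin] at this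
      omega

theorem coeff_of_eq (n : ℕ) (g : GammaPart 𝕂 V n) (T : RTree (Fin n)) :
    Gamma.coeff T (DirectSum.of (fun n => GammaPart 𝕂 V n) n g : Gamma 𝕂 V) = g.1 T := by
  change ((DirectSum.of (fun n => GammaPart 𝕂 V n) n g) n).1 T = _
  rw [DirectSum.of_eq_same]

theorem coeff_of_ne {n m : ℕ} (h : n ≠ m) (g : GammaPart 𝕂 V m) (T : RTree (Fin n)) :
    Gamma.coeff T (DirectSum.of (fun n => GammaPart 𝕂 V n) m g : Gamma 𝕂 V) = 0 := by
  change ((DirectSum.of (fun n => GammaPart 𝕂 V n) m g) n).1 T = _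
  rw [DirectSum.of_eq_of_ne _ _ _ h]
  rfl

theorem coeff_corolla {n : ℕ} (x : V) {y : V} (h : part 𝕂 1 y = 0 ∨ n ≤ 1)
    (T : RTree (Fin (n + 1))) :
    Gamma.coeff T (corolla (𝕂 := 𝕂) n x y) = corollaCoeff n x y T := by
  have h1 : (corolla n x y : Gamma 𝕂 V) = DirectSum.of (fun n => GammaPart 𝕂 V n) (n + 1)
      ⟨corollaCoeff n x y, corollaCoeff_mem x h⟩ := dif_pos (corollaCoeff_mem x h)
  rw [h1]
  exact coeff_of_eq _ _ _

theorem coeff_corolla_of_ne {n m : ℕ} (x : V) {y : V} (h : part 𝕂 1 y = 0 ∨ n ≤ 1)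
    (hm : m ≠ n + 1) (T : RTree (Fin m)) : Gamma.coeff T (corolla (𝕂 := 𝕂) n x y) = 0 := by
  have h1 : (corolla n x y : Gamma 𝕂 V) = DirectSum.of (fun n => GammaPart 𝕂 V n) (n + 1)
      ⟨corollaCoeff n x y, corollaCoeff_mem x h⟩ := dif_pos (corollaCoeff_mem x h)
  rw [h1]
  exact coeff_of_ne hm _ _

theorem isRep_unit (hv : IsHom 𝕂 p v) (a : Λ) : IsRep v p (isPoint a) (Gamma.unit (𝕂 := 𝕂) (v a)) := by
  refine isRep_of_coeff hv (isNatural_isPoint a) (fun _ _ _ _ h => oddInjective_isPoint h)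
    fun n T => ?_
  by_cases hn : n = 1
  · subst hn
    have h1 : ∀ ℓ : Fin 1 → Λ, isPoint a _ T ℓ ↔ ℓ = fun _ => a := fun ℓ =>
      ⟨fun h => funext fun i => (h i).2, fun h i => ⟨Subsingleton.elim _ _, by rw [h]⟩⟩
    rw [labelSum_eq_single _ _ h1, Gamma.unit, coeff_of_eq]
    have : labelSign p (fun _ : Fin 1 => a) = 1 := by
      unfold labelSign
      rw [show lexOrd (fun _ : Fin 1 => a) = fun i j => i < j from
        funext fun i => funext fun j => propext ⟨fun h => h.elim (fun h => absurd h (lt_irrefl _))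
          fun h => h.2, fun h => Or.inr ⟨rfl, h⟩⟩]
      exact koszulSign_self isOrd_lt _
    rw [this]
    simp
  · rw [Gamma.unit, coeff_of_ne hn, labelSum_eq_zero]
    intro ℓ h
    apply hn
    have h1 : n ≤ 1 := by
      by_contra h2
      have h3 := (h ⟨0, by omega⟩).1.trans (h ⟨1, by omega⟩).1.symm
      simp at h3
    have h2 : n ≠ 0 := by
      rintro rfl
      exact T.root.elim0
    omega

/-- With at most one odd element of each label, and the root of a smaller label than the leaves, the
sign of a corolla is that of moving the root to the first place. -/
theorem isRep_corolla (hv : IsHom 𝕂 p v) (hab : a < b) {n : ℕ} (hn : p b = 0 ∨ n ≤ 1) :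
    IsRep v p (isStar (fun I _ => Nat.card I = n + 1) a b) (corolla (𝕂 := 𝕂) n (v a) (v b)) := by
  classical
  have hpart : part 𝕂 1 (v b) = 0 ∨ n ≤ 1 := hn.imp_left fun h => by
    have := proj_of_isHom hv 1 b
    rw [h] at this
    exact this
  have hcond : LeafCond (fun I (_ : I) => Nat.card I = n + 1) (p b) := by
    refine hn.imp_right fun h I r hI i j hi hj => ?_
    by_contra hij
    have : Finite I := Nat.finite_of_card_ne_zero (by omega)
    cases nonempty_fintype I
    have h1 : ({r, i, j} : Finset I).card = 3 := Finset.card_eq_three.mpr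
      ⟨r, i, j, hi.symm, hj.symm, hij, rfl⟩
    have h2 := Finset.card_le_univ ({r, i, j} : Finset I)
    rw [← Nat.card_eq_fintype_card, hI] at h2
    omega
  refine isRep_of_coeff hv (isNatural_isStar (isInvariant_card _) a b)
    (fun _ _ _ _ h => oddInjective_isStar hab.ne hcond h) fun m T => ?_
  by_cases hm : m = n + 1
  swap
  · rw [coeff_corolla_of_ne _ hpart hm, labelSum_eq_zero]
    intro ℓ h
    exact hm (by simpa using h.2.2.2)
  subst hm
  rw [coeff_corolla _ hpart]
  unfold corollaCoeff
  split_ifs with hT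
  swap
  · rw [labelSum_eq_zero _ _ fun ℓ h => hT h.1]
  have h1 : ∀ ℓ : Fin (n + 1) → Λ, isStar (fun I _ => Nat.card I = n + 1) a b _ T ℓ ↔
      ℓ = fun i => if i = T.root then a else b := by
    intro ℓ
    refine ⟨fun h => funext fun i => ?_, ?_⟩
    · split_ifs with hi
      · rw [hi, h.2.1]
      · exact h.2.2.1 i hi
    · rintro rfl
      exact ⟨hT, if_pos rfl, fun i hi => if_neg hi, by simp⟩
  have hs := (h1 _).mpr rfl
  rw [labelSum_eq_single _ _ h1]
  set ℓ : Fin (n + 1) → Λ := fun i => if i = T.root then a else b with hℓ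
  have h2 : (fun i => if i = T.root then v a else v b) = fun i => v (ℓ i) := by
    funext i
    rw [hℓ]
    dsimp only
    split_ifs <;> rfl
  have h3 : IsHom 𝕂 (fun i => p (ℓ i)) (fun i => v (ℓ i)) := fun i => hv (ℓ i)
  have hodd := oddInjective_isStar hab.ne hcond hs
  rw [h2, koszul_tprod _ _ h3]
  congr 3
  -- The root has the smallest label and two different leaves are never both odd, so the order with
  -- the root in front agrees with that of the labels on odd pairs.
  refine koszulSign_congr_odd fun i j hi hj => ?_
  rw [hodd.lexOrd_iff j hi]
  have hr : ∀ i, ℓ i = if i = T.root then a else b := fun i => rfl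
  constructor
  · rintro (⟨h4, h5⟩ | ⟨h4, h5, h6⟩)
    · rwa [hr i, hr j, if_pos h4, if_neg h5]
    · have := hodd i j hi (by rw [hr i, hr j, if_neg h4, if_neg h5])
      exact absurd h6 (this ▸ lt_irrefl _)
  · intro h4
    by_cases h5 : i = T.root <;> by_cases h6 : j = T.root
    · rw [h5, h6] at h4; exact absurd h4 (lt_irrefl _)
    · exact Or.inl ⟨h5, h6⟩
    · rw [hr i, hr j, if_neg h5, if_pos h6] at h4; exact absurd hab h4.asymm
    · rw [hr i, hr j, if_neg h5, if_neg h6] at h4; exact absurd h4 (lt_irrefl _)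

theorem isRep_corolla_one (hv : IsHom 𝕂 p v) (hab : a < b) :
    IsRep v p (isStar IsPair a b) (corolla (𝕂 := 𝕂) 1 (v a) (v b)) :=
  (isRep_corolla hv hab (Or.inr le_rfl)).congr fun I _ T ℓ => by
    unfold isStar
    refine and_congr_right fun _ => and_congr_right fun _ => and_congr_right fun _ => ?_
    exact ⟨fun h => isPair_of_card _ h, card_of_isPair⟩

/-- A corolla with `n` leaves has `n + 1` vertices, so the range `n < N` corresponds to trees with
at most `N` vertices. -/
theorem isRep_sum_corolla (hv : IsHom 𝕂 p v) (hab : a < b) (hb : p b = 0) (N : ℕ) :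
    IsRep v p (isStar (IsSmall N) a b) (∑ n ∈ Finset.range N, corolla (𝕂 := 𝕂) n (v a) (v b)) := by
  have h0 : ∀ (I : Type) [Finite I] (T : RTree I), Nat.card I ≠ 0 := fun I _ T =>
    Nat.card_ne_zero.mpr ⟨⟨T.root⟩, inferInstance⟩
  induction N with
  | zero =>
    intro I _ _ T
    rw [Finset.range_zero, Finset.sum_empty, map_zero, labelSum_eq_zero]
    intro ℓ h
    exact h0 I T (Nat.le_zero.mp h.2.2.2)
  | succ N ih =>
    rw [Finset.sum_range_succ]
    refine (ih.add (isRep_corolla hv hab (Or.inl hb)) ?_).congr ?_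
    · intro I T ℓ h h'
      have h1 : Nat.card I ≤ N := h.2.2.2
      have h2 : Nat.card I = N + 1 := h'.2.2.2
      omega
    · intro I _ T ℓ
      have : IsSmall (N + 1) I T.root ↔ IsSmall N I T.root ∨ Nat.card I = N + 1 := by
        unfold IsSmall; omega
      unfold isStar
      rw [this]
      tauto

end Existence

/-! ### Linearity of corollas -/

section CorollaLinear

variable {𝕂 : Type*} [CommRing 𝕂] {V : Type*} [AddCommGroup V] [Module 𝕂 V] [SuperModule 𝕂 V]

theorem corollaCoeff_add_left (n : ℕ) (x x' y : V) (T : RTree (Fin (n + 1))) :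
    (corollaCoeff n (x + x') y T : ⨂[𝕂] _ : Fin (n + 1), V) =
      corollaCoeff n x y T + corollaCoeff n x' y T := by
  classical
  unfold corollaCoeff
  split_ifs with h
  · rw [← map_add]
    congr 1
    have h1 : ∀ z : V, (fun i => if i = T.root then z else y) =
        Function.update (fun _ => y) T.root z := fun z => by
      funext i
      by_cases hi : i = T.root
      · subst hi; simp
      · simp [hi]
    simp only [h1, MultilinearMap.map_update_add]
  · rw [add_zero]

theorem corollaCoeff_one_add_right (x y y' : V) (T : RTree (Fin (1 + 1))) :
    (corollaCoeff 1 x (y + y') T : ⨂[𝕂] _ : Fin (1 + 1), V) =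
      corollaCoeff 1 x y T + corollaCoeff 1 x y' T := by
  classical
  unfold corollaCoeff
  split_ifs with h
  · rw [← map_add]
    congr 1
    -- Of the two vertices, the leaf is `T.root + 1`, computed modulo `2`.
    have h1 : ∀ z : V, (fun i => if i = T.root then x else z) =
        Function.update (fun _ => x) (T.root + 1) z := fun z => by
      funext i
      have h2 : ∀ i r : Fin 2, i = r ∨ (i = r + 1 ∧ i ≠ r) := by decide
      have h3 : ∀ r : Fin 2, r ≠ r + 1 := by decide
      rcases h2 i T.root with hi | ⟨hi, hi'⟩
      · rw [if_pos hi, Function.update_of_ne]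
        rw [hi]
        exact h3 _
      · rw [if_neg hi', hi, Function.update_self]
    simp only [h1, MultilinearMap.map_update_add]
  · rw [add_zero]

theorem corollaCoeff_zero_right {n : ℕ} (hn : n ≠ 0) (x : V) (T : RTree (Fin (n + 1))) :
    (corollaCoeff n x 0 T : ⨂[𝕂] _ : Fin (n + 1), V) = 0 := by
  classical
  unfold corollaCoeff
  split_ifs with h
  · have : ∃ i, i ≠ T.root := by
      have : Nontrivial (Fin (n + 1)) := Fin.nontrivial_iff_two_le.mpr (by omega)
      exact exists_ne _
    obtain ⟨i, hi⟩ := this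
    rw [MultilinearMap.map_coord_zero _ i (if_neg hi), map_zero]
  · rfl

theorem corolla_zero (x y : V) : (corolla 0 x y : Gamma 𝕂 V) = Gamma.unit x := by
  classical
  have : Subsingleton (Fin (0 + 1)) := inferInstanceAs (Subsingleton (Fin 1))
  refine Gamma.ext fun n T => ?_
  by_cases hn : n = 1
  · subst hn
    rw [coeff_corolla x (Or.inr zero_le_one), Gamma.unit, coeff_of_eq]
    unfold corollaCoeff
    rw [if_pos fun i => Subsingleton.elim _ _]
    have h1 : (rootFirst T.root : Fin 1 → Fin 1 → Prop) = fun i j => i < j := by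
      funext i j
      have hi : i = T.root := Subsingleton.elim _ _
      have hj : j = T.root := Subsingleton.elim _ _
      subst hi
      rw [hj]
      simp [rootFirst]
    rw [h1, koszul_self isOrd_lt]
    congr 1
    funext i
    exact if_pos (Subsingleton.elim _ _)
  · rw [coeff_corolla_of_ne x (Or.inr zero_le_one) hn, Gamma.unit, coeff_of_ne hn]

theorem corolla_add_left {n : ℕ} (x x' : V) {y : V} (h : part 𝕂 1 y = 0 ∨ n ≤ 1) :
    (corolla n (x + x') y : Gamma 𝕂 V) = corolla n x y + corolla n x' y := by
  refine Gamma.ext fun m T => ?_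
  rw [map_add]
  by_cases hm : m = n + 1
  · subst hm
    rw [coeff_corolla _ h, coeff_corolla _ h, coeff_corolla _ h, corollaCoeff_add_left]
  · rw [coeff_corolla_of_ne _ h hm, coeff_corolla_of_ne _ h hm, coeff_corolla_of_ne _ h hm, add_zero]

theorem corolla_one_add_right (x y y' : V) :
    (corolla 1 x (y + y') : Gamma 𝕂 V) = corolla 1 x y + corolla 1 x y' := by
  refine Gamma.ext fun m T => ?_
  rw [map_add]
  by_cases hm : m = 1 + 1
  · subst hm
    rw [coeff_corolla _ (Or.inr le_rfl), coeff_corolla _ (Or.inr le_rfl),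
      coeff_corolla _ (Or.inr le_rfl), corollaCoeff_one_add_right]
  · rw [coeff_corolla_of_ne _ (Or.inr le_rfl) hm, coeff_corolla_of_ne _ (Or.inr le_rfl) hm,
      coeff_corolla_of_ne _ (Or.inr le_rfl) hm, add_zero]

theorem corolla_zero_right {n : ℕ} (hn : n ≠ 0) (x : V) : (corolla n x 0 : Gamma 𝕂 V) = 0 := by
  have h : part 𝕂 1 (0 : V) = 0 ∨ n ≤ 1 := Or.inl (map_zero _)
  refine Gamma.ext fun m T => ?_
  rw [map_zero]
  by_cases hm : m = n + 1
  · subst hm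
    rw [coeff_corolla _ h, corollaCoeff_zero_right hn]
  · rw [coeff_corolla_of_ne _ h hm]

end CorollaLinear

/-! ### Products and sums over the vertices of a labelled corolla -/

section Products

variable {Λ : Type*} {I : Type} [Fintype I] {T : RTree I} {ℓ : I → Λ} {c : ∀ I : Type, I → Prop} {a b : Λ}

theorem prod_isStar {M : Type*} [CommMonoid M] (f : Λ → M) (h : isStar c a b I T ℓ) :
    ∏ i, f (ℓ i) = f a * f b ^ (Fintype.card I - 1) := by
  classical
  rw [← Finset.mul_prod_erase _ _ (Finset.mem_univ T.root), h.2.1,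
    Finset.prod_congr rfl fun i hi => by rw [h.2.2.1 i (Finset.ne_of_mem_erase hi)],
    Finset.prod_const, Finset.card_erase_of_mem (Finset.mem_univ _), Finset.card_univ]

theorem sum_isStar {M : Type*} [AddCommMonoid M] (f : Λ → M) (h : isStar c a b I T ℓ) :
    ∑ i, f (ℓ i) = f a + (Fintype.card I - 1) • f b := by
  classical
  rw [← Finset.add_sum_erase _ _ (Finset.mem_univ T.root), h.2.1,
    Finset.sum_congr rfl fun i hi => by rw [h.2.2.1 i (Finset.ne_of_mem_erase hi)],
    Finset.sum_const, Finset.card_erase_of_mem (Finset.mem_univ _), Finset.card_univ]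

end Products

/-! ### The operations of `L ⊗ A` and their behaviour under ideals -/

section Operations

variable {𝕂 : Type u} [CommRing 𝕂] {A : Type w} [CommRing A] [Algebra 𝕂 A] (L : GammaAlg.{u, v} 𝕂)

namespace GammaAlg

variable {L}

theorem part_of_mem_extE {I : Ideal A} {k : ℤ} {x : L.Ext A} (hx : x ∈ L.extE I k) :
    part 𝕂 (k : ZMod 2) x = x :=
  extSub_induction (P := fun x => part 𝕂 (k : ZMod 2) x = x) (map_zero _)
    (fun x y hx hy => by rw [map_add, hx, hy])
    (fun a _ x hx => by
      change a ⊗ₜ[𝕂] L.M.parity k x = _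
      rw [L.M.parity_of_mem _ hx, if_pos rfl]) hx

theorem part_one_of_mem_extE {I : Ideal A} {x : L.Ext A} (hx : x ∈ L.extE I 0) :
    part 𝕂 1 x = 0 := by
  have h := SuperModule.proj_proj (𝕂 := 𝕂) 1 ((0 : ℤ) : ZMod 2) x
  rw [show SuperModule.proj (𝕂 := 𝕂) ((0 : ℤ) : ZMod 2) x = x from part_of_mem_extE hx] at h
  exact h.trans (if_neg (by decide))

theorem extE_mono {I J : Ideal A} (h : I ≤ J) {k : ℤ} {x : L.Ext A} (hx : x ∈ L.extE I k) :
    x ∈ L.extE J k := extSub_mono h le_rfl hx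

theorem extD_mem {I : Ideal A} {k : ℤ} {x : L.Ext A} (hx : x ∈ L.extE I k) :
    L.extD x ∈ L.extE I (k + 1) := lTensor_mem_extSub (L.M.d_mem k) hx

variable (L) in
theorem extD_extD (x : L.Ext A) : L.extD (L.extD x) = 0 := by
  unfold extD
  rw [← LinearMap.lTensor_comp_apply, show L.M.d ∘ₗ L.M.d = 0 from LinearMap.ext L.M.d_d,
    LinearMap.lTensor_zero, LinearMap.zero_apply]

/-- At least `N` factors have scalars in `𝔪`, so the product of all scalars lies in `𝔪 ^ N = 0`. -/
theorem collapse_tprod_eq_zero {𝔪 : Ideal A} {N : ℕ} (hN : 𝔪 ^ N = ⊥) {V : Type*} [AddCommGroup V]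
    [Module 𝕂 V] {J : Type*} [Fintype J] (s : Finset J) (hs : N ≤ s.card) {x : J → A ⊗[𝕂] V}
    (hx : ∀ j ∈ s, x j ∈ extSub 𝔪 (⊤ : Submodule 𝕂 V)) :
    collapse (PiTensorProduct.tprod 𝕂 x) = 0 := by
  classical
  have h := collapse_tprod_mem (𝕂 := 𝕂) (I := fun j => if j ∈ s then 𝔪 else ⊤)
    (N := fun _ => (⊤ : Submodule 𝕂 V)) (N' := ⊤) (x := x) (fun _ _ => trivial) fun j => by
      split_ifs with hj
      · exact hx j hj
      · exact mem_extSub_top _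
  have h1 : (∏ j, if j ∈ s then 𝔪 else ⊤) = (⊥ : Ideal A) := by
    rw [← Ideal.one_eq_top, Finset.prod_ite_mem, Finset.univ_inter, Finset.prod_const, eq_bot_iff, ← hN]
    exact Ideal.pow_le_pow_right hs
  rw [h1, extSub_bot] at h
  exact (Submodule.mem_bot _).mp h

variable [Module.Flat 𝕂 A]

theorem extL_add (f g : Gamma 𝕂 (L.Ext A)) : L.extL (f + g) = L.extL f + L.extL g :=
  map_add (L.extLₗ A) f g

/-- The unit is additive as the corolla without leaves; this reduces its compatibility with
`scalars` to pure tensors. -/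
theorem extL_unit (x : L.Ext A) : L.extL (Gamma.unit (𝕂 := 𝕂) x) = x := by
  let U : L.M.carrier →ₗ[𝕂] Gamma 𝕂 L.M.carrier :=
    { toFun := Gamma.unit
      map_add' := fun x y => by
        rw [← corolla_zero x 0, ← corolla_zero y 0, ← corolla_zero (x + y) 0,
          corolla_add_left _ _ (Or.inr zero_le_one)]
      map_smul' := fun c x => Gamma.ext fun n T => by
        rw [RingHom.id_apply, map_smul]
        by_cases hn : n = 1
        · subst hn
          rw [Gamma.unit, Gamma.unit, coeff_of_eq, coeff_of_eq]
          have := (PiTensorProduct.tprod 𝕂).map_smul_univ (fun _ : Fin 1 => c) fun _ => x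
          simpa using this
        · rw [Gamma.unit, Gamma.unit, coeff_of_ne hn, coeff_of_ne hn, smul_zero] }
  have h1 : ∀ x, Gamma.scalars (Gamma.unit (𝕂 := 𝕂) x) = U.lTensor A x := by
    intro x
    induction x using TensorProduct.induction_on with
    | zero =>
      rw [map_zero, ← corolla_zero _ (0 : L.Ext A)]
      have : (corolla 0 (0 : L.Ext A) 0 : Gamma 𝕂 (L.Ext A)) = 0 := by
        have := corolla_add_left (𝕂 := 𝕂) (0 : L.Ext A) 0 (Or.inr zero_le_one) (n := 0) (y := 0)
        rw [add_zero] at this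
        exact left_eq_add.mp this
      rw [this]
      exact map_zero (Gamma.scalarsₗ 𝕂 A L.M.carrier)
    | add x y hx hy =>
      rw [map_add, ← hx, ← hy, ← corolla_zero x (0 : L.Ext A), ← corolla_zero y (0 : L.Ext A),
        ← corolla_zero (x + y) (0 : L.Ext A), corolla_add_left _ _ (Or.inr zero_le_one)]
      exact map_add (Gamma.scalarsₗ 𝕂 A L.M.carrier) _ _
    | tmul a x =>
      refine Gamma.scalars_ext fun n T => ?_
      rw [Gamma.lTensor_coeff_scalars, LinearMap.lTensor_tmul, LinearMap.lTensor_tmul]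
      change _ = a ⊗ₜ[𝕂] Gamma.coeff T (Gamma.unit x)
      by_cases hn : n = 1
      · subst hn
        rw [Gamma.unit, Gamma.unit, coeff_of_eq, coeff_of_eq, collapse_tprod]
        simp
      · rw [Gamma.unit, Gamma.unit, coeff_of_ne hn, coeff_of_ne hn, map_zero,
          TensorProduct.tmul_zero]
  unfold extL
  rw [h1, ← LinearMap.lTensor_comp_apply, show L.l ∘ₗ U = LinearMap.id from LinearMap.ext L.l_unit,
    LinearMap.lTensor_id, LinearMap.id_apply]

theorem brace_zero (x y : L.Ext A) : L.brace 0 x y = x := by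
  unfold brace
  rw [corolla_zero, extL_unit]

theorem brace_add_left {n : ℕ} (x x' : L.Ext A) {y : L.Ext A} (h : part 𝕂 1 y = 0 ∨ n ≤ 1) :
    L.brace n (x + x') y = L.brace n x y + L.brace n x' y := by
  unfold brace
  rw [corolla_add_left _ _ h, extL_add]

variable (L A) in
/-- The operation `x{y}₁` as a biadditive map. -/
def braceHom : L.Ext A →+ L.Ext A →+ L.Ext A :=
  AddMonoidHom.mk' (fun x => AddMonoidHom.mk' (L.brace 1 x) fun y y' => by
    unfold brace
    rw [corolla_one_add_right, extL_add]) fun x x' => AddMonoidHom.ext fun y =>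
      brace_add_left x x' (Or.inr le_rfl)

theorem braceHom_apply (x y : L.Ext A) : braceHom A L x y = L.brace 1 x y := rfl

theorem brace_zero_right {n : ℕ} (hn : n ≠ 0) (x : L.Ext A) : L.brace n x 0 = 0 := by
  unfold brace
  rw [corolla_zero_right hn]
  exact map_zero (L.extLₗ A)

theorem circ_zero (x : L.Ext A) : L.circ x 0 = x := by
  unfold circ
  rw [finsum_eq_single _ 0 fun n hn => brace_zero_right hn x, brace_zero]

/-- The leaves alone contribute a factor in `𝔪 ^ n`, so nothing is required of `x`. This makes the
sum defining `circ` finite. -/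
theorem brace_eq_zero {𝔪 : Ideal A} {N : ℕ} (hN : 𝔪 ^ N = ⊥) (x : L.Ext A) {y : L.Ext A}
    (hy : y ∈ L.extE 𝔪 0) {n : ℕ} (hn : N ≤ n) : L.brace n x y = 0 := by
  classical
  have hp : part 𝕂 1 y = 0 ∨ n ≤ 1 := Or.inl (part_one_of_mem_extE hy)
  refine (L.extL_eq_of_coeff (g := 0) fun m T => ?_).trans (map_zero (L.extLₗ A))
  rw [map_zero, map_zero]
  by_cases hm : m = n + 1
  · subst hm
    rw [coeff_corolla _ hp]
    unfold corollaCoeff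
    split_ifs with h
    · simp only [koszul, LinearMap.sum_apply, LinearMap.smul_apply, map_sum, map_smul,
        PiTensorProduct.map_tprod]
      refine Finset.sum_eq_zero fun p _ => ?_
      rw [collapse_tprod_eq_zero hN (Finset.univ.erase T.root) (by simpa using hn), smul_zero]
      intro j hj
      rw [if_neg (Finset.ne_of_mem_erase hj)]
      exact lTensor_mem_extSub (fun _ _ => Submodule.mem_top) hy
    · exact map_zero _
  · rw [coeff_corolla_of_ne _ hp hm, map_zero]

theorem circ_eq_sum {𝔪 : Ideal A} {N : ℕ} (hN : 𝔪 ^ N = ⊥) (x : L.Ext A) {y : L.Ext A}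
    (hy : y ∈ L.extE 𝔪 0) {M : ℕ} (hM : N ≤ M) :
    L.circ x y = ∑ n ∈ Finset.range M, L.brace n x y := by
  unfold circ
  refine finsum_eq_sum_of_support_subset _ fun n hn => ?_
  by_contra h
  exact hn (brace_eq_zero hN x hy (hM.trans (by simpa using h)))

theorem circ_eq_extL {𝔪 : Ideal A} {N : ℕ} (hN : 𝔪 ^ N = ⊥) (x : L.Ext A) {y : L.Ext A}
    (hy : y ∈ L.extE 𝔪 0) : L.circ x y = L.extL (∑ n ∈ Finset.range N, corolla n x y) := by
  rw [circ_eq_sum hN x hy le_rfl]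
  exact (map_sum (L.extLₗ A) _ _).symm

theorem circ_add {𝔪 : Ideal A} {N : ℕ} (hN : 𝔪 ^ N = ⊥) (x x' : L.Ext A) {y : L.Ext A}
    (hy : y ∈ L.extE 𝔪 0) : L.circ (x + x') y = L.circ x y + L.circ x' y := by
  rw [circ_eq_sum hN _ hy le_rfl, circ_eq_sum hN _ hy le_rfl, circ_eq_sum hN _ hy le_rfl,
    ← Finset.sum_add_distrib]
  exact Finset.sum_congr rfl fun n _ => brace_add_left _ _ (Or.inl (part_one_of_mem_extE hy))

theorem circ_sub {𝔪 : Ideal A} {N : ℕ} (hN : 𝔪 ^ N = ⊥) (x x' : L.Ext A) {y : L.Ext A}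
    (hy : y ∈ L.extE 𝔪 0) : L.circ (x - x') y = L.circ x y - L.circ x' y :=
  map_sub (AddMonoidHom.mk' (fun x => L.circ x y) fun x x' => circ_add hN x x' hy) x x'

theorem zero_circ {𝔪 : Ideal A} {N : ℕ} (hN : 𝔪 ^ N = ⊥) {y : L.Ext A}
    (hy : y ∈ L.extE 𝔪 0) : L.circ 0 y = 0 :=
  map_zero (AddMonoidHom.mk' (fun x => L.circ x y) fun x x' => circ_add hN x x' hy)

variable [IdealsSplit 𝕂 A]

/-- Along an admissible labelling the ideals multiply and the degrees add. -/
theorem extL_mem_of_isRep {Λ : Type*} [LinearOrder Λ] [Fintype Λ] {v : Λ → L.Ext A} {p : Λ → ZMod 2}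
    {Q : LabelPred Λ} {g : Gamma 𝕂 (L.Ext A)} (hg : IsRep v p Q g) {I : Λ → Ideal A} {κ : Λ → ℤ}
    (hv : ∀ a, v a ∈ L.extE (I a) (κ a)) {J : Ideal A} {k : ℤ}
    (hJ : ∀ n (T : RTree (Fin n)) ℓ, Q _ T ℓ → ∏ i, I (ℓ i) ≤ J ∧ ∑ i, κ (ℓ i) = k) :
    L.extL g ∈ L.extE J k := by
  classical
  refine L.extL_mem fun n T => ?_
  rw [hg.coeff_eq, labelSum, map_sum]
  refine Submodule.sum_mem _ fun ℓ _ => ?_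
  rw [map_smul]
  split_ifs with h
  · obtain ⟨h1, h2⟩ := hJ n T ℓ h
    refine Submodule.smul_mem _ _ (extSub_mono h1 le_rfl (collapse_tprod_mem
      (N := fun i => L.M.gr (κ (ℓ i))) (fun x hx => ?_) fun i => hv (ℓ i)))
    rw [← h2]
    exact tprod_mem_tensorGr hx
  · rw [zero_smul]
    exact zero_mem _

theorem brace_mem {I J : Ideal A} {k l : ℤ} {x y : L.Ext A} (hx : x ∈ L.extE I k)
    (hy : y ∈ L.extE J l) {n : ℕ} (hn : (l : ZMod 2) = 0 ∨ n ≤ 1) :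
    L.brace n x y ∈ L.extE (I * J ^ n) (k + n * l) := by
  have hv : IsHom 𝕂 ![(k : ZMod 2), (l : ZMod 2)] ![x, y] := fun i => by
    fin_cases i
    · exact part_of_mem_extE hx
    · exact part_of_mem_extE hy
  refine extL_mem_of_isRep (isRep_corolla hv (a := 0) (b := 1) (by decide) hn) (I := ![I, J])
    (κ := ![k, l]) (fun i => ?_) fun m T ℓ h => ?_
  · fin_cases i
    · exact hx
    · exact hy
  · have hm : m = n + 1 := by simpa using h.2.2.2
    rw [prod_isStar _ h, sum_isStar _ h, Fintype.card_fin, hm]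
    simp

theorem brace_one_mem {I J : Ideal A} {k l : ℤ} {x y : L.Ext A} (hx : x ∈ L.extE I k)
    (hy : y ∈ L.extE J l) : L.brace 1 x y ∈ L.extE (I * J) (k + l) := by
  have := brace_mem hx hy (n := 1) (Or.inr le_rfl)
  rwa [pow_one, Nat.cast_one, one_mul] at this

/-- The term for `n = 0` is `x`, and every other term contains a factor from `J`. Thus `⊚ (1 + y)`
is the identity to first order, on which all the successive approximations rely. -/
theorem circ_sub_mem {𝔪 : Ideal A} {N : ℕ} (hN : 𝔪 ^ N = ⊥) {I J : Ideal A} {k : ℤ} {x y : L.Ext A}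
    (hx : x ∈ L.extE I k) (hJ : J ≤ 𝔪) (hy : y ∈ L.extE J 0) :
    L.circ x y - x ∈ L.extE (I * J) k := by
  rw [circ_eq_sum hN x (extE_mono hJ hy) (Nat.le_succ N), Finset.sum_range_succ', brace_zero,
    add_sub_cancel_right]
  refine Submodule.sum_mem _ fun n _ => ?_
  have := brace_mem hx hy (n := n + 1) (Or.inl (by simp))
  rw [mul_zero, add_zero] at this
  exact extE_mono (Ideal.mul_mono_right (Ideal.pow_le_self (Nat.succ_ne_zero n))) this

theorem circ_mem {𝔪 : Ideal A} {N : ℕ} (hN : 𝔪 ^ N = ⊥) {I : Ideal A} {k : ℤ} {x y : L.Ext A}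
    (hx : x ∈ L.extE I k) (hy : y ∈ L.extE 𝔪 0) : L.circ x y ∈ L.extE I k := by
  have := add_mem (extE_mono Ideal.mul_le_left (circ_sub_mem hN hx le_rfl hy)) hx
  rwa [sub_add_cancel] at this

end GammaAlg

end Operations

/-! ### Coefficients of composites of corollas -/

section Composites

variable {𝕂 : Type*} [CommRing 𝕂] {V : Type*} [AddCommGroup V] [Module 𝕂 V] [SuperModule 𝕂 V]

/-- The multiplicities in `mulCoeff_eq` are `0` or `1` by `card_cut`, so that a composite is again a
sum over labelled trees. -/
theorem coeff_mul_eq {Λ Λ' : Type*} [LinearOrder Λ] [LinearOrder Λ'] [Fintype Λ] [Fintype Λ']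
    {v : Λ → V} {p : Λ → ZMod 2} (hv : IsHom 𝕂 p v) {G : Λ' → Gamma 𝕂 V}
    {P : Λ' → ZMod 2} {Q : Λ' → LabelPred Λ} {W : LabelPred Λ'} {F : Gamma 𝕂 (Gamma 𝕂 V)}
    (hF : IsRep G P W F) (hG : ∀ a, IsRep v p (Q a) (G a))
    (hP : ∀ (a : Λ') (J : Type) [Fintype J] (B : RTree J) ℓ, Q a J B ℓ → ∑ i, p (ℓ i) = P a)
    {n : ℕ} (S : RTree (Fin n)) {K : (Fin n → Λ) → Prop} {Pr : (Fin n → Λ) → Fin n → Prop}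
    (hr : ∀ ℓ, K ℓ → Pr ℓ S.root) (m₀ : (Fin n → Λ) → Fin n → Λ')
    (h : ∀ ℓ R m, IsCut W Q S ℓ R m ↔ K ℓ ∧ (∀ i, i ∈ R.1 ↔ Pr ℓ i) ∧ ∀ i, m i = m₀ ℓ i.1)
    (hodd : ∀ ℓ, K ℓ → OddInjective p ℓ)
    (hord : ∀ ℓ R m, IsCut W Q S ℓ R m → ∀ i j, p (ℓ i) = 1 → p (ℓ j) = 1 → ℓ i < ℓ j →
      m (S.top R.2 i) < m (S.top R.2 j) ∨ S.top R.2 i = S.top R.2 j) :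
    Gamma.coeff S (Gamma.mul F) = labelSum 𝕂 v p K := by
  classical
  rw [Gamma.coeff_mul, mulCoeff_eq hv hF hG hP S (fun ℓ R m hc => hodd ℓ ((h ℓ R m).mp hc).1) hord,
    labelSum]
  refine Finset.sum_congr rfl fun ℓ _ => ?_
  rw [card_cut (hr ℓ) (m₀ ℓ) (h ℓ)]
  congr 1
  split_ifs <;> simp

theorem TwoLevel.oddInjective {I : Type} {S : RTree I} {ℓ : I → Fin 3} (H : TwoLevel S ℓ)
    {p : Fin 3 → ZMod 2} (h1 : p 1 = 0 ∨ ∀ i j, ℓ i = 1 → ℓ j = 1 → i = j)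
    (h2 : p 2 = 0 ∨ ∀ i j, ℓ i = 2 → ℓ j = 2 → i = j) : OddInjective p ℓ := by
  have h0 : ∀ i, ℓ i = 0 → i = S.root := fun i hi => by
    by_contra h
    rcases H.step i h with h | h <;> rw [hi] at h <;> exact absurd h.1 (by decide)
  have h3 : ∀ a : Fin 3, a = 0 ∨ a = 1 ∨ a = 2 := by decide
  intro i j hi hij
  rcases h3 (ℓ i) with h | h | h
  · rw [h0 i h, h0 j (hij ▸ h)]
  · rcases h1 with h1 | h1
    · rw [h, h1] at hi; exact absurd hi (by decide)
    · exact h1 i j h (hij ▸ h)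
  · rcases h2 with h2 | h2
    · rw [h, h2] at hi; exact absurd hi (by decide)
    · exact h2 i j h (hij ▸ h)

theorem TwoLevel.eq_root {I : Type} {S : RTree I} {ℓ : I → Fin 3} (H : TwoLevel S ℓ) {i : I}
    (hi : ℓ i = 0) : i = S.root := by
  by_contra h
  rcases H.step i h with h | h <;> rw [hi] at h <;> exact absurd h.1 (by decide)

/-- The labels of a two-level tree for a composite with outer root first. -/
theorem TwoLevel.lt_or_eq {I : Type} {S : RTree I} {ℓ : I → Fin 3} (H : TwoLevel S ℓ)
    {Λ' : Type*} [LinearOrder Λ'] {R : {R : Finset I // S.root ∈ R}} {m : {x // x ∈ R.1} → Λ'}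
    {a : Λ'} (h0 : ∀ i : {x // x ∈ R.1}, i.1 = S.root → m i = a)
    (h1 : ∀ i : {x // x ∈ R.1}, i.1 ≠ S.root → a < m i) {i j : I} (hi : ℓ i = 0) :
    m (S.top R.2 i) < m (S.top R.2 j) ∨ S.top R.2 i = S.top R.2 j := by
  have h2 : S.top R.2 i = ⟨S.root, R.2⟩ := by
    rw [H.eq_root hi]; exact S.top_of_mem R.2 R.2
  rw [h2]
  by_cases h3 : (S.top R.2 j).1 = S.root
  · exact Or.inr (Subtype.ext h3.symm)
  · exact Or.inl (by rw [h0 _ rfl]; exact h1 _ h3)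

variable {v : Fin 3 → V} {p : Fin 3 → ZMod 2} {n : ℕ}

theorem isRep_nestedRoot (hv : IsHom 𝕂 p v) {c : ∀ I : Type, I → Prop} {g : Gamma 𝕂 V}
    (hg : IsRep v p (isStar c 0 1) g) (a : Fin 2) :
    IsRep v p (nestedRoot c a) (![g, Gamma.unit (v 2)] a) := by
  fin_cases a
  · exact hg
  · exact isRep_unit hv 2

theorem isRep_nestedLeaves (hv : IsHom 𝕂 p v) {c : ∀ I : Type, I → Prop} {g : Gamma 𝕂 V}
    (hg : IsRep v p (isStar c 1 2) g) (a : Fin 2) :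
    IsRep v p (nestedLeaves c a) (![Gamma.unit (v 0), Gamma.unit (v 2) + g] a) := by
  fin_cases a
  · exact isRep_unit hv 0
  · refine (isRep_unit hv 2).add hg fun I T ℓ h h' => ?_
    have h3 := (h T.root).2
    rw [h'.2.1] at h3
    exact absurd h3 (by decide)

theorem isRep_nestedMarkedLeaf (hv : IsHom 𝕂 p v) {g : Gamma 𝕂 V}
    (hg : IsRep v p (isStar IsPair 1 2) g) (a : Fin 3) : IsRep v p (nestedMarkedLeaf a)
      (![Gamma.unit (v 0), Gamma.unit (v 1), Gamma.unit (v 2) + g] a) := by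
  fin_cases a
  · exact isRep_unit hv 0
  · exact isRep_unit hv 1
  · refine (isRep_unit hv 2).add hg fun I T ℓ h h' => ?_
    have h3 := (h T.root).2
    rw [h'.2.1] at h3
    exact absurd h3 (by decide)

theorem isRep_nestedMarkedStar (hv : IsHom 𝕂 p v) {c : ∀ I : Type, I → Prop} {g : Gamma 𝕂 V}
    (hg : IsRep v p (isStar c 1 2) g) (a : Fin 3) :
    IsRep v p (nestedMarkedStar c a) (![Gamma.unit (v 0), Gamma.unit (v 2), g] a) := by
  fin_cases a
  · exact isRep_unit hv 0
  · exact isRep_unit hv 2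
  · exact hg

/-- An operation applied to a value `x{…}`: the root of the outer corolla is replaced by a corolla,
and `isCut_nestedRoot_iff` recovers the two from the composite tree. -/
theorem coeff_nestedRoot (hv : IsHom 𝕂 p v) {c₁ c₂ : ∀ I : Type, I → Prop}
    (hc₁ : LeafCond c₁ (p 1)) (hc₂ : LeafCond c₂ (p 2)) {g : Gamma 𝕂 V}
    (hg : IsRep v p (isStar c₁ 0 1) g) {P : ZMod 2}
    (hP : ∀ (J : Type) [Fintype J] (B : RTree J) ℓ, isStar c₁ 0 1 J B ℓ → ∑ i, p (ℓ i) = P)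
    {F : Gamma 𝕂 (Gamma 𝕂 V)}
    (hF : IsRep ![g, Gamma.unit (v 2)] ![P, p 2] (isStar c₂ 0 1) F) (S : RTree (Fin n)) :
    Gamma.coeff S (Gamma.mul F) = labelSum 𝕂 v p fun ℓ => TwoLevel S ℓ ∧
      (∃ h : ℓ S.root ≠ 2, c₁ {i // ℓ i ≠ 2} ⟨S.root, h⟩) ∧
        (∃ h : ℓ S.root ≠ 1, c₂ {i // ℓ i ≠ 1} ⟨S.root, h⟩) := by
  classical
  refine coeff_mul_eq (Q := nestedRoot c₁) (Pr := fun ℓ i => ℓ i ≠ 1) hv hF (fun a => ?_) (fun a => ?_) S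
    (fun ℓ h => by rw [h.1.root]; decide) (fun ℓ i => if i = S.root then 0 else 1)
    (fun ℓ R m => by convert isCut_nestedRoot_iff) (fun ℓ h => ?_) fun ℓ R m hc i j _ _ hij => ?_
  · exact isRep_nestedRoot hv hg a
  · fin_cases a
    · exact hP
    · exact fun J _ B ℓ h => sum_isPoint h
  · obtain ⟨h, ⟨h1, h1'⟩, h2, h2'⟩ := h
    refine h.oddInjective (hc₁.imp_right fun H i j hi hj => ?_) (hc₂.imp_right fun H i j hi hj => ?_)
    · have := H _ _ h1' ⟨i, by rw [hi]; decide⟩ ⟨j, by rw [hj]; decide⟩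
        (fun h3 => by rw [Subtype.mk.injEq] at h3; rw [h3, h.root] at hi; exact absurd hi (by decide))
        (fun h3 => by rw [Subtype.mk.injEq] at h3; rw [h3, h.root] at hj; exact absurd hj (by decide))
      exact congrArg Subtype.val this
    · have := H _ _ h2' ⟨i, by rw [hi]; decide⟩ ⟨j, by rw [hj]; decide⟩
        (fun h3 => by rw [Subtype.mk.injEq] at h3; rw [h3, h.root] at hi; exact absurd hi (by decide))
        (fun h3 => by rw [Subtype.mk.injEq] at h3; rw [h3, h.root] at hj; exact absurd hj (by decide))
      exact congrArg Subtype.val this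
  -- The smaller label is `0` or `1`, so `i` lies in the root block. The vertex `j` lies there too,
  -- or it is a block of greater label.
  · obtain ⟨⟨hT, -⟩, hR, hm⟩ := isCut_nestedRoot_iff.mp hc
    have hi : ℓ i ≠ 2 := fun h => by
      rw [h] at hij
      exact absurd hij (by have : ∀ a : Fin 3, ¬ 2 < a := by decide
                           exact this _)
    have hti := top_nestedRoot hc i hi
    by_cases hj : ℓ j = 2
    · left
      have hj' : j ≠ S.root := fun h => by rw [h, hT.root] at hj; exact absurd hj (by decide)
      rw [hm, hm, if_pos hti, S.top_of_mem R.2 ((hR j).mpr (by rw [hj]; decide)), if_neg hj']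
      decide
    · right
      exact Subtype.ext (hti.trans (top_nestedRoot hc j hj).symm)

/-- Only the label `0` can be odd, so the condition on the order of odd labels is void. The bound `n
≤ N` removes every condition on sizes from the result. -/
theorem coeff_nestedLeaves (hv : IsHom 𝕂 p v) (h1 : p 1 = 0) (h2 : p 2 = 0) {N : ℕ} (hN : n ≤ N)
    {g : Gamma 𝕂 V} (hg : IsRep v p (isStar (IsSmall N) 1 2) g)
    {F : Gamma 𝕂 (Gamma 𝕂 V)}
    (hF : IsRep ![Gamma.unit (v 0), Gamma.unit (v 2) + g] ![p 0, 0] (isStar (IsSmall N) 0 1) F)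
    (S : RTree (Fin n)) :
    Gamma.coeff S (Gamma.mul F) = labelSum 𝕂 v p (TwoLevel S) := by
  classical
  have hN' : Nat.card (Fin n) ≤ N := by simpa using hN
  refine coeff_mul_eq (Q := nestedLeaves (IsSmall N))
    (Pr := fun _ i => i = S.root ∨ S.parent i = S.root) hv hF (fun a => ?_) (fun a => ?_) S
    (fun ℓ h => Or.inl rfl) (fun ℓ i => if i = S.root then 0 else 1)
    (fun ℓ R m => by convert isCut_nestedLeaves_iff hN') (fun ℓ h => h.oddInjective (Or.inl h1) (Or.inl h2))
    fun ℓ R m hc i j hi hj hij => ?_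
  · exact isRep_nestedLeaves hv hg a
  · fin_cases a
    · exact fun J _ B ℓ h => sum_isPoint h
    · rintro J _ B ℓ (h | h)
      · exact (sum_isPoint h).trans h2
      · exact (sum_isStar_of_even h2 h).trans h1
  · obtain ⟨hT, hR, hm⟩ := (isCut_nestedLeaves_iff hN').mp hc
    have h3 : ∀ a : Fin 3, p a = 1 → a = 0 := fun a ha => by
      fin_cases a
      · rfl
      · exact absurd (h1.symm.trans ha) (by decide)
      · exact absurd (h2.symm.trans ha) (by decide)
    rw [h3 _ hi, h3 _ hj] at hij
    exact absurd hij (lt_irrefl _)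

theorem coeff_nestedMarkedLeaf (hv : IsHom 𝕂 p v) (h1 : p 1 = 0) {N : ℕ} (hN : n ≤ N)
    {g : Gamma 𝕂 V} (hg : IsRep v p (isStar IsPair 1 2) g)
    {F : Gamma 𝕂 (Gamma 𝕂 V)}
    (hF : IsRep ![Gamma.unit (v 0), Gamma.unit (v 1), Gamma.unit (v 2) + g] ![p 0, 0, p 2]
      (isMarkedStar (IsSmall N) 0 1 2) F) (S : RTree (Fin n)) :
    Gamma.coeff S (Gamma.mul F) = labelSum 𝕂 v p fun ℓ => TwoLevel S ℓ ∧
      (∃ h : ℓ S.root ≠ 1, IsPair {i // ℓ i ≠ 1} ⟨S.root, h⟩) := by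
  classical
  have hN' : Nat.card (Fin n) ≤ N := by simpa using hN
  refine coeff_mul_eq (Q := nestedMarkedLeaf)
    (Pr := fun _ i => i = S.root ∨ S.parent i = S.root) hv hF (fun a => ?_) (fun a => ?_) S
    (fun ℓ h => Or.inl rfl) (fun ℓ i => if i = S.root then 0 else
        if ∃ k, ℓ k = 2 ∧ (k = i ∨ S.parent k = i) then 2 else 1)
    (fun ℓ R m => by convert isCut_nestedMarkedLeaf_iff hN') (fun ℓ h => ?_)
    fun ℓ R m hc i j hi hj hij => ?_
  · exact isRep_nestedMarkedLeaf hv hg a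
  · fin_cases a
    · exact fun J _ B ℓ h => sum_isPoint h
    · exact fun J _ B ℓ h => (sum_isPoint h).trans h1
    · rintro J _ B ℓ (h | h)
      · exact sum_isPoint h
      · refine (sum_isStar_isPair h).trans ?_
        rw [h1, zero_add]
        rfl
  · obtain ⟨h, h3, k, -, hk⟩ := h
    refine h.oddInjective (Or.inl h1) (Or.inr fun i j hi hj => ?_)
    have h4 : ∀ i (_ : ℓ i = 2), i = k.1 := fun i hi => by
      rcases hk ⟨i, by rw [hi]; decide⟩ with h5 | h5
      · rw [Subtype.mk.injEq] at h5
        rw [h5, h.root] at hi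
        exact absurd hi (by decide)
      · exact congrArg Subtype.val h5
    rw [h4 i hi, h4 j hj]
  · obtain ⟨⟨hT, -⟩, hR, hm⟩ := (isCut_nestedMarkedLeaf_iff hN').mp hc
    have h3 : ∀ a b : Fin 3, a < b → a = 0 ∨ a = 1 := by decide
    rcases h3 _ _ hij with h | h
    · refine hT.lt_or_eq (a := 0) (fun i hi => by rw [hm, if_pos hi])
        (fun i hi => by rw [hm, if_neg hi]; split_ifs <;> decide) h
    · rw [h, h1] at hi
      exact absurd hi (by decide)

theorem coeff_nestedMarkedStar (hv : IsHom 𝕂 p v) {c c' : ∀ I : Type, I → Prop}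
    (h2 : p 2 = 0 ∨ (c = IsPair ∧ c' = IsPair)) {g : Gamma 𝕂 V} (hg : IsRep v p (isStar c 1 2) g)
    {P : ZMod 2}
    (hP : ∀ (J : Type) [Fintype J] (B : RTree J) ℓ, isStar c 1 2 J B ℓ → ∑ i, p (ℓ i) = P)
    {F : Gamma 𝕂 (Gamma 𝕂 V)}
    (hF : IsRep ![Gamma.unit (v 0), Gamma.unit (v 2), g] ![p 0, p 2, P]
      (isMarkedStar c' 0 1 2) F) (S : RTree (Fin n)) :
    Gamma.coeff S (Gamma.mul F) = labelSum 𝕂 v p fun ℓ => TwoLevel S ℓ ∧ UniqueOne S ℓ c c' := by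
  classical
  -- If both pointed sets are pairs, the tree is a chain with labels `0`, `1`, `2`. The vertices
  -- labelled `1` and `2` are then in the same block, as the order condition demands when both are
  -- odd.
  have key : ∀ ℓ : Fin n → Fin 3, TwoLevel S ℓ → UniqueOne S ℓ IsPair IsPair →
      ∀ i, ℓ i = 2 → S.parent i ≠ S.root ∧ S.parent i ≠ i ∧
        ∀ j, ℓ j = 1 ∨ ℓ j = 2 → j = S.parent i ∨ j = i := by
    intro ℓ hT hU i hi
    obtain ⟨b, hb, h3, ⟨⟨k, hk'⟩, hk, h4⟩, ⟨⟨l, hl'⟩, hl, h5⟩⟩ := hU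
    have hir : i ≠ S.root := fun h => by rw [h, hT.root] at hi; exact absurd hi (by decide)
    have hb1 : ℓ b = 1 := by
      rcases hT.step b hb with h | h
      · exact h.1
      · exact absurd h.1 ((h3 b).mpr (Or.inr rfl))
    have hbp : S.parent b = S.root := by
      rcases hT.step b hb with h | h
      · exact h.2
      · rw [h.1] at hb1; exact absurd hb1 (by decide)
    have hlb : l = b := by
      rcases h5 ⟨b, Or.inr hbp⟩ with h | h
      · exact absurd (congrArg Subtype.val h) hb
      · exact (congrArg Subtype.val h).symm
    have hnr : ∀ i, ℓ i = 2 → S.parent i = b := by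
      intro i hi
      have hir : i ≠ S.root := fun h => by rw [h, hT.root] at hi; exact absurd hi (by decide)
      by_cases h6 : S.parent i = S.root
      · rcases h5 ⟨i, Or.inr h6⟩ with h | h
        · exact absurd (congrArg Subtype.val h) hir
        · have : i = b := (congrArg Subtype.val h).trans hlb
          rw [this, hb1] at hi; exact absurd hi (by decide)
      · rcases (h3 (S.parent i)).mp (by rw [(hT.ne_one_of_two h6 hir).2.1]; decide) with h | h
        · exact absurd h h6
        · exact h
    have huniq : ∀ i, ℓ i = 2 → i = k := by
      intro i hi
      rcases h4 ⟨i, Or.inr (hnr i hi)⟩ with h | h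
      · have : i = b := congrArg Subtype.val h
        rw [this, hb1] at hi; exact absurd hi (by decide)
      · exact congrArg Subtype.val h
    refine ⟨by rw [hnr i hi]; exact hb, RTree.parent_ne S hir, fun j hj => ?_⟩
    rcases hj with hj | hj
    · left
      rw [hnr i hi]
      rcases (h3 j).mp (by rw [hj]; decide) with h | h
      · rw [h, hT.root] at hj; exact absurd hj (by decide)
      · exact h
    · right
      rw [huniq i hi, huniq j hj]
  refine coeff_mul_eq (Q := nestedMarkedStar c)
    (Pr := fun _ i => i = S.root ∨ S.parent i = S.root) hv hF (fun a => ?_) (fun a => ?_) S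
    (fun ℓ h => Or.inl rfl) (fun ℓ i => if i = S.root then 0 else if ℓ i = 1 then 2 else 1)
    (fun ℓ R m => by convert isCut_nestedMarkedStar_iff) (fun ℓ h => ?_)
    fun ℓ R m hc i j hi hj hij => ?_
  · exact isRep_nestedMarkedStar hv hg a
  · fin_cases a
    · exact fun J _ B ℓ h => sum_isPoint h
    · exact fun J _ B ℓ h => sum_isPoint h
    · exact hP
  · obtain ⟨hT, hU⟩ := h
    refine hT.oddInjective (Or.inr fun i j hi hj => ?_) (h2.imp_right fun h i j hi hj => ?_)
    · obtain ⟨b, hb, h3, -⟩ := hU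
      have h4 : ∀ i, ℓ i = 1 → i = b := fun i hi => by
        rcases (h3 i).mp (by rw [hi]; decide) with h | h
        · rw [h, hT.root] at hi; exact absurd hi (by decide)
        · exact h
      rw [h4 i hi, h4 j hj]
    · obtain ⟨rfl, rfl⟩ := h
      rcases (key ℓ hT hU i hi).2.2 j (Or.inr hj) with h5 | h5
      · have h6 := (key ℓ hT hU i hi).1
        have h7 := (key ℓ hT hU j hj).2.2 i (Or.inr hi)
        rw [h5] at h7
        rcases h7 with h7 | h7
        · have h8 := (key ℓ hT hU j hj).1
          have := hT.step i (fun h => by rw [h, hT.root] at hi; exact absurd hi (by decide))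
          rcases this with h | ⟨-, h | h⟩
          · rw [h.1] at hi; exact absurd hi (by decide)
          · exact absurd h h6
          · rw [← h5, hj] at h; exact absurd h (by decide)
        · exact (h7.trans h5.symm)
      · exact h5.symm
  · obtain ⟨⟨hT, hU⟩, hR, hm⟩ := isCut_nestedMarkedStar_iff.mp hc
    have h3 : ∀ a b : Fin 3, a < b → a = 0 ∨ (a = 1 ∧ b = 2) := by decide
    rcases h3 _ _ hij with h | ⟨h, h'⟩
    · refine hT.lt_or_eq (a := 0) (fun i hi => by rw [hm, if_pos hi])
        (fun i hi => by rw [hm, if_neg hi]; split_ifs <;> decide) h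
    · rcases h2 with h2 | ⟨rfl, rfl⟩
      · rw [h', h2] at hj
        exact absurd hj (by decide)
      · obtain ⟨h4, h5, h6⟩ := key ℓ hT hU j h'
        right
        have h7 : j ∉ R.1 := fun h8 => by
          rcases (hR j).mp h8 with h9 | h9
          · rw [h9, hT.root] at h'; exact absurd h' (by decide)
          · exact h4 h9
        rw [S.top_of_notMem R.2 h7]
        rcases h6 i (Or.inl h) with h8 | h8
        · rw [h8]
        · rw [h8, h'] at h; exact absurd h (by decide)

end Composites

/-! ### Cancellation of two equal odd elements -/

section Swap

variable {𝕂 : Type*} [CommRing 𝕂] {V : Type*} [AddCommGroup V] [Module 𝕂 V] {I : Type*} [Fintype I]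
  [LinearOrder I]

/-- Exchanging the labels reverses the order of exactly one pair of odd elements, the pair `(i, j)`.
-/
theorem labelSign_swap {p : Fin 3 → ZMod 2} (h1 : p 1 = 1) (h2 : p 2 = 1) {ℓ : I → Fin 3} {i j : I}
    (h : ∀ k, (ℓ k = 1 ↔ k = i) ∧ (ℓ k = 2 ↔ k = j)) :
    labelSign p (Equiv.swap 1 2 ∘ ℓ) = -labelSign p ℓ := by
  classical
  have hp : ∀ a : Fin 3, p (Equiv.swap 1 2 a) = p a := fun a => by
    fin_cases a
    · rfl
    · exact h2.trans h1.symm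
    · exact h1.trans h2.symm
  have hdec : ∀ a b : Fin 3, b < a → Equiv.swap 1 2 a < Equiv.swap (1 : Fin 3) 2 b →
      a = 2 ∧ b = 1 := by decide
  unfold labelSign
  simp only [Function.comp_apply, hp]
  rw [← koszulSign_mul (isOrd_lexOrd _) (isOrd_lexOrd ℓ) isOrd_lt]
  have hcond : ∀ x y, ((lexOrd (Equiv.swap 1 2 ∘ ℓ) x y ∧ lexOrd ℓ y x) ∧ p (ℓ x) = 1 ∧ p (ℓ y) = 1) ↔
      x = j ∧ y = i := by
    intro x y
    constructor
    · rintro ⟨⟨h3, h4⟩, -⟩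
      have h5 : ℓ y < ℓ x := by
        rcases h4 with h4 | ⟨h4, h5⟩
        · exact h4
        · rcases h3 with h3 | ⟨-, h3⟩
          · simp only [Function.comp_apply, h4] at h3
            exact absurd h3 (lt_irrefl _)
          · exact absurd h5 h3.asymm
      have h6 : Equiv.swap 1 2 (ℓ x) < Equiv.swap 1 2 (ℓ y) := by
        rcases h3 with h3 | ⟨h3, -⟩
        · exact h3
        · exact absurd ((Equiv.swap 1 2).injective h3) h5.ne'
      obtain ⟨h7, h8⟩ := hdec _ _ h5 h6
      exact ⟨(h x).2.mp h7, (h y).1.mp h8⟩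
    · rintro ⟨rfl, rfl⟩
      have h3 := (h x).2.mpr rfl
      have h4 := (h y).1.mpr rfl
      refine ⟨⟨Or.inl ?_, Or.inl ?_⟩, ?_, ?_⟩
      · simp only [Function.comp_apply, h3, h4]; decide
      · rw [h3, h4]; decide
      · rw [h3, h2]
      · rw [h4, h1]
  have h3 : koszulSign (lexOrd (Equiv.swap 1 2 ∘ ℓ)) (lexOrd ℓ) (fun k => p (ℓ k)) = -1 := by
    unfold koszulSign
    rw [Finset.prod_eq_single j, Finset.prod_eq_single i]
    · exact if_pos ((hcond j i).mpr ⟨rfl, rfl⟩)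
    · exact fun y _ hy => if_neg fun h => hy ((hcond _ _).mp h).2
    · simp
    · exact fun x _ hx => Finset.prod_eq_one fun y _ => if_neg fun h => hx ((hcond _ _).mp h).1
    · simp
  rw [h3, neg_one_mul]

/-- Two odd labels standing for the same element cancel. -/
theorem labelSum_swap {v : Fin 3 → V} {p : Fin 3 → ZMod 2} (hv : v 1 = v 2) (h1 : p 1 = 1)
    (h2 : p 2 = 1) {S : (I → Fin 3) → Prop} (hS : ∀ ℓ, S ℓ → S (Equiv.swap 1 2 ∘ ℓ))
    (hu : ∀ ℓ, S ℓ → ∃ i j, ∀ k, (ℓ k = 1 ↔ k = i) ∧ (ℓ k = 2 ↔ k = j)) :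
    labelSum 𝕂 v p S = 0 := by
  classical
  have hss : ∀ ℓ : I → Fin 3, Equiv.swap 1 2 ∘ Equiv.swap 1 2 ∘ ℓ = ℓ := fun ℓ => by
    funext k
    exact Equiv.swap_apply_self 1 2 (ℓ k)
  have hvs : ∀ a, v (Equiv.swap 1 2 a) = v a := fun a => by
    fin_cases a
    · rfl
    · exact hv.symm
    · exact hv
  unfold labelSum
  -- Exchanging the labels `1` and `2` is an involution without fixed points on the admissible
  -- labellings. It preserves the tensor and reverses the sign, so the terms cancel in pairs and no
  -- division by `2` is involved.
  refine Finset.sum_involution (fun ℓ _ => Equiv.swap 1 2 ∘ ℓ) (fun ℓ _ => ?_) (fun ℓ _ hℓ => ?_)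
    (fun _ _ => Finset.mem_univ _) (fun ℓ _ => hss ℓ)
  · simp only [Function.comp_apply, hvs]
    rw [← add_smul]
    by_cases h : S ℓ
    · obtain ⟨i, j, hij⟩ := hu ℓ h
      rw [if_pos h, if_pos (hS ℓ h), labelSign_swap h1 h2 hij]
      simp
    · rw [if_neg h, if_neg fun h' => h (hss ℓ ▸ hS _ h'), add_zero, zero_smul]
  · have h : S ℓ := by
      by_contra h
      rw [if_neg h, zero_smul] at hℓ
      exact hℓ rfl
    obtain ⟨i, j, hij⟩ := hu ℓ h
    intro h3
    have h4 := congrFun h3 i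
    simp only [Function.comp_apply, (hij i).1.mpr rfl] at h4
    exact absurd h4 (by decide)

theorem labelSum_eq_sum {Λ ι : Type*} [LinearOrder Λ] [Fintype Λ] (v : Λ → V) (p : Λ → ZMod 2)
    {S : (I → Λ) → Prop} (s : Finset ι) (f : ι → I → Λ) (hf : Set.InjOn f s)
    (h : ∀ ℓ, S ℓ ↔ ∃ k ∈ s, f k = ℓ) :
    labelSum 𝕂 v p S = ∑ k ∈ s, ((labelSign p (f k) : ℤ) : 𝕂) •
      PiTensorProduct.tprod 𝕂 fun i => v (f k i) := by
  classical
  have h1 : labelSum 𝕂 v p S = ∑ ℓ ∈ s.image f, ((labelSign p ℓ : ℤ) : 𝕂) •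
      PiTensorProduct.tprod 𝕂 fun i => v (ℓ i) := by
    unfold labelSum
    simp only [ite_smul, zero_smul]
    rw [← Finset.sum_filter]
    refine Finset.sum_congr ?_ fun _ _ => rfl
    ext ℓ
    simp [h]
  rw [h1, Finset.sum_image hf]

end Swap

/-! ### The differential of a corolla -/

section Differential

variable {𝕂 : Type*} [CommRing 𝕂] {V : Type*} [AddCommGroup V] [Module 𝕂 V] [SuperModule 𝕂 V]
  {d : V →ₗ[𝕂] V} {x y : V} {a b : ZMod 2} {c : ∀ I : Type, I → Prop}

/-- The sign `(-1)ᵃ`. -/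
def paritySign (a : ZMod 2) : ℤˣ := if a = 1 then -1 else 1

theorem isHom_pair (hx : part 𝕂 a x = x) (hy : part 𝕂 b y = y) : IsHom 𝕂 ![a, b] ![x, y] :=
  fun i => by
    fin_cases i
    · exact hx
    · exact hy

/-- The differential of a corolla. -/
theorem diff_isStar {b' : ZMod 2} (hb : b' = b + 1) (hd : IsOdd d) (hx : part 𝕂 a x = x) (hy : part 𝕂 b y = y) (hc : LeafCond c b)
    {g g₁ g₂ : Gamma 𝕂 V} (hg : IsRep ![x, y] ![a, b] (isStar c 0 1) g)
    (hg₁ : IsRep ![d x, y] ![a + 1, b] (isStar c 0 1) g₁)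
    (hg₂ : IsRep ![x, y, d y] ![a, b, b'] (isMarkedStar c 0 1 2) g₂) :
    Gamma.diff d hd g = g₁ + ((paritySign a : ℤ) : 𝕂) • g₂ := by
  classical
  subst hb
  refine Gamma.ext fun n T => ?_
  rw [map_add, map_smul, hg₁.coeff_eq, hg₂.coeff_eq]
  change tensorDiff d (Gamma.coeff T g) = _
  rw [hg.coeff_eq]
  by_cases hT : (∀ i, T.parent i = T.root) ∧ c (Fin n) T.root
  swap
  · rw [labelSum_eq_zero _ _ fun ℓ h => hT ⟨h.1, h.2.2.2⟩,
      labelSum_eq_zero _ _ fun ℓ h => hT ⟨h.1, h.2.2.2⟩,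
      labelSum_eq_zero _ _ fun ℓ h => hT ⟨h.1, h.2.2.2⟩]
    simp
  obtain ⟨hT, hcT⟩ := hT
  set r := T.root with hr
  let ℓ₀ : Fin n → Fin 2 := fun i => if i = r then 0 else 1
  have hℓ₀ : ∀ i, ℓ₀ i = if i = r then 0 else 1 := fun i => rfl
  let f : Fin n → Fin n → Fin 3 := fun k i => if i = r then 0 else if i = k then 2 else 1
  have hf : ∀ k i, f k i = if i = r then 0 else if i = k then 2 else 1 := fun k i => rfl
  have hS : ∀ ℓ : Fin n → Fin 2, isStar c 0 1 _ T ℓ ↔ ℓ = ℓ₀ := by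
    intro ℓ
    refine ⟨fun h => funext fun i => ?_, ?_⟩
    · rw [hℓ₀]
      split_ifs with hi
      · rw [hi, h.2.1]
      · exact h.2.2.1 i hi
    · rintro rfl
      exact ⟨hT, if_pos rfl, fun i hi => if_neg hi, hcT⟩
  have hS' : ∀ ℓ : Fin n → Fin 3, isMarkedStar c 0 1 2 _ T ℓ ↔ ∃ k ∈ Finset.univ.erase r, f k = ℓ := by
    intro ℓ
    constructor
    · rintro ⟨-, h1, ⟨k, hk, h2, h3⟩, -⟩
      refine ⟨k, Finset.mem_erase.mpr ⟨hk, Finset.mem_univ k⟩, funext fun i => ?_⟩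
      rw [hf]
      split_ifs with h4 h5
      · rw [h4, h1]
      · rw [h5, h2]
      · exact (h3 i h4 h5).symm
    · rintro ⟨k, hk, rfl⟩
      have hk' := Finset.ne_of_mem_erase hk
      exact ⟨hT, if_pos rfl, ⟨k, hk', by rw [hf, if_neg hk', if_pos rfl],
        fun i h4 h5 => by rw [hf, if_neg h4, if_neg h5]⟩, hcT⟩
  have hinj : Set.InjOn f (Finset.univ.erase r : Finset (Fin n)) := by
    intro k hk k' _ h
    have hk' := Finset.ne_of_mem_erase (Finset.mem_coe.mp hk)
    have h1 := congrFun h k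
    rw [hf, hf, if_neg hk', if_pos rfl, if_neg hk'] at h1
    by_contra h2
    rw [if_neg h2] at h1
    exact absurd h1 (by decide)
  -- The differential of the tensor has one term for each vertex. The term of the root `r` belongs
  -- to `g₁`, and the term of a leaf `k` is the labelling `f k` of `g₂`.
  rw [labelSum_eq_single _ _ hS, labelSum_eq_single _ _ hS, labelSum_eq_sum _ _ _ f hinj hS', map_smul,
    tensorDiff_tprod d (p := fun i => ![a, b] (ℓ₀ i)) fun i => isHom_pair hx hy (ℓ₀ i),
    ← Finset.add_sum_erase _ _ (Finset.mem_univ r), smul_add, Finset.smul_sum, Finset.smul_sum]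
  have hlt : ∀ i, ¬ lexOrd ℓ₀ i r := by
    rintro i (h | ⟨h, h'⟩)
    · rw [hℓ₀ r, if_pos rfl] at h
      exact absurd h (by have : ∀ z : Fin 2, ¬ z < 0 := by decide
                         exact this _)
    · by_cases hi : i = r
      · rw [hi] at h'; exact lt_irrefl _ h'
      · rw [hℓ₀, hℓ₀, if_neg hi, if_pos rfl] at h; exact absurd h (by decide)
  have hrl : ∀ i, i ≠ r → lexOrd ℓ₀ r i := fun i hi => Or.inl (by
    rw [hℓ₀, hℓ₀, if_pos rfl, if_neg hi]; decide)
  congr 1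
  · rw [smul_smul]
    congr 1
    · rw [← Int.cast_mul, ← Units.val_mul]
      congr 2
      -- Nothing precedes the root in the order of the labels, so changing its parity costs no sign
      -- on that side.
      have h1 := koszulSign_toggle (isOrd_lexOrd ℓ₀) isOrd_lt (fun i => ![a, b] (ℓ₀ i)) r
      rw [Finset.prod_eq_one (fun i _ => if_neg fun h => hlt i h.1), mul_one] at h1
      refine Eq.trans ?_ (h1.symm.trans ?_)
      · rfl
      · unfold labelSign
        congr 1
        funext i
        by_cases hi : i = r
        · subst hi
          rw [Function.update_self, hℓ₀, if_pos rfl]; rfl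
        · rw [Function.update_of_ne hi, hℓ₀, if_neg hi]; rfl
    · congr 1
      funext i
      by_cases hi : i = r
      · subst hi
        rw [Function.update_self, hℓ₀, if_pos rfl]; rfl
      · rw [Function.update_of_ne hi, hℓ₀, if_neg hi]; rfl
  · refine Finset.sum_congr rfl fun k hk => ?_
    have hk := Finset.ne_of_mem_erase hk
    have hodd : ∀ i, i ≠ r → Function.update (fun i => ![a, b] (ℓ₀ i)) k (b + 1) i = 1 → i = k := by
      intro i hi h
      by_contra hik
      rw [Function.update_of_ne hik, hℓ₀, if_neg hi] at h
      rcases hc with hc | hc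
      · exact absurd (hc.symm.trans h) (by decide)
      · exact hik (hc _ _ hcT i k hi hk)
    rw [smul_smul, smul_smul]
    congr 1
    · rw [← Int.cast_mul, ← Int.cast_mul, ← Units.val_mul, ← Units.val_mul]
      congr 2
      -- Changing the parity of the leaf `k` costs the sign of the odd elements before `k` in the
      -- order of the labels. By `LeafCond` only the root can be one of them, which leaves
      -- `paritySign a`.
      have h1 := koszulSign_toggle (isOrd_lexOrd ℓ₀) isOrd_lt (fun i => ![a, b] (ℓ₀ i)) k
      have h2 : ![a, b] (ℓ₀ k) + 1 = b + 1 := by rw [hℓ₀, if_neg hk]; rfl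
      rw [h2, Finset.prod_eq_single r (fun i _ hi => if_neg ?_) (by simp)] at h1
      · have h3 : (if lexOrd ℓ₀ r k ∧ ![a, b] (ℓ₀ r) = 1 then (-1 : ℤˣ) else 1) = paritySign a := by
          unfold paritySign
          have h4 : ![a, b] (ℓ₀ r) = a := by rw [hℓ₀, if_pos rfl]; rfl
          rw [h4]
          simp only [hrl k hk, true_and]
        rw [h3, mul_comm] at h1
        refine Eq.trans ?_ (h1.symm.trans ?_)
        · rfl
        · congr 1
          unfold labelSign
          have h5 : (fun i => ![a, b, b + 1] (f k i)) =
              Function.update (fun i => ![a, b] (ℓ₀ i)) k (b + 1) := by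
            funext i
            by_cases hik : i = k
            · subst hik
              rw [Function.update_self, hf, if_neg hk, if_pos rfl]; rfl
            · rw [Function.update_of_ne hik, hf, hℓ₀]
              split_ifs <;> rfl
          rw [h5]
          refine koszulSign_congr_odd fun i j hi hj => ?_
          have hfr : ∀ i, i = r → f k i = 0 := fun i hi => by rw [hf, if_pos hi]
          have hfk : ∀ i, i = k → f k i = 2 := fun i hi => by rw [hf, hi, if_neg hk, if_pos rfl]
          by_cases hir : i = r <;> by_cases hjr : j = r
          · rw [hir, hjr]
            exact iff_of_false (hlt r) fun h => (isOrd_lexOrd (f k)).asymm _ _ h h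
          · refine iff_of_true (hir ▸ hrl j hjr) (Or.inl ?_)
            rw [hfr i hir, hfk j (hodd j hjr hj)]; decide
          · refine iff_of_false (hjr ▸ hlt i) fun h => (isOrd_lexOrd (f k)).asymm _ _ h (Or.inl ?_)
            rw [hfr j hjr, hfk i (hodd i hir hi)]; decide
          · rw [hodd i hir hi, hodd j hjr hj]
            exact iff_of_false (fun h => (isOrd_lexOrd ℓ₀).asymm _ _ h h)
              fun h => (isOrd_lexOrd (f k)).asymm _ _ h h
      · rintro ⟨h4, h5⟩
        have h6 : i ≠ k := by
          rintro rfl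
          exact (isOrd_lexOrd ℓ₀).asymm _ _ h4 h4
        exact h6 (hodd i hi (by rw [Function.update_of_ne h6]; exact h5))
    · congr 1
      funext i
      by_cases hik : i = k
      · subst hik
        rw [Function.update_self, hf, hℓ₀, if_neg hk, if_neg hk, if_pos rfl]; rfl
      · rw [Function.update_of_ne hik, hf, hℓ₀]
        split_ifs <;> rfl

end Differential

/-! ### Identities between the braces of `L ⊗ A` -/

section Identities

variable {𝕂 : Type u} [CommRing 𝕂] {A : Type w} [CommRing A] [Algebra 𝕂 A] {L : GammaAlg.{u, v} 𝕂}

theorem isHom_triple {V : Type*} [AddCommGroup V] [Module 𝕂 V] [SuperModule 𝕂 V] {x y z : V}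
    {a b c : ZMod 2} (hx : part 𝕂 a x = x) (hy : part 𝕂 b y = y) (hz : part 𝕂 c z = z) :
    IsHom 𝕂 ![a, b, c] ![x, y, z] := fun i => by
  fin_cases i
  · exact hx
  · exact hy
  · exact hz

theorem part_unit {V : Type*} [AddCommGroup V] [Module 𝕂 V] [SuperModule 𝕂 V] {x : V} {a : ZMod 2}
    (hx : part 𝕂 a x = x) : part 𝕂 a (Gamma.unit (𝕂 := 𝕂) x) = Gamma.unit x := by
  have hv : IsHom 𝕂 (fun _ : Fin 1 => a) (fun _ => x) := fun _ => hx
  exact (isRep_unit hv 0).part_eq hv fun _ _ _ _ h => sum_isPoint (p := fun _ : Fin 1 => a) h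

namespace GammaAlg

theorem part_zero_of_mem_extE {I : Ideal A} {x : L.Ext A} (hx : x ∈ L.extE I 0) :
    part 𝕂 0 x = x := by
  have := part_of_mem_extE hx
  rwa [Int.cast_zero] at this

theorem part_self_one_of_mem_extE {I : Ideal A} {x : L.Ext A} (hx : x ∈ L.extE I 1) :
    part 𝕂 1 x = x := by
  have := part_of_mem_extE hx
  rwa [Int.cast_one] at this

theorem brace_of_isRep {Λ : Type*} [LinearOrder Λ] [Fintype Λ] {v : Λ → L.Ext A} {p : Λ → ZMod 2}
    (hv : IsHom 𝕂 p v) {a b : Λ} (hab : a < b) {g : Gamma 𝕂 (L.Ext A)}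
    (hg : IsRep v p (isStar IsPair a b) g) : L.extL g = L.brace 1 (v a) (v b) := by
  unfold brace
  rw [hg.unique (isRep_corolla_one hv hab)]

open Classical in
variable (L) in
/-- The operation given by the sum of the corollas with root `x`, of parity `a`, one odd leaf `β`,
and fewer than `N` leaves in total, all others being the even element `ν`. -/
def markedCirc (N : ℕ) (a : ZMod 2) (x ν β : L.Ext A) : L.Ext A :=
  if h : ∃ g : Gamma 𝕂 (L.Ext A),
    IsRep ![x, ν, β] ![a, 0, 1] (isMarkedStar (IsSmall N) 0 1 2) g then L.extL h.choose else 0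

theorem markedCirc_of_isRep {N : ℕ} {a : ZMod 2} {x ν β : L.Ext A} {g : Gamma 𝕂 (L.Ext A)}
    (hg : IsRep ![x, ν, β] ![a, 0, 1] (isMarkedStar (IsSmall N) 0 1 2) g) :
    L.extL g = L.markedCirc N a x ν β := by
  have h : ∃ g : Gamma 𝕂 (L.Ext A),
    IsRep ![x, ν, β] ![a, 0, 1] (isMarkedStar (IsSmall N) 0 1 2) g := ⟨g, hg⟩
  rw [markedCirc, dif_pos h, hg.unique h.choose_spec]

/-- All `n ≥ N` vertices of the tree carry elements of `L ⊗ 𝔪`. Composites need to be compared only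
in arities at most `N`, where the bounds on sizes are automatic; for the remaining arities the span
of the coefficients suffices and cuttings need not be counted. -/
theorem collapse_coeff_mul_eq_zero {Λ Λ' : Type*} [LinearOrder Λ] [LinearOrder Λ'] [Fintype Λ]
    [Fintype Λ'] {v : Λ → L.Ext A} {p : Λ → ZMod 2} (hv : IsHom 𝕂 p v) {𝔪 : Ideal A} {N : ℕ}
    (hN : 𝔪 ^ N = ⊥) {κ : Λ → ℤ} (hm : ∀ i, v i ∈ L.extE 𝔪 (κ i)) {G : Λ' → Gamma 𝕂 (L.Ext A)}
    {P : Λ' → ZMod 2} {Q : Λ' → LabelPred Λ} {W : LabelPred Λ'} {F : Gamma 𝕂 (Gamma 𝕂 (L.Ext A))}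
    (hF : IsRep G P W F) (hG : ∀ a, IsRep v p (Q a) (G a)) {n : ℕ} (hn : N ≤ n)
    (S : RTree (Fin n)) : collapse (Gamma.coeff S (Gamma.mul F)) = 0 := by
  rw [Gamma.coeff_mul]
  refine Submodule.span_induction (p := fun z _ => collapse z = 0) ?_ (map_zero _) ?_ ?_
    (mulCoeff_mem_span hv hF hG S)
  · rintro _ ⟨ℓ, rfl⟩
    exact collapse_tprod_eq_zero hN Finset.univ (by simpa using hn) fun j _ =>
      extSub_mono le_rfl le_top (hm (ℓ j))
  · intro x y _ _ hx hy
    rw [map_add, hx, hy, add_zero]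
  · intro c x _ hx
    rw [map_smul, hx, smul_zero]

variable [Module.Flat 𝕂 A]

theorem isHom_extL {Λ : Type*} {P : Λ → ZMod 2} {G : Λ → Gamma 𝕂 (L.Ext A)} (hG : IsHom 𝕂 P G) :
    IsHom 𝕂 P fun a => L.extL (G a) := fun a =>
  (L.isEven_extLₗ (P a) (G a)).symm.trans (congrArg (L.extLₗ A) (hG a))

theorem circ_of_isRep {Λ : Type*} [LinearOrder Λ] [Fintype Λ] {v : Λ → L.Ext A} {p : Λ → ZMod 2}
    (hv : IsHom 𝕂 p v) {a b : Λ} (hab : a < b) (hb : p b = 0) {𝔪 : Ideal A} {N : ℕ}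
    (hN : 𝔪 ^ N = ⊥) (hm : v b ∈ L.extE 𝔪 0) {g : Gamma 𝕂 (L.Ext A)}
    (hg : IsRep v p (isStar (IsSmall N) a b) g) : L.extL g = L.circ (v a) (v b) := by
  rw [circ_eq_extL hN _ hm, hg.unique (isRep_sum_corolla hv hab hb N)]

theorem exists_markedStar {N : ℕ} {p : Fin 3 → ZMod 2} {V : Type*} [AddCommGroup V] [Module 𝕂 V]
    [SuperModule 𝕂 V] {v : Fin 3 → V} (hv : IsHom 𝕂 p v) (h1 : p 1 = 0) :
    ∃ g : Gamma 𝕂 V, IsRep v p (isMarkedStar (IsSmall N) 0 1 2) g :=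
  exists_isRep_isMarkedStar hv (isInvariant_isSmall N) (by decide) (by decide) (Or.inl h1) N
    fun _ _ h => h

theorem exists_smallStar {Λ : Type*} [LinearOrder Λ] [Fintype Λ] {V : Type*} [AddCommGroup V]
    [Module 𝕂 V] [SuperModule 𝕂 V] {v : Λ → V} {p : Λ → ZMod 2}
    (hv : IsHom 𝕂 p v) (N : ℕ) {a b : Λ} (hab : a ≠ b) (hb : p b = 0) :
    ∃ g : Gamma 𝕂 V, IsRep v p (isStar (IsSmall N) a b) g :=
  exists_isRep_isStar hv (isInvariant_isSmall N) hab (Or.inl hb) N fun _ _ h => h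

theorem exists_pairStar {Λ : Type*} [LinearOrder Λ] [Fintype Λ] {V : Type*} [AddCommGroup V]
    [Module 𝕂 V] [SuperModule 𝕂 V] {v : Λ → V} {p : Λ → ZMod 2}
    (hv : IsHom 𝕂 p v) {a b : Λ} (hab : a ≠ b) : ∃ g : Gamma 𝕂 V, IsRep v p (isStar IsPair a b) g :=
  exists_isRep_isStar hv isInvariant_isPair hab (leafCond_isPair _) 2
    fun _ _ h => (card_of_isPair h).le

theorem exists_markedPair {p : Fin 3 → ZMod 2} {V : Type*} [AddCommGroup V] [Module 𝕂 V]
    [SuperModule 𝕂 V] {v : Fin 3 → V} (hv : IsHom 𝕂 p v) :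
    ∃ g : Gamma 𝕂 V, IsRep v p (isMarkedStar IsPair 0 1 2) g :=
  exists_isRep_isMarkedStar hv isInvariant_isPair (by decide) (by decide) (leafCond_isPair _) 2
    fun _ _ h => (card_of_isPair h).le

/-- By the associativity law, evaluating a composite amounts to evaluating the inner elements first
and then applying the outer operation to their values. -/
theorem extL_mul_circ {P : Fin 2 → ZMod 2} {G : Fin 2 → Gamma 𝕂 (L.Ext A)} (hG : IsHom 𝕂 P G)
    (h1 : P 1 = 0) {𝔪 : Ideal A} {N : ℕ} (hN : 𝔪 ^ N = ⊥) (hm : L.extL (G 1) ∈ L.extE 𝔪 0)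
    {F : Gamma 𝕂 (Gamma 𝕂 (L.Ext A))} (hF : IsRep G P (isStar (IsSmall N) 0 1) F) :
    L.extL (Gamma.mul F) = L.circ (L.extL (G 0)) (L.extL (G 1)) := by
  rw [← extL_mul]
  exact circ_of_isRep (v := fun a => L.extL (G a)) (isHom_extL hG) (by decide) h1 hN hm (hF.map _)

theorem extL_mul_brace {P : Fin 2 → ZMod 2} {G : Fin 2 → Gamma 𝕂 (L.Ext A)} (hG : IsHom 𝕂 P G)
    {F : Gamma 𝕂 (Gamma 𝕂 (L.Ext A))} (hF : IsRep G P (isStar IsPair 0 1) F) :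
    L.extL (Gamma.mul F) = L.brace 1 (L.extL (G 0)) (L.extL (G 1)) := by
  rw [← extL_mul]
  exact brace_of_isRep (v := fun a => L.extL (G a)) (isHom_extL hG) (by decide) (hF.map _)

theorem extL_mul_markedCirc {a : ZMod 2} {G : Fin 3 → Gamma 𝕂 (L.Ext A)} {N : ℕ}
    {F : Gamma 𝕂 (Gamma 𝕂 (L.Ext A))}
    (hF : IsRep G ![a, 0, 1] (isMarkedStar (IsSmall N) 0 1 2) F) :
    L.extL (Gamma.mul F) =
      L.markedCirc N a (L.extL (G 0)) (L.extL (G 1)) (L.extL (G 2)) := by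
  rw [← extL_mul]
  refine markedCirc_of_isRep ?_
  have h : ![L.extL (G 0), L.extL (G 1), L.extL (G 2)] = fun i => L.extLₗ A (G i) := by
    funext i
    fin_cases i <;> rfl
  rw [h]
  exact hF.map _

theorem extL_mul_eq {Λ Λ₁ Λ₂ : Type*} [LinearOrder Λ] [LinearOrder Λ₁] [LinearOrder Λ₂] [Fintype Λ]
    [Fintype Λ₁] [Fintype Λ₂] {v : Λ → L.Ext A} {p : Λ → ZMod 2} (hv : IsHom 𝕂 p v) {𝔪 : Ideal A}
    {N : ℕ} (hN : 𝔪 ^ N = ⊥) {κ : Λ → ℤ} (hm : ∀ i, v i ∈ L.extE 𝔪 (κ i))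
    {G₁ : Λ₁ → Gamma 𝕂 (L.Ext A)} {P₁ : Λ₁ → ZMod 2} {Q₁ : Λ₁ → LabelPred Λ} {W₁ : LabelPred Λ₁}
    {F₁ : Gamma 𝕂 (Gamma 𝕂 (L.Ext A))} (hF₁ : IsRep G₁ P₁ W₁ F₁)
    (hG₁ : ∀ a, IsRep v p (Q₁ a) (G₁ a))
    {G₂ : Λ₂ → Gamma 𝕂 (L.Ext A)} {P₂ : Λ₂ → ZMod 2} {Q₂ : Λ₂ → LabelPred Λ} {W₂ : LabelPred Λ₂}
    {F₂ : Gamma 𝕂 (Gamma 𝕂 (L.Ext A))} (hF₂ : IsRep G₂ P₂ W₂ F₂)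
    (hG₂ : ∀ a, IsRep v p (Q₂ a) (G₂ a))
    (h : ∀ n ≤ N, ∀ S : RTree (Fin n),
      Gamma.coeff S (Gamma.mul F₁) = Gamma.coeff S (Gamma.mul F₂)) :
    L.extL (Gamma.mul F₁) = L.extL (Gamma.mul F₂) := by
  refine L.extL_eq_of_coeff fun n S => ?_
  rcases le_total n N with hn | hn
  · rw [h n hn S]
  · rw [collapse_coeff_mul_eq_zero hv hN hm hF₁ hG₁ hn,
      collapse_coeff_mul_eq_zero hv hN hm hF₂ hG₂ hn]

variable {𝔪 : Ideal A} {N : ℕ} {k : ℤ} {x ν : L.Ext A}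

theorem brace_mem_self [IdealsSplit 𝕂 A] {l : ℤ} {x y : L.Ext A} (hx : x ∈ L.extE 𝔪 k) (hy : y ∈ L.extE 𝔪 l) :
    L.brace 1 x y ∈ L.extE 𝔪 (k + l) := extE_mono Ideal.mul_le_left (brace_one_mem hx hy)

/-- Both sides are composites in which every two-level tree with root `x`, vertices `μ` attached to
the root and leaves `ν` attached to the root or to some `μ` occurs once. On the left the tree is cut
below the vertices `ν`, on the right below the children of the root. -/
theorem circ_circ [IdealsSplit 𝕂 A] (hN : 𝔪 ^ N = ⊥) {μ : L.Ext A} (hx : x ∈ L.extE 𝔪 k) (hμ : μ ∈ L.extE 𝔪 0)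
    (hν : ν ∈ L.extE 𝔪 0) : L.circ (L.circ x μ) ν = L.circ x (ν + L.circ μ ν) := by
  have hv : IsHom 𝕂 ![(k : ZMod 2), 0, 0] ![x, μ, ν] :=
    isHom_triple (part_of_mem_extE hx) (part_zero_of_mem_extE hμ) (part_zero_of_mem_extE hν)
  have hm : ∀ i, ![x, μ, ν] i ∈ L.extE 𝔪 (![k, 0, 0] i) := fun i => by
    fin_cases i
    · exact hx
    · exact hμ
    · exact hν
  obtain ⟨g, hg⟩ := exists_smallStar hv N (a := 0) (b := 1) (by decide) rfl
  have eg := circ_of_isRep hv (a := 0) (b := 1) (by decide) rfl hN hμ hg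
  have hP : ∀ (J : Type) [Fintype J] (B : RTree J) ℓ, isStar (IsSmall N) 0 1 J B ℓ →
      ∑ i, ![(k : ZMod 2), 0, 0] (ℓ i) = (k : ZMod 2) := fun J _ B ℓ h =>
    sum_isStar_of_even (a := 0) (b := 1) rfl h
  have hG : IsHom 𝕂 ![(k : ZMod 2), 0] ![g, Gamma.unit ν] :=
    isHom_pair (hg.part_eq hv hP) (part_unit (part_zero_of_mem_extE hν))
  obtain ⟨F, hF⟩ := exists_smallStar hG N (a := 0) (b := 1) (by decide) rfl
  have eF := extL_mul_circ hG rfl hN (by change L.extL (Gamma.unit ν) ∈ _; rwa [extL_unit]) hF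
  obtain ⟨g', hg'⟩ := exists_smallStar hv N (a := 1) (b := 2) (by decide) rfl
  have eg' := circ_of_isRep hv (a := 1) (b := 2) (by decide) rfl hN hν hg'
  have hG' : IsHom 𝕂 ![(k : ZMod 2), 0] ![Gamma.unit x, Gamma.unit ν + g'] := by
    refine isHom_pair (part_unit (part_of_mem_extE hx)) ?_
    have h1 : part 𝕂 0 (Gamma.unit (𝕂 := 𝕂) ν) = Gamma.unit ν := part_unit (part_zero_of_mem_extE hν)
    have h2 : part 𝕂 0 g' = g' := hg'.part_eq hv fun J _ B ℓ h =>
      sum_isStar_of_even (a := 1) (b := 2) rfl h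
    rw [map_add, h1, h2]
  obtain ⟨F', hF'⟩ := exists_smallStar hG' N (a := 0) (b := 1) (by decide) rfl
  have eG' : L.extL (Gamma.unit ν + g') = ν + L.circ μ ν := by
    rw [extL_add, extL_unit, eg']; rfl
  have eF' := extL_mul_circ hG' rfl hN
    (by change L.extL (Gamma.unit ν + g') ∈ _; rw [eG']; exact add_mem hν (circ_mem hN hμ hν)) hF'
  have key := extL_mul_eq hv hN hm hF (isRep_nestedRoot hv hg) hF' (isRep_nestedLeaves hv hg')
    fun n hn S => by
      rw [coeff_nestedRoot hv (Or.inl rfl) (Or.inl rfl) hg hP hF S,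
        coeff_nestedLeaves hv rfl rfl hn hg' hF' S]
      refine labelSum_congr _ _ fun ℓ => ⟨fun h => h.1, fun h => ⟨h, ⟨?_, ?_⟩, ⟨?_, ?_⟩⟩⟩
      · rw [h.root]; decide
      · exact isSmall_subtype (by simpa using hn) _ _
      · rw [h.root]; decide
      · exact isSmall_subtype (by simpa using hn) _ _
  rw [eF, eF'] at key
  change L.circ (L.extL g) (L.extL (Gamma.unit ν)) =
    L.circ (L.extL (Gamma.unit x)) (L.extL (Gamma.unit ν + g')) at key
  rw [eG', extL_unit, extL_unit, eg] at key
  exact key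

/-- The trees have a root `x`, leaves `ν` and a single further vertex `α`. It is attached to the
root or to one of the `ν`, and accordingly the marked leaf carries `α` or `ν{α}₁`. -/
theorem brace_circ (hN : 𝔪 ^ N = ⊥) {α : L.Ext A} (hx : x ∈ L.extE 𝔪 k) (hν : ν ∈ L.extE 𝔪 0)
    (hα : α ∈ L.extE 𝔪 1) : L.brace 1 (L.circ x ν) α =
      L.markedCirc N (k : ZMod 2) x ν (α + L.brace 1 ν α) := by
  have hv : IsHom 𝕂 ![(k : ZMod 2), 0, 1] ![x, ν, α] :=
    isHom_triple (part_of_mem_extE hx) (part_zero_of_mem_extE hν) (part_self_one_of_mem_extE hα)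
  have hm : ∀ i, ![x, ν, α] i ∈ L.extE 𝔪 (![k, 0, 1] i) := fun i => by
    fin_cases i
    · exact hx
    · exact hν
    · exact hα
  obtain ⟨g, hg⟩ := exists_smallStar hv N (a := 0) (b := 1) (by decide) rfl
  have eg := circ_of_isRep hv (a := 0) (b := 1) (by decide) rfl hN hν hg
  have hP : ∀ (J : Type) [Fintype J] (B : RTree J) ℓ, isStar (IsSmall N) 0 1 J B ℓ →
      ∑ i, ![(k : ZMod 2), 0, 1] (ℓ i) = (k : ZMod 2) := fun J _ B ℓ h =>
    sum_isStar_of_even (a := 0) (b := 1) rfl h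
  have hG : IsHom 𝕂 ![(k : ZMod 2), 1] ![g, Gamma.unit α] :=
    isHom_pair (hg.part_eq hv hP) (part_unit (part_self_one_of_mem_extE hα))
  obtain ⟨F, hF⟩ := exists_pairStar hG (a := 0) (b := 1) (by decide)
  have eF := extL_mul_brace hG hF
  obtain ⟨g', hg'⟩ := exists_pairStar hv (a := 1) (b := 2) (by decide)
  have eg' := brace_of_isRep hv (by decide) hg'
  have hG' : IsHom 𝕂 ![(k : ZMod 2), 0, 1] ![Gamma.unit x, Gamma.unit ν, Gamma.unit α + g'] := by
    refine isHom_triple (part_unit (part_of_mem_extE hx)) (part_unit (part_zero_of_mem_extE hν)) ?_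
    have h1 : part 𝕂 1 (Gamma.unit (𝕂 := 𝕂) α) = Gamma.unit α := part_unit (part_self_one_of_mem_extE hα)
    have h2 : part 𝕂 1 g' = g' := hg'.part_eq hv fun J _ B ℓ h =>
      (sum_isStar_isPair h).trans (zero_add _)
    rw [map_add, h1, h2]
  obtain ⟨F', hF'⟩ := exists_markedStar (N := N) hG' rfl
  have eF' := extL_mul_markedCirc hF'
  have key := extL_mul_eq hv hN hm hF (isRep_nestedRoot hv hg) hF' (isRep_nestedMarkedLeaf hv hg')
    fun n hn S => by
      rw [coeff_nestedRoot hv (Or.inl rfl) (leafCond_isPair _) hg hP hF S,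
        coeff_nestedMarkedLeaf hv rfl hn hg' hF' S]
      refine labelSum_congr _ _ fun ℓ => ⟨fun h => ⟨h.1, h.2.2⟩, fun h => ⟨h.1, ⟨?_, ?_⟩, h.2⟩⟩
      · rw [h.1.root]; decide
      · exact isSmall_subtype (by simpa using hn) _ _
  rw [eF, eF'] at key
  change L.brace 1 (L.extL g) (L.extL (Gamma.unit α)) =
    L.markedCirc N k (L.extL (Gamma.unit x)) (L.extL (Gamma.unit ν)) (L.extL (Gamma.unit α + g'))
    at key
  rw [extL_add, extL_unit, extL_unit, extL_unit, eg, eg'] at key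
  exact key

/-- The new leaves `ν` are attached to `x` or to `β`. Those at `β` form `β ⊚ (1 + ν)`, which becomes
the marked leaf. -/
theorem circ_brace (hN : 𝔪 ^ N = ⊥) {β : L.Ext A} (hx : x ∈ L.extE 𝔪 k) (hν : ν ∈ L.extE 𝔪 0)
    (hβ : β ∈ L.extE 𝔪 1) : L.circ (L.brace 1 x β) ν =
      L.markedCirc N (k : ZMod 2) x ν (L.circ β ν) := by
  have hv : IsHom 𝕂 ![(k : ZMod 2), 1, 0] ![x, β, ν] :=
    isHom_triple (part_of_mem_extE hx) (part_self_one_of_mem_extE hβ) (part_zero_of_mem_extE hν)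
  have hm : ∀ i, ![x, β, ν] i ∈ L.extE 𝔪 (![k, 1, 0] i) := fun i => by
    fin_cases i
    · exact hx
    · exact hβ
    · exact hν
  obtain ⟨g, hg⟩ := exists_pairStar hv (a := 0) (b := 1) (by decide)
  have eg := brace_of_isRep hv (by decide) hg
  have hP : ∀ (J : Type) [Fintype J] (B : RTree J) ℓ, isStar IsPair 0 1 J B ℓ →
      ∑ i, ![(k : ZMod 2), 1, 0] (ℓ i) = (k : ZMod 2) + 1 := fun J _ B ℓ h =>
    sum_isStar_isPair h
  have hG : IsHom 𝕂 ![(k : ZMod 2) + 1, 0] ![g, Gamma.unit ν] :=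
    isHom_pair (hg.part_eq hv hP) (part_unit (part_zero_of_mem_extE hν))
  obtain ⟨F, hF⟩ := exists_smallStar hG N (a := 0) (b := 1) (by decide) rfl
  have eF := extL_mul_circ hG rfl hN (by change L.extL (Gamma.unit ν) ∈ _; rwa [extL_unit]) hF
  obtain ⟨g', hg'⟩ := exists_smallStar hv N (a := 1) (b := 2) (by decide) rfl
  have eg' := circ_of_isRep hv (a := 1) (b := 2) (by decide) rfl hN hν hg'
  have hP' : ∀ (J : Type) [Fintype J] (B : RTree J) ℓ, isStar (IsSmall N) 1 2 J B ℓ →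
      ∑ i, ![(k : ZMod 2), 1, 0] (ℓ i) = 1 := fun J _ B ℓ h =>
    sum_isStar_of_even (a := 1) (b := 2) rfl h
  have hG' : IsHom 𝕂 ![(k : ZMod 2), 0, 1] ![Gamma.unit x, Gamma.unit ν, g'] :=
    isHom_triple (part_unit (part_of_mem_extE hx)) (part_unit (part_zero_of_mem_extE hν)) (hg'.part_eq hv hP')
  obtain ⟨F', hF'⟩ := exists_markedStar (N := N) hG' rfl
  have eF' := extL_mul_markedCirc hF'
  have key := extL_mul_eq hv hN hm hF (isRep_nestedRoot hv hg) hF' (isRep_nestedMarkedStar hv hg')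
    fun n hn S => by
      have hn' : Nat.card (Fin n) ≤ N := by simpa using hn
      rw [coeff_nestedRoot hv (leafCond_isPair _) (Or.inl rfl) hg hP hF S,
        coeff_nestedMarkedStar hv (Or.inl rfl) hg' hP' hF' S]
      refine labelSum_congr _ _ fun ℓ => and_congr_right fun hT => ⟨?_, ?_⟩
      · rintro ⟨⟨h, b, hb, h1⟩, -⟩
        refine ⟨b, fun h2 => hb (Subtype.ext h2), fun i => ⟨fun hi => ?_, ?_⟩,
          isSmall_subtype hn' _ _, isSmall_subtype hn' _ _⟩
        · exact (h1 ⟨i, hi⟩).imp (congrArg Subtype.val) (congrArg Subtype.val)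
        · rintro (rfl | rfl)
          · exact h
          · exact b.2
      · rintro ⟨b, hb, h1, -, -⟩
        refine ⟨⟨(h1 _).mpr (Or.inl rfl), ⟨b, (h1 b).mpr (Or.inr rfl)⟩,
          fun h => hb (congrArg Subtype.val h), fun i => ?_⟩, ?_, isSmall_subtype hn' _ _⟩
        · exact ((h1 i).mp i.2).imp Subtype.ext Subtype.ext
        · rw [hT.root]; decide
  rw [eF, eF'] at key
  change L.circ (L.extL g) (L.extL (Gamma.unit ν)) =
    L.markedCirc N k (L.extL (Gamma.unit x)) (L.extL (Gamma.unit ν)) (L.extL g') at key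
  rw [extL_unit, extL_unit, eg, eg'] at key
  exact key

/-- With a single leaf, the mark leaves no room for unmarked leaves. -/
theorem isMarkedStar_isPair_iff {Λ : Type*} {a b b' : Λ} {I : Type} {T : RTree I} {ℓ : I → Λ} :
    isMarkedStar IsPair a b b' I T ℓ ↔ isStar IsPair a b' I T ℓ := by
  refine and_congr_right fun _ => and_congr_right fun _ => ⟨?_, ?_⟩
  · rintro ⟨⟨j, hj, hj', -⟩, l, hl, hl'⟩
    have : j = l := (hl' j).resolve_left hj
    subst this
    exact ⟨fun i hi => by rw [(hl' i).resolve_left hi, hj'], j, hj, hl'⟩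
  · rintro ⟨h, l, hl, hl'⟩
    exact ⟨⟨l, hl, h l hl, fun i hi hi' => absurd ((hl' i).resolve_left hi) hi'⟩, l, hl, hl'⟩

/-- In a two-level tree with one pair at the root and one other pair, the two leaves are attached
one above the other or both to the root. -/
theorem twoLevel_pair_iff {I : Type} {S : RTree I} {ℓ : I → Fin 3} :
    (TwoLevel S ℓ ∧ (∃ h : ℓ S.root ≠ 2, IsPair {i // ℓ i ≠ 2} ⟨S.root, h⟩) ∧
      (∃ h : ℓ S.root ≠ 1, IsPair {i // ℓ i ≠ 1} ⟨S.root, h⟩)) ↔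
    (TwoLevel S ℓ ∧ UniqueOne S ℓ IsPair IsPair) ∨ ((∀ i, S.parent i = S.root) ∧ ℓ S.root = 0 ∧
      ∃ i j, ∀ k, (k ≠ S.root → ℓ k ≠ 0) ∧ (ℓ k = 1 ↔ k = i) ∧ (ℓ k = 2 ↔ k = j)) := by
  have h012 : ∀ a : Fin 3, a = 0 ∨ a = 1 ∨ a = 2 := by decide
  constructor
  · rintro ⟨hT, ⟨hr2, ⟨b, hb2⟩, hb, h1⟩, ⟨hr1, ⟨e, he1⟩, he, h2⟩⟩
    have hbr : b ≠ S.root := fun h => hb (Subtype.ext h)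
    have her : e ≠ S.root := fun h => he (Subtype.ext h)
    have h1' : ∀ i, ℓ i ≠ 2 → i = S.root ∨ i = b := fun i hi =>
      (h1 ⟨i, hi⟩).imp (congrArg Subtype.val) (congrArg Subtype.val)
    have h2' : ∀ i, ℓ i ≠ 1 → i = S.root ∨ i = e := fun i hi =>
      (h2 ⟨i, hi⟩).imp (congrArg Subtype.val) (congrArg Subtype.val)
    have hlb : ℓ b = 1 := (hT.step b hbr).elim (fun h => h.1) fun h => absurd h.1 hb2
    have hle : ℓ e = 2 := (hT.step e her).elim (fun h => absurd h.1 he1) fun h => h.1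
    have hbp : S.parent b = S.root := (hT.step b hbr).elim (fun h => h.2) fun h => absurd h.1 hb2
    have hall : ∀ i, i = S.root ∨ i = b ∨ i = e := fun i => by
      by_cases h : ℓ i = 2
      · rcases h2' i (by rw [h]; decide) with h | h
        · exact Or.inl h
        · exact Or.inr (Or.inr h)
      · exact (h1' i h).imp_right Or.inl
    -- The vertex labelled `2` is attached to the root, which gives a fork, or to the vertex
    -- labelled `1`, which gives a chain.
    by_cases hep : S.parent e = S.root
    · right
      refine ⟨fun i => ?_, hT.root, b, e, fun k => ⟨fun hk hk' => hk (hT.eq_root hk'), ?_, ?_⟩⟩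
      · rcases hall i with rfl | rfl | rfl
        · exact S.parent_root
        · exact hbp
        · exact hep
      · refine ⟨fun h => (h1' k (by rw [h]; decide)).resolve_left fun h' => hr1 (h' ▸ h), ?_⟩
        rintro rfl; exact hlb
      · refine ⟨fun h => (h2' k (by rw [h]; decide)).resolve_left fun h' => hr2 (h' ▸ h), ?_⟩
        rintro rfl; exact hle
    · left
      have hep' : S.parent e = b := by
        rcases hall (S.parent e) with h | h | h
        · exact absurd h hep
        · exact h
        · exact absurd h (RTree.parent_ne S her)
      have hbe : e ≠ b := fun h => by rw [h, hlb] at hle; exact absurd hle (by decide)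
      refine ⟨hT, b, hbr, fun i => ⟨h1' i, ?_⟩, ⟨⟨e, Or.inr hep'⟩, fun h => hbe (congrArg Subtype.val h),
        fun i => ?_⟩, ⟨⟨b, Or.inr hbp⟩, fun h => hbr (congrArg Subtype.val h), fun i => ?_⟩⟩
      · rintro (rfl | rfl)
        · exact hr2
        · exact hb2
      · rcases hall i with h | h | h
        · rcases i.2 with h' | h'
          · exact Or.inl (Subtype.ext h')
          · rw [h, S.parent_root] at h'; exact absurd h'.symm hbr
        · exact Or.inl (Subtype.ext h)
        · exact Or.inr (Subtype.ext h)
      · rcases hall i with h | h | h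
        · exact Or.inl (Subtype.ext h)
        · exact Or.inr (Subtype.ext h)
        · rcases i.2 with h' | h'
          · exact Or.inl (Subtype.ext h')
          · rw [h, hep'] at h'; exact absurd h' hbr
  · rintro (⟨hT, b, hb, h1, ⟨⟨k, hk'⟩, hk, h2⟩, ⟨⟨l, hl'⟩, hl, h3⟩⟩ | ⟨hp, h0, i, j, h⟩)
    · have hbl : ℓ b = 1 := (hT.step b hb).elim (fun h => h.1)
        fun h => absurd h.1 ((h1 b).mpr (Or.inr rfl))
      have hbp : S.parent b = S.root := (hT.step b hb).elim (fun h => h.2)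
        fun h => absurd h.1 ((h1 b).mpr (Or.inr rfl))
      have hkb : k ≠ b := fun h => hk (Subtype.ext h)
      have hkp : S.parent k = b := hk'.resolve_left hkb
      have hkr : k ≠ S.root := fun h => by
        rw [h, S.parent_root] at hkp; exact hb hkp.symm
      have hlb : l = b := by
        rcases h3 ⟨b, Or.inr hbp⟩ with h | h
        · exact absurd (congrArg Subtype.val h) hb
        · exact (congrArg Subtype.val h).symm
      refine ⟨hT, ⟨(h1 _).mpr (Or.inl rfl), ⟨b, (h1 b).mpr (Or.inr rfl)⟩,
        fun h => hb (congrArg Subtype.val h), fun i => ((h1 i).mp i.2).imp Subtype.ext Subtype.ext⟩,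
        by rw [hT.root]; decide, ⟨k, fun h => ?_⟩, fun h => hkr (congrArg Subtype.val h), fun i => ?_⟩
      · rcases (h1 k).mp (by rw [h]; decide) with h | h
        · exact hkr h
        · exact hkb h
      · by_cases hi : i.1 = S.root
        · exact Or.inl (Subtype.ext hi)
        right
        refine Subtype.ext ?_
        obtain ⟨hi2, hi3⟩ := (hT.step i hi).resolve_left fun h => i.2 h.1
        have hib : i.1 ≠ b := fun h => i.2 (h ▸ hbl)
        rcases hi3 with h | h
        · rcases h3 ⟨i, Or.inr h⟩ with h | h
          · exact absurd (congrArg Subtype.val h) hi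
          · exact absurd ((congrArg Subtype.val h).trans hlb) hib
        · have hpb : S.parent i = b := by
            rcases (h1 (S.parent i)).mp (by rw [h]; decide) with h' | h'
            · rw [h', hT.root] at h; exact absurd h (by decide)
            · exact h'
          rcases h2 ⟨i, Or.inr hpb⟩ with h | h
          · exact absurd (congrArg Subtype.val h) hib
          · have h' := congrArg Subtype.val h
            exact h'
    · have hi := (h i).2.1.mpr rfl
      have hj := (h j).2.2.mpr rfl
      have hr : ∀ k, ℓ k = 0 → k = S.root := fun k hk => by
        by_contra h'
        exact (h k).1 h' hk
      refine ⟨⟨h0, fun k hk => ?_⟩, ⟨by rw [h0]; decide, ⟨i, by rw [hi]; decide⟩, fun h => ?_,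
        fun k => ?_⟩, ⟨by rw [h0]; decide, ⟨j, by rw [hj]; decide⟩, fun h => ?_, fun k => ?_⟩⟩
      · rcases h012 (ℓ k) with h' | h' | h'
        · exact absurd (hr k h') hk
        · exact Or.inl ⟨h', hp k⟩
        · exact Or.inr ⟨h', Or.inl (hp k)⟩
      · rw [show i = S.root from Subtype.ext_iff.mp h, h0] at hi; exact absurd hi (by decide)
      · rcases h012 (ℓ k) with h' | h' | h'
        · exact Or.inl (Subtype.ext (hr k h'))
        · exact Or.inr (Subtype.ext ((h k).2.1.mp h'))
        · exact absurd h' k.2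
      · rw [show j = S.root from Subtype.ext_iff.mp h, h0] at hj; exact absurd hj (by decide)
      · rcases h012 (ℓ k) with h' | h' | h'
        · exact Or.inl (Subtype.ext (hr k h'))
        · exact absurd h' k.2
        · exact Or.inr (Subtype.ext ((h k).2.2.mp h'))

theorem not_uniqueOne {I : Type} {S : RTree I} {ℓ : I → Fin 3} (h : UniqueOne S ℓ IsPair IsPair)
    (hp : ∀ i, S.parent i = S.root) : False := by
  obtain ⟨b, hb, -, ⟨⟨k, hk'⟩, hk, -⟩, -⟩ := h
  rcases hk' with h | h
  · exact hk (Subtype.ext h)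
  · rw [hp k] at h; exact hb h.symm

/-- This is the pre-Lie identity for two equal odd arguments. In `(x{α}₁){α}₁` the second `α` is
attached to the first one, giving the right-hand side, or to `x`, giving a corolla with two odd
leaves `α`, which vanishes. -/
theorem brace_brace (hN : 𝔪 ^ N = ⊥) {α : L.Ext A} (hx : x ∈ L.extE 𝔪 k) (hα : α ∈ L.extE 𝔪 1) :
    L.brace 1 (L.brace 1 x α) α = L.brace 1 x (L.brace 1 α α) := by
  have hv : IsHom 𝕂 ![(k : ZMod 2), 1, 1] ![x, α, α] :=
    isHom_triple (part_of_mem_extE hx) (part_self_one_of_mem_extE hα) (part_self_one_of_mem_extE hα)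
  have hm : ∀ i, ![x, α, α] i ∈ L.extE 𝔪 (![k, 1, 1] i) := fun i => by
    fin_cases i
    · exact hx
    · exact hα
    · exact hα
  obtain ⟨g, hg⟩ := exists_pairStar hv (a := 0) (b := 1) (by decide)
  have eg := brace_of_isRep hv (a := 0) (b := 1) (by decide) hg
  have hP : ∀ (J : Type) [Fintype J] (B : RTree J) ℓ, isStar IsPair 0 1 J B ℓ →
      ∑ i, ![(k : ZMod 2), 1, 1] (ℓ i) = (k : ZMod 2) + 1 := fun J _ B ℓ h =>
    sum_isStar_isPair h
  have hG : IsHom 𝕂 ![(k : ZMod 2) + 1, 1] ![g, Gamma.unit α] :=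
    isHom_pair (hg.part_eq hv hP) (part_unit (part_self_one_of_mem_extE hα))
  obtain ⟨F, hF⟩ := exists_pairStar hG (a := 0) (b := 1) (by decide)
  have eF := extL_mul_brace hG hF
  obtain ⟨g', hg'⟩ := exists_pairStar hv (a := 1) (b := 2) (by decide)
  have eg' := brace_of_isRep hv (a := 1) (b := 2) (by decide) hg'
  have hP' : ∀ (J : Type) [Fintype J] (B : RTree J) ℓ, isStar IsPair 1 2 J B ℓ →
      ∑ i, ![(k : ZMod 2), 1, 1] (ℓ i) = 0 := fun J _ B ℓ h =>
    (sum_isStar_isPair h).trans (show (1 : ZMod 2) + 1 = 0 by decide)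
  have hG' : IsHom 𝕂 ![(k : ZMod 2), 1, 0] ![Gamma.unit x, Gamma.unit α, g'] :=
    isHom_triple (part_unit (part_of_mem_extE hx)) (part_unit (part_self_one_of_mem_extE hα))
      (hg'.part_eq hv hP')
  obtain ⟨F', hF'⟩ := exists_markedPair hG'
  have eF' : L.extL (Gamma.mul F') = L.brace 1 (L.extL (Gamma.unit x)) (L.extL g') := by
    rw [← extL_mul]
    refine brace_of_isRep (v := fun a => L.extL (![Gamma.unit x, Gamma.unit α, g'] a)) (a := 0)
      (b := 2) (isHom_extL hG') (by decide) ((hF'.map L.isEven_extLₗ).congr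
        fun I _ T ℓ => isMarkedStar_isPair_iff)
  have key := extL_mul_eq hv hN hm hF (isRep_nestedRoot hv hg) hF' (isRep_nestedMarkedStar hv hg')
    fun n hn S => by
      rw [coeff_nestedRoot hv (leafCond_isPair _) (leafCond_isPair _) hg hP hF S,
        coeff_nestedMarkedStar hv (Or.inr ⟨rfl, rfl⟩) hg' hP' hF' S,
        labelSum_congr _ _ fun ℓ => twoLevel_pair_iff, labelSum_or _ _ fun ℓ h h' =>
          not_uniqueOne h.2 h'.1]
      -- The forks cancel under the exchange of their two leaves, which both stand for `α`.
      rw [labelSum_swap (S := fun ℓ => (∀ i, S.parent i = S.root) ∧ ℓ S.root = 0 ∧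
        ∃ i j, ∀ k, (k ≠ S.root → ℓ k ≠ 0) ∧ (ℓ k = 1 ↔ k = i) ∧ (ℓ k = 2 ↔ k = j)) rfl rfl rfl,
        add_zero]
      · rintro ℓ ⟨h1, h2, i, j, h⟩
        have hs : ∀ a : Fin 3, (Equiv.swap 1 2 a = 0 ↔ a = 0) ∧ (Equiv.swap 1 2 a = 1 ↔ a = 2) ∧
          (Equiv.swap 1 2 a = 2 ↔ a = 1) := by decide
        refine ⟨h1, (hs _).1.mpr h2, j, i, fun k => ⟨fun hk hk' => (h k).1 hk ((hs _).1.mp hk'),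
          (hs _).2.1.trans (h k).2.2, (hs _).2.2.trans (h k).2.1⟩⟩
      · rintro ℓ ⟨h1, h2, i, j, h⟩
        exact ⟨i, j, fun k => (h k).2⟩
  rw [eF, eF'] at key
  change L.brace 1 (L.extL g) (L.extL (Gamma.unit α)) =
    L.brace 1 (L.extL (Gamma.unit x)) (L.extL g') at key
  rw [extL_unit, extL_unit, eg, eg'] at key
  exact key

theorem extL_smul (c : 𝕂) (f : Gamma 𝕂 (L.Ext A)) : L.extL (c • f) = c • L.extL f :=
  map_smul (L.extLₗ A) c f

/-- The structure map commutes with the differentials, and `diff_isStar` computes the differential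
of the sum of corollas. The sign comes from moving `d` past `x`. -/
theorem extD_circ (hN : 𝔪 ^ N = ⊥) (hx : x ∈ L.extE 𝔪 k) (hν : ν ∈ L.extE 𝔪 0) :
    L.extD (L.circ x ν) = L.circ (L.extD x) ν + ((paritySign (k : ZMod 2) : ℤ) : 𝕂) •
      L.markedCirc N (k : ZMod 2) x ν (L.extD ν) := by
  have hv : IsHom 𝕂 ![(k : ZMod 2), 0] ![x, ν] :=
    isHom_pair (part_of_mem_extE hx) (part_zero_of_mem_extE hν)
  have hdx : part 𝕂 ((k : ZMod 2) + 1) (L.extD x) = L.extD x := by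
    have := part_of_mem_extE (extD_mem hx)
    rwa [Int.cast_add, Int.cast_one] at this
  have hdν : part 𝕂 1 (L.extD ν) = L.extD ν := by
    have h := extD_mem hν
    rw [zero_add] at h
    exact part_self_one_of_mem_extE h
  have hv₁ : IsHom 𝕂 ![(k : ZMod 2) + 1, 0] ![L.extD x, ν] := isHom_pair hdx (part_zero_of_mem_extE hν)
  have hv₂ : IsHom 𝕂 ![(k : ZMod 2), 0, 1] ![x, ν, L.extD ν] :=
    isHom_triple (part_of_mem_extE hx) (part_zero_of_mem_extE hν) hdν
  obtain ⟨g, hg⟩ := exists_smallStar hv N (a := 0) (b := 1) (by decide) rfl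
  obtain ⟨g₁, hg₁⟩ := exists_smallStar hv₁ N (a := 0) (b := 1) (by decide) rfl
  obtain ⟨g₂, hg₂⟩ := exists_markedStar (N := N) hv₂ rfl
  have e := circ_of_isRep hv (a := 0) (b := 1) (by decide) rfl hN hν hg
  have e₁ := circ_of_isRep hv₁ (a := 0) (b := 1) (by decide) rfl hN hν hg₁
  have h := diff_isStar (zero_add 1).symm L.isOdd_extD (part_of_mem_extE hx)
    (part_zero_of_mem_extE hν) (Or.inl rfl) hg hg₁ hg₂
  have h' := congrArg L.extL h
  rw [extL_diff, extL_add, extL_smul, e, e₁, markedCirc_of_isRep hg₂] at h'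
  exact h'

theorem extD_brace {l : ℤ} {z : L.Ext A} (hx : x ∈ L.extE 𝔪 k) (hz : z ∈ L.extE 𝔪 l) :
    L.extD (L.brace 1 x z) = L.brace 1 (L.extD x) z + ((paritySign (k : ZMod 2) : ℤ) : 𝕂) •
      L.brace 1 x (L.extD z) := by
  have hv : IsHom 𝕂 ![(k : ZMod 2), (l : ZMod 2)] ![x, z] :=
    isHom_pair (part_of_mem_extE hx) (part_of_mem_extE hz)
  have hdx : part 𝕂 ((k : ZMod 2) + 1) (L.extD x) = L.extD x := by
    have := part_of_mem_extE (extD_mem hx)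
    rwa [Int.cast_add, Int.cast_one] at this
  have hdz : part 𝕂 ((l : ZMod 2) + 1) (L.extD z) = L.extD z := by
    have := part_of_mem_extE (extD_mem hz)
    rwa [Int.cast_add, Int.cast_one] at this
  have hv₁ : IsHom 𝕂 ![(k : ZMod 2) + 1, (l : ZMod 2)] ![L.extD x, z] :=
    isHom_pair hdx (part_of_mem_extE hz)
  have hv₂ : IsHom 𝕂 ![(k : ZMod 2), (l : ZMod 2), (l : ZMod 2) + 1] ![x, z, L.extD z] :=
    isHom_triple (part_of_mem_extE hx) (part_of_mem_extE hz) hdz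
  obtain ⟨g, hg⟩ := exists_pairStar hv (a := 0) (b := 1) (by decide)
  obtain ⟨g₁, hg₁⟩ := exists_pairStar hv₁ (a := 0) (b := 1) (by decide)
  obtain ⟨g₂, hg₂⟩ := exists_markedPair hv₂
  have e := brace_of_isRep hv (a := 0) (b := 1) (by decide) hg
  have e₁ := brace_of_isRep hv₁ (a := 0) (b := 1) (by decide) hg₁
  have e₂ := brace_of_isRep hv₂ (a := 0) (b := 2) (by decide)
    (hg₂.congr fun I _ T ℓ => isMarkedStar_isPair_iff)
  have h := diff_isStar rfl L.isOdd_extD (part_of_mem_extE hx) (part_of_mem_extE hz)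
    (leafCond_isPair _) hg hg₁ hg₂
  have h' := congrArg L.extL h
  rw [extL_diff, extL_add, extL_smul, e, e₁, e₂] at h'
  exact h'

end GammaAlg

end Identities

/-! ### Additivity in a label that occurs once -/

section MarkedAdd

variable {𝕂 : Type*} [CommRing 𝕂] {V : Type*} [AddCommGroup V] [Module 𝕂 V]

/-- The label `a` occurs exactly once in each admissible labelling, so every tensor is linear in the
element that it stands for. -/
theorem labelSum_add {I Λ : Type*} [Fintype I] [LinearOrder I] [LinearOrder Λ] [Fintype Λ]
    {v v' v'' : Λ → V} (p : Λ → ZMod 2) {a : Λ} (ha : v'' a = v a + v' a)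
    (hne : ∀ b, b ≠ a → v'' b = v b ∧ v'' b = v' b) {S : (I → Λ) → Prop}
    (hS : ∀ ℓ, S ℓ → ∃ j, ∀ i, ℓ i = a ↔ i = j) :
    labelSum 𝕂 v'' p S = labelSum 𝕂 v p S + labelSum 𝕂 v' p S := by
  classical
  simp only [labelSum, ← Finset.sum_add_distrib]
  refine Finset.sum_congr rfl fun ℓ _ => ?_
  split_ifs with h
  · obtain ⟨j, hj⟩ := hS ℓ h
    rw [← smul_add]
    congr 1
    have h1 : ∀ u : Λ → V, (∀ b, b ≠ a → v'' b = u b) →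
        (fun i => u (ℓ i)) = Function.update (fun i => v'' (ℓ i)) j (u a) := by
      intro u hu
      funext i
      by_cases hi : i = j
      · subst hi
        rw [Function.update_self, (hj i).mpr rfl]
      · rw [Function.update_of_ne hi, hu _ fun h => hi ((hj i).mp h)]
    have e := congrArg (PiTensorProduct.tprod 𝕂) (h1 v fun b hb => (hne b hb).1)
    have e' := congrArg (PiTensorProduct.tprod 𝕂) (h1 v' fun b hb => (hne b hb).2)
    refine (congrArg (PiTensorProduct.tprod 𝕂) (h1 v'' fun _ _ => rfl)).trans ?_
    rw [ha, MultilinearMap.map_update_add]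
    exact (congrArg₂ (· + ·) e e').symm
  · simp

end MarkedAdd

/-! ### The gauge group and its action -/

namespace GammaAlg

variable {𝕂 : Type u} [CommRing 𝕂] {A : Type w} [CommRing A] [Algebra 𝕂 A] {L : GammaAlg.{u, v} 𝕂}
  [Module.Flat 𝕂 A] {𝔪 : Ideal A} {N : ℕ} {k : ℤ} {x ν μ : L.Ext A}

theorem markedCirc_add {β β' : L.Ext A} (hx : x ∈ L.extE 𝔪 k) (hν : ν ∈ L.extE 𝔪 0)
    (hβ : β ∈ L.extE 𝔪 1) (hβ' : β' ∈ L.extE 𝔪 1) :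
    L.markedCirc N (k : ZMod 2) x ν (β + β') =
      L.markedCirc N (k : ZMod 2) x ν β + L.markedCirc N (k : ZMod 2) x ν β' := by
  have hv : IsHom 𝕂 ![(k : ZMod 2), 0, 1] ![x, ν, β] :=
    isHom_triple (part_of_mem_extE hx) (part_zero_of_mem_extE hν) (part_self_one_of_mem_extE hβ)
  have hv' : IsHom 𝕂 ![(k : ZMod 2), 0, 1] ![x, ν, β'] :=
    isHom_triple (part_of_mem_extE hx) (part_zero_of_mem_extE hν) (part_self_one_of_mem_extE hβ')
  obtain ⟨g, hg⟩ := exists_markedStar (N := N) hv rfl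
  obtain ⟨g', hg'⟩ := exists_markedStar (N := N) hv' rfl
  rw [← markedCirc_of_isRep hg, ← markedCirc_of_isRep hg', ← extL_add]
  refine (markedCirc_of_isRep fun I _ _ T => ?_).symm
  rw [map_add, hg, hg']
  refine (labelSum_add _ (a := 2) rfl (fun b hb => ?_) fun ℓ h => ?_).symm
  · fin_cases b
    · exact ⟨rfl, rfl⟩
    · exact ⟨rfl, rfl⟩
    · exact absurd rfl hb
  · obtain ⟨-, h0, ⟨j, hj, h2, h1⟩, -⟩ := h
    refine ⟨j, fun i => ⟨fun hi => ?_, fun hi => hi ▸ h2⟩⟩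
    by_contra hij
    by_cases hir : i = T.root
    · rw [hir, h0] at hi; exact absurd hi (by decide)
    · rw [h1 i hir hij] at hi; exact absurd hi (by decide)

theorem brace_add (x y z : L.Ext A) : L.brace 1 (x + y) z = L.brace 1 x z + L.brace 1 y z :=
  brace_add_left x y (Or.inr le_rfl)

omit [Module.Flat 𝕂 A] in
theorem eq_zero_of_mem_pow (hN : 𝔪 ^ N = ⊥) (h : ∀ i : ℕ, x ∈ L.extE (𝔪 ^ (i + 1)) k) : x = 0 := by
  have h1 := h N
  rw [pow_succ, hN, Ideal.bot_mul, extE, extSub_bot] at h1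
  exact (Submodule.mem_bot _).mp h1

theorem zero_gaugeMul (hN : 𝔪 ^ N = ⊥) (hμ : μ ∈ L.extE 𝔪 0) : L.gaugeMul 0 μ = μ := by
  rw [gaugeMul, zero_circ hN hμ, add_zero]

variable [IdealsSplit 𝕂 A]

/-- By `circ_sub_mem`, if `x` lies in `L ⊗ 𝔪ⁱ` then it differs from `x ⊚ (1 + μ) = 0` by an element
of `L ⊗ 𝔪ⁱ⁺¹`. So `x` lies in every step of the filtration. -/
theorem circ_injective (hN : 𝔪 ^ N = ⊥) (hx : x ∈ L.extE 𝔪 k) (hμ : μ ∈ L.extE 𝔪 0)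
    (h : L.circ x μ = 0) : x = 0 := by
  refine eq_zero_of_mem_pow (k := k) hN fun i => ?_
  induction i with
  | zero => rwa [zero_add, pow_one]
  | succ i ih =>
    have h1 := circ_sub_mem hN ih le_rfl hμ
    rw [h, zero_sub, ← pow_succ] at h1
    exact neg_mem_iff.mp h1

theorem circ_right_inj (hN : 𝔪 ^ N = ⊥) {y : L.Ext A} (hx : x ∈ L.extE 𝔪 k) (hy : y ∈ L.extE 𝔪 k)
    (hμ : μ ∈ L.extE 𝔪 0) (h : L.circ x μ = L.circ y μ) : x = y := by
  rw [← sub_eq_zero]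
  exact circ_injective hN (sub_mem hx hy) hμ (by rw [circ_sub hN _ _ hμ, h, sub_self])

/-- Successive approximation: adding the error `x - y ⊚ (1 + μ)` to `y` moves the error into the
next power of `𝔪`. -/
theorem exists_circ_eq (hN : 𝔪 ^ N = ⊥) (hx : x ∈ L.extE 𝔪 k) (hμ : μ ∈ L.extE 𝔪 0) :
    ∃ y ∈ L.extE 𝔪 k, L.circ y μ = x := by
  have h : ∀ i : ℕ, ∃ y ∈ L.extE 𝔪 k, x - L.circ y μ ∈ L.extE (𝔪 ^ (i + 1)) k := by
    intro i
    induction i with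
    | zero => exact ⟨0, zero_mem _, by rwa [zero_circ hN hμ, sub_zero, zero_add, pow_one]⟩
    | succ i ih =>
      obtain ⟨y, hy, hr⟩ := ih
      refine ⟨y + (x - L.circ y μ), add_mem hy (extE_mono (Ideal.pow_le_self (by omega)) hr), ?_⟩
      have h1 := circ_sub_mem hN hr le_rfl hμ
      rw [← pow_succ] at h1
      rw [circ_add hN _ _ hμ, ← sub_sub, ← neg_sub]
      exact neg_mem h1
  obtain ⟨y, hy, hr⟩ := h N
  refine ⟨y, hy, ?_⟩
  rw [pow_succ, hN, Ideal.bot_mul, extE, extSub_bot] at hr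
  exact (sub_eq_zero.mp ((Submodule.mem_bot _).mp hr)).symm

theorem gaugeMul_mem (hN : 𝔪 ^ N = ⊥) (hμ : μ ∈ L.extE 𝔪 0) (hν : ν ∈ L.extE 𝔪 0) :
    L.gaugeMul μ ν ∈ L.extE 𝔪 0 := add_mem hν (circ_mem hN hμ hν)

theorem gaugeMul_assoc (hN : 𝔪 ^ N = ⊥) {ξ : L.Ext A} (hμ : μ ∈ L.extE 𝔪 0) (hν : ν ∈ L.extE 𝔪 0)
    (hξ : ξ ∈ L.extE 𝔪 0) :
    L.gaugeMul (L.gaugeMul μ ν) ξ = L.gaugeMul μ (L.gaugeMul ν ξ) := by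
  unfold gaugeMul
  rw [circ_add hN _ _ hξ, circ_circ hN hμ hν hξ, add_assoc]

omit [IdealsSplit 𝕂 A] in
theorem gaugeMul_zero (μ : L.Ext A) : L.gaugeMul μ 0 = μ := by
  rw [gaugeMul, circ_zero, zero_add]

/-- The equation `(1 + ν) ⊚ (1 + μ) = 1` reads `ν ⊚ (1 + μ) = -μ`, which `exists_circ_eq` solves. -/
theorem exists_left_inv (hN : 𝔪 ^ N = ⊥) (hμ : μ ∈ L.extE 𝔪 0) :
    ∃ ν ∈ L.extE 𝔪 0, L.gaugeMul ν μ = 0 := by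
  obtain ⟨ν, hν, h⟩ := exists_circ_eq hN (neg_mem hμ) hμ
  exact ⟨ν, hν, by rw [gaugeMul, h, add_neg_cancel]⟩

/-- In a monoid in which every element has a left inverse, left inverses are two-sided. -/
theorem exists_gauge_inv (hN : 𝔪 ^ N = ⊥) (hμ : μ ∈ L.extE 𝔪 0) :
    ∃ ν ∈ L.extE 𝔪 0, L.gaugeMul μ ν = 0 ∧ L.gaugeMul ν μ = 0 := by
  obtain ⟨ν, hν, h⟩ := exists_left_inv hN hμ
  obtain ⟨ξ, hξ, h'⟩ := exists_left_inv hN hν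
  have : ξ = μ := by
    rw [← gaugeMul_zero ξ, ← h, ← gaugeMul_assoc hN hξ hν hμ, h', zero_gaugeMul hN hμ]
  exact ⟨ν, hν, this ▸ h', h⟩

section Local

variable [IsLocalRing A] (hN : IsLocalRing.maximalIdeal A ^ N = ⊥)
include hN

theorem gaugeInv_spec (hμ : μ ∈ L.extGr A 0) : L.gaugeInv μ ∈ L.extGr A 0 ∧
    L.gaugeMul μ (L.gaugeInv μ) = 0 ∧ L.gaugeMul (L.gaugeInv μ) μ = 0 := by
  have h' : ∃ ν ∈ L.extGr A 0, L.gaugeMul μ ν = 0 ∧ L.gaugeMul ν μ = 0 := exists_gauge_inv hN hμ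
  rw [gaugeInv, dif_pos h']
  exact h'.choose_spec

variable {α β : L.Ext A}

omit hN in
theorem gaugeAct_aux (hμ : μ ∈ L.extGr A 0) (hα : α ∈ L.extGr A 1) :
    α + L.brace 1 μ α - L.extD μ ∈ L.extGr A 1 := by
  have h1 := extD_mem hμ
  have h2 := brace_mem_self hμ hα
  rw [zero_add] at h1 h2
  exact sub_mem (add_mem hα h2) h1

theorem gaugeAct_mem (hμ : μ ∈ L.extGr A 0) (hα : α ∈ L.extGr A 1) :
    L.gaugeAct μ α ∈ L.extGr A 1 :=
  circ_mem hN (gaugeAct_aux hμ hα) (gaugeInv_spec hN hμ).1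

/-- Frees the action from the inverse in its definition. With the injectivity of `⊚ (1 + μ)` this
equation characterizes the action, see `eq_gaugeAct`, and the laws are derived from it. -/
theorem circ_gaugeAct (hμ : μ ∈ L.extGr A 0) (hα : α ∈ L.extGr A 1) :
    L.circ (L.gaugeAct μ α) μ = α + L.brace 1 μ α - L.extD μ := by
  obtain ⟨h1, -, h3⟩ := gaugeInv_spec hN hμ
  rw [gaugeAct, circ_circ hN (gaugeAct_aux hμ hα) h1 hμ]
  change L.circ _ (L.gaugeMul (L.gaugeInv μ) μ) = _
  rw [h3, circ_zero]

theorem eq_gaugeAct (hμ : μ ∈ L.extGr A 0) (hα : α ∈ L.extGr A 1) (hβ : β ∈ L.extGr A 1)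
    (h : L.circ β μ = α + L.brace 1 μ α - L.extD μ) : L.gaugeAct μ α = β :=
  circ_right_inj hN (gaugeAct_mem hN hμ hα) hβ hμ ((circ_gaugeAct hN hμ hα).trans h.symm)

/-- For `β = (1 + μ) · α` and `ω = β ⊚ (1 + μ)`, the identities for marked corollas give `(d(β) +
β{β}₁) ⊚ (1 + μ) = d(ω) + ω{α}₁`. The right-hand side vanishes by `ω = α + μ{α}₁ - d(μ)`, the
Maurer–Cartan equation and `brace_brace`. Then `⊚ (1 + μ)` is cancelled. -/
theorem gaugeAct_mc (hμ : μ ∈ L.extGr A 0) (hα : α ∈ L.extGr A 1)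
    (hmc : L.extD α + L.brace 1 α α = 0) :
    L.extD (L.gaugeAct μ α) + L.brace 1 (L.gaugeAct μ α) (L.gaugeAct μ α) = 0 := by
  have hβ := gaugeAct_mem hN hμ hα
  have hω := circ_gaugeAct hN hμ hα
  set β := L.gaugeAct μ α
  have hdμ := extD_mem hμ
  have hμα := brace_mem_self hμ hα
  rw [zero_add] at hdμ hμα
  refine circ_injective (k := 1 + 1) hN (add_mem (extD_mem hβ) (brace_mem_self hβ hβ)) hμ ?_
  have h1 := circ_brace hN hβ hμ hβ
  have h2 := extD_circ hN hβ hμ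
  have h3 := brace_circ hN hβ hμ hα
  -- The equation of the action in the form `α + μ{α}₁ = β ⊚ (1 + μ) + d(μ)`, inserted at the marked
  -- leaf.
  have h4 : L.markedCirc N ((1 : ℤ) : ZMod 2) β μ (α + L.brace 1 μ α) =
      L.markedCirc N ((1 : ℤ) : ZMod 2) β μ (L.circ β μ) +
        L.markedCirc N ((1 : ℤ) : ZMod 2) β μ (L.extD μ) := by
    rw [← markedCirc_add hβ hμ (circ_mem hN hβ hμ) hdμ, hω, sub_add_cancel]
  have hs : paritySign ((1 : ℤ) : ZMod 2) = -1 := by rw [Int.cast_one]; exact if_pos rfl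
  have hneg : ∀ m : L.Ext A, (((-1 : ℤˣ) : ℤ) : 𝕂) • m = -m := fun m => by
    rw [Units.val_neg, Units.val_one, Int.cast_neg, Int.cast_one]
    exact neg_one_smul 𝕂 m
  rw [hs] at h2
  replace h2 := h2.trans (congrArg (_ + ·) (hneg _))
  have h5 := extD_brace hμ hα
  have hs' : paritySign ((0 : ℤ) : ZMod 2) = 1 := by rw [Int.cast_zero]; exact if_neg (by decide)
  rw [hs', Units.val_one, Int.cast_one, one_smul] at h5
  have h6 : L.extD (L.circ β μ) + L.brace 1 (L.circ β μ) α = 0 := by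
    have h7 : L.brace 1 (α + L.brace 1 μ α - L.extD μ) α =
        L.brace 1 α α + L.brace 1 μ (L.brace 1 α α) - L.brace 1 (L.extD μ) α := by
      rw [← brace_brace hN hμ hα]
      simp only [← braceHom_apply, map_add, map_sub, AddMonoidHom.add_apply, AddMonoidHom.sub_apply]
    have h8 : L.brace 1 μ (L.extD α) + L.brace 1 μ (L.brace 1 α α) = 0 := by
      rw [← braceHom_apply, ← braceHom_apply, ← map_add, hmc, map_zero]
    rw [hω, h7, map_sub, map_add, h5, L.extD_extD, sub_zero]
    have : L.extD α + (L.brace 1 (L.extD μ) α + L.brace 1 μ (L.extD α)) + (L.brace 1 α α +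
        L.brace 1 μ (L.brace 1 α α) - L.brace 1 (L.extD μ) α) = (L.extD α + L.brace 1 α α) +
        (L.brace 1 μ (L.extD α) + L.brace 1 μ (L.brace 1 α α)) := by abel
    rw [this, hmc, h8, add_zero]
  rw [circ_add hN _ _ hμ, h1, ← h6, h2, h3, h4]
  abel

/-- By `eq_gaugeAct` it suffices to apply `⊚ ((1 + μ) ⊚ (1 + ν))` to the right-hand side, which
`circ_circ` does in two steps. The two corollas marked by `d(ν)`, one from the brace with `α` and
one from the differential of `μ ⊚ (1 + ν)`, cancel. -/
theorem gaugeMul_act (hμ : μ ∈ L.extGr A 0) (hν : ν ∈ L.extGr A 0) (hα : α ∈ L.extGr A 1) :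
    L.gaugeAct (L.gaugeMul μ ν) α = L.gaugeAct μ (L.gaugeAct ν α) := by
  have hβ := gaugeAct_mem hN hν hα
  have hγ := gaugeAct_mem hN hμ hβ
  have hβω := circ_gaugeAct hN hν hα
  have hγω := circ_gaugeAct hN hμ hβ
  set β := L.gaugeAct ν α
  set γ := L.gaugeAct μ β
  refine eq_gaugeAct hN (gaugeMul_mem hN hμ hν) hα hγ ?_
  have hdν := extD_mem hν
  have hνα := brace_mem_self hν hα
  rw [zero_add] at hdν hνα
  have h1 := circ_circ hN hγ hμ hν
  have h2 := circ_brace hN hμ hν hβ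
  have h3 := extD_circ hN hμ hν
  have hs' : paritySign ((0 : ℤ) : ZMod 2) = 1 := by rw [Int.cast_zero]; exact if_neg (by decide)
  rw [hs', Units.val_one, Int.cast_one, one_smul] at h3
  have h4 := brace_circ hN hμ hν hα
  have h5 : L.markedCirc N ((0 : ℤ) : ZMod 2) μ ν (α + L.brace 1 ν α) =
      L.markedCirc N ((0 : ℤ) : ZMod 2) μ ν (L.circ β ν) +
        L.markedCirc N ((0 : ℤ) : ZMod 2) μ ν (L.extD ν) := by
    rw [← markedCirc_add hμ hν (circ_mem hN hβ hν) hdν, hβω, sub_add_cancel]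
  change L.circ γ (ν + L.circ μ ν) = α + L.brace 1 (ν + L.circ μ ν) α - L.extD (ν + L.circ μ ν)
  rw [← h1, hγω, circ_sub hN _ _ hν, circ_add hN _ _ hν, h2, brace_add, h4, h5, map_add, h3, hβω]
  abel

theorem zero_act (hα : α ∈ L.extGr A 1) : L.gaugeAct 0 α = α := by
  refine eq_gaugeAct hN (zero_mem _) hα hα ?_
  rw [circ_zero, ← braceHom_apply, map_zero, map_zero, AddMonoidHom.zero_apply, add_zero, sub_zero]

/-- The gauge group is a group acting on the Maurer–Cartan elements. -/
theorem deligneLaws : L.DeligneLaws A where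
  mul_mem _ _ hμ hν := gaugeMul_mem hN hμ hν
  mul_assoc _ _ _ hμ hν hξ := gaugeMul_assoc hN hμ hν hξ
  one_mul _ hμ := zero_gaugeMul hN hμ
  mul_one μ _ := gaugeMul_zero μ
  exists_inv _ hμ := exists_gauge_inv hN hμ
  act_mem _ α hμ := ⟨gaugeAct_mem hN hμ α.2.1, gaugeAct_mc hN hμ α.2.1 α.2.2⟩
  one_act α := zero_act hN α.2.1
  mul_act _ _ α hμ hν := gaugeMul_act hN hμ hν α.2.1

end Local

end GammaAlg

/-! ### The functor induced by `φ` -/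

namespace DeligneGroupoid

variable {𝕂 : Type u} [CommRing 𝕂] {A : Type w} [CommRing A] [Algebra 𝕂 A]
  {L₁ : GammaAlg.{u, v₁} 𝕂} {L₂ : GammaAlg.{u, v₂} 𝕂} (φ : GammaHom L₁ L₂)

theorem extMap_mem_extE {I : Ideal A} {k : ℤ} {x : L₁.Ext A} (hx : x ∈ L₁.extE I k) :
    extMap A φ x ∈ L₂.extE I k := lTensor_mem_extSub (φ.g.map_mem k) hx

theorem extMap_extD (x : L₁.Ext A) : extMap A φ (L₁.extD x) = L₂.extD (extMap A φ x) := by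
  unfold extMap GammaAlg.extD
  rw [← LinearMap.lTensor_comp_apply, ← LinearMap.lTensor_comp_apply]
  congr 2
  exact LinearMap.ext φ.g.map_d

theorem isEven_extMap : IsEven (extMap A φ) := isEven_lTensor φ.g.isEven

variable [Module.Flat 𝕂 A]

theorem extMap_extL (f : Gamma 𝕂 (L₁.Ext A)) :
    extMap A φ (L₁.extL f) = L₂.extL (Gamma.map (extMap A φ) (isEven_extMap φ) f) := by
  have h := Gamma.scalars_map (A := A) φ.g.isEven f
  change φ.g.f.lTensor A (L₁.l.lTensor A (Gamma.scalars f)) =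
    L₂.l.lTensor A (Gamma.scalars (Gamma.map (φ.g.f.lTensor A) _ f))
  rw [h, ← LinearMap.lTensor_comp_apply, ← LinearMap.lTensor_comp_apply]
  congr 2
  exact LinearMap.ext φ.map_l

theorem extMap_brace {a b : ZMod 2} {x y : L₁.Ext A} (hx : part 𝕂 a x = x) (hy : part 𝕂 b y = y)
    {n : ℕ} (hn : b = 0 ∨ n ≤ 1) :
    extMap A φ (L₁.brace n x y) = L₂.brace n (extMap A φ x) (extMap A φ y) := by
  unfold GammaAlg.brace
  rw [extMap_extL]
  congr 1
  have hv := isHom_pair hx hy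
  have hv' : IsHom 𝕂 ![a, b] ![extMap A φ x, extMap A φ y] :=
    isHom_pair ((isEven_extMap φ a x).symm.trans (congrArg _ hx))
      ((isEven_extMap φ b y).symm.trans (congrArg _ hy))
  have h1 := (isRep_corolla hv (a := 0) (b := 1) (by decide) hn).map (isEven_extMap φ)
  have h2 := isRep_corolla hv' (a := 0) (b := 1) (by decide) hn
  have h3 : (fun i => extMap A φ (![x, y] i)) = ![extMap A φ x, extMap A φ y] := by
    funext i
    fin_cases i <;> rfl
  rw [h3] at h1
  exact h1.unique h2

theorem extMap_circ {𝔪 : Ideal A} {N : ℕ} (hN : 𝔪 ^ N = ⊥) {k : ℤ} {x y : L₁.Ext A}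
    (hx : x ∈ L₁.extE 𝔪 k) (hy : y ∈ L₁.extE 𝔪 0) :
    extMap A φ (L₁.circ x y) = L₂.circ (extMap A φ x) (extMap A φ y) := by
  rw [GammaAlg.circ_eq_sum hN x hy le_rfl, GammaAlg.circ_eq_sum hN _ (extMap_mem_extE φ hy) le_rfl,
    map_sum]
  exact Finset.sum_congr rfl fun n _ => extMap_brace φ (GammaAlg.part_of_mem_extE hx)
    (GammaAlg.part_zero_of_mem_extE hy) (Or.inl rfl)

variable [IdealsSplit 𝕂 A] [IsLocalRing A] {N : ℕ} (hN : IsLocalRing.maximalIdeal A ^ N = ⊥)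
include hN

omit [IdealsSplit 𝕂 A] in
theorem extMap_gaugeMul {μ ν : L₁.Ext A} (hμ : μ ∈ L₁.extGr A 0) (hν : ν ∈ L₁.extGr A 0) :
    extMap A φ (L₁.gaugeMul μ ν) = L₂.gaugeMul (extMap A φ μ) (extMap A φ ν) := by
  unfold GammaAlg.gaugeMul
  rw [map_add, extMap_circ φ hN hμ hν]

/-- Inverses need not be compared: the image satisfies the equation which characterizes the action.
-/
theorem extMap_gaugeAct {μ α : L₁.Ext A} (hμ : μ ∈ L₁.extGr A 0) (hα : α ∈ L₁.extGr A 1) :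
    extMap A φ (L₁.gaugeAct μ α) = L₂.gaugeAct (extMap A φ μ) (extMap A φ α) := by
  refine (GammaAlg.eq_gaugeAct hN (extMap_mem φ hμ) (extMap_mem φ hα)
    (extMap_mem φ (GammaAlg.gaugeAct_mem hN hμ hα)) ?_).symm
  rw [← extMap_circ φ hN (GammaAlg.gaugeAct_mem hN hμ hα) hμ, GammaAlg.circ_gaugeAct hN hμ hα,
    map_sub, map_add, extMap_extD, extMap_brace φ (GammaAlg.part_of_mem_extE hμ)
    (GammaAlg.part_of_mem_extE hα) (Or.inr le_rfl)]

theorem functorLaws : FunctorLaws A φ where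
  map_mc α := by
    rw [← extMap_brace φ (GammaAlg.part_of_mem_extE α.2.1) (GammaAlg.part_of_mem_extE α.2.1)
      (Or.inr le_rfl), ← extMap_extD, ← map_add, α.2.2, map_zero]
  map_mul _ _ hμ hν := extMap_gaugeMul φ hN hμ hν
  map_act _ α hμ := extMap_gaugeAct φ hN hμ α.2.1

end DeligneGroupoid

/-! ### Cohomological hypotheses as exactness of the mapping cone -/

section ConeExact

variable {𝕂 : Type u} [CommRing 𝕂] {M : DGMod.{u, v₁} 𝕂} {M' : DGMod.{u, v₂} 𝕂}

/-- Exactness of the mapping cone of `φ` at `Mˡ ⊕ M'ᵏ`, where `j`, `k`, `l` are consecutive. -/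
def DGHom.ConeExact (φ : DGHom M M') (j k l : ℤ) : Prop :=
  ∀ x ∈ M.gr l, ∀ y ∈ M'.gr k, M.d x = 0 → φ.f x = M'.d y →
    ∃ z ∈ M.gr k, ∃ w ∈ M'.gr j, M.d z = x ∧ φ.f z + M'.d w = y

theorem DGMod.mk_eq_zero_iff {k : ℤ} (x : M.Z k) :
    (Submodule.Quotient.mk x : M.H k) = 0 ↔ x.1 ∈ M.B k := by
  rw [Submodule.Quotient.mk_eq_zero]
  rfl

/-- Injectivity in degree `l` writes `x` as `d(z)`. Then `φ(z) - y` is a cocycle, and by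
surjectivity in degree `k` it is cohomologous to `φ(c)` for a cocycle `c`. The element `z - c`
solves the problem. -/
theorem DGHom.coneExact_of_bijective (φ : DGHom M M') {j k l : ℤ} (hj : j = k - 1) (hl : l = k + 1)
    (h : Function.Surjective (φ.H k)) (h' : Function.Injective (φ.H l)) : φ.ConeExact j k l := by
  subst hl hj
  intro x hx y hy hdx hxy
  have h1 : φ.H (k + 1) (Submodule.Quotient.mk ⟨x, hx, hdx⟩) = 0 :=
    (M'.mk_eq_zero_iff _).mpr ⟨y, by rwa [add_sub_cancel_right], hxy.symm⟩
  rw [← map_zero (φ.H (k + 1))] at h1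
  obtain ⟨z, hz, rfl⟩ := (M.mk_eq_zero_iff _).mp (h' h1)
  simp only [SetLike.mem_coe, add_sub_cancel_right] at hz
  have hc : φ.f z - y ∈ M'.Z k := by
    refine ⟨sub_mem (φ.map_mem k z hz) hy, ?_⟩
    change M'.d (φ.f z - y) = 0
    rw [map_sub, ← φ.map_d, hxy, sub_self]
  obtain ⟨c, hc'⟩ := h (Submodule.Quotient.mk ⟨_, hc⟩)
  obtain ⟨c, rfl⟩ := Submodule.Quotient.mk_surjective _ c
  obtain ⟨w, hw, hw'⟩ := (Submodule.Quotient.eq _).mp hc'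
  change M'.d w = φ.f c.1 - (φ.f z - y) at hw'
  have hdc : M.d c.1 = 0 := c.2.2
  refine ⟨z - c.1, sub_mem hz c.2.1, w, hw, ?_, ?_⟩
  · rw [map_sub, hdc, sub_zero]
  · rw [hw', map_sub]; abel

/-- There are no coboundaries in degree `0`, so the hypothesis says that `φ` is injective on the
cocycles of degree `0`. -/
theorem DGHom.coneExact_of_injective (φ : DGHom M M') (hM : M.IsPositivelyGraded)
    (hM' : M'.IsPositivelyGraded) (h : Function.Injective (φ.H 0)) : φ.ConeExact (-2) (-1) 0 := by
  intro x hx y hy hdx hxy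
  rw [hM' (-1) (by norm_num)] at hy
  rw [(Submodule.mem_bot 𝕂).mp hy, map_zero] at hxy
  have h1 : φ.H 0 (Submodule.Quotient.mk ⟨x, hx, hdx⟩) = 0 :=
    (M'.mk_eq_zero_iff _).mpr (by change φ.f x ∈ _; rw [hxy]; exact zero_mem _)
  rw [← map_zero (φ.H 0)] at h1
  obtain ⟨z, hz, rfl⟩ := (M.mk_eq_zero_iff _).mp (h h1)
  refine ⟨z, by simpa using hz, 0, zero_mem _, rfl, ?_⟩
  have hz' : z = 0 := by
    have : z ∈ M.gr (0 - 1) := hz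
    rw [hM _ (by norm_num)] at this
    exact (Submodule.mem_bot 𝕂).mp this
  rw [hz', (Submodule.mem_bot 𝕂).mp hy]
  simp

end ConeExact

/-! ### Cone exactness with coefficients in an ideal modulo a smaller one -/

section Lifting

variable {𝕂 : Type u} [CommRing 𝕂] {A : Type w} [CommRing A] [Algebra 𝕂 A]

/-- With projections `P` onto `I` and `Q` onto `J`, the map `q = P - Q P` models `I / J` on a
complement of `J` in `I`. It turns congruences modulo `J` into equations. -/
theorem exists_proj_mod [IdealsSplit 𝕂 A] {I J : Ideal A} (h : J ≤ I) : ∃ q : A →ₗ[𝕂] A,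
    (∀ a, q a ∈ I) ∧ (∀ a ∈ J, q a = 0) ∧ ∀ a ∈ I, a - q a ∈ J := by
  obtain ⟨P, hP, hP'⟩ := IdealsSplit.exists_proj (𝕂 := 𝕂) I
  obtain ⟨Q, hQ, hQ'⟩ := IdealsSplit.exists_proj (𝕂 := 𝕂) J
  refine ⟨P - Q ∘ₗ P, fun a => sub_mem (hP a) (h (hQ _)), fun a ha => ?_, fun a ha => ?_⟩
  · rw [LinearMap.sub_apply, LinearMap.comp_apply, hP' a (h ha), hQ' a ha, sub_self]
  · rw [LinearMap.sub_apply, LinearMap.comp_apply, hP' a ha, sub_sub_cancel]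
    exact hQ a

section Modules

variable {V W X Y U : Type*} [AddCommGroup V] [Module 𝕂 V] [AddCommGroup W] [Module 𝕂 W]
  [AddCommGroup X] [Module 𝕂 X] [AddCommGroup Y] [Module 𝕂 Y] [AddCommGroup U] [Module 𝕂 U]

theorem exists_lTensor_eq [Module.Flat 𝕂 A] {f : U →ₗ[𝕂] V} {g : V →ₗ[𝕂] W}
    (h : ∀ v, g v = 0 → ∃ u, f u = v) {x : A ⊗[𝕂] V} (hx : g.lTensor A x = 0) :
    ∃ u, f.lTensor A u = x := by
  obtain ⟨y, rfl⟩ := exists_lTensor_ker g hx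
  clear hx
  induction y using TensorProduct.induction_on with
  | zero => exact ⟨0, by simp only [map_zero]⟩
  | tmul a v =>
    obtain ⟨u, hu⟩ := h v.1 v.2
    exact ⟨a ⊗ₜ u, by rw [LinearMap.lTensor_tmul, LinearMap.lTensor_tmul, hu]; rfl⟩
  | add y y' hy hy' =>
    obtain ⟨u, hu⟩ := hy
    obtain ⟨u', hu'⟩ := hy'
    exact ⟨u + u', by rw [map_add, map_add, hu, hu']⟩

theorem lTensor_prod_eq_zero {f : V →ₗ[𝕂] X} {g : V →ₗ[𝕂] Y} {x : A ⊗[𝕂] V}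
    (hf : f.lTensor A x = 0) (hg : g.lTensor A x = 0) : (f.prod g).lTensor A x = 0 := by
  have h : f.prod g = LinearMap.inl 𝕂 X Y ∘ₗ f + LinearMap.inr 𝕂 X Y ∘ₗ g := by
    ext v <;> simp
  rw [h, LinearMap.lTensor_add, LinearMap.add_apply, LinearMap.lTensor_comp_apply,
    LinearMap.lTensor_comp_apply, hf, hg, map_zero, map_zero, add_zero]

theorem map_eq_rTensor_lTensor (π : A →ₗ[𝕂] A) (g : V →ₗ[𝕂] W) (x : A ⊗[𝕂] V) :
    TensorProduct.map π g x = π.rTensor W (g.lTensor A x) := by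
  rw [← LinearMap.comp_apply, LinearMap.rTensor_comp_lTensor]

theorem lTensor_rTensor_comm (π : A →ₗ[𝕂] A) (g : V →ₗ[𝕂] W) (x : A ⊗[𝕂] V) :
    g.lTensor A (π.rTensor V x) = π.rTensor W (g.lTensor A x) := by
  rw [← LinearMap.comp_apply, ← LinearMap.comp_apply, LinearMap.rTensor_comp_lTensor,
    LinearMap.lTensor_comp_rTensor]

theorem rTensor_eq_zero {J : Ideal A} {N : Submodule 𝕂 V} {q : A →ₗ[𝕂] A}
    (hq : ∀ a ∈ J, q a = 0) {x : A ⊗[𝕂] V} (hx : x ∈ extSub J N) : q.rTensor V x = 0 := by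
  refine extSub_induction (P := fun x => q.rTensor V x = 0) (map_zero _) ?_ ?_ hx
  · intro x y hx hy; rw [map_add, hx, hy, add_zero]
  · intro a ha x hx; rw [LinearMap.rTensor_tmul, hq a ha, TensorProduct.zero_tmul]

theorem sub_rTensor_mem {I J : Ideal A} {N : Submodule 𝕂 V} {q : A →ₗ[𝕂] A}
    (hq : ∀ a ∈ I, a - q a ∈ J) {x : A ⊗[𝕂] V} (hx : x ∈ extSub I N) :
    x - q.rTensor V x ∈ extSub J N := by
  refine extSub_induction (P := fun x => x - q.rTensor V x ∈ extSub J N) ?_ ?_ ?_ hx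
  · rw [map_zero, sub_zero]; exact zero_mem _
  · intro x y hx hy; rw [map_add, add_sub_add_comm]; exact add_mem hx hy
  · intro a ha x hx
    rw [LinearMap.rTensor_tmul, ← TensorProduct.sub_tmul]
    exact tmul_mem_extSub (hq a ha) hx

theorem lTensor_inl_add_inr (r : X × Y →ₗ[𝕂] U) (x : A ⊗[𝕂] X) (y : A ⊗[𝕂] Y) :
    r.lTensor A ((LinearMap.inl 𝕂 X Y).lTensor A x + (LinearMap.inr 𝕂 X Y).lTensor A y) =
      (r ∘ₗ LinearMap.inl 𝕂 X Y).lTensor A x + (r ∘ₗ LinearMap.inr 𝕂 X Y).lTensor A y := by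
  rw [map_add, ← LinearMap.lTensor_comp_apply, ← LinearMap.lTensor_comp_apply]

theorem lTensor_rTensor_eq_zero {I : Ideal A} {N : Submodule 𝕂 V} {g : V →ₗ[𝕂] W}
    (hg : ∀ x ∈ N, g x = 0) (q : A →ₗ[𝕂] A) {x : A ⊗[𝕂] V} (hx : x ∈ extSub I N) :
    g.lTensor A (q.rTensor V x) = 0 := by
  refine extSub_induction (P := fun x => g.lTensor A (q.rTensor V x) = 0) ?_ ?_ ?_ hx
  · rw [map_zero, map_zero]
  · intro x y hx hy; rw [map_add, map_add, hx, hy, add_zero]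
  · intro a _ x hx
    rw [LinearMap.rTensor_tmul, LinearMap.lTensor_tmul, hg x hx, TensorProduct.tmul_zero]

theorem rTensor_rTensor {P q : A →ₗ[𝕂] A} (h : ∀ a, P (q a) = q a) (x : A ⊗[𝕂] V) :
    P.rTensor V (q.rTensor V x) = q.rTensor V x := by
  rw [← LinearMap.comp_apply, ← LinearMap.rTensor_comp,
    show P ∘ₗ q = q from LinearMap.ext h]

theorem map_mem_extSub_of_forall {I : Ideal A} {N : Submodule 𝕂 W} {π : A →ₗ[𝕂] A} {g : V →ₗ[𝕂] W}
    (hπ : ∀ a, π a ∈ I) (hg : ∀ x, g x ∈ N) (x : A ⊗[𝕂] V) :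
    TensorProduct.map π g x ∈ extSub I N :=
  map_mem_extSub (fun a _ => hπ a) (fun x _ => hg x) (mem_extSub_top x)

/-- Solutions of a system of linear equations extend to tensor products with flat algebras. -/
theorem exists_lTensor_pair [Module.Flat 𝕂 A] {X' Y' Z : Type*} [AddCommGroup X'] [Module 𝕂 X']
    [AddCommGroup Y'] [Module 𝕂 Y'] [AddCommGroup Z] [Module 𝕂 Z]
    {f : U →ₗ[𝕂] X} {f₁ : U →ₗ[𝕂] Y} {f₂ : V →ₗ[𝕂] Y}
    {g : X →ₗ[𝕂] X'} {g' : Y →ₗ[𝕂] Y'} {h : X →ₗ[𝕂] Z} {h' : Y →ₗ[𝕂] Z}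
    (hex : ∀ x y, g x = 0 → g' y = 0 → h x = h' y → ∃ z w, f z = x ∧ f₁ z + f₂ w = y)
    {x : A ⊗[𝕂] X} {y : A ⊗[𝕂] Y} (hx : g.lTensor A x = 0) (hy : g'.lTensor A y = 0)
    (hxy : h.lTensor A x = h'.lTensor A y) :
    ∃ z w, f.lTensor A z = x ∧ f₁.lTensor A z + f₂.lTensor A w = y := by
  -- The unknowns form `U × V`, the given elements lie in `X × Y`, and the conditions on them are
  -- the vanishing of one linear map on `X × Y`. A single application of flatness then suffices.
  have key := exists_lTensor_eq (A := A)
    (f := (f ∘ₗ LinearMap.fst 𝕂 U V).prod (f₁.coprod f₂))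
    (g := (h.coprod (-h')).prod ((g ∘ₗ LinearMap.fst 𝕂 X Y).prod (g' ∘ₗ LinearMap.snd 𝕂 X Y)))
    (x := (LinearMap.inl 𝕂 X Y).lTensor A x + (LinearMap.inr 𝕂 X Y).lTensor A y) ?_ ?_
  rotate_left
  · rintro ⟨x, y⟩ h1
    have h2 : h x + -h' y = 0 := congrArg Prod.fst h1
    have h3 : g x = 0 := congrArg (fun p => p.2.1) h1
    have h4 : g' y = 0 := congrArg (fun p => p.2.2) h1
    obtain ⟨z, w, h5, h6⟩ := hex x y h3 h4 (add_neg_eq_zero.mp h2)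
    exact ⟨(z, w), Prod.ext h5 h6⟩
  · refine lTensor_prod_eq_zero ?_ (lTensor_prod_eq_zero ?_ ?_)
    · rw [lTensor_inl_add_inr, LinearMap.coprod_inl, LinearMap.coprod_inr, hxy, LinearMap.lTensor_neg,
        LinearMap.neg_apply, add_neg_cancel]
    · rw [lTensor_inl_add_inr, LinearMap.comp_assoc, LinearMap.comp_assoc, LinearMap.fst_comp_inl,
        LinearMap.fst_comp_inr, LinearMap.comp_id, LinearMap.comp_zero, hx, LinearMap.lTensor_zero]
      exact add_zero _
    · rw [lTensor_inl_add_inr, LinearMap.comp_assoc, LinearMap.comp_assoc, LinearMap.snd_comp_inl,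
        LinearMap.snd_comp_inr, LinearMap.comp_id, LinearMap.comp_zero, hy, LinearMap.lTensor_zero]
      exact zero_add _
  obtain ⟨u, hu⟩ := key
  refine ⟨(LinearMap.fst 𝕂 U V).lTensor A u, (LinearMap.snd 𝕂 U V).lTensor A u, ?_, ?_⟩
  · have h1 := congrArg ((LinearMap.fst 𝕂 X Y).lTensor A) hu
    rw [lTensor_inl_add_inr, ← LinearMap.lTensor_comp_apply, LinearMap.fst_prod, LinearMap.fst_comp_inl,
      LinearMap.fst_comp_inr, LinearMap.lTensor_zero, LinearMap.lTensor_id] at h1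
    rw [← LinearMap.lTensor_comp_apply, h1]
    exact add_zero _
  · have h1 := congrArg ((LinearMap.snd 𝕂 X Y).lTensor A) hu
    rw [lTensor_inl_add_inr, ← LinearMap.lTensor_comp_apply, LinearMap.snd_prod, LinearMap.snd_comp_inl,
      LinearMap.snd_comp_inr, LinearMap.lTensor_zero, LinearMap.lTensor_id] at h1
    rw [← LinearMap.lTensor_comp_apply, ← LinearMap.lTensor_comp_apply, ← LinearMap.add_apply,
      ← LinearMap.lTensor_add]
    exact h1.trans (zero_add _)

end Modules

namespace DGHom

variable {M : DGMod.{u, v₁} 𝕂} {M' : DGMod.{u, v₂} 𝕂}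

/-- An exact mapping cone remains exact, in a filtered sense, after extension of scalars. -/
theorem ConeExact.exists_approx [Module.Flat 𝕂 A] [IdealsSplit 𝕂 A] {φ : DGHom M M'} {j k l : ℤ}
    (hφ : φ.ConeExact j k l) {I J : Ideal A} (hJI : J ≤ I) {x : A ⊗[𝕂] M.carrier}
    {y : A ⊗[𝕂] M'.carrier} (hx : x ∈ extSub I (M.gr l)) (hy : y ∈ extSub I (M'.gr k))
    {p p' : ℤ} (hdx : M.d.lTensor A x ∈ extSub J (M.gr p))
    (hxy : φ.f.lTensor A x - M'.d.lTensor A y ∈ extSub J (M'.gr p')) :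
    ∃ z ∈ extSub I (M.gr k), ∃ w ∈ extSub I (M'.gr j),
      x - M.d.lTensor A z ∈ extSub J (M.gr l) ∧
      y - (φ.f.lTensor A z + M'.d.lTensor A w) ∈ extSub J (M'.gr k) := by
  -- After applying `q` to the scalars, the congruences modulo `J` hold exactly and the extended
  -- system can be solved. Nothing is lost, because `q` is the identity of `I` modulo `J`.
  obtain ⟨q, hqI, hqJ, hq⟩ := exists_proj_mod (𝕂 := 𝕂) hJI
  obtain ⟨P, hP, hP'⟩ := IdealsSplit.exists_proj (𝕂 := 𝕂) I
  have hgr {C : DGMod.{u, v₁} 𝕂} (n : ℤ) (x : C.carrier) (hx : x ∈ C.gr n) :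
      (LinearMap.id - C.projGr n : C.carrier →ₗ[𝕂] C.carrier) x = 0 := by
    rw [LinearMap.sub_apply, C.projGr_of_mem hx]; exact sub_self x
  have hgr' {C : DGMod.{u, v₂} 𝕂} (n : ℤ) (x : C.carrier) (hx : x ∈ C.gr n) :
      (LinearMap.id - C.projGr n : C.carrier →ₗ[𝕂] C.carrier) x = 0 := by
    rw [LinearMap.sub_apply, C.projGr_of_mem hx]; exact sub_self x
  -- The projections to the graded pieces express the conditions on degrees as linear equations.
  have key := exists_lTensor_pair (A := A)
    (f := M.d ∘ₗ M.projGr k) (f₁ := φ.f ∘ₗ M.projGr k) (f₂ := M'.d ∘ₗ M'.projGr j)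
    (g := M.d.prod (LinearMap.id - M.projGr l)) (g' := LinearMap.id - M'.projGr k) (h := φ.f)
    (h' := M'.d) (x := q.rTensor _ x) (y := q.rTensor _ y) ?_ ?_ ?_ ?_
  rotate_left
  · intro x y hx hy hxy
    have hx1 : M.d x = 0 := congrArg Prod.fst hx
    have hx2 : x - M.projGr l x = 0 := congrArg Prod.snd hx
    have hy' : y - M'.projGr k y = 0 := hy
    obtain ⟨z, hz, w, hw, h1, h2⟩ := hφ x (by rw [sub_eq_zero.mp hx2]; exact M.projGr_mem l x) y
      (by rw [sub_eq_zero.mp hy']; exact M'.projGr_mem k y) hx1 hxy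
    refine ⟨z, w, ?_, ?_⟩
    · rw [LinearMap.comp_apply, M.projGr_of_mem hz, h1]
    · rw [LinearMap.comp_apply, LinearMap.comp_apply, M.projGr_of_mem hz, M'.projGr_of_mem hw, h2]
  · refine lTensor_prod_eq_zero ?_ (lTensor_rTensor_eq_zero (hgr l) q hx)
    rw [lTensor_rTensor_comm]
    exact rTensor_eq_zero hqJ hdx
  · exact lTensor_rTensor_eq_zero (hgr' k) q hy
  · rw [lTensor_rTensor_comm, lTensor_rTensor_comm, ← sub_eq_zero, ← map_sub]
    exact rTensor_eq_zero hqJ hxy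
  obtain ⟨z, w, h1, h2⟩ := key
  -- The solutions need not have scalars in `I` or be homogeneous. Projecting them repairs this and
  -- preserves the equations, which contain the degree projections already and whose given sides are
  -- fixed by `P`.
  refine ⟨TensorProduct.map P (M.projGr k) z,
    map_mem_extSub_of_forall hP (M.projGr_mem k) z, TensorProduct.map P (M'.projGr j) w,
    map_mem_extSub_of_forall hP (M'.projGr_mem j) w, ?_, ?_⟩
  · rw [map_eq_rTensor_lTensor, lTensor_rTensor_comm, ← LinearMap.lTensor_comp_apply, h1,
      rTensor_rTensor fun a => hP' _ (hqI a)]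
    exact sub_rTensor_mem hq hx
  · rw [map_eq_rTensor_lTensor, lTensor_rTensor_comm, ← LinearMap.lTensor_comp_apply,
      map_eq_rTensor_lTensor, lTensor_rTensor_comm, ← LinearMap.lTensor_comp_apply, ← map_add, h2,
      rTensor_rTensor fun a => hP' _ (hqI a)]
    exact sub_rTensor_mem hq hy

end DGHom

end Lifting

/-! ### Curvature and first-order estimates -/

namespace GammaAlg

variable {𝕂 : Type u} [CommRing 𝕂] {A : Type w} [CommRing A] [Algebra 𝕂 A] {L : GammaAlg.{u, v} 𝕂}
  [Module.Flat 𝕂 A]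

theorem brace_add_right (x y z : L.Ext A) : L.brace 1 x (y + z) = L.brace 1 x y + L.brace 1 x z :=
  map_add (braceHom A L x) y z

variable (L A) in
/-- The curvature `d(α) + α{α}₁`. -/
def curv (α : L.Ext A) : L.Ext A := L.extD α + L.brace 1 α α

theorem curv_add (α ξ : L.Ext A) : L.curv A (α + ξ) =
    L.curv A α + L.extD ξ + (L.brace 1 ξ α + L.brace 1 (α + ξ) ξ) := by
  unfold curv
  rw [map_add, brace_add_right, brace_add α ξ α]
  abel

variable [IdealsSplit 𝕂 A] {I J : Ideal A}

theorem brace_one_one_mem {x y : L.Ext A} (hx : x ∈ L.extE I 1) (hy : y ∈ L.extE J 1) :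
    L.brace 1 x y ∈ L.extE (I * J) 2 := by
  have h := brace_one_mem hx hy
  rwa [one_add_one_eq_two] at h

/-- Each of the remaining bilinear terms contains `ξ` and another factor from `𝔪`, so the curvature
is affine to first order. -/
theorem curv_add_sub_mem {𝔪 : Ideal A} (hI : I ≤ 𝔪) {α ξ : L.Ext A} (hα : α ∈ L.extE 𝔪 1)
    (hξ : ξ ∈ L.extE I 1) :
    L.curv A (α + ξ) - (L.curv A α + L.extD ξ) ∈ L.extE (I * 𝔪) 2 := by
  rw [curv_add, add_sub_cancel_left]
  refine add_mem (brace_one_one_mem hξ hα) ?_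
  rw [mul_comm]
  exact brace_one_one_mem (add_mem hα (extE_mono hI hξ)) hξ

section Local

variable [IsLocalRing A] {N : ℕ} (hN : maximalIdeal A ^ N = ⊥)
include hN

omit [IdealsSplit 𝕂 A] in
-- Bianchi identity. The cubic terms on the right cancel by `brace_brace`.
theorem extD_curv {α : L.Ext A} (hα : α ∈ L.extGr A 1) :
    L.extD (L.curv A α) = L.brace 1 (L.curv A α) α - L.brace 1 α (L.curv A α) := by
  have hneg : ∀ m : L.Ext A, (((-1 : ℤˣ) : ℤ) : 𝕂) • m = -m := fun m => by
    rw [Units.val_neg, Units.val_one, Int.cast_neg, Int.cast_one]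
    exact neg_one_smul 𝕂 m
  have h := extD_brace hα hα
  rw [show paritySign ((1 : ℤ) : ZMod 2) = -1 by rw [Int.cast_one]; exact if_pos rfl] at h
  replace h := h.trans (congrArg (_ + ·) (hneg _))
  have h' := brace_brace hN hα hα
  unfold curv
  rw [map_add, L.extD_extD, h, brace_add, brace_add_right, h']
  abel

theorem extD_curv_mem {α : L.Ext A} (hα : α ∈ L.extGr A 1) (h : L.curv A α ∈ L.extE I 2) :
    L.extD (L.curv A α) ∈ L.extE (I * maximalIdeal A) 3 := by
  rw [extD_curv hN hα]
  have h1 := brace_one_mem h hα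
  have h2 := brace_one_mem hα h
  rw [mul_comm] at h2
  exact sub_mem h1 h2

/-- Multiplying by the inverse of `1 + μ` recovers `x` and does not leave `Lᵏ ⊗ I`. -/
theorem mem_of_circ_mem {k : ℤ} {x μ : L.Ext A} (hx : x ∈ L.extGr A k) (hμ : μ ∈ L.extGr A 0)
    (h : L.circ x μ ∈ L.extE I k) : x ∈ L.extE I k := by
  obtain ⟨h1, h2, -⟩ := gaugeInv_spec hN hμ
  have h3 := circ_circ hN hx hμ h1
  change _ = L.circ x (L.gaugeMul μ (L.gaugeInv μ)) at h3
  rw [h2, circ_zero] at h3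
  rw [← h3]
  exact circ_mem hN h h1

omit [IsLocalRing A] hN in
theorem gaugeMul_sub_mem {𝔪 : Ideal A} (hN : 𝔪 ^ N = ⊥) {σ μ : L.Ext A} (hσ : σ ∈ L.extE I 0)
    (hμ : μ ∈ L.extE 𝔪 0) : L.gaugeMul σ μ - (μ + σ) ∈ L.extE (I * 𝔪) 0 := by
  rw [gaugeMul, add_sub_add_left_eq_sub]
  exact circ_sub_mem hN hσ le_rfl hμ

/-- In `circ_gaugeAct` the term `σ{β}₁` and the deviation of `⊚ (1 + σ)` from the identity both have
a factor in `I` and another in `𝔪`. What remains is a translation by `-d(σ)`. -/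
theorem gaugeAct_sub_mem (hI : I ≤ maximalIdeal A) {σ β : L.Ext A} (hσ : σ ∈ L.extE I 0)
    (hβ : β ∈ L.extGr A 1) :
    L.gaugeAct σ β - (β - L.extD σ) ∈ L.extE (I * maximalIdeal A) 1 := by
  have hγ := gaugeAct_mem hN (extE_mono hI hσ) hβ
  have h1 := circ_sub_mem hN hγ hI hσ
  have h2 := brace_one_mem hσ hβ
  rw [zero_add] at h2
  rw [circ_gaugeAct hN (extE_mono hI hσ) hβ, mul_comm] at h1
  have h3 := sub_mem h2 h1
  convert h3 using 1
  abel

/-- The difference of two elements of the gauge group in terms of their quotient. -/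
theorem exists_quotient {μ ν : L.Ext A} (hμ : μ ∈ L.extGr A 0) (hν : ν ∈ L.extGr A 0)
    (h : μ - ν ∈ L.extE I 0) :
    ∃ σ ∈ L.extGr A 0, σ ∈ L.extE I 0 ∧ L.gaugeMul σ ν = μ := by
  obtain ⟨σ, hσ, hσ'⟩ := exists_circ_eq hN (sub_mem hμ hν) hν
  refine ⟨σ, hσ, mem_of_circ_mem hN hσ hν (by rwa [hσ']), ?_⟩
  rw [gaugeMul, hσ', add_sub_cancel]

end Local

end GammaAlg

/-! ### Faithfulness, fullness and essential surjectivity -/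

namespace DeligneGroupoid

open GammaAlg

variable {𝕂 : Type u} [CommRing 𝕂] {A : Type w} [CommRing A] [Algebra 𝕂 A]
  {L₁ : GammaAlg.{u, v₁} 𝕂} {L₂ : GammaAlg.{u, v₂} 𝕂} (φ : GammaHom L₁ L₂)
  [Module.Flat 𝕂 A]

theorem extMap_curv {α : L₁.Ext A} {I : Ideal A} (hα : α ∈ L₁.extE I 1) :
    extMap A φ (L₁.curv A α) = L₂.curv A (extMap A φ α) := by
  unfold curv
  rw [map_add, extMap_extD, extMap_brace φ (part_of_mem_extE hα) (part_of_mem_extE hα)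
    (Or.inr le_rfl)]

variable [IdealsSplit 𝕂 A]

variable {φ} in
theorem exists_approx {j k l : ℤ} (hφ : φ.g.ConeExact j k l) {I J : Ideal A} (hJI : J ≤ I)
    {x : L₁.Ext A} {y : L₂.Ext A} (hx : x ∈ L₁.extE I l) (hy : y ∈ L₂.extE I k) {p p' : ℤ}
    (hdx : L₁.extD x ∈ L₁.extE J p) (hxy : extMap A φ x - L₂.extD y ∈ L₂.extE J p') :
    ∃ z ∈ L₁.extE I k, ∃ w ∈ L₂.extE I j, x - L₁.extD z ∈ L₁.extE J l ∧
      y - (extMap A φ z + L₂.extD w) ∈ L₂.extE J k :=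
  hφ.exists_approx hJI hx hy hdx hxy

omit [Module.Flat 𝕂 A] [IdealsSplit 𝕂 A] in
theorem eq_zero_of_gr_eq_bot {L : GammaAlg.{u, v} 𝕂} {k : ℤ} (h : L.M.gr k = ⊥) {I : Ideal A}
    {x : L.Ext A} (hx : x ∈ L.extE I k) : x = 0 := by
  rw [extE, h] at hx
  refine extSub_induction (P := fun z => z = 0) rfl ?_ ?_ hx
  · rintro x y rfl rfl; exact add_zero 0
  · intro a _ x hx
    rw [(Submodule.mem_bot _).mp hx, TensorProduct.tmul_zero]

variable [IsLocalRing A] {N : ℕ} (hN : maximalIdeal A ^ N = ⊥)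
include hN

omit [Module.Flat 𝕂 A] [IdealsSplit 𝕂 A] in
theorem eq_zero_of_mem_pow_succ {L : GammaAlg.{u, v} 𝕂} {k : ℤ} {x : L.Ext A}
    (h : x ∈ L.extE (maximalIdeal A ^ (N + 1)) k) : x = 0 := by
  rw [pow_succ, hN, Ideal.bot_mul, extE, extSub_bot] at h
  exact (Submodule.mem_bot _).mp h

variable {φ}

/-- A stabilizer which is trivial in the target is trivial. -/
theorem eq_zero_of_stabilizer (h0 : φ.g.ConeExact (-2) (-1) 0) (hL : L₁.M.IsPositivelyGraded)
    {σ α : L₁.Ext A} (hσ : σ ∈ L₁.extGr A 0) (hα : α ∈ L₁.extGr A 1)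
    (hact : L₁.gaugeAct σ α = α) (hφ : extMap A φ σ = 0) : σ = 0 := by
  have key : ∀ i : ℕ, σ ∈ L₁.extE (maximalIdeal A ^ (i + 1)) 0 := by
    intro i
    induction i with
    | zero => rwa [zero_add, pow_one]
    | succ i ih =>
      have hI : maximalIdeal A ^ (i + 1) ≤ maximalIdeal A := Ideal.pow_le_self (by omega)
      -- To first order, stabilizing `α` means `d(σ) = 0`. Cone exactness in degree `0` then moves
      -- `σ` into the next power of `𝔪`, the correction `z` being of degree `-1` and hence zero.
      have h1 := gaugeAct_sub_mem hN hI ih hα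
      rw [hact, sub_sub_cancel] at h1
      obtain ⟨z, hz, -, -, h2, -⟩ := exists_approx h0 Ideal.mul_le_left ih (zero_mem _) (p' := 0) h1
        (by rw [hφ, map_zero, sub_zero]; exact zero_mem _)
      have hz0 : z = 0 := eq_zero_of_gr_eq_bot (hL (-1) (by norm_num)) hz
      rw [hz0, map_zero, sub_zero] at h2
      rwa [pow_succ]
  exact eq_zero_of_mem_pow_succ hN (key N)

/-- Fullness. Let `γ = (1 + μ) · α` be the current approximation to `β`, and let `σ'` be the
quotient of `μ'` by the image of `μ`. Then `(γ - β, σ')` is a cocycle of the cone modulo the next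
power of `𝔪`: the first condition holds since `β` and `γ` both have curvature zero, the second since
`1 + σ'` carries `φ(γ)` to `φ(β)`. Exactness provides `z`, and `(1 + z) ⊚ (1 + μ)` is the next
approximation. -/
theorem exists_gauge_lift (h1 : φ.g.ConeExact (-1) 0 1) (hL' : L₂.M.IsPositivelyGraded)
    {α β : L₁.Ext A} (hα : α ∈ L₁.extGr A 1) (hcα : L₁.curv A α = 0) (hβ : β ∈ L₁.extGr A 1)
    (hcβ : L₁.curv A β = 0) {μ' : L₂.Ext A} (hμ' : μ' ∈ L₂.extGr A 0)
    (hact : L₂.gaugeAct μ' (extMap A φ α) = extMap A φ β) :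
    ∃ μ ∈ L₁.extGr A 0, L₁.gaugeAct μ α = β ∧ extMap A φ μ = μ' := by
  have key : ∀ i : ℕ, ∃ μ ∈ L₁.extGr A 0,
      L₁.gaugeAct μ α - β ∈ L₁.extE (maximalIdeal A ^ (i + 1)) 1 ∧
      μ' - extMap A φ μ ∈ L₂.extE (maximalIdeal A ^ (i + 1)) 0 := by
    intro i
    induction i with
    | zero =>
      refine ⟨0, zero_mem _, ?_, ?_⟩
      · rw [zero_add, pow_one, zero_act hN hα]
        exact sub_mem hα hβ
      · rwa [zero_add, pow_one, map_zero, sub_zero]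
    | succ i ih =>
      obtain ⟨μ, hμ, hγβ, hd⟩ := ih
      have hI : maximalIdeal A ^ (i + 1) ≤ maximalIdeal A := Ideal.pow_le_self (by omega)
      rw [pow_succ]
      generalize maximalIdeal A ^ (i + 1) = I at hγβ hd hI ⊢
      have hγ := gaugeAct_mem hN hμ hα
      have hφγ := extMap_gaugeAct φ hN hμ hα
      have hmul := fun {σ : L₁.Ext A} (hσ : σ ∈ L₁.extGr A 0) => gaugeMul_act hN hσ hμ hα
      have hcγ : L₁.curv A (L₁.gaugeAct μ α) = 0 := gaugeAct_mc hN hμ hα hcα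
      obtain ⟨σ', hσ', hσI, hσμ⟩ := exists_quotient hN hμ' (extMap_mem φ hμ) hd
      have h2 := gaugeAct_sub_mem hN hI hσI (extMap_mem φ hγ)
      rw [hφγ, ← gaugeMul_act hN hσ' (extMap_mem φ hμ) (extMap_mem φ hα), hσμ, hact, ← hφγ] at h2
      generalize L₁.gaugeAct μ α = γ at hγβ hγ hcγ h2 hmul
      have h3 := curv_add_sub_mem hI hβ hγβ
      rw [add_sub_cancel, hcγ, hcβ, zero_add, zero_sub, neg_mem_iff] at h3
      obtain ⟨z, hz, w, hw, h4, h5⟩ := exists_approx h1 Ideal.mul_le_left hγβ hσI (p' := 1) h3 (by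
        rw [map_sub]
        have := neg_mem h2
        convert this using 1
        abel)
      -- The correction `w` would have degree `-1`, so `z` alone must account for `σ'`.
      have hw0 : w = 0 := eq_zero_of_gr_eq_bot (hL' (-1) (by norm_num)) hw
      rw [hw0, map_zero, add_zero] at h5
      have hz' : z ∈ L₁.extGr A 0 := extE_mono hI hz
      refine ⟨L₁.gaugeMul z μ, gaugeMul_mem hN hz' hμ, ?_, ?_⟩
      · rw [hmul hz']
        have h6 := add_mem (gaugeAct_sub_mem hN hI hz hγ) h4
        convert h6 using 1
        abel
      · rw [extMap_gaugeMul φ hN hz' hμ, ← hσμ]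
        have h6 := gaugeMul_sub_mem hN hσI (extMap_mem φ hμ)
        have h7 := gaugeMul_sub_mem hN (extMap_mem_extE φ hz) (extMap_mem φ hμ)
        have h8 := add_mem (sub_mem h6 h7) h5
        convert h8 using 1
        abel
  obtain ⟨μ, hμ, h2, h3⟩ := key N
  exact ⟨μ, hμ, sub_eq_zero.mp (eq_zero_of_mem_pow_succ hN h2),
    (sub_eq_zero.mp (eq_zero_of_mem_pow_succ hN h3)).symm⟩

/-- Essential surjectivity. Here the cocycle of the cone consists of the curvature of `α` and the
difference of `φ(α)` and `γ = (1 + ν) · β`. It is closed to the required order by the Bianchi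
identity and because `γ` has curvature zero. Exactness provides `z` and `w`; then `α - z` and `(1 -
w) ⊚ (1 + ν)` are the next approximations. -/
theorem exists_mc_lift (h2 : φ.g.ConeExact 0 1 2) {β : L₂.Ext A} (hβ : β ∈ L₂.extGr A 1)
    (hcβ : L₂.curv A β = 0) : ∃ α ∈ L₁.extGr A 1, L₁.curv A α = 0 ∧
      ∃ ν ∈ L₂.extGr A 0, L₂.gaugeAct ν β = extMap A φ α := by
  have key : ∀ i : ℕ, ∃ α ∈ L₁.extGr A 1, ∃ ν ∈ L₂.extGr A 0,
      L₁.curv A α ∈ L₁.extE (maximalIdeal A ^ (i + 1)) 2 ∧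
      extMap A φ α - L₂.gaugeAct ν β ∈ L₂.extE (maximalIdeal A ^ (i + 1)) 1 := by
    intro i
    induction i with
    | zero =>
      refine ⟨0, zero_mem _, 0, zero_mem _, ?_, ?_⟩
      · unfold curv
        rw [map_zero, zero_add, ← braceHom_apply, map_zero]
        exact zero_mem _
      · rw [zero_add, pow_one, map_zero, zero_act hN hβ, zero_sub]
        exact neg_mem hβ
    | succ i ih =>
      obtain ⟨α, hα, ν, hν, hR, hξ⟩ := ih
      have hI : maximalIdeal A ^ (i + 1) ≤ maximalIdeal A := Ideal.pow_le_self (by omega)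
      rw [pow_succ]
      generalize maximalIdeal A ^ (i + 1) = I at hR hξ hI ⊢
      have hγ := gaugeAct_mem hN hν hβ
      have hcγ : L₂.curv A (L₂.gaugeAct ν β) = 0 := gaugeAct_mc hN hν hβ hcβ
      have hmul := fun {σ : L₂.Ext A} (hσ : σ ∈ L₂.extGr A 0) => gaugeMul_act hN hσ hν hβ
      generalize L₂.gaugeAct ν β = γ at hξ hγ hcγ hmul
      have h3 := curv_add_sub_mem hI hγ hξ
      rw [add_sub_cancel, hcγ, zero_add, ← extMap_curv φ hα] at h3
      obtain ⟨z, hz, w, hw, h4, h5⟩ := exists_approx h2 Ideal.mul_le_left hR hξ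
        (extD_curv_mem hN hα hR) h3
      have hw' : -w ∈ L₂.extGr A 0 := neg_mem (extE_mono hI hw)
      refine ⟨α + -z, add_mem hα (neg_mem (extE_mono hI hz)), L₂.gaugeMul (-w) ν,
        gaugeMul_mem hN hw' hν, ?_, ?_⟩
      · have h6 := add_mem (curv_add_sub_mem hI hα (neg_mem hz)) h4
        rw [map_neg] at h6
        convert h6 using 1
        abel
      · rw [hmul hw', map_add, map_neg]
        have h6 := gaugeAct_sub_mem hN hI (neg_mem hw) hγ
        rw [map_neg] at h6
        have h7 := sub_mem h5 h6
        convert h7 using 1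
        abel
  obtain ⟨α, hα, ν, hν, h3, h4⟩ := key N
  exact ⟨α, hα, eq_zero_of_mem_pow_succ hN h3, ν, hν, (sub_eq_zero.mp (eq_zero_of_mem_pow_succ hN h4)).symm⟩

end DeligneGroupoid

/-- An ideal is a `K`-subspace of `A`, so there is a `K`-linear projection onto it. This is where
the field of fractions is needed in addition to flatness. -/
theorem idealsSplit_of_field (𝕂 K A : Type*) [CommRing 𝕂] [Field K] [CommRing A] [Algebra 𝕂 K]
    [Algebra K A] [Algebra 𝕂 A] [IsScalarTower 𝕂 K A] : IdealsSplit 𝕂 A where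
  exists_proj I := by
    obtain ⟨g, hg⟩ := LinearMap.exists_leftInverse_of_injective (I.restrictScalars K).subtype
      (Submodule.ker_subtype _)
    refine ⟨((I.restrictScalars K).subtype ∘ₗ g).restrictScalars 𝕂, fun a => (g a).2, fun a ha => ?_⟩
    exact congrArg Subtype.val (LinearMap.congr_fun hg ⟨a, ha⟩)

/-! ### The equivalence of the Deligne groupoids -/

namespace DeligneGroupoid

open CategoryTheory

variable {𝕂 : Type u} [CommRing 𝕂] {A : Type w} [CommRing A] [Algebra 𝕂 A] [Module.Flat 𝕂 A]
  [IdealsSplit 𝕂 A] [IsLocalRing A] {L₁ : GammaAlg.{u, v₁} 𝕂} {L₂ : GammaAlg.{u, v₂} 𝕂}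
  {φ : GammaHom L₁ L₂} {N : ℕ}

/-- Exactness of the cone at the three places gives faithfulness, fullness and essential
surjectivity, in this order. -/
theorem isEquivalence_functor (hN : maximalIdeal A ^ N = ⊥) (hL : L₁.M.IsPositivelyGraded)
    (hL' : L₂.M.IsPositivelyGraded) (h0 : φ.g.ConeExact (-2) (-1) 0) (h1 : φ.g.ConeExact (-1) 0 1)
    (h2 : φ.g.ConeExact 0 1 2) (h : L₁.DeligneLaws A) (h' : L₂.DeligneLaws A)
    (hφ : FunctorLaws A φ) : (functor h h' hφ).IsEquivalence where
  faithful :=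
    { map_injective := fun {α β} f g hfg => by
        -- In a groupoid, faithfulness may be tested on automorphisms: two morphisms with the same
        -- image differ by one whose image is trivial.
        have hker : ∀ k : α ⟶ α, extMap A φ (Hom.μ k) = 0 → k = 𝟙 α :=
          fun k hk => Hom.ext
            (eq_zero_of_stabilizer hN h0 hL (Hom.mem k) (Subtype.property α).1 (Hom.act k) hk)
        have h3 : f ≫ Groupoid.inv g =
            𝟙 α := by
          refine hker _ (congrArg Hom.μ (?_ : (functor h h' hφ).map _ = 𝟙 ((functor h h' hφ).obj α)))
          rw [Functor.map_comp, hfg, ← Functor.map_comp,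
            Groupoid.comp_inv, CategoryTheory.Functor.map_id]
        rw [← Category.comp_id f, ← Groupoid.inv_comp g,
          ← Category.assoc, h3, Category.id_comp] }
  full :=
    { map_surjective := fun {α β} f => by
        obtain ⟨μ, hμ, hact, hμ'⟩ := exists_gauge_lift hN h1 hL' (Subtype.property α).1
          (Subtype.property α).2 (Subtype.property β).1 (Subtype.property β).2 (Hom.mem f)
          (Hom.act f)
        exact ⟨(⟨μ, hμ, hact⟩ : Hom α β), Hom.ext hμ'⟩ }
  essSurj :=
    { mem_essImage := fun β => by
        obtain ⟨α, hα, hcα, ν, hν, hact⟩ := exists_mc_lift hN h2 (Subtype.property β).1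
          (Subtype.property β).2
        refine ⟨(⟨α, hα, hcα⟩ : L₁.MC A), ⟨?_⟩⟩
        exact (asIso (⟨ν, hν, hact⟩ : Hom β _)).symm }

end DeligneGroupoid

end GammaPreLie

end

theorem theoremB {𝕂 : Type*} [CommRing 𝕂] [IsDomain 𝕂] [IsNoetherianRing 𝕂]
    {K : Type*} [Field K] [Algebra 𝕂 K] [IsFractionRing 𝕂 K]
    (L : GammaPreLie.GammaAlg 𝕂) (L' : GammaPreLie.GammaAlg 𝕂)
    (hL : L.M.IsPositivelyGraded) (hL' : L'.M.IsPositivelyGraded)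
    (φ : GammaPreLie.GammaHom L L')
    (h0 : Function.Bijective (φ.g.H 0)) (h1 : Function.Bijective (φ.g.H 1))
    (h2 : Function.Injective (φ.g.H 2))
    (A : Type*) [CommRing A] [IsLocalRing A] [IsArtinianRing A]
    [Algebra K A] [Algebra 𝕂 A] [IsScalarTower 𝕂 K A] :
    ∃ (h : L.DeligneLaws A) (h' : L'.DeligneLaws A)
      (hφ : GammaPreLie.DeligneGroupoid.FunctorLaws A φ),
      (GammaPreLie.DeligneGroupoid.functor h h' hφ).IsEquivalence := by
  -- Localizations are flat, and every module over the field `K` is flat.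
  have hK : Module.Flat 𝕂 K := IsLocalization.flat K (nonZeroDivisors 𝕂)
  have hA : Module.Flat 𝕂 A := Module.Flat.trans 𝕂 K A
  have hs := GammaPreLie.idealsSplit_of_field 𝕂 K A
  -- The maximal ideal of a local ring is its Jacobson radical, which is nilpotent in an artinian
  -- ring.
  obtain ⟨N, hN⟩ := IsArtinianRing.isNilpotent_jacobson_bot (R := A)
  rw [IsLocalRing.jacobson_eq_maximalIdeal ⊥ bot_ne_top] at hN
  exact ⟨GammaPreLie.GammaAlg.deligneLaws hN, GammaPreLie.GammaAlg.deligneLaws hN,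
    GammaPreLie.DeligneGroupoid.functorLaws φ hN,
    GammaPreLie.DeligneGroupoid.isEquivalence_functor hN hL hL'
      -- The three places use injectivity on `H⁰`; surjectivity on `H⁰` and injectivity on `H¹`;
      -- surjectivity on `H¹` and injectivity on `H²`.
      (φ.g.coneExact_of_injective hL hL' h0.1)
      (φ.g.coneExact_of_bijective (by norm_num) (by norm_num) h0.2 h1.1)
      (φ.g.coneExact_of_bijective (by norm_num) (by norm_num) h1.2 h2) _ _ _⟩
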